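/- Let $(M,g)$ be a connected, complete, finite-dimensional smooth Riemannian manifold without boundary, with Riemannian distance $d_M$, and let $V:M\to\mathbb R$ be smooth and asymptotically regular: there are a nonempty compact set $K\subset M$ and a constant $V_\infty>0$ such that $$|\operatorname{grad}V(q)|\ge V_\infty\ \text{ for } q\in M\setminus K,\qquad \frac{\|\operatorname{Hess}V(q)\|}{|\operatorname{grad}V(q)|}\to0\ \text{ as } d_M(q,K)\to\infty .$$ Let $\Lambda M=H^1(S^1,M)$, $S^1=[0,1]/\{0,1\}$, be the Hilbert manifold of absolutely continuous loops in $M$ with square integrable derivative; its tangent space $T_c\Lambda M$ consists of the $H^1$ vector fields $\xi$ along $c$, with norm $\|\xi\|_{H^1}^2=\int_0^1|\xi|^2\,ds+\int_0^1|\nabla_s\xi|^2\,ds$. For $\varepsilon>0$ and $(c,\tau)\in\Lambda M\times\mathbb R$ put $$\mathscr A_\varepsilon(c,\tau)=\frac{e^{-\tau}}2\int_0^1|c'(s)|^2\,ds-e^{\tau}\int_0^1V(c(s))\,ds+\varepsilon\,(e^{-\tau}+e^{\tau/2}).$$ Proposition 4.4. Let $\varepsilon>0$, and let $(c_n,\tau_n)$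 be a Palais–Smale sequence for $\mathscr A_\varepsilon$ at positive levels, that is, a sequence in $\Lambda M\times\mathbb R$ such that for some constants $a_1,a_2>0$ one has $a_1\le\mathscr A_\varepsilon(c_n,\tau_n)\le a_2$ for all $n$, and $d\mathscr A_\varepsilon(c_n,\tau_n)\to0$, in the sense that $d\mathscr A_\varepsilon(c_n,\tau_n)(\xi,\sigma)=o(1)\,(\|\xi\|_{H^1}+|\sigma|)$ as $n\to\infty$, uniformly in $(\xi,\sigma)\in T_{c_n}\Lambda M\times\mathbb R$. Then a subsequence of $(c_n,\tau_n)$ converges in $\Lambda M\times\mathbb R$ to a point $(c_\varepsilon,\tau_\varepsilon)$ with $d\mathscr A_\varepsilon(c_\varepsilon,\tau_\varepsilon)=0$; along this subsequence $\mathscr A_\varepsilon(c_n,\tau_n)\to\mathscr A_\varepsilon(c_\varepsilon,\tau_\varepsilon)$, and $0<a_1\le\mathscr A_\varepsilon(c_\varepsilon,\tau_\varepsilon)\le a_2$. -/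

import Mathlib

open Set Filter MeasureTheory Manifold
open scoped Topology ENNReal ContDiff

noncomputable section

namespace MechanicalAction

/-- For a metric `G` on the vector space `E`, the linear form
`u ↦ (1/2) (∂_v G(w, u) + ∂_w G(v, u) - ∂_u G(v, w))` at the point `z`. -/
def koszulForm {E : Type*} [NormedAddCommGroup E] [NormedSpace ℝ E]
    (G : E → E →L[ℝ] E →L[ℝ] ℝ) (z v w : E) : E →ₗ[ℝ] ℝ where
  toFun u := (1 / 2 : ℝ) * (fderiv ℝ G z v w u + fderiv ℝ G z w v u - fderiv ℝ G z u v w)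
  map_add' u u' := by simp only [map_add, add_apply]; ring
  map_smul' r u := by
    simp only [map_smul, smul_apply, smul_eq_mul, RingHom.id_apply]; ring

section Geometry

open Bundle

/-! `M` is a manifold without boundary modelled on the finite-dimensional space `E`, and
`TangentSpace 𝓘(ℝ, E) q` carries the inner product given by the Riemannian metric. In Mathlib
`TangentSpace 𝓘(ℝ, E) q` is a copy of `E`, a tangent vector being identified with its coordinates
in the preferred chart at `q`. -/

variable {E : Type*} [NormedAddCommGroup E] [NormedSpace ℝ E] [FiniteDimensional ℝ E]
  {M : Type*} [MetricSpace M] [ChartedSpace E M]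
  [RiemannianBundle (fun x : M => TangentSpace 𝓘(ℝ, E) x)]

/-- The vector of the finite-dimensional inner product space `T_q M` that represents a
linear form. -/
def riesz (q : M) (l : TangentSpace 𝓘(ℝ, E) q →ₗ[ℝ] ℝ) : TangentSpace 𝓘(ℝ, E) q :=
  haveI : FiniteDimensional ℝ (TangentSpace 𝓘(ℝ, E) q) :=
    inferInstanceAs (FiniteDimensional ℝ E)
  haveI : CompleteSpace (TangentSpace 𝓘(ℝ, E) q) := FiniteDimensional.complete ℝ _
  (InnerProductSpace.toDual ℝ (TangentSpace 𝓘(ℝ, E) q)).symm (LinearMap.toContinuousLinearMap l)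

/-- `riesz q l` does represent `l`. -/
theorem inner_riesz (q : M) (l : TangentSpace 𝓘(ℝ, E) q →ₗ[ℝ] ℝ) (u : TangentSpace 𝓘(ℝ, E) q) :
    inner ℝ (riesz q l) u = l u := by
  simp [riesz]

/-- The Riemannian metric in the chart at `x`: the pull-back of the metric of `M` under the
inverse of the chart, as a bilinear form on `E` depending on the point `z : E`. -/
def chartMetric (x : M) (z : E) : E →L[ℝ] E →L[ℝ] ℝ :=
  let T : E →L[ℝ] TangentSpace 𝓘(ℝ, E) ((extChartAt 𝓘(ℝ, E) x).symm z) :=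
    mfderiv 𝓘(ℝ, E) 𝓘(ℝ, E) (extChartAt 𝓘(ℝ, E) x).symm z
  (innerSL ℝ (E := TangentSpace 𝓘(ℝ, E) ((extChartAt 𝓘(ℝ, E) x).symm z))).bilinearComp T T

/-- The linear form `u ↦ (1/2) (∂_v g(w, u) + ∂_w g(v, u) - ∂_u g(v, w))` at the point `q`, in the
chart at `q` (Christoffel symbols of the first kind). -/
def christoffelForm (q : M) (v w : TangentSpace 𝓘(ℝ, E) q) : TangentSpace 𝓘(ℝ, E) q →ₗ[ℝ] ℝ :=
  koszulForm (E := E) (chartMetric q) (extChartAt 𝓘(ℝ, E) q q) v w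

/-- The Christoffel symbol `Γ(v, w)` of the Levi-Civita connection at `q`, in the chart at `q`. -/
def christoffel (q : M) (v w : TangentSpace 𝓘(ℝ, E) q) : TangentSpace 𝓘(ℝ, E) q :=
  riesz q (christoffelForm q v w)

/-- The gradient of `V` at `q` with respect to the Riemannian metric. -/
def gradient (V : M → ℝ) (q : M) : TangentSpace 𝓘(ℝ, E) q :=
  riesz q (mfderiv 𝓘(ℝ, E) 𝓘(ℝ, ℝ) V q : TangentSpace 𝓘(ℝ, E) q →L[ℝ] ℝ).toLinearMap

/-- The Hessian `(∇_v dV) w = v (w V) - (∇_v w) V` at `q`, in the chart at `q`. -/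
def hessian (V : M → ℝ) (q : M) (v w : TangentSpace 𝓘(ℝ, E) q) : ℝ :=
  let f : E → ℝ := V ∘ (extChartAt 𝓘(ℝ, E) q).symm
  let z : E := extChartAt 𝓘(ℝ, E) q q
  fderiv ℝ (fderiv ℝ f) z v w - fderiv ℝ f z (christoffel q v w)

variable (E) in
/-- `‖Hess V(q)‖ = sup {|Hess V(q)(v, w)| : |v| = |w| = 1}`. -/
def hessianNorm (V : M → ℝ) (q : M) : ℝ :=
  sSup {r : ℝ | ∃ v w : TangentSpace 𝓘(ℝ, E) q, ‖v‖ = 1 ∧ ‖w‖ = 1 ∧ r = |hessian V q v w|}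

variable (E) in
/-- The potential `V` is asymptotically regular: for some compact set `K` and some constant
`V∞ > 0`, one has `|grad V| ≥ V∞` outside `K`, and `‖Hess V(q)‖ / |grad V(q)| → 0` as
`d(q, K) → ∞`. The set `K` is nonempty, so that `d(q, K)` makes sense. -/
def AsymptoticallyRegular (V : M → ℝ) : Prop :=
  ∃ K : Set M, IsCompact K ∧ K.Nonempty ∧ ∃ Vinf : ℝ, 0 < Vinf ∧
    (∀ q, q ∉ K → Vinf ≤ ‖(gradient V q : TangentSpace 𝓘(ℝ, E) q)‖) ∧
    Tendsto (fun q => hessianNorm E V q / ‖(gradient V q : TangentSpace 𝓘(ℝ, E) q)‖)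
      (comap (fun q => Metric.infDist q K) atTop) (𝓝 0)

end Geometry

section LoopSpace

open Bundle

variable (E : Type*) [NormedAddCommGroup E] [NormedSpace ℝ E]
  (M : Type*) [MetricSpace M] [ChartedSpace E M]
  [RiemannianBundle (fun x : M => TangentSpace 𝓘(ℝ, E) x)]

variable {M} in
/-- The derivative `c'(s)` of a curve in `M`. -/
def velocity (c : ℝ → M) (s : ℝ) : TangentSpace 𝓘(ℝ, E) (c s) :=
  mfderiv 𝓘(ℝ, ℝ) 𝓘(ℝ, E) c s (1 : ℝ)

/-- The free loop space `ΛM = H¹(S¹, M)`: absolutely continuous loops whose derivative, which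
exists almost everywhere, is square integrable. A loop is given by its 1-periodic lift to `ℝ`. -/
structure LoopSpace where
  toFun : ℝ → M
  periodic : Function.Periodic toFun 1
  absolutelyContinuous : ∀ a b : ℝ, AbsolutelyContinuousOnInterval toFun a b
  energy_lt_top : ∫⁻ s in Icc (0 : ℝ) 1, ‖velocity E toFun s‖ₑ ^ 2 < ⊤

instance : CoeFun (LoopSpace E M) (fun _ => ℝ → M) := ⟨LoopSpace.toFun⟩

end LoopSpace

section Differential

open Bundle

variable {E : Type*} [NormedAddCommGroup E] [NormedSpace ℝ E]
  {M : Type*} [MetricSpace M] [ChartedSpace E M]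
  [RiemannianBundle (fun x : M => TangentSpace 𝓘(ℝ, E) x)]

/-- The square of the `H¹` norm on `[a, b]` of an absolutely continuous function. -/
def h1NormSq (a b : ℝ) (u : ℝ → E) : ℝ≥0∞ :=
  ∫⁻ s in Icc a b, (‖u s‖ₑ ^ 2 + ‖deriv u s‖ₑ ^ 2)

/-- The loop `c` maps `[a, b]` into the domain of the chart at `x`. -/
def MapsIntoChart (c : LoopSpace E M) (x : M) (a b : ℝ) : Prop :=
  ∀ s ∈ Icc a b, c s ∈ (chartAt E x).source

/-- The loops that map `[a, b]` into the domain of the chart `φ` at `x`, and for which the squared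
`H¹` distance on `[a, b]` from `φ ∘ e` to `φ ∘ c` is less than `r`. -/
def chartBall (c : LoopSpace E M) (x : M) (a b : ℝ) (r : ℝ≥0∞) : Set (LoopSpace E M) :=
  {e | MapsIntoChart e x a b ∧
    h1NormSq a b (fun s => extChartAt 𝓘(ℝ, E) x (e s) - extChartAt 𝓘(ℝ, E) x (c s)) < r}

/-- The topology of the Hilbert manifold `ΛM`, that is, `H¹` convergence in charts: the coarsest
topology for which, for each chart `φ` and each interval `[a, b]`, the set of loops `e` that map
`[a, b]` into the domain of `φ` is open, and `e ↦ φ ∘ e` is continuous from it to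
`H¹([a, b], E)`. -/
instance : TopologicalSpace (LoopSpace E M) :=
  TopologicalSpace.generateFrom
    {U | ∃ (c : LoopSpace E M) (x : M) (a b : ℝ) (r : ℝ≥0∞), a ≤ b ∧ MapsIntoChart c x a b ∧
      0 < r ∧ U = chartBall c x a b r}

/-- The coordinates in the chart at `x` of a vector field along a loop. -/
def fieldCoord (c : LoopSpace E M) (ξ : ∀ s, TangentSpace 𝓘(ℝ, E) (c s)) (x : M) (s : ℝ) : E :=
  mfderiv 𝓘(ℝ, E) 𝓘(ℝ, E) (extChartAt 𝓘(ℝ, E) x) (c s) (ξ s)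

/-- The tangent space `T_c ΛM`: the periodic vector fields along `c` that are of class `H¹`, which
means that the coordinates in each chart are absolutely continuous with square integrable
derivative, on each interval that `c` maps into the domain of the chart. -/
structure LoopTangent (c : LoopSpace E M) where
  toFun : ∀ s, TangentSpace 𝓘(ℝ, E) (c s)
  periodic : Function.Periodic (fun s => (⟨c s, toFun s⟩ : TangentBundle 𝓘(ℝ, E) M)) 1
  absolutelyContinuous : ∀ (x : M) (a b : ℝ), a ≤ b → MapsIntoChart c x a b →
    AbsolutelyContinuousOnInterval (fieldCoord c toFun x) a b
  deriv_sq_lt_top : ∀ (x : M) (a b : ℝ), a ≤ b → MapsIntoChart c x a b →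
    ∫⁻ s in Icc a b, ‖deriv (fieldCoord c toFun x) s‖ₑ ^ 2 < ⊤

instance (c : LoopSpace E M) :
    CoeFun (LoopTangent c) (fun _ => ∀ s, TangentSpace 𝓘(ℝ, E) (c s)) := ⟨LoopTangent.toFun⟩

/-- The covariant derivative `∇_s ξ` of a vector field along a loop, computed at `s` in the chart
at `c(s)` as `ξ' + Γ(c', ξ)`. -/
def covDeriv [FiniteDimensional ℝ E] (c : LoopSpace E M) (ξ : LoopTangent c) (s : ℝ) :
    TangentSpace 𝓘(ℝ, E) (c s) :=
  let u : ℝ → E := fieldCoord c ξ (c s)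
  let u' : E := deriv u s
  let ξ' : TangentSpace 𝓘(ℝ, E) (c s) := u'
  ξ' + christoffel (c s) (velocity E c s) (ξ s)

/-- The `H¹` norm on `T_c ΛM`. -/
def h1Norm [FiniteDimensional ℝ E] {c : LoopSpace E M} (ξ : LoopTangent c) : ℝ :=
  Real.sqrt ((∫ s in (0 : ℝ)..1, ‖ξ s‖ ^ 2) + ∫ s in (0 : ℝ)..1, ‖covDeriv c ξ s‖ ^ 2)

/-- The curve `γ` in `ΛM` passes at time `0` through `c`, and it is differentiable there with
velocity `ξ`: it is continuous at `0`, and in each chart the difference quotients of `γ` converge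
in `H¹` to the coordinates of `ξ`. -/
structure HasLoopVelocity (γ : ℝ → LoopSpace E M) (c : LoopSpace E M) (ξ : LoopTangent c) :
    Prop where
  base : γ 0 = c
  continuousAt : ContinuousAt γ 0
  tendsto : ∀ (x : M) (a b : ℝ), a ≤ b → MapsIntoChart c x a b →
    Tendsto (fun t : ℝ => h1NormSq a b (fun s =>
        t⁻¹ • (extChartAt 𝓘(ℝ, E) x (γ t s) - extChartAt 𝓘(ℝ, E) x (c s)) - fieldCoord c ξ x s))
      (𝓝[≠] 0) (𝓝 0)

/-- `d` is the value `dF(p)(ξ, σ)` of the differential at `p = (c, τ)` of a function `F` on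
`ΛM × ℝ`: along each curve through `p` with velocity `(ξ, σ)`, `F` has derivative `d` at time `0`.
(Each tangent vector is the velocity of some curve, for example of `t ↦ (exp_c (t ξ), τ + t σ)`.) -/
def HasDifferential (F : LoopSpace E M × ℝ → ℝ) (p : LoopSpace E M × ℝ) (ξ : LoopTangent p.1)
    (σ d : ℝ) : Prop :=
  ∀ (γ : ℝ → LoopSpace E M) (θ : ℝ → ℝ), HasLoopVelocity γ p.1 ξ → θ 0 = p.2 →
    HasDerivAt θ σ 0 → HasDerivAt (fun t => F (γ t, θ t)) d 0

/-- `p` is a critical point of `F`, that is, `dF(p) = 0`. -/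
def IsCriticalPt (F : LoopSpace E M × ℝ → ℝ) (p : LoopSpace E M × ℝ) : Prop :=
  ∀ (ξ : LoopTangent p.1) (σ : ℝ), HasDifferential F p ξ σ 0

/-- `p` is a Palais-Smale sequence for `F` at levels between `a₁ > 0` and `a₂`: one has
`a₁ ≤ F(p_n) ≤ a₂` for all `n`, and `dF(p_n) → 0`, in the sense that
`dF(p_n)(ξ, σ) = o(1) (‖ξ‖_{H¹} + |σ|)`. -/
structure IsPalaisSmaleSeq [FiniteDimensional ℝ E] (F : LoopSpace E M × ℝ → ℝ) (a₁ a₂ : ℝ)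
    (p : ℕ → LoopSpace E M × ℝ) : Prop where
  pos : 0 < a₁
  le_action : ∀ n, a₁ ≤ F (p n)
  action_le : ∀ n, F (p n) ≤ a₂
  differential_tendsto_zero : ∀ δ > 0, ∀ᶠ n in atTop, ∀ (ξ : LoopTangent (p n).1) (σ d : ℝ),
    HasDifferential F (p n) ξ σ d → |d| ≤ δ * (h1Norm ξ + |σ|)

end Differential

section Action

open Bundle

variable {E : Type*} [NormedAddCommGroup E] [NormedSpace ℝ E]
  {M : Type*} [MetricSpace M] [ChartedSpace E M]
  [RiemannianBundle (fun x : M => TangentSpace 𝓘(ℝ, E) x)]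

/-- The action `A(c, τ) = (e^{-τ} / 2) ∫₀¹ |c'|² - e^τ ∫₀¹ V(c)`. -/
def action (V : M → ℝ) (p : LoopSpace E M × ℝ) : ℝ :=
  Real.exp (-p.2) / 2 * (∫ s in (0 : ℝ)..1, ‖velocity E p.1 s‖ ^ 2) -
    Real.exp p.2 * ∫ s in (0 : ℝ)..1, V (p.1 s)

/-- The penalized action `A_ε(c, τ) = A(c, τ) + ε (e^{-τ} + e^{τ / 2})`. -/
def penalizedAction (V : M → ℝ) (ε : ℝ) (p : LoopSpace E M × ℝ) : ℝ :=
  action V p + ε * (Real.exp (-p.2) + Real.exp (p.2 / 2))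

end Action

end MechanicalAction

end

/-! Subtracting from the penalized action its τ-derivative leaves e^{-τ}∫|c'|² + ε(2e^{-τ} +
e^{τ/2}/2): the potential cancels. Along a Palais–Smale sequence this quantity is eventually at most
a₂ + 1, which bounds τ on both sides and then the energy (`IsPalaisSmaleSeq.exists_bounds`).

Bounded energy bounds the diameter of the loops, so a loop with one point far from K is far away as
a whole. Along such a loop the differential is tested on ξ = grad V/|grad V|. Since |∇_s ξ| ≤ (‖Hess
V‖/|grad V|)|c'| (`norm_covDeriv_unitGradField_le`), the kinetic part is small, while the potential
part is at least e^τ V∞; this contradicts the smallness of the differential. Hence the loops stay in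
a closed ball (`IsPalaisSmaleSeq.exists_closedBall`), which is compact by Hopf–Rinow
(`isCompact_closedBall_of_complete`), and Arzelà–Ascoli gives a uniformly convergent subsequence
(`exists_subseq_tendstoUniformly`).

To pass from uniform to H¹ convergence, two loops of the sequence are compared over a short interval
in one chart, with coordinates u₁, u₂ and a cut-off ρ. The same coordinate vector ρ(u₁ - u₂) defines
a test field along each loop. The difference of the two first variations of the energy is at least
κ∫ρ|u₁' - u₂'|² up to an error of order sup|u₁ - u₂| (`energy_density_le`); each of the two is small
by the Palais–Smale condition, up to a potential term of the same order. So the derivatives are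
Cauchy in L² (`LoopSpace.integral_sq_sub_deriv_le`, `exists_h1_convergence_chart`), and the local
limits fit together to a limit in ΛM (`LoopSpace.exists_tendsto`).

For criticality, a field along the limit that is supported in one chart is transplanted, with
unchanged coordinates, to the nearby loops; its H¹ norm stays bounded, so the differential of the
limit vanishes on it (`IsChartField.actionDiff_eq_zero`). A partition of unity on the circle writes
every field as a finite sum of such fields (`LoopTangent.exists_sum_chartFields`). The τ-derivative
is continuous.

The differential is defined through curves in ΛM and is computed in
`hasDifferential_penalizedAction`. The computations take place in charts: `inner_covDeriv` expresses
∇_s ξ in any chart, by the transformation law of the Christoffel symbols, and `interval_induction`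
turns facts about short intervals into facts about [0, 1]. -/

set_option linter.unusedSectionVars false

noncomputable section

open Bundle

namespace MechanicalAction

/-! ### Tangent vectors and the metric in chart coordinates -/

section ChartMetric

variable {E : Type*} [NormedAddCommGroup E] [NormedSpace ℝ E]
  {M : Type*} [MetricSpace M] [ChartedSpace E M]

/-- The coordinates of a tangent vector in the chart at `x`. -/
def chartCoord (x q : M) : TangentSpace 𝓘(ℝ, E) q →L[ℝ] E :=
  mfderiv 𝓘(ℝ, E) 𝓘(ℝ, E) (extChartAt 𝓘(ℝ, E) x) q

/-- The tangent vector with given coordinates in the chart at `x`. -/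
def chartVec (x : M) (z : E) : E →L[ℝ] TangentSpace 𝓘(ℝ, E) ((extChartAt 𝓘(ℝ, E) x).symm z) :=
  mfderiv 𝓘(ℝ, E) 𝓘(ℝ, E) (extChartAt 𝓘(ℝ, E) x).symm z

theorem chartMetric_apply [RiemannianBundle (fun x : M => TangentSpace 𝓘(ℝ, E) x)]
    (x : M) (z v w : E) :
    chartMetric x z v w = inner ℝ (chartVec x z v) (chartVec x z w) := rfl

theorem chartMetric_symm [RiemannianBundle (fun x : M => TangentSpace 𝓘(ℝ, E) x)]
    (x : M) (z v w : E) : chartMetric x z v w = chartMetric x z w v := by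
  rw [chartMetric_apply, chartMetric_apply]
  exact real_inner_comm _ _

variable [IsManifold 𝓘(ℝ, E) ∞ M]

theorem chartCoord_chartVec {x : M} {z : E} (hz : z ∈ (extChartAt 𝓘(ℝ, E) x).target) (v : E) :
    chartCoord x ((extChartAt 𝓘(ℝ, E) x).symm z) (chartVec x z v) = v := by
  have := mfderiv_extChartAt_comp_mfderivWithin_extChartAt_symm (I := 𝓘(ℝ, E)) hz
  rw [modelWithCornersSelf_coe, range_id, mfderivWithin_univ] at this
  exact congrArg (fun L : E →L[ℝ] E => L v) this

theorem chartVec_chartCoord {x : M} {z : E} (hz : z ∈ (extChartAt 𝓘(ℝ, E) x).target)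
    (v : TangentSpace 𝓘(ℝ, E) ((extChartAt 𝓘(ℝ, E) x).symm z)) :
    chartVec x z (chartCoord x ((extChartAt 𝓘(ℝ, E) x).symm z) v) = v := by
  have := mfderivWithin_extChartAt_symm_comp_mfderiv_extChartAt (I := 𝓘(ℝ, E)) hz
  rw [modelWithCornersSelf_coe, range_id, mfderivWithin_univ] at this
  exact congrArg (fun L : TangentSpace 𝓘(ℝ, E) ((extChartAt 𝓘(ℝ, E) x).symm z) →L[ℝ]
    TangentSpace 𝓘(ℝ, E) ((extChartAt 𝓘(ℝ, E) x).symm z) => L v) this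

/-- Tangent vectors at `q` are by convention their coordinates in the preferred chart, so the
derivative of that chart at `q` is the identity. This links `christoffel`, `hessian` and `covDeriv`,
all written in the preferred chart, to formulas valid in every chart. -/
theorem chartCoord_self (q : M) (v : TangentSpace 𝓘(ℝ, E) q) : chartCoord q q v = v :=
  congrArg (fun L : TangentSpace 𝓘(ℝ, E) q →L[ℝ] E => L v) (mfderiv_extChartAt_self (x := q))

theorem exists_chartCoord_eq {x q : M} (hq : q ∈ (chartAt E x).source) (v : E) :
    ∃ w : TangentSpace 𝓘(ℝ, E) q, chartCoord x q w = v := by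
  have hq' : q ∈ (extChartAt 𝓘(ℝ, E) x).source := by simpa using hq
  obtain ⟨z, hz, rfl⟩ : ∃ z ∈ (extChartAt 𝓘(ℝ, E) x).target, (extChartAt 𝓘(ℝ, E) x).symm z = q :=
    ⟨_, (extChartAt 𝓘(ℝ, E) x).map_source hq', (extChartAt 𝓘(ℝ, E) x).left_inv hq'⟩
  exact ⟨_, chartCoord_chartVec hz v⟩

variable [RiemannianBundle (fun x : M => TangentSpace 𝓘(ℝ, E) x)]

theorem inner_eq_chartMetric {x q : M} (hq : q ∈ (chartAt E x).source)
    (v w : TangentSpace 𝓘(ℝ, E) q) :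
    inner ℝ v w = chartMetric x (extChartAt 𝓘(ℝ, E) x q) (chartCoord x q v) (chartCoord x q w) := by
  have hq' : q ∈ (extChartAt 𝓘(ℝ, E) x).source := by simpa using hq
  obtain ⟨z, hz, rfl⟩ : ∃ z ∈ (extChartAt 𝓘(ℝ, E) x).target, (extChartAt 𝓘(ℝ, E) x).symm z = q :=
    ⟨_, (extChartAt 𝓘(ℝ, E) x).map_source hq', (extChartAt 𝓘(ℝ, E) x).left_inv hq'⟩
  rw [(extChartAt 𝓘(ℝ, E) x).right_inv hz, chartMetric_apply, chartVec_chartCoord hz,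
    chartVec_chartCoord hz]

theorem chartMetric_pos {x : M} {z : E} (hz : z ∈ (extChartAt 𝓘(ℝ, E) x).target) {v : E}
    (hv : v ≠ 0) : 0 < chartMetric x z v v := by
  rw [chartMetric_apply]
  refine real_inner_self_pos.2 fun h => hv ?_
  rw [← chartCoord_chartVec hz v, h]
  exact map_zero _

/-- A constant vector is a smooth section over `E`; the tangent map of the inverse chart carries it
to a smooth map into the tangent bundle of `M`, and the inner product of two such maps is smooth
because the bundle metric is. -/
theorem contDiffOn_chartMetric [FiniteDimensional ℝ E]
    [IsContMDiffRiemannianBundle 𝓘(ℝ, E) ∞ E (fun x : M => TangentSpace 𝓘(ℝ, E) x)] (x : M) :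
    ContDiffOn ℝ ∞ (chartMetric x : E → E →L[ℝ] E →L[ℝ] ℝ) (extChartAt 𝓘(ℝ, E) x).target := by
  rw [contDiffOn_clm_apply]
  intro v
  rw [contDiffOn_clm_apply]
  intro w
  have key : ∀ v : E, ContMDiffOn 𝓘(ℝ, E) (𝓘(ℝ, E).prod 𝓘(ℝ, E)) ∞
      (fun z : E => (⟨(extChartAt 𝓘(ℝ, E) x).symm z, chartVec x z v⟩ : TangentBundle 𝓘(ℝ, E) M))
      (extChartAt 𝓘(ℝ, E) x).target := by
    intro v
    have h1 : ContMDiffOn 𝓘(ℝ, E) 𝓘(ℝ, E) ∞ (extChartAt 𝓘(ℝ, E) x).symm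
      (extChartAt 𝓘(ℝ, E) x).target := contMDiffOn_extChartAt_symm x
    have h2 := h1.contMDiffOn_tangentMapWithin (m := ∞) (by simp)
      (isOpen_extChartAt_target x).uniqueMDiffOn
    have h3 : ContMDiff 𝓘(ℝ, E) (𝓘(ℝ, E).prod 𝓘(ℝ, E)) ∞
        (fun z : E => (⟨z, v⟩ : TangentBundle 𝓘(ℝ, E) E)) :=
      (contMDiff_vectorSpace_iff_contDiff (V := fun _ => v)).2 contDiff_const
    refine (h2.comp h3.contMDiffOn (fun z hz => hz)).congr fun z hz => ?_
    simp only [Function.comp_def, tangentMapWithin]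
    rw [mfderivWithin_of_isOpen (isOpen_extChartAt_target x) hz]
    rfl
  have := ContMDiffOn.inner_bundle (E := (fun x : M => TangentSpace 𝓘(ℝ, E) x)) (b := fun z => (extChartAt 𝓘(ℝ, E) x).symm z) (key v) (key w)
  exact contMDiffOn_iff_contDiffOn.1 this

end ChartMetric

/-! ### Change of charts, Christoffel symbols and the covariant derivative -/

section Transition

theorem koszulForm_apply {E : Type*} [NormedAddCommGroup E] [NormedSpace ℝ E]
    (G : E → E →L[ℝ] E →L[ℝ] ℝ) (z v w u : E) : koszulForm G z v w u =
      (1 / 2 : ℝ) * (fderiv ℝ G z v w u + fderiv ℝ G z w v u - fderiv ℝ G z u v w) := rfl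

theorem hasDerivAt_fderiv_apply {E F : Type*} [NormedAddCommGroup E] [NormedSpace ℝ E]
    [NormedAddCommGroup F] [NormedSpace ℝ F] {ψ : E → F} {u w : ℝ → E} {s : ℝ}
    (hψ : DifferentiableAt ℝ (fderiv ℝ ψ) (u s))
    (hu : DifferentiableAt ℝ u s) (hw : DifferentiableAt ℝ w s) :
    HasDerivAt (fun r => fderiv ℝ ψ (u r) (w r))
      (fderiv ℝ (fderiv ℝ ψ) (u s) (deriv u s) (w s) + fderiv ℝ ψ (u s) (deriv w s)) s :=
  (hψ.hasFDerivAt.comp_hasDerivAt s hu.hasDerivAt).clm_apply hw.hasDerivAt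

set_option synthInstance.maxHeartbeats 100000 in
/-- The transformation law of the Christoffel symbols of the first kind. -/
theorem koszulForm_pullback {E : Type*} [NormedAddCommGroup E] [NormedSpace ℝ E]
    {G₁ G₂ : E → E →L[ℝ] E →L[ℝ] ℝ} {ψ : E → E} {z : E}
    (h₁ : DifferentiableAt ℝ G₁ z) (h₂ : DifferentiableAt ℝ G₂ (ψ z))
    (hψ : DifferentiableAt ℝ ψ z) (hψ' : DifferentiableAt ℝ (fderiv ℝ ψ) z)
    (hsymm : ∀ v w, fderiv ℝ (fderiv ℝ ψ) z v w = fderiv ℝ (fderiv ℝ ψ) z w v)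
    (hG : ∀ v w, G₂ (ψ z) v w = G₂ (ψ z) w v)
    (h : ∀ᶠ y in 𝓝 z, ∀ v w, G₁ y v w = G₂ (ψ y) (fderiv ℝ ψ y v) (fderiv ℝ ψ y w)) (v w u : E) :
    koszulForm G₁ z v w u =
      koszulForm G₂ (ψ z) (fderiv ℝ ψ z v) (fderiv ℝ ψ z w) (fderiv ℝ ψ z u) +
      G₂ (ψ z) (fderiv ℝ (fderiv ℝ ψ) z v w) (fderiv ℝ ψ z u) := by
  -- The product rule applied to G₁ = ψ^*G₂: one term from the derivative of G₂, two from that of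
  -- Dψ.
  have key : ∀ v w u : E, fderiv ℝ G₁ z v w u =
      fderiv ℝ G₂ (ψ z) (fderiv ℝ ψ z v) (fderiv ℝ ψ z w) (fderiv ℝ ψ z u) +
      G₂ (ψ z) (fderiv ℝ (fderiv ℝ ψ) z v w) (fderiv ℝ ψ z u) +
      G₂ (ψ z) (fderiv ℝ ψ z w) (fderiv ℝ (fderiv ℝ ψ) z v u) := by
    intro v w u
    have e1 : HasFDerivAt (fun y => G₁ y w u) _ z :=
      (h₁.hasFDerivAt.clm_apply (hasFDerivAt_const w z)).clm_apply (hasFDerivAt_const u z)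
    have e2 : HasFDerivAt (fun y => G₂ (ψ y) (fderiv ℝ ψ y w) (fderiv ℝ ψ y u)) _ z :=
      ((h₂.hasFDerivAt.comp z hψ.hasFDerivAt).clm_apply
        (hψ'.hasFDerivAt.clm_apply (hasFDerivAt_const w z))).clm_apply
        (hψ'.hasFDerivAt.clm_apply (hasFDerivAt_const u z))
    have e3 := e1.unique (e2.congr_of_eventuallyEq (h.mono fun y hy => hy w u))
    have := congrArg (fun L : E →L[ℝ] ℝ => L v) e3
    simpa [add_comm, add_left_comm, add_assoc] using this
  simp only [koszulForm_apply, key]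
  -- Of the six terms with D²ψ, four cancel in pairs by the symmetry of D²ψ and of G₂; the two that
  -- remain are equal, and absorb the factor 1/2.
  rw [hsymm w v, hsymm u v, hsymm u w, hG (fderiv ℝ (fderiv ℝ ψ) z v u),
    hG (fderiv ℝ (fderiv ℝ ψ) z v w)]
  rw [hG (fderiv ℝ ψ z v) (fderiv ℝ (fderiv ℝ ψ) z w u)]
  ring

variable {E : Type*} [NormedAddCommGroup E] [NormedSpace ℝ E]
  {M : Type*} [MetricSpace M] [ChartedSpace E M]

/-- The change of coordinates from the chart at `x` to the chart at `y`. -/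
def chartChange (x y : M) : E → E := extChartAt 𝓘(ℝ, E) y ∘ (extChartAt 𝓘(ℝ, E) x).symm

theorem chartChange_apply {x y q : M} (hx : q ∈ (chartAt E x).source) :
    chartChange x y (extChartAt 𝓘(ℝ, E) x q) = extChartAt 𝓘(ℝ, E) y q := by
  rw [chartChange, Function.comp_apply, (extChartAt 𝓘(ℝ, E) x).left_inv (by simpa using hx)]

variable [IsManifold 𝓘(ℝ, E) ∞ M]

/-- A vector of `E`, as a tangent vector in the coordinates of the preferred chart. -/
def toTangent (q : M) (v : E) : TangentSpace 𝓘(ℝ, E) q := v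

theorem chartCoord_toTangent (q : M) (v : E) : chartCoord q q (toTangent q v) = v :=
  chartCoord_self q (toTangent q v)

/-- The chain rule where `c` is differentiable. Elsewhere both sides are zero by convention: the
chart and its inverse are differentiable, so `c` and its coordinate expression fail to be
differentiable at the same points. -/
theorem chartCoord_velocity {x : M} {c : ℝ → M} {s : ℝ} (hc : ContinuousAt c s)
    (hs : c s ∈ (chartAt E x).source) :
    chartCoord x (c s) (velocity E c s) = deriv (extChartAt 𝓘(ℝ, E) x ∘ c) s := by
  by_cases hd : MDifferentiableAt 𝓘(ℝ, ℝ) 𝓘(ℝ, E) c s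
  · have h1 := mfderiv_comp s (mdifferentiableAt_extChartAt (I := 𝓘(ℝ, E)) hs) hd
    have h2 : fderiv ℝ (extChartAt 𝓘(ℝ, E) x ∘ c) s 1 =
        chartCoord x (c s) (velocity E c s) := by
      rw [← mfderiv_eq_fderiv, h1]; rfl
    rw [← h2, fderiv_apply_one_eq_deriv]
  · have h1 : velocity E c s = 0 := by
      rw [velocity, mfderiv_zero_of_not_mdifferentiableAt hd]; rfl
    rw [h1, map_zero, deriv_zero_of_not_differentiableAt]
    intro h2
    apply hd
    have h3 : MDifferentiableAt 𝓘(ℝ, E) 𝓘(ℝ, E) (extChartAt 𝓘(ℝ, E) x).symm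
        ((extChartAt 𝓘(ℝ, E) x ∘ c) s) := by
      have := mdifferentiableWithinAt_extChartAt_symm (I := 𝓘(ℝ, E))
        ((extChartAt 𝓘(ℝ, E) x).map_source (by simpa using hs : c s ∈ _))
      rwa [modelWithCornersSelf_coe, range_id, mdifferentiableWithinAt_univ] at this
    refine (h3.comp s h2.mdifferentiableAt).congr_of_eventuallyEq ?_
    filter_upwards [hc.preimage_mem_nhds ((chartAt E x).open_source.mem_nhds hs)] with r hr
    exact ((extChartAt 𝓘(ℝ, E) x).left_inv (by simpa using hr)).symm

theorem contDiffAt_chartChange {x y q : M} (hx : q ∈ (chartAt E x).source)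
    (hy : q ∈ (chartAt E y).source) :
    ContDiffAt ℝ ∞ (chartChange x y : E → E) (extChartAt 𝓘(ℝ, E) x q) := by
  have h1 : ContMDiffAt 𝓘(ℝ, E) 𝓘(ℝ, E) ∞ (extChartAt 𝓘(ℝ, E) x).symm
      (extChartAt 𝓘(ℝ, E) x q) :=
    (contMDiffOn_extChartAt_symm x).contMDiffAt (extChartAt_target_mem_nhds'
      ((extChartAt 𝓘(ℝ, E) x).map_source (by simpa using hx)))
  have h2 : (extChartAt 𝓘(ℝ, E) x).symm (extChartAt 𝓘(ℝ, E) x q) = q :=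
    (extChartAt 𝓘(ℝ, E) x).left_inv (by simpa using hx)
  have h3 : ContMDiffAt 𝓘(ℝ, E) 𝓘(ℝ, E) ∞ (extChartAt 𝓘(ℝ, E) y) q :=
    contMDiffAt_extChartAt' hy
  rw [← h2] at h3
  exact (h3.comp _ h1).contDiffAt

theorem chartCoord_eq_fderiv_chartChange {x y q : M} (hx : q ∈ (chartAt E x).source)
    (hy : q ∈ (chartAt E y).source) (v : TangentSpace 𝓘(ℝ, E) q) :
    chartCoord y q v =
      fderiv ℝ (chartChange x y) (extChartAt 𝓘(ℝ, E) x q) (chartCoord x q v) := by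
  have h1 := mfderiv_comp q ((contDiffAt_chartChange hx hy).differentiableAt
    (by simp)).mdifferentiableAt (mdifferentiableAt_extChartAt (I := 𝓘(ℝ, E)) hx)
  have h2 : chartChange x y ∘ extChartAt 𝓘(ℝ, E) x =ᶠ[𝓝 q] extChartAt 𝓘(ℝ, E) y := by
    filter_upwards [(chartAt E x).open_source.mem_nhds hx] with r hr
    exact chartChange_apply hr
  rw [h2.mfderiv_eq, mfderiv_eq_fderiv] at h1
  exact congrArg (fun L : TangentSpace 𝓘(ℝ, E) q →L[ℝ] E => L v) h1

variable [RiemannianBundle (fun x : M => TangentSpace 𝓘(ℝ, E) x)]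

theorem chartMetric_chartChange {x y q : M} (hx : q ∈ (chartAt E x).source)
    (hy : q ∈ (chartAt E y).source) (v w : E) :
    chartMetric x (extChartAt 𝓘(ℝ, E) x q) v w = chartMetric y (extChartAt 𝓘(ℝ, E) y q)
      (fderiv ℝ (chartChange x y) (extChartAt 𝓘(ℝ, E) x q) v)
      (fderiv ℝ (chartChange x y) (extChartAt 𝓘(ℝ, E) x q) w) := by
  obtain ⟨v, rfl⟩ := exists_chartCoord_eq hx v
  obtain ⟨w, rfl⟩ := exists_chartCoord_eq hx w
  rw [← inner_eq_chartMetric hx, ← chartCoord_eq_fderiv_chartChange hx hy,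
    ← chartCoord_eq_fderiv_chartChange hx hy, ← inner_eq_chartMetric hy]

theorem sq_norm_velocity {x : M} {c : ℝ → M} {s : ℝ} (hc : ContinuousAt c s)
    (hs : c s ∈ (chartAt E x).source) :
    ‖velocity E c s‖ ^ 2 = chartMetric x (extChartAt 𝓘(ℝ, E) x (c s))
      (deriv (extChartAt 𝓘(ℝ, E) x ∘ c) s) (deriv (extChartAt 𝓘(ℝ, E) x ∘ c) s) := by
  rw [← real_inner_self_eq_norm_sq, inner_eq_chartMetric hs, chartCoord_velocity hc hs]

variable [FiniteDimensional ℝ E]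
    [IsContMDiffRiemannianBundle 𝓘(ℝ, E) ∞ E (fun x : M => TangentSpace 𝓘(ℝ, E) x)]

theorem contDiffAt_chartMetric {x q : M} (hx : q ∈ (chartAt E x).source) :
    ContDiffAt ℝ ∞ (chartMetric x : E → E →L[ℝ] E →L[ℝ] ℝ) (extChartAt 𝓘(ℝ, E) x q) :=
  (contDiffOn_chartMetric x).contDiffAt (extChartAt_target_mem_nhds'
    ((extChartAt 𝓘(ℝ, E) x).map_source (by simpa using hx)))

/-- The transformation law of the Christoffel symbols under a change of charts. -/
theorem koszulForm_chartChange {x y q : M} (hx : q ∈ (chartAt E x).source)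
    (hy : q ∈ (chartAt E y).source) (v w u : E) :
    koszulForm (chartMetric x : E → E →L[ℝ] E →L[ℝ] ℝ) (extChartAt 𝓘(ℝ, E) x q) v w u =
      koszulForm (chartMetric y : E → E →L[ℝ] E →L[ℝ] ℝ) (extChartAt 𝓘(ℝ, E) y q)
        (fderiv ℝ (chartChange x y) (extChartAt 𝓘(ℝ, E) x q) v)
        (fderiv ℝ (chartChange x y) (extChartAt 𝓘(ℝ, E) x q) w)
        (fderiv ℝ (chartChange x y) (extChartAt 𝓘(ℝ, E) x q) u) +
      chartMetric y (extChartAt 𝓘(ℝ, E) y q)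
        (fderiv ℝ (fderiv ℝ (chartChange x y)) (extChartAt 𝓘(ℝ, E) x q) v w)
        (fderiv ℝ (chartChange x y) (extChartAt 𝓘(ℝ, E) x q) u) := by
  have hψ := contDiffAt_chartChange hx hy
  have hψ' : ContDiffAt ℝ 1 (fderiv ℝ (chartChange x y : E → E)) (extChartAt 𝓘(ℝ, E) x q) :=
    hψ.fderiv_right (by norm_cast)
  have hg : DifferentiableAt ℝ (chartMetric y : E → E →L[ℝ] E →L[ℝ] ℝ)
      (chartChange x y (extChartAt 𝓘(ℝ, E) x q)) := by
    rw [chartChange_apply hx]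
    exact (contDiffAt_chartMetric hy).differentiableAt (by simp)
  have := koszulForm_pullback (G₁ := chartMetric x) (G₂ := chartMetric y)
    (ψ := chartChange x y) (z := extChartAt 𝓘(ℝ, E) x q)
    ((contDiffAt_chartMetric hx).differentiableAt (by simp)) hg
    (hψ.differentiableAt (by simp)) (hψ'.differentiableAt (by simp))
    (fun v w => (hψ.isSymmSndFDerivAt (by
      rw [minSmoothness_of_isRCLikeNormedField]; exact ENat.LEInfty.out)) v w)
    (fun v w => chartMetric_symm _ _ _ _) ?_ v w u
  · rwa [chartChange_apply hx] at this
  · have hO : IsOpen ((extChartAt 𝓘(ℝ, E) x).target ∩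
        (extChartAt 𝓘(ℝ, E) x).symm ⁻¹' (chartAt E y).source) :=
      (continuousOn_extChartAt_symm x).isOpen_inter_preimage (isOpen_extChartAt_target x)
        (chartAt E y).open_source
    have hq : extChartAt 𝓘(ℝ, E) x q ∈ ((extChartAt 𝓘(ℝ, E) x).target ∩
        (extChartAt 𝓘(ℝ, E) x).symm ⁻¹' (chartAt E y).source) := by
      refine ⟨(extChartAt 𝓘(ℝ, E) x).map_source (by simpa using hx), ?_⟩
      rwa [mem_preimage, (extChartAt 𝓘(ℝ, E) x).left_inv (by simpa using hx)]
    filter_upwards [hO.mem_nhds hq] with z hz v w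
    have hz' : (extChartAt 𝓘(ℝ, E) x).symm z ∈ (chartAt E x).source := by
      simpa using (extChartAt 𝓘(ℝ, E) x).map_target hz.1
    have := chartMetric_chartChange hz' hz.2 v w
    rw [(extChartAt 𝓘(ℝ, E) x).right_inv hz.1] at this
    exact this

/-- The covariant derivative of a vector field along a loop, in the chart at `x`. -/
theorem inner_covDeriv {x : M} {c : LoopSpace E M} {ξ : LoopTangent c} {s : ℝ}
    (hc : ContinuousAt c s) (hs : c s ∈ (chartAt E x).source)
    (hu : DifferentiableAt ℝ (extChartAt 𝓘(ℝ, E) x ∘ c) s)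
    (hw : DifferentiableAt ℝ (fieldCoord c ξ x) s) (y : TangentSpace 𝓘(ℝ, E) (c s)) :
    inner ℝ (covDeriv c ξ s) y =
      chartMetric x (extChartAt 𝓘(ℝ, E) x (c s)) (deriv (fieldCoord c ξ x) s)
        (chartCoord x (c s) y) +
      koszulForm (chartMetric x : E → E →L[ℝ] E →L[ℝ] ℝ) (extChartAt 𝓘(ℝ, E) x (c s))
        (deriv (extChartAt 𝓘(ℝ, E) x ∘ c) s) (fieldCoord c ξ x s) (chartCoord x (c s) y) := by
  have hs' : c s ∈ (chartAt E (c s)).source := mem_chart_source E (c s)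
  have e1 : inner ℝ (covDeriv c ξ s) y =
      chartMetric (c s) (extChartAt 𝓘(ℝ, E) (c s) (c s)) (deriv (fieldCoord c ξ (c s)) s)
        (chartCoord (c s) (c s) y) +
      koszulForm (chartMetric (c s) : E → E →L[ℝ] E →L[ℝ] ℝ) (extChartAt 𝓘(ℝ, E) (c s) (c s))
        (chartCoord (c s) (c s) (velocity E c s)) (chartCoord (c s) (c s) (ξ s))
        (chartCoord (c s) (c s) y) := by
    have : covDeriv c ξ s = toTangent (c s) (deriv (fieldCoord c ξ (c s)) s) + christoffel (c s) (velocity E c s) (ξ s) := rfl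
    rw [this, inner_add_left, christoffel, inner_riesz, inner_eq_chartMetric hs',
      chartCoord_toTangent, chartCoord_self, chartCoord_self, chartCoord_self]
    rfl
  -- Near `s` the coordinates in the preferred chart are Dψ(u)w. Differentiating produces D²ψ(u',
  -- w), which is exactly the inhomogeneous term in the transformation law of the Christoffel
  -- symbols.
  have e2 : deriv (fieldCoord c ξ (c s)) s =
      fderiv ℝ (fderiv ℝ (chartChange x (c s))) (extChartAt 𝓘(ℝ, E) x (c s))
        (deriv (extChartAt 𝓘(ℝ, E) x ∘ c) s) (fieldCoord c ξ x s) +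
      fderiv ℝ (chartChange x (c s)) (extChartAt 𝓘(ℝ, E) x (c s))
        (deriv (fieldCoord c ξ x) s) := by
    have h1 : fieldCoord c ξ (c s) =ᶠ[𝓝 s] fun r =>
        fderiv ℝ (chartChange x (c s)) ((extChartAt 𝓘(ℝ, E) x ∘ c) r) (fieldCoord c ξ x r) := by
      filter_upwards [hc.preimage_mem_nhds ((chartAt E x).open_source.mem_nhds hs),
        hc.preimage_mem_nhds ((chartAt E (c s)).open_source.mem_nhds hs')] with r hr hr'
      exact chartCoord_eq_fderiv_chartChange hr hr' (ξ r)
    have hψ' : ContDiffAt ℝ 1 (fderiv ℝ (chartChange x (c s) : E → E))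
        (extChartAt 𝓘(ℝ, E) x (c s)) :=
      (contDiffAt_chartChange hs hs').fderiv_right (by norm_cast)
    have h2 := hasDerivAt_fderiv_apply (u := extChartAt 𝓘(ℝ, E) x ∘ c)
      (hψ'.differentiableAt (by simp)) hu hw
    rw [h1.deriv_eq]
    exact h2.deriv
  have e3 : fieldCoord c ξ x s = chartCoord x (c s) (ξ s) := rfl
  rw [e1, e2, koszulForm_chartChange hs hs', chartMetric_chartChange hs hs', map_add, e3,
    chartCoord_eq_fderiv_chartChange hs hs', chartCoord_eq_fderiv_chartChange hs hs' (ξ s),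
    chartCoord_eq_fderiv_chartChange hs hs' (velocity E c s), chartCoord_velocity hc hs,
    add_apply]
  ring

end Transition

/-! ### From short intervals to long ones -/

section IntervalInduction

/-- A property of intervals that is additive and holds for short intervals holds for all
intervals. -/
theorem interval_induction {P : ℝ → ℝ → Prop}
    (hadd : ∀ a b c, a ≤ b → b ≤ c → P a b → P b c → P a c) {a b : ℝ} (hab : a ≤ b)
    (hloc : ∀ s ∈ Icc a b, ∃ δ > 0, ∀ u v, a ≤ u → u ≤ v → v ≤ b → s - δ < u → v < s + δ → P u v) :
    P a b := by
  have haa : P a a := by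
    obtain ⟨δ, hδ, h⟩ := hloc a ⟨le_rfl, hab⟩
    exact h a a le_rfl le_rfl hab (by linarith) (by linarith)
  set S : Set ℝ := {t | t ∈ Icc a b ∧ P a t} with hS
  have haS : a ∈ S := ⟨⟨le_rfl, hab⟩, haa⟩
  have hbdd : BddAbove S := ⟨b, fun t ht => ht.1.2⟩
  have h1 : sSup S ∈ Icc a b := ⟨le_csSup hbdd haS, csSup_le ⟨a, haS⟩ fun t ht => ht.1.2⟩
  obtain ⟨δ, hδ, h⟩ := hloc _ h1
  obtain ⟨t, htS, ht⟩ := exists_lt_of_lt_csSup ⟨a, haS⟩ (show sSup S - δ < sSup S by linarith)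
  have htle : t ≤ sSup S := le_csSup hbdd htS
  -- A good endpoint just below the supremum is joined to a point beyond it (or to `b`) by an
  -- interval inside the δ-neighbourhood of the supremum. Hence the supremum can only be `b`.
  have hr : min b (sSup S + δ / 2) ∈ S := by
    have hle : t ≤ min b (sSup S + δ / 2) := le_min htS.1.2 (by linarith)
    refine ⟨⟨htS.1.1.trans hle, min_le_left _ _⟩, hadd a t _ htS.1.1 hle htS.2 ?_⟩
    exact h t _ htS.1.1 hle (min_le_left _ _) ht
      ((min_le_right _ _).trans_lt (by linarith))
  have h2 := le_csSup hbdd hr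
  rcases min_le_iff.1 h2 with h3 | h3
  · have : min b (sSup S + δ / 2) = b := min_eq_left (by linarith)
    rw [this] at hr
    exact hr.2
  · linarith

end IntervalInduction

/-! ### Absolutely continuous functions with values in E -/

section AbsolutelyContinuous

theorem _root_.AbsolutelyContinuousOnInterval.of_dist_le {X Y : Type*} [PseudoMetricSpace X]
    [PseudoMetricSpace Y] {f : ℝ → X} {g : ℝ → Y} {a b : ℝ} {C : ℝ}
    (hg : AbsolutelyContinuousOnInterval g a b)
    (h : ∀ s ∈ uIcc a b, ∀ t ∈ uIcc a b, dist (f s) (f t) ≤ C * dist (g s) (g t)) :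
    AbsolutelyContinuousOnInterval f a b := by
  have h0 : Tendsto (fun E : ℕ × (ℕ → ℝ × ℝ) =>
      C * ∑ i ∈ Finset.range E.1, dist (g (E.2 i).1) (g (E.2 i).2))
      (AbsolutelyContinuousOnInterval.totalLengthFilter ⊓
        𝓟 (AbsolutelyContinuousOnInterval.disjWithin a b)) (𝓝 0) := by
    simpa using Tendsto.const_mul C hg
  refine squeeze_zero' (Eventually.of_forall fun E => Finset.sum_nonneg fun i _ => dist_nonneg)
    ?_ h0
  filter_upwards [mem_inf_of_right (mem_principal_self _)] with E hE
  rw [Finset.mul_sum]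
  exact Finset.sum_le_sum fun i hi => h _ (hE.1 i hi).1 _ (hE.1 i hi).2

theorem _root_.AbsolutelyContinuousOnInterval.of_dist_le_integral {X : Type*} [PseudoMetricSpace X]
    {f : ℝ → X} {g : ℝ → ℝ} {a b : ℝ} (hab : a ≤ b) (hg : IntervalIntegrable g volume a b)
    (h : ∀ s t, a ≤ s → s ≤ t → t ≤ b → dist (f s) (f t) ≤ ∫ r in s..t, g r) :
    AbsolutelyContinuousOnInterval f a b := by
  have hG := hg.absolutelyContinuousOnInterval_intervalIntegral (c := a) (by simp)
  have key : ∀ s t, a ≤ s → s ≤ t → t ≤ b →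
      dist (f s) (f t) ≤ 1 * dist (∫ r in a..s, g r) (∫ r in a..t, g r) := by
    intro s t hs hst ht
    have i1 : IntervalIntegrable g volume a s := hg.mono_set (by
      rw [uIcc_of_le hs, uIcc_of_le hab]; exact Icc_subset_Icc le_rfl (hst.trans ht))
    have i2 : IntervalIntegrable g volume a t := hg.mono_set (by
      rw [uIcc_of_le (hs.trans hst), uIcc_of_le hab]; exact Icc_subset_Icc le_rfl ht)
    rw [one_mul, dist_comm (∫ r in a..s, g r), Real.dist_eq, intervalIntegral.integral_interval_sub_left i2 i1]
    exact (h s t hs hst ht).trans (le_abs_self _)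
  refine hG.of_dist_le (C := 1) fun s hs t ht => ?_
  rw [uIcc_of_le hab] at hs ht
  rcases le_total s t with hst | hst
  · exact key s t hs.1 hst ht.2
  · rw [dist_comm, dist_comm (∫ r in a..s, g r)]
    exact key t s ht.1 hst hs.2

variable {E : Type*} [NormedAddCommGroup E] [NormedSpace ℝ E]

theorem _root_.AbsolutelyContinuousOnInterval.clm_comp {F : Type*} [NormedAddCommGroup F]
    [NormedSpace ℝ F] {f : ℝ → E} {a b : ℝ}
    (hf : AbsolutelyContinuousOnInterval f a b) (L : E →L[ℝ] F) :
    AbsolutelyContinuousOnInterval (fun s => L (f s)) a b :=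
  hf.of_dist_le (C := ‖L‖) fun s _ t _ => by
    rw [dist_eq_norm, dist_eq_norm, ← map_sub]; exact L.le_opNorm _

variable [FiniteDimensional ℝ E]

variable (E) in
/-- The coordinates with respect to a basis. -/
def coordFun (i : Fin (Module.finrank ℝ E)) : E →L[ℝ] ℝ :=
  (ContinuousLinearMap.proj (R := ℝ) (φ := fun _ : Fin (Module.finrank ℝ E) => ℝ) i).comp
    ((Module.finBasis ℝ E).equivFunL : E →L[ℝ] _)

theorem differentiableAt_of_forall_clm {f : ℝ → E} {s : ℝ}
    (h : ∀ i, DifferentiableAt ℝ (fun r => coordFun E i (f r)) s) :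
    DifferentiableAt ℝ f s := by
  have h1 : DifferentiableAt ℝ (fun r => (Module.finBasis ℝ E).equivFunL (f r)) s :=
    differentiableAt_pi.2 h
  have h2 := (Module.finBasis ℝ E).equivFunL.symm.differentiableAt.comp s h1
  refine h2.congr_of_eventuallyEq (Eventually.of_forall fun r => ?_)
  simp

theorem _root_.AbsolutelyContinuousOnInterval.ae_differentiableAt_vec {f : ℝ → E} {a b : ℝ}
    (hf : AbsolutelyContinuousOnInterval f a b) :
    ∀ᵐ s, s ∈ uIcc a b → DifferentiableAt ℝ f s := by
  have : ∀ i, ∀ᵐ s, s ∈ uIcc a b →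
      DifferentiableAt ℝ (fun r => coordFun E i (f r)) s := fun i =>
    (hf.clm_comp (coordFun E i)).ae_differentiableAt
  filter_upwards [ae_all_iff.2 this] with s hs hmem
  exact differentiableAt_of_forall_clm fun i => hs i hmem

/-- Coordinates in a basis reduce this to the scalar fundamental theorem of calculus; coordinate
functionals commute with the derivative wherever `f` is differentiable, hence almost everywhere. -/
theorem _root_.AbsolutelyContinuousOnInterval.intervalIntegrable_deriv_vec {f : ℝ → E} {a b : ℝ}
    (hf : AbsolutelyContinuousOnInterval f a b) :
    IntervalIntegrable (deriv f) volume a b ∧ ∫ s in a..b, deriv f s = f b - f a := by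
  set e := (Module.finBasis ℝ E).equivFunL
  let L : Fin (Module.finrank ℝ E) → E →L[ℝ] ℝ := coordFun E
  have hd : ∀ i, ∀ᵐ s, s ∈ uIcc a b → deriv (fun r => L i (f r)) s = L i (deriv f s) := by
    intro i
    filter_upwards [hf.ae_differentiableAt_vec] with s hs hmem
    exact ((L i).hasFDerivAt.comp_hasDerivAt s (hs hmem).hasDerivAt).deriv
  have h1 : ∀ i, IntervalIntegrable (fun s => L i (deriv f s)) volume a b := fun i =>
    (hf.clm_comp (L i)).intervalIntegrable_deriv.congr_ae
      ((ae_restrict_iff' measurableSet_uIoc).2 ((hd i).mono fun s hs hmem =>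
        hs (uIoc_subset_uIcc hmem)))
  have h2 : IntervalIntegrable (fun s => e (deriv f s)) volume a b := by
    rw [intervalIntegrable_iff]
    exact Integrable.of_eval fun i => (intervalIntegrable_iff.1 (h1 i))
  have h3 : IntervalIntegrable (deriv f) volume a b := by
    rw [intervalIntegrable_iff] at h2 ⊢
    have := (e.symm : _ →L[ℝ] E).integrable_comp h2
    exact this.congr (Eventually.of_forall fun s => by simp)
  refine ⟨h3, e.injective (funext fun i => ?_)⟩
  change L i _ = L i _
  rw [← (L i).intervalIntegral_comp_comm h3, map_sub,
    ← (hf.clm_comp (L i)).integral_deriv_eq_sub]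
  exact intervalIntegral.integral_congr_ae ((hd i).mono fun s hs hmem =>
    (hs (uIoc_subset_uIcc hmem)).symm)

end AbsolutelyContinuous

/-! ### H¹ functions on an interval and near a point -/

section SobolevLocal

variable {E : Type*} [NormedAddCommGroup E] [NormedSpace ℝ E]

/-- The function `f` is of class `H¹` on the interval `[a, b]`. -/
def H1On (f : ℝ → E) (a b : ℝ) : Prop :=
  AbsolutelyContinuousOnInterval f a b ∧ ∫⁻ s in Icc a b, ‖deriv f s‖ₑ ^ 2 < ⊤

/-- The function `f` is of class `H¹` near `s`. -/
def H1At (f : ℝ → E) (s : ℝ) : Prop := ∃ δ > 0, H1On f (s - δ) (s + δ)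

theorem H1On.mono {f : ℝ → E} {a b a' b' : ℝ} (h : H1On f a b) (ha : a ≤ a') (hab : a' ≤ b')
    (hb : b' ≤ b) : H1On f a' b' :=
  ⟨h.1.mono (by
    rw [uIcc_of_le hab, uIcc_of_le (ha.trans (hab.trans hb))]; exact Icc_subset_Icc ha hb),
    (lintegral_mono_set (Icc_subset_Icc ha hb)).trans_lt h.2⟩

theorem H1At.exists_lt {f : ℝ → E} {s : ℝ} (h : H1At f s) {η : ℝ} (hη : 0 < η) :
    ∃ δ > 0, δ < η ∧ H1On f (s - δ) (s + δ) := by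
  obtain ⟨δ, hδ, h⟩ := h
  have : 0 < min δ (η / 2) := lt_min hδ (by linarith)
  exact ⟨_, this, (min_le_right _ _).trans_lt (by linarith),
    h.mono (by linarith [min_le_left δ (η / 2)]) (by linarith)
      (by linarith [min_le_left δ (η / 2)])⟩

theorem H1At.continuousAt {f : ℝ → E} {s : ℝ} (h : H1At f s) : ContinuousAt f s := by
  obtain ⟨δ, hδ, h⟩ := h
  have := h.1.continuousOn
  rw [uIcc_of_le (by linarith)] at this
  exact this.continuousAt (Icc_mem_nhds (by linarith) (by linarith))

theorem H1At.congr {f g : ℝ → E} {s : ℝ} (h : H1At f s) (hfg : g =ᶠ[𝓝 s] f) : H1At g s := by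
  obtain ⟨η, hη, hball⟩ := Metric.eventually_nhds_iff.1 hfg.eventuallyEq_nhds
  obtain ⟨δ, hδ, hδη, h⟩ := h.exists_lt hη
  -- Since δ < η, the functions agree on a neighbourhood of every point of the closed interval, so
  -- their derivatives agree there too.
  have key : ∀ r ∈ Icc (s - δ) (s + δ), g =ᶠ[𝓝 r] f := fun r hr =>
    hball (by rw [Real.dist_eq, abs_lt]; constructor <;> linarith [hr.1, hr.2])
  refine ⟨δ, hδ, h.1.of_dist_le (C := 1) fun r hr t ht => ?_, ?_⟩
  · rw [uIcc_of_le (by linarith)] at hr ht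
    rw [(key r hr).eq_of_nhds, (key t ht).eq_of_nhds, one_mul]
  · refine (setLIntegral_congr_fun measurableSet_Icc fun r hr => ?_).trans_lt h.2
    rw [(key r hr).deriv_eq]

theorem H1At.of_lipschitzWith {f : ℝ → E} {K : NNReal} (hf : LipschitzWith K f) (s : ℝ) :
    H1At f s := by
  refine ⟨1, one_pos, hf.lipschitzOnWith.absolutelyContinuousOnInterval, ?_⟩
  have : ∀ r, ‖deriv f r‖ₑ ^ 2 ≤ (K : ℝ≥0∞) ^ 2 := fun r => by
    gcongr
    exact_mod_cast norm_deriv_le_of_lipschitz hf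
  refine (lintegral_mono this).trans_lt ?_
  simp [ENNReal.mul_lt_top_iff]

variable [FiniteDimensional ℝ E]

theorem H1On.ae_differentiableAt {f : ℝ → E} {a b : ℝ} (h : H1On f a b) (hab : a ≤ b) :
    ∀ᵐ s ∂volume.restrict (Icc a b), DifferentiableAt ℝ f s := by
  rw [ae_restrict_iff' measurableSet_Icc, ← uIcc_of_le hab]
  exact h.1.ae_differentiableAt_vec

theorem H1On.memLp {f : ℝ → E} {a b : ℝ} (h : H1On f a b) :
    MemLp (deriv f) 2 (volume.restrict (Icc a b)) := by
  refine ⟨aestronglyMeasurable_deriv f _, ?_⟩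
  rw [eLpNorm_lt_top_iff_lintegral_rpow_enorm_lt_top (by simp) (by simp)]
  simpa using h.2

/-- A square integrable function on a bounded interval is integrable, so the increments are
controlled by an absolutely continuous indefinite integral. This criterion, unlike the definition
through families of disjoint intervals, is easy to glue and to pass to the limit. -/
theorem H1On.of_dist_le {f : ℝ → E} {a b : ℝ} (hab : a ≤ b)
    (h2 : ∫⁻ s in Icc a b, ‖deriv f s‖ₑ ^ 2 < ⊤)
    (h : ∀ s t, a ≤ s → s ≤ t → t ≤ b → dist (f s) (f t) ≤ ∫ r in s..t, ‖deriv f r‖) :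
    H1On f a b := by
  refine ⟨AbsolutelyContinuousOnInterval.of_dist_le_integral hab ?_ h, h2⟩
  have : MemLp (deriv f) 2 (volume.restrict (Icc a b)) := by
    refine ⟨aestronglyMeasurable_deriv f _, ?_⟩
    rw [eLpNorm_lt_top_iff_lintegral_rpow_enorm_lt_top (by simp) (by simp)]
    simpa using h2
  rw [intervalIntegrable_iff_integrableOn_Icc_of_le hab]
  exact (this.integrable (by norm_num)).norm

theorem H1On.dist_le {f : ℝ → E} {a b : ℝ} (h : H1On f a b) (hab : a ≤ b) :
    dist (f a) (f b) ≤ ∫ r in a..b, ‖deriv f r‖ := by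
  rw [dist_comm, dist_eq_norm, ← h.1.intervalIntegrable_deriv_vec.2]
  exact intervalIntegral.norm_integral_le_integral_norm hab

/-- The bound of increments by ∫‖f'‖ is additive, so an increment across `b` is split at `b` by the
triangle inequality. -/
theorem H1On.trans {f : ℝ → E} {a b c : ℝ} (h₁ : H1On f a b) (h₂ : H1On f b c) (hab : a ≤ b)
    (hbc : b ≤ c) : H1On f a c := by
  refine H1On.of_dist_le (hab.trans hbc) ?_ fun s t hs hst ht => ?_
  · rw [← Icc_union_Icc_eq_Icc hab hbc]
    exact (lintegral_union_le _ _ _).trans_lt (ENNReal.add_lt_top.2 ⟨h₁.2, h₂.2⟩)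
  · rcases le_total t b with htb | htb
    · exact (h₁.mono hs hst htb).dist_le hst
    rcases le_total b s with hsb | hsb
    · exact (h₂.mono hsb hst ht).dist_le hst
    have k1 := h₁.mono hs hsb le_rfl
    have k2 := h₂.mono le_rfl htb ht
    rw [← intervalIntegral.integral_add_adjacent_intervals
      k1.1.intervalIntegrable_deriv_vec.1.norm k2.1.intervalIntegrable_deriv_vec.1.norm]
    exact (dist_triangle _ (f b) _).trans (add_le_add (k1.dist_le hsb) (k2.dist_le htb))

theorem H1On.of_forall_h1At {f : ℝ → E} {a b : ℝ} (hab : a ≤ b) (h : ∀ s ∈ Icc a b, H1At f s) :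
    H1On f a b := by
  refine interval_induction (P := H1On f) (fun a b c hab hbc h₁ h₂ => h₁.trans h₂ hab hbc) hab
    fun s hs => ?_
  obtain ⟨δ, hδ, h⟩ := h s hs
  exact ⟨δ, hδ, fun u v _ huv _ hu hv => h.mono hu.le huv hv.le⟩

theorem H1At.of_lipschitz {F : Type*} [NormedAddCommGroup F] [NormedSpace ℝ F]
    {s : ℝ} {f : ℝ → E} {g : ℝ → F} (hf : H1At f s) {K : ℝ} {U : Set ℝ} (hU : U ∈ 𝓝 s)
    (hK : ∀ r ∈ U, ∀ t ∈ U, dist (g r) (g t) ≤ K * dist (f r) (f t)) : H1At g s := by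
  obtain ⟨η, hη, hball⟩ := Metric.mem_nhds_iff.1 hU
  obtain ⟨δ, hδ, hδη, h⟩ := hf.exists_lt hη
  have hsub : Icc (s - δ) (s + δ) ⊆ U := fun r hr => hball (by
    rw [Metric.mem_ball, Real.dist_eq, abs_lt]; constructor <;> linarith [hr.1, hr.2])
  refine ⟨δ, hδ, h.1.of_dist_le (C := K) fun r hr t ht => ?_, ?_⟩
  · rw [uIcc_of_le (by linarith)] at hr ht
    exact hK r (hsub hr) t (hsub ht)
  · have hle : ∀ᵐ r ∂volume.restrict (Icc (s - δ) (s + δ)),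
        ‖deriv g r‖ₑ ^ 2 ≤ ENNReal.ofReal |K| ^ 2 * ‖deriv f r‖ₑ ^ 2 := by
      have hne : ∀ᵐ r ∂volume.restrict (Icc (s - δ) (s + δ)), r ∈ Ioo (s - δ) (s + δ) := by
        rw [← restrict_Ioo_eq_restrict_Icc]
        exact ae_restrict_mem measurableSet_Ioo
      filter_upwards [h.ae_differentiableAt (by linarith), hne] with r hr hmem
      -- Where `g` is differentiable its slopes are bounded by |K| times those of `f`; where it is
      -- not, `deriv g` is zero by convention. No differentiability theorem for `g` is needed.
      by_cases hg : DifferentiableAt ℝ g r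
      · rw [← mul_pow]
        gcongr
        rw [← ofReal_norm, ← ofReal_norm, ← ENNReal.ofReal_mul (abs_nonneg K)]
        refine ENNReal.ofReal_le_ofReal ?_
        have t1 := (hasDerivAt_iff_tendsto_slope.1 hg.hasDerivAt).norm
        have t2 := ((hasDerivAt_iff_tendsto_slope.1 hr.hasDerivAt).norm).const_mul |K|
        refine le_of_tendsto_of_tendsto t1 t2 ?_
        filter_upwards [mem_nhdsWithin_of_mem_nhds
          (mem_of_superset (Icc_mem_nhds hmem.1 hmem.2) hsub)] with t ht
        rw [slope_def_module, slope_def_module, norm_smul, norm_smul, mul_left_comm]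
        gcongr
        have := hK t ht r (hsub (Ioo_subset_Icc_self hmem))
        rw [dist_eq_norm, dist_eq_norm] at this
        exact this.trans (by gcongr; exact le_abs_self K)
      · simp [deriv_zero_of_not_differentiableAt hg]
    refine (lintegral_mono_ae hle).trans_lt ?_
    rw [lintegral_const_mul' _ _ (by simp)]
    exact ENNReal.mul_lt_top (by simp) h.2

theorem H1At.comp_contDiffAt {F : Type*} [NormedAddCommGroup F] [NormedSpace ℝ F] {s : ℝ}
    {f : ℝ → E} {Φ : E → F} (hf : H1At f s) (hΦ : ContDiffAt ℝ 1 Φ (f s)) :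
    H1At (fun r => Φ (f r)) s := by
  obtain ⟨K, t, ht, hK⟩ := hΦ.exists_lipschitzOnWith
  exact hf.of_lipschitz (f := f) (hf.continuousAt.preimage_mem_nhds ht)
    fun r hr t ht => hK.dist_le_mul _ hr _ ht

theorem H1At.prodMk {F : Type*} [NormedAddCommGroup F] [NormedSpace ℝ F] [FiniteDimensional ℝ F]
    {s : ℝ} {f : ℝ → E} {g : ℝ → F} (hf : H1At f s) (hg : H1At g s) :
    H1At (fun r => (f r, g r)) s := by
  obtain ⟨δ, hδ, h⟩ := hf
  obtain ⟨δ', hδ', hδδ, h'⟩ := hg.exists_lt hδ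
  replace h := h.mono (a' := s - δ') (b' := s + δ') (by linarith) (by linarith) (by linarith)
  have hle : s - δ' ≤ s + δ' := by linarith
  refine ⟨δ', hδ', ?_, ?_⟩
  · refine squeeze_zero (fun E => Finset.sum_nonneg fun i _ => dist_nonneg) (fun E => ?_)
      (by simpa using Tendsto.add h.1 h'.1)
    rw [← Finset.sum_add_distrib]
    exact Finset.sum_le_sum fun i _ => by
      rw [Prod.dist_eq]; exact max_le_add_of_nonneg dist_nonneg dist_nonneg
  · have : ∀ᵐ r ∂volume.restrict (Icc (s - δ') (s + δ')),
        ‖deriv (fun r => (f r, g r)) r‖ₑ ^ 2 ≤ ‖deriv f r‖ₑ ^ 2 + ‖deriv g r‖ₑ ^ 2 := by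
      filter_upwards [h.ae_differentiableAt hle, h'.ae_differentiableAt hle] with r h1 h2
      rw [(h1.hasDerivAt.prodMk h2.hasDerivAt).deriv]
      rcases le_total ‖deriv f r‖ ‖deriv g r‖ with h3 | h3
      · rw [← ofReal_norm, Prod.norm_mk, max_eq_right h3, ofReal_norm]; exact le_add_self
      · rw [← ofReal_norm, Prod.norm_mk, max_eq_left h3, ofReal_norm]; exact le_self_add
    refine (lintegral_mono_ae this).trans_lt ?_
    rw [lintegral_add_left' (by
      exact ((aestronglyMeasurable_deriv f _).enorm.pow_const 2))]
    exact ENNReal.add_lt_top.2 ⟨h.2, h'.2⟩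

end SobolevLocal

/-- A shortcut for instance search. -/
instance {E : Type*} [NormedAddCommGroup E] [NormedSpace ℝ E] :
    NormedAddCommGroup (E →L[ℝ] E →L[ℝ] ℝ) := ContinuousLinearMap.toNormedAddCommGroup

/-- A shortcut for instance search. -/
instance {E : Type*} [NormedAddCommGroup E] [NormedSpace ℝ E] :
    SeminormedAddCommGroup (E →L[ℝ] E →L[ℝ] ℝ) := ContinuousLinearMap.toSeminormedAddCommGroup

/-- A shortcut for instance search. -/
instance {E : Type*} [NormedAddCommGroup E] [NormedSpace ℝ E] :
    NormedSpace ℝ (E →L[ℝ] E →L[ℝ] ℝ) := ContinuousLinearMap.toNormedSpace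

theorem aestronglyMeasurable_bilin {E : Type*} [NormedAddCommGroup E] [NormedSpace ℝ E]
    {α : Type*} [MeasurableSpace α] {μ : Measure α} {B : α → E →L[ℝ] E →L[ℝ] ℝ} {v w : α → E}
    (hB : AEStronglyMeasurable B μ) (hv : AEStronglyMeasurable v μ)
    (hw : AEStronglyMeasurable w μ) : AEStronglyMeasurable (fun r => B r (v r) (w r)) μ := by
  have hcont : Continuous fun p : (E →L[ℝ] E →L[ℝ] ℝ) × E × E => p.1 p.2.1 p.2.2 := by fun_prop
  exact hcont.comp_aestronglyMeasurable (hB.prodMk (hv.prodMk hw))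

/-- Continuity with values in a metric space is reduced to that of the real-valued absolutely
continuous function r ↦ dist (f r) (f s). -/
theorem _root_.AbsolutelyContinuousOnInterval.continuousAt_of_mem_Ioo {X : Type*}
    [PseudoMetricSpace X] {f : ℝ → X} {a b s : ℝ} (hf : AbsolutelyContinuousOnInterval f a b)
    (hs : s ∈ Ioo a b) : ContinuousAt f s := by
  have hac : AbsolutelyContinuousOnInterval (fun r => dist (f r) (f s)) a b :=
    hf.of_dist_le (C := 1) fun r _ r' _ => by
      rw [one_mul, Real.dist_eq]; exact abs_dist_sub_le (f r) (f r') (f s)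
  have h := hac.continuousOn
  rw [uIcc_of_le (hs.1.trans hs.2).le] at h
  have := h.continuousAt (Icc_mem_nhds hs.1 hs.2)
  rw [ContinuousAt, dist_self] at this
  exact tendsto_iff_dist_tendsto_zero.2 this

/-! ### Bounds for the metric coefficients on compact sets -/

section MetricBounds

variable {E : Type*} [NormedAddCommGroup E] [NormedSpace ℝ E] [FiniteDimensional ℝ E]

/-- The constant is the minimum of G over A times the unit sphere, extended to all vectors by
homogeneity. If this product is empty, any positive constant serves. -/
theorem exists_coercive_of_isCompact {G : E → E →L[ℝ] E →L[ℝ] ℝ} {A : Set E} (hA : IsCompact A)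
    (hG : ContinuousOn G A) (hpos : ∀ z ∈ A, ∀ v, v ≠ 0 → 0 < G z v v) :
    ∃ κ > 0, ∀ z ∈ A, ∀ v, κ * ‖v‖ ^ 2 ≤ G z v v := by
  have hcomp : IsCompact (A ×ˢ Metric.sphere (0 : E) 1) := hA.prod (isCompact_sphere 0 1)
  have hcont : ContinuousOn (fun p : E × E => G p.1 p.2 p.2) (A ×ˢ Metric.sphere (0 : E) 1) :=
    ((hG.comp continuousOn_fst fun p hp => hp.1).clm_apply continuousOn_snd).clm_apply
      continuousOn_snd
  obtain ⟨κ, hκ, h⟩ : ∃ κ > 0, ∀ p ∈ A ×ˢ Metric.sphere (0 : E) 1, κ ≤ G p.1 p.2 p.2 := by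
    rcases (A ×ˢ Metric.sphere (0 : E) 1).eq_empty_or_nonempty with he | hne
    · exact ⟨1, one_pos, by simp [he]⟩
    · obtain ⟨p, hp, hmin⟩ := hcomp.exists_isMinOn hne hcont
      refine ⟨_, hpos p.1 hp.1 p.2 ?_, fun q hq => hmin hq⟩
      rintro h0
      have := hp.2
      simp [h0] at this
  refine ⟨κ, hκ, fun z hz v => ?_⟩
  rcases eq_or_ne v 0 with rfl | hv
  · simp
  have hv' : ‖v‖ ≠ 0 := norm_ne_zero_iff.2 hv
  have := h (z, ‖v‖⁻¹ • v) ⟨hz, by simp [norm_smul, hv']⟩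
  simp only [map_smul, smul_apply, smul_eq_mul] at this
  calc κ * ‖v‖ ^ 2 ≤ (‖v‖⁻¹ * (‖v‖⁻¹ * G z v v)) * ‖v‖ ^ 2 := by gcongr
    _ = G z v v := by field_simp

variable {M : Type*} [MetricSpace M] [ChartedSpace E M]

theorem exists_compact_nhds_in_chart {x q : M} (hq : q ∈ (chartAt E x).source) :
    ∃ A : Set E, IsCompact A ∧ A ⊆ (extChartAt 𝓘(ℝ, E) x).target ∧
      (chartAt E x).source ∩ extChartAt 𝓘(ℝ, E) x ⁻¹' A ∈ 𝓝 q := by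
  obtain ⟨A, hA, hAt, hAc⟩ := local_compact_nhds (extChartAt_target_mem_nhds' (I := 𝓘(ℝ, E))
    ((extChartAt 𝓘(ℝ, E) x).map_source (by simpa using hq : q ∈ _)))
  exact ⟨A, hAc, hAt, inter_mem ((chartAt E x).open_source.mem_nhds hq)
    ((continuousAt_extChartAt' (by simpa using hq)).preimage_mem_nhds hA)⟩

variable [IsManifold 𝓘(ℝ, E) ∞ M]
  [RiemannianBundle (fun x : M => TangentSpace 𝓘(ℝ, E) x)]
  [IsContMDiffRiemannianBundle 𝓘(ℝ, E) ∞ E (fun x : M => TangentSpace 𝓘(ℝ, E) x)]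

/-- Bounds for the metric in a chart, uniform on a compact set. -/
theorem exists_chartMetric_bounds {x : M} {A : Set E} (hA : IsCompact A)
    (hAt : A ⊆ (extChartAt 𝓘(ℝ, E) x).target) :
    ∃ κ > 0, ∃ C > 0, ∀ z ∈ A, (∀ v, κ * ‖v‖ ^ 2 ≤ chartMetric x z v v) ∧
      ‖(chartMetric x z : E →L[ℝ] E →L[ℝ] ℝ)‖ ≤ C ∧
      ‖fderiv ℝ (chartMetric x : E → E →L[ℝ] E →L[ℝ] ℝ) z‖ ≤ C := by
  have hG := contDiffOn_chartMetric (E := E) x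
  have hG' := hG.continuousOn_fderiv_of_isOpen (isOpen_extChartAt_target x) (by simp)
  obtain ⟨κ, hκ, h⟩ := exists_coercive_of_isCompact hA (hG.continuousOn.mono hAt)
    (fun z hz v hv => chartMetric_pos (hAt hz) hv)
  obtain ⟨C₁, h₁⟩ := hA.exists_bound_of_continuousOn (hG.continuousOn.mono hAt)
  obtain ⟨C₂, h₂⟩ := hA.exists_bound_of_continuousOn (hG'.mono hAt)
  refine ⟨κ, hκ, max 1 (max C₁ C₂), by positivity, fun z hz => ⟨h z hz, ?_, ?_⟩⟩
  · exact (h₁ z hz).trans ((le_max_left _ _).trans (le_max_right _ _))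
  · exact (h₂ z hz).trans ((le_max_right _ _).trans (le_max_right _ _))

end MetricBounds

/-! ### Riemannian distance: Hopf–Rinow, Lipschitz charts, speed -/

section Distance

variable {E : Type*} [NormedAddCommGroup E] [NormedSpace ℝ E]
  {M : Type*} [MetricSpace M] [ChartedSpace E M]
  [RiemannianBundle (fun x : M => TangentSpace 𝓘(ℝ, E) x)] [IsRiemannianManifold 𝓘(ℝ, E) M]

theorem exists_path_of_dist_lt {y z : M} {ℓ : ℝ} (h : dist y z < ℓ) :
    ∃ γ : ℝ → M, γ 0 = y ∧ γ 1 = z ∧ ContMDiff 𝓘(ℝ, ℝ) 𝓘(ℝ, E) 1 γ ∧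
      pathELength 𝓘(ℝ, E) γ 0 1 < ENNReal.ofReal ℓ := by
  have h' : riemannianEDist 𝓘(ℝ, E) y z < ENNReal.ofReal ℓ := by
    rw [← IsRiemannianManifold.out, edist_dist]
    exact (ENNReal.ofReal_lt_ofReal_iff (dist_nonneg.trans_lt h)).2 h
  obtain ⟨γ, h0, h1, hγ, hl, -⟩ := exists_lt_locally_constant_of_riemannianEDist_lt h' zero_lt_one
  exact ⟨γ, h0, h1, hγ, hl⟩

theorem edist_le_pathELength {γ : ℝ → M} (hγ : ContMDiff 𝓘(ℝ, ℝ) 𝓘(ℝ, E) 1 γ) {s t : ℝ}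
    (hst : s ≤ t) : edist (γ s) (γ t) ≤ pathELength 𝓘(ℝ, E) γ s t := by
  rw [IsRiemannianManifold.out (I := 𝓘(ℝ, E)) (γ s) (γ t)]
  exact riemannianEDist_le_pathELength hγ.contMDiffOn rfl rfl hst

/-- Between two points there are almost-midpoints in any proportion. -/
theorem exists_dist_le_dist_lt (E : Type*) [NormedAddCommGroup E] [NormedSpace ℝ E]
    {M : Type*} [MetricSpace M] [ChartedSpace E M]
    [RiemannianBundle (fun x : M => TangentSpace 𝓘(ℝ, E) x)] [IsRiemannianManifold 𝓘(ℝ, E) M]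
    {y z : M} {a b : ℝ} (ha : 0 ≤ a) (hb : 0 < b)
    (h : dist y z < a + b) : ∃ m : M, dist y m ≤ a ∧ dist m z < b := by
  rcases le_total (dist y z) a with hle | hle
  · exact ⟨z, hle, by simpa using hb⟩
  obtain ⟨γ, h0, h1, hγ, hl⟩ := exists_path_of_dist_lt (E := E) h
  have hcont : Continuous fun t => dist y (γ t) := continuous_const.dist hγ.continuous
  -- The point sought is on a path of length less than a + b, where the distance from `y` equals
  -- `a`; the rest of the path is shorter than `b`.
  obtain ⟨t, ht, hta⟩ := intermediate_value_Icc (zero_le_one' ℝ) hcont.continuousOn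
    (show a ∈ Icc (dist y (γ 0)) (dist y (γ 1)) by rw [h0, h1, dist_self]; exact ⟨ha, hle⟩)
  refine ⟨γ t, hta.le, ?_⟩
  have e1 := edist_le_pathELength (E := E) hγ ht.1
  have e2 := edist_le_pathELength (E := E) hγ ht.2
  have e3 := add_le_add e1 e2
  rw [pathELength_add ht.1 ht.2, h0, h1] at e3
  have e4 := e3.trans_lt hl
  simp only at hta
  rw [edist_dist, edist_dist, ← ENNReal.ofReal_add dist_nonneg dist_nonneg,
    ENNReal.ofReal_lt_ofReal_iff (by linarith), hta] at e4
  linarith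

/-- The Hopf-Rinow theorem: bounded closed sets are compact. -/
theorem isCompact_closedBall_of_complete (E : Type*) [NormedAddCommGroup E] [NormedSpace ℝ E]
    [FiniteDimensional ℝ E] {M : Type*} [MetricSpace M] [ChartedSpace E M]
    [RiemannianBundle (fun x : M => TangentSpace 𝓘(ℝ, E) x)] [IsRiemannianManifold 𝓘(ℝ, E) M]
    [CompleteSpace M] (p : M) (r : ℝ) :
    IsCompact (Metric.closedBall p r) := by
  have : LocallyCompactSpace M := ChartedSpace.locallyCompactSpace E M
  -- The radius of a compact ball can be increased: some δ-thickening of it is compact, and by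
  -- almost-midpoints contains the ball of radius R + δ/2.
  have hstep : ∀ R : ℝ, 0 ≤ R → IsCompact (Metric.closedBall p R) →
      ∃ δ > 0, IsCompact (Metric.closedBall p (R + δ)) := by
    intro R hR hc
    obtain ⟨δ, hδ, hcδ⟩ := hc.exists_isCompact_cthickening
    refine ⟨δ / 2, by positivity, hcδ.of_isClosed_subset Metric.isClosed_closedBall fun z hz => ?_⟩
    obtain ⟨m, hm, hmz⟩ := exists_dist_le_dist_lt E (y := p) (z := z) hR hδ (by
      rw [dist_comm]; linarith [Metric.mem_closedBall.1 hz])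
    refine Metric.mem_cthickening_of_dist_le z m δ _ (Metric.mem_closedBall'.2 hm) ?_
    rw [dist_comm]; exact hmz.le
  -- Compactness passes to the limit radius: every point of the R-ball is within η/2 of the slightly
  -- smaller ball of radius ρ, so the R-ball is totally bounded. Completeness of `M` is used here.
  have hlim : ∀ R : ℝ, 0 < R → (∀ R' < R, IsCompact (Metric.closedBall p R')) →
      IsCompact (Metric.closedBall p R) := by
    intro R hR h
    refine TotallyBounded.isCompact_of_isClosed ?_ Metric.isClosed_closedBall
    rw [Metric.totallyBounded_iff]
    intro η hη
    set ρ := max 0 (R - η / 4) with hρ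
    have hρR : ρ < R := max_lt hR (by linarith)
    obtain ⟨t, ht, hcov⟩ := Metric.totallyBounded_iff.1 (h ρ hρR).totallyBounded (η / 2)
      (by positivity)
    refine ⟨t, ht, fun z hz => ?_⟩
    obtain ⟨m, hm, hmz⟩ := exists_dist_le_dist_lt E (y := p) (z := z)
      (le_max_left 0 (R - η / 4)) (show 0 < η / 2 by positivity) (by
      rw [dist_comm]; linarith [Metric.mem_closedBall.1 hz, le_max_right 0 (R - η / 4)])
    obtain ⟨i, hi, hmi⟩ := mem_iUnion₂.1 (hcov (Metric.mem_closedBall'.2 hm))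
    refine mem_iUnion₂.2 ⟨i, hi, ?_⟩
    rw [Metric.mem_ball] at hmi ⊢
    rw [dist_comm] at hmz
    linarith [dist_triangle z m i]
  by_contra hr
  set S : Set ℝ := {R | 0 ≤ R ∧ IsCompact (Metric.closedBall p R)} with hS
  have h0 : (0 : ℝ) ∈ S := ⟨le_rfl, by simp⟩
  have hub : ∀ R ∈ S, R ≤ r := fun R hR => by
    by_contra hlt
    exact hr (hR.2.of_isClosed_subset Metric.isClosed_closedBall
      (Metric.closedBall_subset_closedBall (not_le.1 hlt).le))
  have hbdd : BddAbove S := ⟨r, hub⟩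
  have hlt : ∀ R' < sSup S, IsCompact (Metric.closedBall p R') := fun R' hR' => by
    obtain ⟨R, hR, hRR⟩ := exists_lt_of_lt_csSup ⟨0, h0⟩ hR'
    exact hR.2.of_isClosed_subset Metric.isClosed_closedBall
      (Metric.closedBall_subset_closedBall hRR.le)
  have hs : IsCompact (Metric.closedBall p (sSup S)) := by
    rcases (le_csSup hbdd h0).eq_or_lt with h | h
    · rw [← h]; simp
    · exact hlim _ h hlt
  obtain ⟨δ, hδ, hc⟩ := hstep _ (le_csSup hbdd h0) hs
  have : sSup S + δ ≤ sSup S := le_csSup hbdd ⟨by linarith [le_csSup hbdd h0], hc⟩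
  linarith

theorem chartMetric_self_nonneg {E : Type*} [NormedAddCommGroup E] [NormedSpace ℝ E]
    {M : Type*} [MetricSpace M] [ChartedSpace E M]
    [RiemannianBundle (fun x : M => TangentSpace 𝓘(ℝ, E) x)] (x : M) (z v : E) :
    0 ≤ chartMetric x z v v := by
  rw [chartMetric_apply]; exact real_inner_self_nonneg

variable [FiniteDimensional ℝ E] [IsManifold 𝓘(ℝ, E) ∞ M]
  [IsContMDiffRiemannianBundle 𝓘(ℝ, E) ∞ E (fun x : M => TangentSpace 𝓘(ℝ, E) x)]

theorem norm_deriv_le_norm_velocity {x : M} {c : ℝ → M} {s κ : ℝ} (hc : ContinuousAt c s)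
    (hs : c s ∈ (chartAt E x).source) (hκ : 0 < κ)
    (h : ∀ v, κ * ‖v‖ ^ 2 ≤ chartMetric x (extChartAt 𝓘(ℝ, E) x (c s)) v v) :
    ‖deriv (extChartAt 𝓘(ℝ, E) x ∘ c) s‖ ≤ Real.sqrt κ⁻¹ * ‖velocity E c s‖ := by
  refine abs_le_of_sq_le_sq' ?_ (by positivity) |>.2
  rw [mul_pow, Real.sq_sqrt (by positivity), sq_norm_velocity hc hs]
  calc _ = κ⁻¹ * (κ * ‖deriv (extChartAt 𝓘(ℝ, E) x ∘ c) s‖ ^ 2) := by field_simp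
    _ ≤ _ := by gcongr; exact h _

/-- Charts are locally Lipschitz for the Riemannian distance. -/
theorem exists_lipschitz_extChartAt {x q : M} (hq : q ∈ (chartAt E x).source) :
    ∃ K : ℝ, ∃ U ∈ 𝓝 q, ∀ y ∈ U, ∀ z ∈ U,
      dist (extChartAt 𝓘(ℝ, E) x y) (extChartAt 𝓘(ℝ, E) x z) ≤ K * dist y z := by
  obtain ⟨A, hA, hAt, hAq⟩ := exists_compact_nhds_in_chart hq
  obtain ⟨κ, hκ, C, hC, hbd⟩ := exists_chartMetric_bounds hA hAt
  obtain ⟨r, hr, hball⟩ := Metric.mem_nhds_iff.1 hAq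
  -- For points in the ball of radius r/4, an almost shortest path between them has length less than
  -- r/2, so it stays in the r-ball, where the chart and the metric bounds are available.
  refine ⟨Real.sqrt κ⁻¹, Metric.ball q (r / 4), Metric.ball_mem_nhds q (by positivity),
    fun y hy z hz => ?_⟩
  have hyz : dist y z < r / 2 := by
    linarith [dist_triangle_right y z q, Metric.mem_ball.1 hy, Metric.mem_ball.1 hz]
  have key : ∀ d, dist y z < d → d < r / 2 →
      dist (extChartAt 𝓘(ℝ, E) x y) (extChartAt 𝓘(ℝ, E) x z) ≤ Real.sqrt κ⁻¹ * d := by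
    intro d hd hdr
    obtain ⟨γ, h0, h1, hγ, hl⟩ := exists_path_of_dist_lt (E := E) hd
    have hd0 : 0 ≤ d := dist_nonneg.trans hd.le
    have hmem : ∀ t ∈ Icc (0 : ℝ) 1, γ t ∈ Metric.ball q r := by
      intro t ht
      have e1 := (edist_le_pathELength (E := E) hγ ht.1).trans (pathELength_mono le_rfl ht.2)
      have e2 := e1.trans_lt hl
      rw [h0, edist_dist, ENNReal.ofReal_lt_ofReal_iff (by linarith [dist_nonneg (x := y) (y := z)])]
        at e2
      rw [Metric.mem_ball]
      linarith [dist_triangle_left (γ t) q y, Metric.mem_ball.1 hy]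
    have hsrc : ∀ t ∈ Icc (0 : ℝ) 1, γ t ∈ (chartAt E x).source := fun t ht =>
      (hball (hmem t ht)).1
    have hcd : ContDiffOn ℝ 1 (extChartAt 𝓘(ℝ, E) x ∘ γ) (Icc 0 1) :=
      contMDiffOn_iff_contDiffOn.1 ((contMDiffOn_extChartAt (n := 1)).comp hγ.contMDiffOn hsrc)
    have hle := enorm_sub_le_lintegral_derivWithin_Icc_of_contDiffOn_Icc hcd zero_le_one
    rw [← restrict_Ioo_eq_restrict_Icc] at hle
    have hle2 : ∫⁻ t in Ioo (0 : ℝ) 1, ‖derivWithin (extChartAt 𝓘(ℝ, E) x ∘ γ) (Icc 0 1) t‖ₑ ≤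
        ∫⁻ t in Ioo (0 : ℝ) 1, ENNReal.ofReal (Real.sqrt κ⁻¹) *
          ‖mfderiv 𝓘(ℝ, ℝ) 𝓘(ℝ, E) γ t 1‖ₑ := by
      refine setLIntegral_mono' measurableSet_Ioo fun t ht => ?_
      have ht' := Ioo_subset_Icc_self ht
      rw [derivWithin_of_mem_nhds (Icc_mem_nhds ht.1 ht.2), ← ofReal_norm, ← ofReal_norm,
        ← ENNReal.ofReal_mul (by positivity)]
      exact ENNReal.ofReal_le_ofReal (norm_deriv_le_norm_velocity
        hγ.continuous.continuousAt (hsrc t ht') hκ (hbd _ (hball (hmem t ht')).2).1)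
    rw [lintegral_const_mul' _ _ (by simp), ← pathELength_eq_lintegral_mfderiv_Ioo] at hle2
    have hle3 := (hle.trans hle2).trans (mul_le_mul_right hl.le _)
    rw [← ENNReal.ofReal_mul (by positivity), ← ofReal_norm,
      ENNReal.ofReal_le_ofReal_iff (by positivity)] at hle3
    simpa [dist_eq_norm, h0, h1, norm_sub_rev] using hle3
  -- The estimate holds for every d > dist y z; let d decrease to the distance.
  have ht : Tendsto (fun d => Real.sqrt κ⁻¹ * d) (𝓝[>] (dist y z))
      (𝓝 (Real.sqrt κ⁻¹ * dist y z)) :=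
    ((continuous_const.mul continuous_id).tendsto _).mono_left nhdsWithin_le_nhds
  refine ge_of_tendsto ht ?_
  filter_upwards [Ioo_mem_nhdsGT hyz] with d hd
  exact key d hd.1 hd.2

/-- The Riemannian distance to `q` is, up to a small relative error, at most the norm at `q` of
the difference of the coordinates. -/
theorem eventually_dist_le (q : M) {η : ℝ} (hη : 0 < η) :
    ∀ᶠ q' in 𝓝 q, dist q q' ≤ Real.sqrt
      (chartMetric q (extChartAt 𝓘(ℝ, E) q q)
        (extChartAt 𝓘(ℝ, E) q q' - extChartAt 𝓘(ℝ, E) q q)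
        (extChartAt 𝓘(ℝ, E) q q' - extChartAt 𝓘(ℝ, E) q q) +
      η * ‖extChartAt 𝓘(ℝ, E) q q' - extChartAt 𝓘(ℝ, E) q q‖ ^ 2) := by
  set φ := extChartAt 𝓘(ℝ, E) q with hφ
  set z₀ := φ q with hz₀
  have hq : q ∈ (chartAt E q).source := mem_chart_source E q
  have hG : ContinuousAt (chartMetric q : E → E →L[ℝ] E →L[ℝ] ℝ) z₀ :=
    (contDiffAt_chartMetric hq).continuousAt
  obtain ⟨r, hr, hball⟩ := Metric.mem_nhds_iff.1 (inter_mem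
    (extChartAt_target_mem_nhds (I := 𝓘(ℝ, E)) q) (hG.preimage_mem_nhds
      (Metric.ball_mem_nhds _ hη)))
  filter_upwards [(continuousAt_extChartAt (I := 𝓘(ℝ, E)) q).preimage_mem_nhds
    (Metric.ball_mem_nhds _ hr), (chartAt E q).open_source.mem_nhds hq] with q' hq' hq's
  set Δ := φ q' - z₀ with hΔ
  have hseg : ∀ t ∈ Icc (0 : ℝ) 1, z₀ + t • Δ ∈ Metric.ball z₀ r := by
    intro t ht
    have : ‖Δ‖ < r := by rw [hΔ, ← dist_eq_norm]; exact hq'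
    rw [Metric.mem_ball, dist_eq_norm, add_sub_cancel_left, norm_smul, Real.norm_eq_abs,
      abs_of_nonneg ht.1]
    nlinarith [ht.2, norm_nonneg Δ]
  -- The comparison path is the straight segment in the chart. Its velocity has constant coordinates
  -- Δ, and along it the metric differs from its value at z₀ by at most η.
  set γ : ℝ → M := fun t => φ.symm (z₀ + t • Δ) with hγ
  have hcd : ContMDiffOn 𝓘(ℝ, ℝ) 𝓘(ℝ, E) 1 γ (Icc 0 1) := by
    refine (contMDiffOn_extChartAt_symm (n := 1) q).comp (t := φ.target) ?_
      (fun t ht => (hball (hseg t ht)).1)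
    exact contMDiffOn_iff_contDiffOn.2 (by fun_prop)
  have h0 : γ 0 = q := by simp [hγ, hz₀, hφ]
  have h1 : γ 1 = q' := by
    simp only [hγ, hΔ, one_smul, add_sub_cancel]
    exact φ.left_inv (by simpa [hφ] using hq's)
  have hle := riemannianEDist_le_pathELength hcd h0 h1 zero_le_one
  rw [← IsRiemannianManifold.out (I := 𝓘(ℝ, E)) q q', pathELength_eq_lintegral_mfderiv_Ioo] at hle
  set L := Real.sqrt (chartMetric q z₀ Δ Δ + η * ‖Δ‖ ^ 2) with hL
  have hle2 : ∫⁻ t in Ioo (0 : ℝ) 1, ‖mfderiv 𝓘(ℝ, ℝ) 𝓘(ℝ, E) γ t 1‖ₑ ≤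
      ∫⁻ t in Ioo (0 : ℝ) 1, ENNReal.ofReal L := by
    refine setLIntegral_mono' measurableSet_Ioo fun t ht => ?_
    have ht' := Ioo_subset_Icc_self ht
    have hcont : ContinuousAt γ t := (hcd.continuousOn t ht').continuousAt
      (Icc_mem_nhds ht.1 ht.2)
    have hsrc : γ t ∈ (chartAt E q).source := by
      have := φ.map_target (hball (hseg t ht')).1
      rwa [hφ, extChartAt_source] at this
    have hφγ : φ ∘ γ =ᶠ[𝓝 t] fun t => z₀ + t • Δ := by
      filter_upwards [Ioo_mem_nhds ht.1 ht.2] with t ht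
      exact φ.right_inv (hball (hseg t (Ioo_subset_Icc_self ht))).1
    have hder : deriv (φ ∘ γ) t = Δ := by
      rw [hφγ.deriv_eq]
      simpa using (((hasDerivAt_id t).smul_const Δ).const_add z₀).deriv
    rw [← ofReal_norm]
    refine ENNReal.ofReal_le_ofReal (Real.le_sqrt_of_sq_le ?_)
    change ‖velocity E γ t‖ ^ 2 ≤ _
    rw [sq_norm_velocity hcont hsrc, ← hφ, hder]
    have hGt : ‖chartMetric q (φ (γ t)) - chartMetric q z₀‖ ≤ η := by
      rw [show φ (γ t) = z₀ + t • Δ from hφγ.eq_of_nhds, ← dist_eq_norm]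
      exact (hball (hseg t ht')).2.le
    have := (le_abs_self _).trans (((chartMetric q (φ (γ t)) - chartMetric q z₀).le_opNorm₂ Δ Δ))
    simp only [sub_apply] at this
    nlinarith [norm_nonneg Δ, mul_le_mul_of_nonneg_right hGt (mul_self_nonneg ‖Δ‖)]
  have hle3 := hle.trans hle2
  rw [lintegral_const, Measure.restrict_apply_univ, Real.volume_Ioo] at hle3
  simp only [sub_zero, ENNReal.ofReal_one, mul_one] at hle3
  rw [edist_dist, ENNReal.ofReal_le_ofReal_iff (Real.sqrt_nonneg _)] at hle3
  exact hle3

/-- The distance along a curve grows at most at the speed of the curve. -/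
theorem abs_deriv_dist_le {c : ℝ → M} {p : M} {t : ℝ} {f' : ℝ} (hc : ContinuousAt c t)
    (hu : DifferentiableAt ℝ (extChartAt 𝓘(ℝ, E) (c t) ∘ c) t)
    (hf : HasDerivAt (fun r => dist p (c r)) f' t) : |f'| ≤ ‖velocity E c t‖ := by
  have hsrc : c t ∈ (chartAt E (c t)).source := mem_chart_source E (c t)
  refine abs_le_of_sq_le_sq' ?_ (norm_nonneg _) |> abs_le.2
  rw [sq_norm_velocity hc hsrc]
  set u := extChartAt 𝓘(ℝ, E) (c t) ∘ c with hu_def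
  set G := chartMetric (c t) (extChartAt 𝓘(ℝ, E) (c t) (c t)) with hG
  -- The slopes of the distance are compared with those of the coordinates, up to an error η that is
  -- removed at the end.
  have key : ∀ η > 0, f' ^ 2 ≤ G (deriv u t) (deriv u t) + η * ‖deriv u t‖ ^ 2 := by
    intro η hη
    have t1 := ((hasDerivAt_iff_tendsto_slope.1 hf).pow 2)
    have t2 := hasDerivAt_iff_tendsto_slope.1 hu.hasDerivAt
    have t3 : Tendsto (fun r => G (slope u t r) (slope u t r) + η * ‖slope u t r‖ ^ 2) (𝓝[≠] t)
        (𝓝 (G (deriv u t) (deriv u t) + η * ‖deriv u t‖ ^ 2)) := by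
      have hcont : Continuous fun v : E => G v v + η * ‖v‖ ^ 2 := by fun_prop
      exact (hcont.tendsto _).comp t2
    refine le_of_tendsto_of_tendsto t1 t3 ?_
    filter_upwards [mem_nhdsWithin_of_mem_nhds (hc.eventually (eventually_dist_le (E := E) (c t) hη))]
      with r hr
    have h1 : |dist p (c r) - dist p (c t)| ≤ dist (c t) (c r) := by
      rw [dist_comm p (c r), dist_comm p (c t), dist_comm (c t) (c r)]
      exact abs_dist_sub_le (c r) (c t) p
    set Δ := extChartAt 𝓘(ℝ, E) (c t) (c r) - extChartAt 𝓘(ℝ, E) (c t) (c t) with hΔ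
    have h2 : slope u t r = (r - t)⁻¹ • Δ := slope_def_module u t r
    have hX : 0 ≤ G Δ Δ + η * ‖Δ‖ ^ 2 :=
      add_nonneg (chartMetric_self_nonneg _ _ _) (by positivity)
    have h3 : (dist p (c r) - dist p (c t)) ^ 2 ≤ G Δ Δ + η * ‖Δ‖ ^ 2 := by
      rw [← sq_abs, ← Real.sq_sqrt hX]
      gcongr
      exact h1.trans hr
    rw [h2, slope_def_module, smul_eq_mul, mul_pow]
    simp only [map_smul, smul_apply, smul_eq_mul, norm_smul, mul_pow]
    rw [Real.norm_eq_abs, sq_abs]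
    calc _ ≤ (r - t)⁻¹ ^ 2 * (G Δ Δ + η * ‖Δ‖ ^ 2) := by gcongr
      _ = _ := by ring
  have t4 : Tendsto (fun η : ℝ => G (deriv u t) (deriv u t) + η * ‖deriv u t‖ ^ 2) (𝓝[>] 0)
      (𝓝 (G (deriv u t) (deriv u t) + 0 * ‖deriv u t‖ ^ 2)) := by
    have : Continuous fun η : ℝ => G (deriv u t) (deriv u t) + η * ‖deriv u t‖ ^ 2 := by fun_prop
    exact (this.tendsto 0).mono_left nhdsWithin_le_nhds
  rw [zero_mul, add_zero] at t4
  exact ge_of_tendsto t4 (by filter_upwards [self_mem_nhdsWithin] with η hη using key η hη)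

/-! ### Regularity of loops in charts; length and energy -/

section Loop

/-- The coordinates of an absolutely continuous curve are absolutely continuous. -/
theorem exists_absolutelyContinuous_chart {x : M} {c : ℝ → M} {s a b : ℝ}
    (hc : AbsolutelyContinuousOnInterval c a b) (hs : s ∈ Ioo a b)
    (hsrc : c s ∈ (chartAt E x).source) :
    ∃ δ > 0, AbsolutelyContinuousOnInterval (extChartAt 𝓘(ℝ, E) x ∘ c) (s - δ) (s + δ) := by
  obtain ⟨K, U, hU, hK⟩ := exists_lipschitz_extChartAt hsrc
  have hcont : ContinuousAt c s := hc.continuousAt_of_mem_Ioo hs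
  obtain ⟨δ, hδ, hball⟩ := Metric.mem_nhds_iff.1
    (inter_mem (hcont.preimage_mem_nhds hU) (Icc_mem_nhds hs.1 hs.2))
  have hsub : Icc (s - δ / 2) (s + δ / 2) ⊆ c ⁻¹' U ∩ Icc a b := fun r hr => hball (by
    rw [Metric.mem_ball, Real.dist_eq, abs_lt]; constructor <;> linarith [hr.1, hr.2])
  have hle : s - δ / 2 ≤ s + δ / 2 := by linarith
  refine ⟨δ / 2, by positivity, (hc.mono ?_).of_dist_le (C := K) fun r hr t ht => ?_⟩
  · rw [uIcc_of_le hle, uIcc_of_le (hs.1.trans hs.2).le]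
    exact fun r hr => (hsub hr).2
  · rw [uIcc_of_le hle] at hr ht
    exact hK _ (hsub hr).1 _ (hsub ht).1

theorem LoopSpace.continuous (c : LoopSpace E M) : Continuous c := by
  refine continuous_iff_continuousAt.2 fun s => ?_
  exact (c.absolutelyContinuous (s - 1) (s + 1)).continuousAt_of_mem_Ioo
    ⟨by linarith, by linarith⟩

/-- The two velocities lie in tangent spaces that are not definitionally equal, so their norms are
compared through one fixed chart, where the coordinate expression is periodic. -/
theorem LoopSpace.norm_velocity_add_one (c : LoopSpace E M) (s : ℝ) :
    ‖velocity E c (s + 1)‖ = ‖velocity E c s‖ := by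
  have hper := c.periodic s
  have h : ‖velocity E c (s + 1)‖ ^ 2 = ‖velocity E c s‖ ^ 2 := by
    have hsrc : c s ∈ (chartAt E (c s)).source := mem_chart_source E (c s)
    rw [sq_norm_velocity c.continuous.continuousAt (by rw [hper]; exact hsrc),
      sq_norm_velocity c.continuous.continuousAt hsrc, hper]
    have hd : deriv (extChartAt 𝓘(ℝ, E) (c s) ∘ c) (s + 1) =
        deriv (extChartAt 𝓘(ℝ, E) (c s) ∘ c) s := by
      rw [← deriv_comp_add_const]
      congr 1
      exact funext fun r => congrArg (extChartAt 𝓘(ℝ, E) (c s)) (c.periodic r)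
    rw [hd]
  exact (sq_eq_sq₀ (norm_nonneg _) (norm_nonneg _)).1 h

/-- The speed of a loop is measurable. -/
theorem LoopSpace.aestronglyMeasurable_speed (c : LoopSpace E M) (a b : ℝ) :
    AEStronglyMeasurable (fun s => ‖velocity E c s‖) (volume.restrict (Icc a b)) := by
  rcases lt_or_ge b a with hba | hab
  · simp [Icc_eq_empty hba.not_ge]
  refine interval_induction
    (P := fun a b => AEStronglyMeasurable (fun s => ‖velocity E c s‖) (volume.restrict (Icc a b)))
    (fun a b d hab hbc h₁ h₂ => ?_) hab fun s hs => ?_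
  · rw [← Icc_union_Icc_eq_Icc hab hbc]
    exact aestronglyMeasurable_union_iff.2 ⟨h₁, h₂⟩
  · have hcont := c.continuous.continuousAt (x := s)
    have hsrc : c s ∈ (chartAt E (c s)).source := mem_chart_source E (c s)
    obtain ⟨δ, hδ, hball⟩ := Metric.mem_nhds_iff.1
      (hcont.preimage_mem_nhds ((chartAt E (c s)).open_source.mem_nhds hsrc))
    refine ⟨δ, hδ, fun u v _ huv _ hu hv => ?_⟩
    have hmaps : ∀ r ∈ Icc u v, c r ∈ (chartAt E (c s)).source := fun r hr => hball (by
      rw [Metric.mem_ball, Real.dist_eq, abs_lt]; constructor <;> linarith [hr.1, hr.2])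
    set x := c s
    have hcG : ContinuousOn (fun r => chartMetric x (extChartAt 𝓘(ℝ, E) x (c r))) (Icc u v) := by
      refine (contDiffOn_chartMetric x).continuousOn.comp
        ((continuousOn_extChartAt x).comp c.continuous.continuousOn fun r hr => ?_) fun r hr => ?_
      · rw [extChartAt_source]; exact hmaps r hr
      · exact (extChartAt 𝓘(ℝ, E) x).map_source (by rw [extChartAt_source]; exact hmaps r hr)
    have hd := aestronglyMeasurable_deriv (extChartAt 𝓘(ℝ, E) x ∘ c) (volume.restrict (Icc u v))
    have h1 : AEStronglyMeasurable (fun r => Real.sqrt (chartMetric x (extChartAt 𝓘(ℝ, E) x (c r))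
        (deriv (extChartAt 𝓘(ℝ, E) x ∘ c) r) (deriv (extChartAt 𝓘(ℝ, E) x ∘ c) r)))
        (volume.restrict (Icc u v)) := by
      refine Real.continuous_sqrt.comp_aestronglyMeasurable ?_
      exact aestronglyMeasurable_bilin
        (hcG.aestronglyMeasurable (μ := volume) measurableSet_Icc) hd hd
    refine h1.congr ?_
    filter_upwards [ae_restrict_mem measurableSet_Icc] with r hr
    rw [← sq_norm_velocity c.continuous.continuousAt (hmaps r hr), Real.sqrt_sq (norm_nonneg _)]

theorem LoopSpace.lintegral_speed_lt_top (c : LoopSpace E M) (a b : ℝ) :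
    ∫⁻ s in Icc a b, ‖velocity E c s‖ₑ ^ 2 < ⊤ := by
  have hper : ∀ k : ℤ, ∀ s, ‖velocity E c (s + k)‖ₑ = ‖velocity E c s‖ₑ := by
    intro k s
    have : Function.Periodic (fun s => ‖velocity E c s‖) 1 := c.norm_velocity_add_one
    have h2 := this.int_mul k s
    have h3 : s + k = s + k * 1 := by ring
    rw [← ofReal_norm, ← ofReal_norm]
    congr 1
    rw [← h2]
    exact congrArg (fun s => ‖velocity E c s‖) h3
  have hone : ∀ k : ℤ, ∫⁻ s in Icc (k : ℝ) (k + 1), ‖velocity E c s‖ₑ ^ 2 < ⊤ := by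
    intro k
    have h1 := (measurePreserving_add_right volume (k : ℝ)).setLIntegral_comp_preimage_emb
      (measurableEmbedding_addRight (k : ℝ)) (fun s => ‖velocity E c s‖ₑ ^ 2) (Icc (k : ℝ) (k + 1))
    rw [← h1]
    have h2 : (fun s => s + (k : ℝ)) ⁻¹' Icc (k : ℝ) (k + 1) = Icc 0 1 := by
      ext s; simp
    rw [h2]
    simp only [hper]
    exact c.energy_lt_top
  have hind : ∀ n : ℕ, ∀ k : ℤ, ∫⁻ s in Icc (k : ℝ) (k + n), ‖velocity E c s‖ₑ ^ 2 < ⊤ := by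
    intro n k
    induction n with
    | zero => simp
    | succ n ih =>
      have h1 := hone (k + n)
      push_cast at h1 ⊢
      rw [← Icc_union_Icc_eq_Icc (show (k : ℝ) ≤ k + n by simp)
        (show (k : ℝ) + n ≤ k + (n + 1) by linarith)]
      refine (lintegral_union_le _ _ _).trans_lt (ENNReal.add_lt_top.2 ⟨ih, ?_⟩)
      rwa [← add_assoc]
  refine (lintegral_mono_set ?_).trans_lt (hind ⌈b - ⌊a⌋⌉₊ ⌊a⌋)
  refine Icc_subset_Icc (Int.floor_le a) ?_
  linarith [Nat.le_ceil (b - ⌊a⌋)]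

theorem LoopSpace.memLp_speed (c : LoopSpace E M) (a b : ℝ) :
    MemLp (fun s => ‖velocity E c s‖) 2 (volume.restrict (Icc a b)) := by
  refine ⟨c.aestronglyMeasurable_speed a b, ?_⟩
  rw [eLpNorm_lt_top_iff_lintegral_rpow_enorm_lt_top (by simp) (by simp)]
  simpa using c.lintegral_speed_lt_top a b

theorem LoopSpace.intervalIntegrable_sq_speed (c : LoopSpace E M) (a b : ℝ) :
    IntervalIntegrable (fun s => ‖velocity E c s‖ ^ 2) volume a b := by
  rw [intervalIntegrable_iff]
  have := ((c.memLp_speed (min a b) (max a b)).integrable_sq)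
  exact IntegrableOn.mono_set this Ioc_subset_Icc_self

theorem LoopSpace.intervalIntegrable_speed (c : LoopSpace E M) (a b : ℝ) :
    IntervalIntegrable (fun s => ‖velocity E c s‖) volume a b := by
  rw [intervalIntegrable_iff]
  have := ((c.memLp_speed (min a b) (max a b)).integrable (by norm_num))
  exact IntegrableOn.mono_set this Ioc_subset_Icc_self

theorem mdifferentiableAt_of_differentiableAt_chart {x : M} {c : ℝ → M} {s : ℝ}
    (hc : ContinuousAt c s) (hs : c s ∈ (chartAt E x).source)
    (h : DifferentiableAt ℝ (extChartAt 𝓘(ℝ, E) x ∘ c) s) :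
    MDifferentiableAt 𝓘(ℝ, ℝ) 𝓘(ℝ, E) c s := by
  have h3 : MDifferentiableAt 𝓘(ℝ, E) 𝓘(ℝ, E) (extChartAt 𝓘(ℝ, E) x).symm
      ((extChartAt 𝓘(ℝ, E) x ∘ c) s) := by
    have := mdifferentiableWithinAt_extChartAt_symm (I := 𝓘(ℝ, E))
      ((extChartAt 𝓘(ℝ, E) x).map_source (by simpa using hs : c s ∈ _))
    rwa [modelWithCornersSelf_coe, range_id, mdifferentiableWithinAt_univ] at this
  refine (h3.comp s h.mdifferentiableAt).congr_of_eventuallyEq ?_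
  filter_upwards [hc.preimage_mem_nhds ((chartAt E x).open_source.mem_nhds hs)] with r hr
  exact ((extChartAt 𝓘(ℝ, E) x).left_inv (by simpa using hr)).symm

theorem LoopSpace.ae_mdifferentiableAt (c : LoopSpace E M) :
    ∀ᵐ s : ℝ, MDifferentiableAt 𝓘(ℝ, ℝ) 𝓘(ℝ, E) c s := by
  have h : ∀ n : ℕ, ∀ᵐ s ∂volume.restrict (Icc (-n : ℝ) n),
      MDifferentiableAt 𝓘(ℝ, ℝ) 𝓘(ℝ, E) c s := by
    intro n
    refine interval_induction (P := fun a b => ∀ᵐ s ∂volume.restrict (Icc a b),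
      MDifferentiableAt 𝓘(ℝ, ℝ) 𝓘(ℝ, E) c s) (fun a b d hab hbc h₁ h₂ => ?_)
      (by linarith [(n.cast_nonneg : (0 : ℝ) ≤ n)]) fun s hs => ?_
    · rw [← Icc_union_Icc_eq_Icc hab hbc]
      exact (ae_restrict_union_iff _ _ _).2 ⟨h₁, h₂⟩
    · have hsrc : c s ∈ (chartAt E (c s)).source := mem_chart_source E (c s)
      obtain ⟨δ, hδ, hac⟩ := exists_absolutelyContinuous_chart
        (c.absolutelyContinuous (s - 1) (s + 1)) (s := s) ⟨by linarith, by linarith⟩ hsrc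
      obtain ⟨δ', hδ', hball⟩ := Metric.mem_nhds_iff.1 (c.continuous.continuousAt.preimage_mem_nhds
        ((chartAt E (c s)).open_source.mem_nhds hsrc))
      refine ⟨min δ δ', lt_min hδ hδ', fun u v _ huv _ hu hv => ?_⟩
      filter_upwards [ae_restrict_of_ae hac.ae_differentiableAt_vec,
        ae_restrict_mem measurableSet_Icc] with r hr hmem
      have h1 := min_le_left δ δ'
      have h2 := min_le_right δ δ'
      refine mdifferentiableAt_of_differentiableAt_chart c.continuous.continuousAt
        (hball (show r ∈ _ from ?_)) (hr ?_)
      · rw [Metric.mem_ball, Real.dist_eq, abs_lt]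
        constructor <;> linarith [hmem.1, hmem.2]
      · rw [uIcc_of_le (by linarith)]
        constructor <;> linarith [hmem.1, hmem.2]
  have h2 := (ae_restrict_iUnion_iff (μ := volume) (fun n : ℕ => Icc (-n : ℝ) n) _).2 h
  have h3 : ⋃ n : ℕ, Icc (-n : ℝ) n = univ := by
    refine eq_univ_of_forall fun s => ?_
    obtain ⟨n, hn⟩ := exists_nat_ge |s|
    exact mem_iUnion.2 ⟨n, abs_le.1 hn⟩
  rwa [h3, Measure.restrict_univ] at h2

/-- The exceptional set is where `c` itself is not differentiable, so it is independent of the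
chart. This matters because `covDeriv` uses at time `s` the chart at `c s`, which varies with `s`.
-/
theorem LoopSpace.ae_differentiableAt_chart (c : LoopSpace E M) :
    ∀ᵐ s : ℝ, ∀ x : M, c s ∈ (chartAt E x).source →
      DifferentiableAt ℝ (extChartAt 𝓘(ℝ, E) x ∘ c) s := by
  filter_upwards [c.ae_mdifferentiableAt] with s hs x hx
  exact ((mdifferentiableAt_extChartAt hx).comp s hs).differentiableAt

/-- The coordinates of a loop are of class `H¹`. -/
theorem LoopSpace.h1At_chart (c : LoopSpace E M) {x : M} {s : ℝ}
    (hs : c s ∈ (chartAt E x).source) : H1At (extChartAt 𝓘(ℝ, E) x ∘ c) s := by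
  obtain ⟨δ, hδ, hac⟩ := exists_absolutelyContinuous_chart
    (c.absolutelyContinuous (s - 1) (s + 1)) (s := s) ⟨by linarith, by linarith⟩ hs
  obtain ⟨A, hA, hAt, hAq⟩ := exists_compact_nhds_in_chart hs
  obtain ⟨κ, hκ, C, hC, hbd⟩ := exists_chartMetric_bounds hA hAt
  obtain ⟨δ', hδ', hball⟩ := Metric.mem_nhds_iff.1 (c.continuous.continuousAt.preimage_mem_nhds hAq)
  have h1 := min_le_left δ (δ' / 2)
  have h2 := min_le_right δ (δ' / 2)
  have h3 : 0 < min δ (δ' / 2) := lt_min hδ (by linarith)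
  refine ⟨min δ (δ' / 2), h3, hac.mono ?_, ?_⟩
  · rw [uIcc_of_le (by linarith), uIcc_of_le (by linarith)]
    exact Icc_subset_Icc (by linarith) (by linarith)
  · have hle : ∀ r ∈ Icc (s - min δ (δ' / 2)) (s + min δ (δ' / 2)),
        ‖deriv (extChartAt 𝓘(ℝ, E) x ∘ c) r‖ₑ ^ 2 ≤
          ENNReal.ofReal (Real.sqrt κ⁻¹) ^ 2 * ‖velocity E c r‖ₑ ^ 2 := by
      intro r hr
      have hm := hball (show r ∈ Metric.ball s δ' by
        rw [Metric.mem_ball, Real.dist_eq, abs_lt]; constructor <;> linarith [hr.1, hr.2])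
      rw [← mul_pow, ← ofReal_norm, ← ofReal_norm, ← ENNReal.ofReal_mul (by positivity)]
      gcongr
      exact norm_deriv_le_norm_velocity c.continuous.continuousAt hm.1 hκ (hbd _ hm.2).1
    refine (setLIntegral_mono' measurableSet_Icc hle).trans_lt ?_
    rw [lintegral_const_mul' _ _ (by simp)]
    exact ENNReal.mul_lt_top (by simp) (c.lintegral_speed_lt_top _ _)

/-- The distance between two points of a loop is at most the length of the arc between them. -/
theorem LoopSpace.dist_le (c : LoopSpace E M) {s t : ℝ} (hst : s ≤ t) :
    dist (c s) (c t) ≤ ∫ r in s..t, ‖velocity E c r‖ := by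
  -- The distance from the starting point is a real absolutely continuous function, and its
  -- derivative is at most the speed.
  have hac : AbsolutelyContinuousOnInterval (fun r => dist (c s) (c r)) s t :=
    (c.absolutelyContinuous s t).of_dist_le (C := 1) fun r _ r' _ => by
      rw [one_mul, Real.dist_eq, dist_comm (c s) (c r), dist_comm (c s) (c r')]
      exact abs_dist_sub_le (c r) (c r') (c s)
  have h1 := hac.integral_deriv_eq_sub
  simp only [dist_self, sub_zero] at h1
  rw [← h1]
  refine intervalIntegral.integral_mono_ae_restrict hst hac.intervalIntegrable_deriv
    (c.intervalIntegrable_speed s t) ?_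
  filter_upwards [ae_restrict_of_ae hac.ae_differentiableAt,
    ae_restrict_of_ae c.ae_differentiableAt_chart, ae_restrict_mem measurableSet_Icc]
    with r hr hr' hmem
  rw [← uIcc_of_le hst] at hmem
  exact (le_abs_self _).trans (abs_deriv_dist_le c.continuous.continuousAt
    (hr' _ (mem_chart_source E (c r))) (hr hmem).hasDerivAt)

end Loop

end Distance

/-! ### Uniform first-order expansion -/

section Expansion

/-- A `C¹` function is differentiable uniformly on compact sets. -/
theorem exists_uniform_expansion {E F : Type*} [NormedAddCommGroup E] [NormedSpace ℝ E]
    [NormedAddCommGroup F] [NormedSpace ℝ F] {f : E → F} {A : Set E} (hA : IsCompact A)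
    (hf : ∀ z ∈ A, ContDiffAt ℝ 1 f z) {η : ℝ} (hη : 0 < η) :
    ∃ r > 0, ∀ z ∈ A, ∀ y, ‖y - z‖ < r → ‖f y - f z - fderiv ℝ f z (y - z)‖ ≤ η * ‖y - z‖ := by
  refine hA.induction_on (p := fun A => ∃ r > 0, ∀ z ∈ A, ∀ y, ‖y - z‖ < r →
    ‖f y - f z - fderiv ℝ f z (y - z)‖ ≤ η * ‖y - z‖) ⟨1, one_pos, by simp⟩ ?_ ?_ ?_
  · rintro s t hst ⟨r, hr, h⟩
    exact ⟨r, hr, fun z hz => h z (hst hz)⟩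
  · rintro s t ⟨r, hr, h⟩ ⟨r', hr', h'⟩
    refine ⟨min r r', lt_min hr hr', fun z hz y hy => ?_⟩
    rcases hz with hz | hz
    · exact h z hz y (hy.trans_le (min_le_left _ _))
    · exact h' z hz y (hy.trans_le (min_le_right _ _))
  · intro z₀ hz₀
    have h1 := (hf z₀ hz₀).hasStrictFDerivAt (by simp)
    have h2 := h1.isLittleO.def (c := η / 2) (by positivity)
    have h3 : ∀ᶠ z in 𝓝 z₀, ‖fderiv ℝ f z - fderiv ℝ f z₀‖ < η / 2 := by
      have := ((hf z₀ hz₀).fderiv_right (m := 0) (by simp)).continuousAt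
      have := this.eventually (Metric.ball_mem_nhds _ (show 0 < η / 2 by positivity))
      simpa [dist_eq_norm] using this
    obtain ⟨ε, hε, h2'⟩ := Metric.eventually_nhds_iff.1 h2
    obtain ⟨ε', hε', h3'⟩ := Metric.eventually_nhds_iff.1 h3
    refine ⟨Metric.ball z₀ (min (ε / 2) ε'), mem_nhdsWithin_of_mem_nhds
      (Metric.ball_mem_nhds _ (by positivity)), ε / 2, by positivity, fun z hz y hy => ?_⟩
    have hz1 : dist z z₀ < ε / 2 := (Metric.mem_ball.1 hz).trans_le (min_le_left _ _)
    have hz2 : dist z z₀ < ε' := (Metric.mem_ball.1 hz).trans_le (min_le_right _ _)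
    have hy1 : dist y z₀ < ε := by
      rw [← dist_eq_norm] at hy
      linarith [dist_triangle y z z₀]
    have e1 := h2' (y := (y, z)) (by rw [Prod.dist_eq]; exact max_lt hy1 (by linarith))
    have e2 := h3' hz2
    dsimp only at e1
    have e3 : f y - f z - fderiv ℝ f z (y - z) = (f y - f z - fderiv ℝ f z₀ (y - z)) -
        (fderiv ℝ f z - fderiv ℝ f z₀) (y - z) := by
      rw [sub_apply]; abel
    rw [e3]
    refine (norm_sub_le _ _).trans ?_
    have e4 := (fderiv ℝ f z - fderiv ℝ f z₀).le_opNorm (y - z)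
    have e5 : ‖fderiv ℝ f z - fderiv ℝ f z₀‖ * ‖y - z‖ ≤ η / 2 * ‖y - z‖ := by gcongr
    linarith

end Expansion

/-! ### Integrals of bilinear expressions in L² functions -/

section Bilinear

variable {E : Type*} [NormedAddCommGroup E] [NormedSpace ℝ E] {α : Type*} [MeasurableSpace α]
  {μ : Measure α}

theorem eLpNorm_bilin_le {B : α → E →L[ℝ] E →L[ℝ] ℝ} {v w : α → E}
    (hv : AEStronglyMeasurable v μ) (hw : AEStronglyMeasurable w μ) {C : ℝ}
    (hC : ∀ᵐ s ∂μ, ‖B s‖ ≤ C) :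
    eLpNorm (fun s => B s (v s) (w s)) 1 μ ≤
      ENNReal.ofReal C * (eLpNorm v 2 μ * eLpNorm w 2 μ) := by
  have h1 : ∀ᵐ s ∂μ, ‖B s (v s) (w s)‖ ≤ C * ‖‖v s‖ * ‖w s‖‖ := by
    filter_upwards [hC] with s hs
    rw [norm_mul, norm_norm, norm_norm, ← mul_assoc]
    exact ((B s).le_opNorm₂ _ _).trans (by gcongr)
  refine (eLpNorm_le_mul_eLpNorm_of_ae_le_mul h1 1).trans ?_
  gcongr
  have := eLpNorm_smul_le_mul_eLpNorm (p := 2) (q := 2) (r := 1) hw.norm hv.norm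
  rw [eLpNorm_norm, eLpNorm_norm] at this
  exact this

theorem integrable_bilin {B : α → E →L[ℝ] E →L[ℝ] ℝ} {v w : α → E}
    (hB : AEStronglyMeasurable B μ) (hv : MemLp v 2 μ) (hw : MemLp w 2 μ) {C : ℝ}
    (hC : ∀ᵐ s ∂μ, ‖B s‖ ≤ C) : Integrable (fun s => B s (v s) (w s)) μ := by
  rw [← memLp_one_iff_integrable]
  exact ⟨aestronglyMeasurable_bilin hB hv.1 hw.1, (eLpNorm_bilin_le hv.1 hw.1 hC).trans_lt
    (ENNReal.mul_lt_top (by simp) (ENNReal.mul_lt_top hv.2 hw.2))⟩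

theorem enorm_integral_bilin_le {B : α → E →L[ℝ] E →L[ℝ] ℝ} {v w : α → E}
    (hv : AEStronglyMeasurable v μ) (hw : AEStronglyMeasurable w μ) {C : ℝ}
    (hC : ∀ᵐ s ∂μ, ‖B s‖ ≤ C) :
    ‖∫ s, B s (v s) (w s) ∂μ‖ₑ ≤ ENNReal.ofReal C * (eLpNorm v 2 μ * eLpNorm w 2 μ) := by
  refine (enorm_integral_le_lintegral_enorm _).trans ?_
  rw [← eLpNorm_one_eq_lintegral_enorm]
  exact eLpNorm_bilin_le hv hw hC

/-- Convergence of integrals of bilinear expressions under uniform convergence of the bilinear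
forms and `L²` convergence of the vectors. -/
theorem tendsto_integral_bilin {ι : Type*} {l : Filter ι} {B : ι → α → E →L[ℝ] E →L[ℝ] ℝ}
    {B₀ : α → E →L[ℝ] E →L[ℝ] ℝ} {v w : ι → α → E} {v₀ w₀ : α → E}
    (hB : ∀ᶠ i in l, AEStronglyMeasurable (B i) μ) (hB₀ : AEStronglyMeasurable B₀ μ) {C : ℝ}
    (hC : ∀ᵐ s ∂μ, ‖B₀ s‖ ≤ C)
    (hBl : ∀ η > 0, ∀ᶠ i in l, ∀ᵐ s ∂μ, ‖B i s - B₀ s‖ ≤ η)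
    (hv : ∀ᶠ i in l, MemLp (v i) 2 μ) (hv₀ : MemLp v₀ 2 μ)
    (hvl : Tendsto (fun i => eLpNorm (v i - v₀) 2 μ) l (𝓝 0))
    (hw : ∀ᶠ i in l, MemLp (w i) 2 μ) (hw₀ : MemLp w₀ 2 μ)
    (hwl : Tendsto (fun i => eLpNorm (w i - w₀) 2 μ) l (𝓝 0)) :
    Tendsto (fun i => ∫ s, B i s (v i s) (w i s) ∂μ) l (𝓝 (∫ s, B₀ s (v₀ s) (w₀ s) ∂μ)) := by
  rw [ENNReal.tendsto_nhds_zero] at hvl hwl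
  set N := eLpNorm v₀ 2 μ with hN
  set N' := eLpNorm w₀ 2 μ with hN'
  have hNt : N + 1 ≠ ⊤ := by simpa using hv₀.2.ne
  have hNt' : N' + 1 ≠ ⊤ := by simpa using hw₀.2.ne
  rw [EMetric.tendsto_nhds]
  intro ε hε
  -- The difference telescopes into (Bᵢ - B₀)(vᵢ, wᵢ) + B₀(vᵢ - v₀, wᵢ) + B₀(v₀, wᵢ - w₀). When all
  -- three convergences are within η ≤ 1, its integral is bounded by ηQ, one summand of Q for each
  -- term.
  set Q : ℝ≥0∞ := (N + 1) * (N' + 1) + ENNReal.ofReal C * (N' + 1) + ENNReal.ofReal C * (N + 1)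
    with hQ
  have hQt : Q ≠ ⊤ := by
    simp only [hQ]
    exact ENNReal.add_ne_top.2 ⟨ENNReal.add_ne_top.2 ⟨ENNReal.mul_ne_top hNt hNt',
      ENNReal.mul_ne_top (by simp) hNt'⟩, ENNReal.mul_ne_top (by simp) hNt⟩
  obtain ⟨η, hη, hηε⟩ : ∃ η : ℝ, 0 < η ∧ η ≤ 1 ∧ ENNReal.ofReal η * Q < ε := by
    rcases eq_or_ne ε ⊤ with rfl | hεt
    · exact ⟨1, one_pos, le_rfl, by simpa using hQt.lt_top⟩
    have h1 : 0 < ε.toReal := ENNReal.toReal_pos hε.ne' hεt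
    have h2 : 0 ≤ Q.toReal := ENNReal.toReal_nonneg
    refine ⟨min 1 (ε.toReal / (2 * (Q.toReal + 1))), lt_min one_pos (by positivity),
      min_le_left _ _, ?_⟩
    calc ENNReal.ofReal (min 1 (ε.toReal / (2 * (Q.toReal + 1)))) * Q
        ≤ ENNReal.ofReal (ε.toReal / (2 * (Q.toReal + 1))) * ENNReal.ofReal Q.toReal := by
          rw [ENNReal.ofReal_toReal hQt]; gcongr; exact min_le_right _ _
      _ = ENNReal.ofReal (ε.toReal / (2 * (Q.toReal + 1)) * Q.toReal) := by
          rw [ENNReal.ofReal_mul (by positivity)]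
      _ < ENNReal.ofReal ε.toReal := by
          rw [ENNReal.ofReal_lt_ofReal_iff h1, div_mul_eq_mul_div, div_lt_iff₀ (by positivity)]
          nlinarith
      _ = ε := ENNReal.ofReal_toReal hεt
  obtain ⟨hη1, hηε⟩ := hηε
  filter_upwards [hB, hBl η hη, hv, hw, hvl (ENNReal.ofReal η) (by simpa using hη),
    hwl (ENNReal.ofReal η) (by simpa using hη)] with i hBi hBli hvi hwi hvli hwli
  have hη1' : ENNReal.ofReal η ≤ 1 := by simpa using hη1
  have hCi : ∀ᵐ s ∂μ, ‖B i s‖ ≤ C + η := by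
    filter_upwards [hC, hBli] with s h1 h2
    calc ‖B i s‖ = ‖B₀ s + (B i s - B₀ s)‖ := by rw [add_sub_cancel]
      _ ≤ _ := (norm_add_le _ _).trans (add_le_add h1 h2)
  have hvn : eLpNorm (v i) 2 μ ≤ N + 1 := by
    have : v i = v₀ + (v i - v₀) := by abel
    rw [this]
    exact (eLpNorm_add_le hv₀.1 (hvi.1.sub hv₀.1) (by norm_num)).trans
      (add_le_add le_rfl (hvli.trans hη1'))
  have hwn : eLpNorm (w i) 2 μ ≤ N' + 1 := by
    have : w i = w₀ + (w i - w₀) := by abel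
    rw [this]
    exact (eLpNorm_add_le hw₀.1 (hwi.1.sub hw₀.1) (by norm_num)).trans
      (add_le_add le_rfl (hwli.trans hη1'))
  have i1 := integrable_bilin (hBi.sub hB₀) hvi hwi (C := η) hBli
  have i2 := integrable_bilin hB₀ (hvi.sub hv₀) hwi hC
  have i3 := integrable_bilin hB₀ hv₀ (hwi.sub hw₀) hC
  have e : ∫ s, B i s (v i s) (w i s) ∂μ - ∫ s, B₀ s (v₀ s) (w₀ s) ∂μ =
      ∫ s, (B i - B₀) s (v i s) (w i s) ∂μ + ∫ s, B₀ s ((v i - v₀) s) (w i s) ∂μ +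
        ∫ s, B₀ s (v₀ s) ((w i - w₀) s) ∂μ := by
    rw [← integral_sub (integrable_bilin hBi hvi hwi hCi) (integrable_bilin hB₀ hv₀ hw₀ hC),
      ← integral_add i1 i2, ← integral_add (show Integrable (fun s => _ + _) μ from i1.add i2) i3]
    refine integral_congr_ae (Eventually.of_forall fun s => ?_)
    simp
  rw [edist_eq_enorm_sub, e]
  refine lt_of_le_of_lt ?_ hηε
  refine (enorm_add_le _ _).trans ((add_le_add (enorm_add_le _ _) le_rfl).trans ?_)
  rw [hQ, mul_add, mul_add]
  refine add_le_add (add_le_add ?_ ?_) ?_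
  · refine (enorm_integral_bilin_le hvi.1 hwi.1 hBli).trans ?_
    gcongr
  · refine (enorm_integral_bilin_le (hvi.1.sub hv₀.1) hwi.1 hC).trans ?_
    calc _ ≤ ENNReal.ofReal C * (ENNReal.ofReal η * (N' + 1)) := by gcongr
      _ = _ := by ring
  · refine (enorm_integral_bilin_le hv₀.1 (hwi.1.sub hw₀.1) hC).trans ?_
    calc _ ≤ ENNReal.ofReal C * ((N + 1) * ENNReal.ofReal η) := by
          gcongr; exact le_self_add
      _ = _ := by ring

end Bilinear

/-! ### The H¹ norm and the Sobolev inequality -/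

section Sobolev

variable {E : Type*} [NormedAddCommGroup E] [NormedSpace ℝ E] [FiniteDimensional ℝ E]

theorem eLpNorm_two_sq {α : Type*} [MeasurableSpace α] {F : Type*} [NormedAddCommGroup F]
    (μ : Measure α) (f : α → F) : eLpNorm f 2 μ ^ 2 = ∫⁻ s, ‖f s‖ₑ ^ 2 ∂μ := by
  rw [eLpNorm_eq_lintegral_rpow_enorm_toReal (by simp) (by simp), ← ENNReal.rpow_natCast,
    ← ENNReal.rpow_mul]
  simp

theorem h1NormSq_eq {f : ℝ → E} {a b : ℝ} (hf : AEStronglyMeasurable f (volume.restrict (Icc a b))) :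
    h1NormSq a b f = eLpNorm f 2 (volume.restrict (Icc a b)) ^ 2 +
      eLpNorm (deriv f) 2 (volume.restrict (Icc a b)) ^ 2 := by
  rw [eLpNorm_two_sq, eLpNorm_two_sq, h1NormSq, lintegral_add_left' (hf.enorm.pow_const 2)]

theorem H1On.aestronglyMeasurable {f : ℝ → E} {a b : ℝ} (hf : H1On f a b) (hab : a ≤ b) :
    AEStronglyMeasurable f (volume.restrict (Icc a b)) := by
  have := hf.1.continuousOn
  rw [uIcc_of_le hab] at this
  exact this.aestronglyMeasurable measurableSet_Icc

/-- The Sobolev inequality on an interval. -/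
theorem H1On.enorm_le {f : ℝ → E} {a b : ℝ} (hf : H1On f a b) (hab : a < b) {s : ℝ}
    (hs : s ∈ Icc a b) {κ : ℝ≥0∞} (h : h1NormSq a b f ≤ κ ^ 2) :
    ‖f s‖ₑ ≤ (ENNReal.ofReal (b - a) ^ (-(1 / 2 : ℝ)) + ENNReal.ofReal (b - a) ^ (1 / 2 : ℝ)) * κ := by
  set μ := volume.restrict (Icc a b) with hμ
  have hm := hf.aestronglyMeasurable hab.le
  set ℓ := ENNReal.ofReal (b - a) with hℓ
  have hℓ0 : ℓ ≠ 0 := by simpa [hℓ] using hab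
  have hℓt : ℓ ≠ ⊤ := by simp [hℓ]
  have hμuniv : μ univ = ℓ := by simp [hμ, hℓ]
  rw [h1NormSq_eq hm] at h
  have h2 : eLpNorm f 2 μ ≤ κ :=
    (ENNReal.pow_le_pow_left_iff two_ne_zero).1 (le_self_add.trans h)
  have h3 : eLpNorm (deriv f) 2 μ ≤ κ :=
    (ENNReal.pow_le_pow_left_iff two_ne_zero).1 (le_add_self.trans h)
  have hL1 : ∀ g : ℝ → E, AEStronglyMeasurable g μ → eLpNorm g 2 μ ≤ κ →
      ∫⁻ r, ‖g r‖ₑ ∂μ ≤ κ * ℓ ^ (1 / 2 : ℝ) := by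
    intro g hg hgκ
    rw [← eLpNorm_one_eq_lintegral_enorm]
    refine (eLpNorm_le_eLpNorm_mul_rpow_measure_univ (p := 1) (q := 2) (by norm_num) hg).trans ?_
    rw [hμuniv, show (1 : ℝ) / ENNReal.toReal 1 - 1 / ENNReal.toReal 2 = 1 / 2 by norm_num]
    gcongr
  have h4 := hL1 f hm h2
  have h5 := hL1 (deriv f) (aestronglyMeasurable_deriv f _) h3
  -- Averaging this over t in [a, b] replaces the value at t by the L¹ norm of f; both L¹ norms are
  -- then bounded by L² norms.
  have h6 : ∀ t ∈ Icc a b, ‖f s‖ₑ ≤ ‖f t‖ₑ + ∫⁻ r, ‖deriv f r‖ₑ ∂μ := by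
    have hmain : ∀ p q, a ≤ p → p ≤ q → q ≤ b → ‖f q - f p‖ₑ ≤ ∫⁻ r, ‖deriv f r‖ₑ ∂μ := by
      intro p q hp hpq hq
      rw [← (hf.mono hp hpq hq).1.intervalIntegrable_deriv_vec.2,
        intervalIntegral.integral_of_le hpq]
      refine (enorm_integral_le_lintegral_enorm _).trans ?_
      exact lintegral_mono_set (Ioc_subset_Icc_self.trans (Icc_subset_Icc hp hq))
    intro t ht
    have e : f s = f t + (f s - f t) := by abel
    have h7 : ‖f s - f t‖ₑ ≤ ∫⁻ r, ‖deriv f r‖ₑ ∂μ := by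
      rcases le_total t s with hts | hst
      · exact hmain t s ht.1 hts hs.2
      · rw [← edist_eq_enorm_sub, edist_comm, edist_eq_enorm_sub]
        exact hmain s t hs.1 hst ht.2
    calc ‖f s‖ₑ = ‖f t + (f s - f t)‖ₑ := by rw [← e]
      _ ≤ _ := (enorm_add_le _ _).trans (add_le_add le_rfl h7)
  have h8 : ‖f s‖ₑ * ℓ ≤ κ * ℓ ^ (1 / 2 : ℝ) + κ * ℓ ^ (1 / 2 : ℝ) * ℓ := by
    calc ‖f s‖ₑ * ℓ = ∫⁻ t, ‖f s‖ₑ ∂μ := by rw [lintegral_const, hμuniv]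
      _ ≤ ∫⁻ t, (‖f t‖ₑ + ∫⁻ r, ‖deriv f r‖ₑ ∂μ) ∂μ := by
          exact setLIntegral_mono' measurableSet_Icc h6
      _ = ∫⁻ t, ‖f t‖ₑ ∂μ + (∫⁻ r, ‖deriv f r‖ₑ ∂μ) * ℓ := by
          rw [lintegral_add_left' hm.enorm, lintegral_const, hμuniv]
      _ ≤ _ := by gcongr
  calc ‖f s‖ₑ = ‖f s‖ₑ * ℓ * ℓ⁻¹ := by rw [mul_assoc, ENNReal.mul_inv_cancel hℓ0 hℓt, mul_one]
    _ ≤ (κ * ℓ ^ (1 / 2 : ℝ) + κ * ℓ ^ (1 / 2 : ℝ) * ℓ) * ℓ⁻¹ := by gcongr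
    _ = (ℓ ^ (1 / 2 : ℝ) * ℓ⁻¹ + ℓ ^ (1 / 2 : ℝ) * (ℓ * ℓ⁻¹)) * κ := by ring
    _ = _ := by
        rw [ENNReal.mul_inv_cancel hℓ0 hℓt, mul_one, ← ENNReal.rpow_neg_one ℓ,
          ← ENNReal.rpow_add _ _ hℓ0 hℓt]
        norm_num

end Sobolev

/-! ### Uniform convergence of compositions and difference quotients -/

section UniformConvergence

variable {E : Type*} [NormedAddCommGroup E] [NormedSpace ℝ E] {F : Type*} [NormedAddCommGroup F]
  [NormedSpace ℝ F] {ι : Type*} {l : Filter ι} {S : Set ℝ}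

theorem tendstoUniformlyOn_iff_norm {u : ι → ℝ → E} {u₀ : ℝ → E} :
    TendstoUniformlyOn u u₀ l S ↔ ∀ η > 0, ∀ᶠ i in l, ∀ s ∈ S, ‖u i s - u₀ s‖ ≤ η := by
  rw [Metric.tendstoUniformlyOn_iff]
  constructor
  · intro h η hη
    filter_upwards [h η hη] with i hi s hs
    rw [← dist_eq_norm, dist_comm]
    exact (hi s hs).le
  · intro h η hη
    filter_upwards [h (η / 2) (by positivity)] with i hi s hs
    rw [dist_comm, dist_eq_norm]
    linarith [hi s hs]

theorem TendstoUniformlyOn.comp_of_continuousAt {G : E → F} {A : Set E} (hA : IsCompact A)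
    (hG : ∀ z ∈ A, ContinuousAt G z) {u : ι → ℝ → E} {u₀ : ℝ → E} (hu₀ : MapsTo u₀ S A)
    (hu : TendstoUniformlyOn u u₀ l S) :
    TendstoUniformlyOn (fun i s => G (u i s)) (fun s => G (u₀ s)) l S := by
  intro r hr
  have h := hA.uniformContinuousAt_of_continuousAt G hG hr
  filter_upwards [hu _ h] with i hi s hs
  exact hi s hs (hu₀ hs)

/-- Difference quotients of the composition with a `C¹` function converge uniformly. -/
theorem tendstoUniformlyOn_slope_comp {G : E → F} {A : Set E} (hA : IsCompact A)
    (hG : ∀ z ∈ A, ContDiffAt ℝ 1 G z) {u : ℝ → ℝ → E} {u₀ w : ℝ → E} (hu₀ : MapsTo u₀ S A)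
    {C : ℝ} (hC : ∀ s ∈ S, ‖w s‖ ≤ C)
    (hu : TendstoUniformlyOn (fun t s => t⁻¹ • (u t s - u₀ s)) w (𝓝[≠] 0) S) :
    TendstoUniformlyOn (fun t s => t⁻¹ • (G (u t s) - G (u₀ s)))
      (fun s => fderiv ℝ G (u₀ s) (w s)) (𝓝[≠] 0) S := by
  rw [tendstoUniformlyOn_iff_norm] at hu ⊢
  intro η hη
  have hcont : ContinuousOn (fderiv ℝ G) A := fun z hz =>
    ((hG z hz).fderiv_right (m := 0) (by simp)).continuousAt.continuousWithinAt
  obtain ⟨D, hD⟩ := hA.exists_bound_of_continuousOn hcont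
  set C' := |C| + 1
  set D' := |D| + 1
  have hC' : 0 < C' := by positivity
  have hD' : 0 < D' := by positivity
  obtain ⟨r, hr, hexp⟩ := exists_uniform_expansion hA hG (η := η / (2 * C')) (by positivity)
  have ht : ∀ᶠ t in 𝓝[≠] (0 : ℝ), |t| < r / C' := by
    refine mem_nhdsWithin_of_mem_nhds ?_
    filter_upwards [Metric.ball_mem_nhds (0 : ℝ) (show 0 < r / C' by positivity)] with t ht
    simpa using ht
  filter_upwards [hu 1 one_pos, hu (η / (2 * D')) (by positivity), ht, self_mem_nhdsWithin]
    with t h1 h2 h3 h4 s hs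
  have ht0 : t ≠ 0 := h4
  have e0 : u t s - u₀ s = t • (t⁻¹ • (u t s - u₀ s)) := by
    rw [smul_smul, mul_inv_cancel₀ ht0, one_smul]
  have e1 : ‖t⁻¹ • (u t s - u₀ s)‖ ≤ C' := by
    have : t⁻¹ • (u t s - u₀ s) = (t⁻¹ • (u t s - u₀ s) - w s) + w s := by abel
    rw [this]
    refine (norm_add_le _ _).trans ?_
    linarith [h1 s hs, hC s hs, le_abs_self C]
  have e2 : ‖u t s - u₀ s‖ ≤ |t| * C' := by
    rw [e0, norm_smul, Real.norm_eq_abs]; gcongr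
  have e3 : ‖u t s - u₀ s‖ < r := by
    refine e2.trans_lt ?_
    rwa [lt_div_iff₀ hC'] at h3
  have e4 := hexp _ (hu₀ hs) _ e3
  -- The first term is the Taylor remainder, controlled by the uniform expansion on A; the second is
  -- the error of the quotients of u, to which the bounded derivative of G is applied.
  have e5 : t⁻¹ • (G (u t s) - G (u₀ s)) - fderiv ℝ G (u₀ s) (w s) =
      t⁻¹ • (G (u t s) - G (u₀ s) - fderiv ℝ G (u₀ s) (u t s - u₀ s)) +
        fderiv ℝ G (u₀ s) (t⁻¹ • (u t s - u₀ s) - w s) := by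
    rw [map_sub (fderiv ℝ G (u₀ s)) (t⁻¹ • _), map_smul, smul_sub t⁻¹ (G (u t s) - G (u₀ s))]; abel
  rw [e5]
  refine (norm_add_le _ _).trans ?_
  have e6 : ‖t⁻¹ • (G (u t s) - G (u₀ s) - fderiv ℝ G (u₀ s) (u t s - u₀ s))‖ ≤ η / 2 := by
    rw [norm_smul, norm_inv, Real.norm_eq_abs]
    calc |t|⁻¹ * _ ≤ |t|⁻¹ * (η / (2 * C') * (|t| * C')) := by gcongr; exact e4.trans (by gcongr)
      _ = η / 2 := by
        have : |t| ≠ 0 := abs_ne_zero.2 ht0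
        field_simp
  have e7 : ‖fderiv ℝ G (u₀ s) (t⁻¹ • (u t s - u₀ s) - w s)‖ ≤ η / 2 := by
    calc _ ≤ ‖fderiv ℝ G (u₀ s)‖ * ‖t⁻¹ • (u t s - u₀ s) - w s‖ := ContinuousLinearMap.le_opNorm _ _
      _ ≤ D' * (η / (2 * D')) := by
        gcongr
        · linarith [hD _ (hu₀ hs), le_abs_self D]
        · exact h2 s hs
      _ = η / 2 := by field_simp
  linarith

theorem eLpNorm_deriv_sq_le_h1NormSq {f : ℝ → E} {a b : ℝ} :
    eLpNorm (deriv f) 2 (volume.restrict (Icc a b)) ^ 2 ≤ h1NormSq a b f := by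
  rw [eLpNorm_two_sq]
  exact lintegral_mono fun s => le_add_self

theorem tendsto_eLpNorm_deriv {f : ι → ℝ → E} {a b : ℝ}
    (h : Tendsto (fun i => h1NormSq a b (f i)) l (𝓝 0)) :
    Tendsto (fun i => eLpNorm (deriv (f i)) 2 (volume.restrict (Icc a b))) l (𝓝 0) := by
  rw [ENNReal.tendsto_nhds_zero] at h ⊢
  intro ε hε
  filter_upwards [h (ε ^ 2) (by positivity)] with i hi
  exact (ENNReal.pow_le_pow_left_iff two_ne_zero).1 (eLpNorm_deriv_sq_le_h1NormSq.trans hi)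

theorem tendstoUniformlyOn_of_tendsto_h1NormSq [FiniteDimensional ℝ E] {f : ι → ℝ → E} {a b : ℝ}
    (hab : a < b) (hf : ∀ᶠ i in l, H1On (f i) a b)
    (h : Tendsto (fun i => h1NormSq a b (f i)) l (𝓝 0)) :
    TendstoUniformlyOn f 0 l (Icc a b) := by
  rw [tendstoUniformlyOn_iff_norm]
  intro η hη
  set Q : ℝ≥0∞ := ENNReal.ofReal (b - a) ^ (-(1 / 2 : ℝ)) + ENNReal.ofReal (b - a) ^ (1 / 2 : ℝ)
  have hQt : Q ≠ ⊤ := by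
    refine ENNReal.add_ne_top.2 ⟨?_, ?_⟩
    · exact ENNReal.rpow_ne_top_of_ne_zero (by simpa using hab) (by simp)
    · exact ENNReal.rpow_ne_top_of_nonneg (by norm_num) (by simp)
  have hQ0 : Q ≠ 0 := by
    simp only [Q]
    simp
  rw [ENNReal.tendsto_nhds_zero] at h
  set κ : ℝ≥0∞ := Q⁻¹ * ENNReal.ofReal η
  have hκ : 0 < κ := ENNReal.mul_pos (by simpa using hQt) (by simpa using hη)
  filter_upwards [hf, h (κ ^ 2) (by positivity)] with i hi1 hi2 s hs
  have := hi1.enorm_le hab hs hi2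
  rw [show Q * κ = ENNReal.ofReal η by
    simp only [κ]; rw [← mul_assoc, ENNReal.mul_inv_cancel hQ0 hQt, one_mul]] at this
  rw [← ofReal_norm, ENNReal.ofReal_le_ofReal_iff hη.le] at this
  simpa using this

end UniformConvergence

/-! ### Coordinate formulas for dV and the Christoffel symbols -/

section ChartFormulas

variable {E : Type*} [NormedAddCommGroup E] [NormedSpace ℝ E]
  {M : Type*} [MetricSpace M] [ChartedSpace E M] [IsManifold 𝓘(ℝ, E) ∞ M]

/-- The differential of a function on `M`. -/
def dPot (E : Type*) [NormedAddCommGroup E] [NormedSpace ℝ E] {M : Type*} [MetricSpace M]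
    [ChartedSpace E M] (V : M → ℝ) (q : M) : TangentSpace 𝓘(ℝ, E) q →L[ℝ] ℝ :=
  mfderiv 𝓘(ℝ, E) 𝓘(ℝ, ℝ) V q

theorem contDiffOn_chart {V : M → ℝ} (hV : ContMDiff 𝓘(ℝ, E) 𝓘(ℝ, ℝ) ∞ V) (x : M) :
    ContDiffOn ℝ ∞ (V ∘ (extChartAt 𝓘(ℝ, E) x).symm) (extChartAt 𝓘(ℝ, E) x).target := by
  rw [← contMDiffOn_iff_contDiffOn]
  exact hV.comp_contMDiffOn (contMDiffOn_extChartAt_symm x)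

theorem contDiffAt_chart {V : M → ℝ} (hV : ContMDiff 𝓘(ℝ, E) 𝓘(ℝ, ℝ) ∞ V) {x : M} {z : E}
    (hz : z ∈ (extChartAt 𝓘(ℝ, E) x).target) :
    ContDiffAt ℝ ∞ (V ∘ (extChartAt 𝓘(ℝ, E) x).symm) z :=
  (contDiffOn_chart hV x).contDiffAt ((isOpen_extChartAt_target x).mem_nhds hz)

theorem dPot_eq_fderiv {V : M → ℝ} (hV : ContMDiff 𝓘(ℝ, E) 𝓘(ℝ, ℝ) ∞ V) {x q : M}
    (hq : q ∈ (chartAt E x).source) (v : TangentSpace 𝓘(ℝ, E) q) :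
    dPot E V q v = fderiv ℝ (V ∘ (extChartAt 𝓘(ℝ, E) x).symm) (extChartAt 𝓘(ℝ, E) x q)
      (chartCoord x q v) := by
  have hq' : q ∈ (extChartAt 𝓘(ℝ, E) x).source := by rwa [extChartAt_source]
  have hz := (extChartAt 𝓘(ℝ, E) x).map_source hq'
  have h1 : V =ᶠ[𝓝 q] (V ∘ (extChartAt 𝓘(ℝ, E) x).symm) ∘ extChartAt 𝓘(ℝ, E) x := by
    filter_upwards [(isOpen_extChartAt_source x).mem_nhds hq'] with y hy
    rw [Function.comp_apply, Function.comp_apply, (extChartAt 𝓘(ℝ, E) x).left_inv hy]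
  have h2 : MDifferentiableAt 𝓘(ℝ, E) 𝓘(ℝ, ℝ) (V ∘ (extChartAt 𝓘(ℝ, E) x).symm)
      (extChartAt 𝓘(ℝ, E) x q) :=
    ((contDiffAt_chart hV hz).differentiableAt (by simp)).mdifferentiableAt
  have h3 : MDifferentiableAt 𝓘(ℝ, E) 𝓘(ℝ, E) (extChartAt 𝓘(ℝ, E) x) q :=
    mdifferentiableAt_extChartAt hq
  have h4 : mfderiv 𝓘(ℝ, E) 𝓘(ℝ, ℝ) V q = _ := h1.mfderiv_eq.trans (mfderiv_comp q h2 h3)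
  rw [mfderiv_eq_fderiv] at h4
  exact congrArg (fun L : TangentSpace 𝓘(ℝ, E) q →L[ℝ] ℝ => L v) h4

theorem fderiv_bilin_symm {G : E → E →L[ℝ] E →L[ℝ] ℝ} {z : E} (hG : DifferentiableAt ℝ G z)
    (hsymm : ∀ z v w, G z v w = G z w v) (a v w : E) :
    fderiv ℝ G z a v w = fderiv ℝ G z a w v := by
  have key : ∀ v w, fderiv ℝ G z a v w = fderiv ℝ (fun z => G z v w) z a := by
    intro v w
    have h1 := (hG.hasFDerivAt.clm_apply (hasFDerivAt_const v z)).clm_apply (hasFDerivAt_const w z)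
    rw [h1.fderiv]
    simp
  rw [key, key]
  congr 2
  funext z
  exact hsymm z v w

/-- The first and third terms cancel by the symmetry of G. For this reason ⟨c', ∇_s ξ⟩ contains only
one derivative of the metric, in the direction of the field. -/
theorem koszulForm_apply_self {G : E → E →L[ℝ] E →L[ℝ] ℝ} {z : E} (hG : DifferentiableAt ℝ G z)
    (hsymm : ∀ z v w, G z v w = G z w v) (v w : E) :
    koszulForm G z v w v = (1 / 2 : ℝ) * fderiv ℝ G z w v v := by
  rw [koszulForm_apply, fderiv_bilin_symm hG hsymm v w v]
  ring

end ChartFormulas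

/-! ### Loops and fields on intervals mapped into a chart -/

section Charts

variable {E : Type*} [NormedAddCommGroup E] [NormedSpace ℝ E] [FiniteDimensional ℝ E]
  {M : Type*} [MetricSpace M] [ChartedSpace E M] [IsManifold 𝓘(ℝ, E) ∞ M]
  [RiemannianBundle (fun x : M => TangentSpace 𝓘(ℝ, E) x)]
  [IsContMDiffRiemannianBundle 𝓘(ℝ, E) ∞ E (fun x : M => TangentSpace 𝓘(ℝ, E) x)]
  [IsRiemannianManifold 𝓘(ℝ, E) M]

theorem LoopSpace.exists_mapsIntoChart (c : LoopSpace E M) {x : M} {s : ℝ}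
    (hs : c s ∈ (chartAt E x).source) : ∃ δ > 0, MapsIntoChart c x (s - δ) (s + δ) := by
  have h : c ⁻¹' (chartAt E x).source ∈ 𝓝 s :=
    c.continuous.continuousAt.preimage_mem_nhds ((chartAt E x).open_source.mem_nhds hs)
  obtain ⟨δ, hδ, h⟩ := Metric.nhds_basis_closedBall.mem_iff.1 h
  refine ⟨δ, hδ, fun t ht => h ?_⟩
  rwa [Real.closedBall_eq_Icc]

theorem MapsIntoChart.mono {c : LoopSpace E M} {x : M} {a b a' b' : ℝ}
    (h : MapsIntoChart c x a b) (ha : a ≤ a') (hb : b' ≤ b) : MapsIntoChart c x a' b' :=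
  fun s hs => h s (Icc_subset_Icc ha hb hs)

theorem LoopSpace.h1On_chart (c : LoopSpace E M) {x : M} {a b : ℝ} (hab : a ≤ b)
    (h : MapsIntoChart c x a b) : H1On (extChartAt 𝓘(ℝ, E) x ∘ c) a b :=
  H1On.of_forall_h1At hab fun s hs => c.h1At_chart (h s hs)

theorem LoopTangent.h1On {c : LoopSpace E M} (ξ : LoopTangent c) {x : M} {a b : ℝ} (hab : a ≤ b)
    (h : MapsIntoChart c x a b) : H1On (fieldCoord c ξ x) a b :=
  ⟨ξ.absolutelyContinuous x a b hab h, ξ.deriv_sq_lt_top x a b hab h⟩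

theorem LoopTangent.h1At {c : LoopSpace E M} (ξ : LoopTangent c) {x : M} {s : ℝ}
    (hs : c s ∈ (chartAt E x).source) : H1At (fieldCoord c ξ x) s := by
  obtain ⟨δ, hδ, h⟩ := c.exists_mapsIntoChart hs
  exact ⟨δ, hδ, ξ.h1On (by linarith) h⟩

theorem MapsIntoChart.mapsTo {c : LoopSpace E M} {x : M} {a b : ℝ} (h : MapsIntoChart c x a b) :
    MapsTo (extChartAt 𝓘(ℝ, E) x ∘ c) (Icc a b) (extChartAt 𝓘(ℝ, E) x).target := fun s hs =>
  (extChartAt 𝓘(ℝ, E) x).map_source (by rw [extChartAt_source]; exact h s hs)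

theorem MapsIntoChart.isCompact_image {c : LoopSpace E M} {x : M} {a b : ℝ}
    (h : MapsIntoChart c x a b) : IsCompact ((extChartAt 𝓘(ℝ, E) x ∘ c) '' Icc a b) :=
  isCompact_Icc.image_of_continuousOn fun s hs =>
    ((c.h1At_chart (h s hs)).continuousAt).continuousWithinAt

theorem MapsIntoChart.image_subset {c : LoopSpace E M} {x : M} {a b : ℝ}
    (h : MapsIntoChart c x a b) :
    (extChartAt 𝓘(ℝ, E) x ∘ c) '' Icc a b ⊆ (extChartAt 𝓘(ℝ, E) x).target :=
  h.mapsTo.image_subset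

/-- The right-hand side is half the derivative of G(u)(u', u') in the direction of the field, which
identifies the first variation of the energy with the integral of ⟨c', ∇_s ξ⟩. -/
theorem inner_velocity_covDeriv {x : M} {c : LoopSpace E M} {ξ : LoopTangent c} {s : ℝ}
    (hs : c s ∈ (chartAt E x).source)
    (hu : DifferentiableAt ℝ (extChartAt 𝓘(ℝ, E) x ∘ c) s)
    (hw : DifferentiableAt ℝ (fieldCoord c ξ x) s) :
    inner ℝ (velocity E c s) (covDeriv c ξ s) =
      chartMetric x (extChartAt 𝓘(ℝ, E) x (c s)) (deriv (fieldCoord c ξ x) s)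
        (deriv (extChartAt 𝓘(ℝ, E) x ∘ c) s) +
      (1 / 2 : ℝ) * fderiv ℝ (chartMetric x : E → E →L[ℝ] E →L[ℝ] ℝ) (extChartAt 𝓘(ℝ, E) x (c s))
        (fieldCoord c ξ x s) (deriv (extChartAt 𝓘(ℝ, E) x ∘ c) s)
        (deriv (extChartAt 𝓘(ℝ, E) x ∘ c) s) := by
  have hc : ContinuousAt c s := c.continuous.continuousAt
  rw [real_inner_comm, inner_covDeriv hc hs hu hw, chartCoord_velocity hc hs,
    koszulForm_apply_self ((contDiffAt_chartMetric hs).differentiableAt (by simp))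
      (chartMetric_symm x)]

theorem LoopTangent.ae_inner_velocity_covDeriv {c : LoopSpace E M} (ξ : LoopTangent c) {x : M}
    {a b : ℝ} (hab : a ≤ b) (h : MapsIntoChart c x a b) :
    ∀ᵐ s ∂volume.restrict (Icc a b), inner ℝ (velocity E c s) (covDeriv c ξ s) =
      chartMetric x (extChartAt 𝓘(ℝ, E) x (c s)) (deriv (fieldCoord c ξ x) s)
        (deriv (extChartAt 𝓘(ℝ, E) x ∘ c) s) +
      (1 / 2 : ℝ) * fderiv ℝ (chartMetric x : E → E →L[ℝ] E →L[ℝ] ℝ) (extChartAt 𝓘(ℝ, E) x (c s))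
        (fieldCoord c ξ x s) (deriv (extChartAt 𝓘(ℝ, E) x ∘ c) s)
        (deriv (extChartAt 𝓘(ℝ, E) x ∘ c) s) := by
  filter_upwards [(c.h1On_chart hab h).ae_differentiableAt hab, (ξ.h1On hab h).ae_differentiableAt hab,
    ae_restrict_mem measurableSet_Icc] with s h1 h2 h3
  exact inner_velocity_covDeriv (h s h3) h1 h2

theorem LoopSpace.h1NormSq_self (c : LoopSpace E M) (x : M) (a b : ℝ) :
    h1NormSq a b (fun s => extChartAt 𝓘(ℝ, E) x (c s) - extChartAt 𝓘(ℝ, E) x (c s)) = 0 := by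
  simp [h1NormSq]

/-- Convergence in the loop space implies `H¹` convergence in charts. -/
theorem LoopSpace.tendsto_chart {ι : Type*} {l : Filter ι} {e : ι → LoopSpace E M}
    {c : LoopSpace E M} (he : Tendsto e l (𝓝 c)) {x : M} {a b : ℝ} (hab : a ≤ b)
    (h : MapsIntoChart c x a b) : (∀ᶠ i in l, MapsIntoChart (e i) x a b) ∧
      Tendsto (fun i => h1NormSq a b
        (extChartAt 𝓘(ℝ, E) x ∘ e i - extChartAt 𝓘(ℝ, E) x ∘ c)) l (𝓝 0) := by
  have key : ∀ r > 0, ∀ᶠ i in l, e i ∈ chartBall c x a b r := by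
    intro r hr
    have hopen : IsOpen (chartBall c x a b r) :=
      TopologicalSpace.isOpen_generateFrom_of_mem ⟨c, x, a, b, r, hab, h, hr, rfl⟩
    refine he (hopen.mem_nhds ⟨h, ?_⟩)
    rw [c.h1NormSq_self]
    exact hr
  refine ⟨(key 1 one_pos).mono fun i hi => hi.1, ?_⟩
  rw [ENNReal.tendsto_nhds_zero]
  exact fun r hr => (key r hr).mono fun i hi => hi.2.le

end Charts

/-! ### Limits of integrals; H¹ calculus on an interval -/

section Integrals

variable {E : Type*} [NormedAddCommGroup E] [NormedSpace ℝ E] {ι : Type*} {l : Filter ι} {a b : ℝ}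

theorem tendsto_intervalIntegral_of_tendstoUniformlyOn (hab : a ≤ b) {F : ι → ℝ → ℝ} {F₀ : ℝ → ℝ}
    (hF : ∀ᶠ i in l, ContinuousOn (F i) (Icc a b)) (hF₀ : ContinuousOn F₀ (Icc a b))
    (h : TendstoUniformlyOn F F₀ l (Icc a b)) :
    Tendsto (fun i => ∫ s in a..b, F i s) l (𝓝 (∫ s in a..b, F₀ s)) := by
  rw [tendstoUniformlyOn_iff_norm] at h
  rw [Metric.tendsto_nhds]
  intro ε hε
  have hpos : 0 < b - a + 1 := by linarith
  filter_upwards [hF, h (ε / (2 * (b - a + 1))) (by positivity)] with i hi1 hi2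
  have i0 := hF₀.intervalIntegrable_of_Icc (μ := volume) hab
  have i1 := hi1.intervalIntegrable_of_Icc (μ := volume) hab
  rw [dist_eq_norm, ← intervalIntegral.integral_sub i1 i0]
  have : ‖∫ s in a..b, F i s - F₀ s‖ ≤ ε / (2 * (b - a + 1)) * |b - a| := by
    refine intervalIntegral.norm_integral_le_of_norm_le_const fun s hs => ?_
    rw [uIoc_of_le hab] at hs
    exact hi2 s (Ioc_subset_Icc_self hs)
  refine this.trans_lt ?_
  rw [abs_of_nonneg (by linarith), div_mul_eq_mul_div, div_lt_iff₀ (by positivity)]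
  nlinarith

theorem integrable_bilin_of_continuousOn {B : ℝ → E →L[ℝ] E →L[ℝ] ℝ} {v w : ℝ → E}
    (hB : ContinuousOn B (Icc a b)) (hv : MemLp v 2 (volume.restrict (Icc a b)))
    (hw : MemLp w 2 (volume.restrict (Icc a b))) :
    Integrable (fun s => B s (v s) (w s)) (volume.restrict (Icc a b)) := by
  obtain ⟨C, hC⟩ := isCompact_Icc.exists_bound_of_continuousOn hB
  exact integrable_bilin (hB.aestronglyMeasurable measurableSet_Icc) hv hw
    ((ae_restrict_mem measurableSet_Icc).mono fun s hs => hC s hs)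

theorem tendsto_integral_bilin_of_continuousOn {B : ι → ℝ → E →L[ℝ] E →L[ℝ] ℝ}
    {B₀ : ℝ → E →L[ℝ] E →L[ℝ] ℝ} {v w : ι → ℝ → E} {v₀ w₀ : ℝ → E}
    (hB : ∀ᶠ i in l, ContinuousOn (B i) (Icc a b)) (hB₀ : ContinuousOn B₀ (Icc a b))
    (hBl : TendstoUniformlyOn B B₀ l (Icc a b))
    (hv : ∀ᶠ i in l, MemLp (v i) 2 (volume.restrict (Icc a b)))
    (hv₀ : MemLp v₀ 2 (volume.restrict (Icc a b)))
    (hvl : Tendsto (fun i => eLpNorm (v i - v₀) 2 (volume.restrict (Icc a b))) l (𝓝 0))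
    (hw : ∀ᶠ i in l, MemLp (w i) 2 (volume.restrict (Icc a b)))
    (hw₀ : MemLp w₀ 2 (volume.restrict (Icc a b)))
    (hwl : Tendsto (fun i => eLpNorm (w i - w₀) 2 (volume.restrict (Icc a b))) l (𝓝 0)) :
    Tendsto (fun i => ∫ s in Icc a b, B i s (v i s) (w i s)) l
      (𝓝 (∫ s in Icc a b, B₀ s (v₀ s) (w₀ s))) := by
  obtain ⟨C, hC⟩ := isCompact_Icc.exists_bound_of_continuousOn hB₀
  refine tendsto_integral_bilin (hB.mono fun i hi => hi.aestronglyMeasurable measurableSet_Icc)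
    (hB₀.aestronglyMeasurable measurableSet_Icc)
    ((ae_restrict_mem measurableSet_Icc).mono fun s hs => hC s hs) (fun η hη => ?_)
    hv hv₀ hvl hw hw₀ hwl
  filter_upwards [tendstoUniformlyOn_iff_norm.1 hBl η hη] with i hi
  exact (ae_restrict_mem measurableSet_Icc).mono fun s hs => hi s hs

variable [FiniteDimensional ℝ E]

theorem H1On.sub {f g : ℝ → E} (hf : H1On f a b) (hg : H1On g a b) (hab : a ≤ b) :
    H1On (f - g) a b ∧
      deriv (f - g) =ᵐ[volume.restrict (Icc a b)] deriv f - deriv g := by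
  have h1 : deriv (f - g) =ᵐ[volume.restrict (Icc a b)] deriv f - deriv g := by
    filter_upwards [hf.ae_differentiableAt hab, hg.ae_differentiableAt hab] with s h1 h2
    rw [deriv_sub h1 h2, Pi.sub_apply]
  refine ⟨⟨hf.1.sub hg.1, ?_⟩, h1⟩
  have := (hf.memLp.sub hg.memLp).ae_eq h1.symm
  rw [← eLpNorm_two_sq]
  exact ENNReal.pow_lt_top this.2

theorem H1On.const_smul {f : ℝ → E} (hf : H1On f a b) (hab : a ≤ b) (r : ℝ) :
    H1On (r • f) a b ∧ deriv (r • f) =ᵐ[volume.restrict (Icc a b)] r • deriv f := by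
  have h1 : deriv (r • f) =ᵐ[volume.restrict (Icc a b)] r • deriv f := by
    filter_upwards [hf.ae_differentiableAt hab] with s h1
    rw [deriv_const_smul _ h1, Pi.smul_apply]
  refine ⟨⟨hf.1.const_smul r, ?_⟩, h1⟩
  have := (hf.memLp.const_smul r).ae_eq h1.symm
  rw [← eLpNorm_two_sq]
  exact ENNReal.pow_lt_top this.2

theorem H1On.tendsto_of_h1NormSq (hab : a < b) {f : ι → ℝ → E} {g : ℝ → E}
    (hf : ∀ᶠ i in l, H1On (f i) a b) (hg : H1On g a b)
    (h : Tendsto (fun i => h1NormSq a b (f i - g)) l (𝓝 0)) :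
    TendstoUniformlyOn f g l (Icc a b) ∧
      Tendsto (fun i => eLpNorm (deriv (f i) - deriv g) 2 (volume.restrict (Icc a b))) l (𝓝 0) := by
  constructor
  · have := tendstoUniformlyOn_of_tendsto_h1NormSq hab
      (hf.mono fun i hi => (hi.sub hg hab.le).1) h
    rw [tendstoUniformlyOn_iff_norm] at this ⊢
    intro η hη
    filter_upwards [this η hη] with i hi s hs
    simpa using hi s hs
  · refine (tendsto_eLpNorm_deriv h).congr' ?_
    filter_upwards [hf] with i hi
    exact eLpNorm_congr_ae (hi.sub hg hab.le).2

theorem H1On.continuousOn {f : ℝ → E} (hf : H1On f a b) (hab : a ≤ b) :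
    ContinuousOn f (Icc a b) := by
  have := hf.1.continuousOn
  rwa [uIcc_of_le hab] at this

end Integrals

/-! ### Continuity of the action -/

section Energy

variable {E : Type*} [NormedAddCommGroup E] [NormedSpace ℝ E] [FiniteDimensional ℝ E]
  {M : Type*} [MetricSpace M] [ChartedSpace E M] [IsManifold 𝓘(ℝ, E) ∞ M]
  [RiemannianBundle (fun x : M => TangentSpace 𝓘(ℝ, E) x)]
  [IsContMDiffRiemannianBundle 𝓘(ℝ, E) ∞ E (fun x : M => TangentSpace 𝓘(ℝ, E) x)]
  [IsRiemannianManifold 𝓘(ℝ, E) M]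

theorem contDiffAt_chartMetric_of_mem_target {x : M} {z : E}
    (hz : z ∈ (extChartAt 𝓘(ℝ, E) x).target) :
    ContDiffAt ℝ ∞ (chartMetric x : E → E →L[ℝ] E →L[ℝ] ℝ) z :=
  (contDiffOn_chartMetric x).contDiffAt ((isOpen_extChartAt_target x).mem_nhds hz)

theorem continuousAt_fderiv_chartMetric {x : M} {z : E}
    (hz : z ∈ (extChartAt 𝓘(ℝ, E) x).target) :
    ContinuousAt (fderiv ℝ (chartMetric x : E → E →L[ℝ] E →L[ℝ] ℝ)) z :=
  ((contDiffAt_chartMetric_of_mem_target hz).fderiv_right (m := 0) (by simp)).continuousAt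

theorem LoopSpace.integral_sq_speed_chart (c : LoopSpace E M) {x : M} {a b : ℝ} (hab : a ≤ b)
    (h : MapsIntoChart c x a b) : ∫ s in a..b, ‖velocity E c s‖ ^ 2 =
      ∫ s in Icc a b, chartMetric x ((extChartAt 𝓘(ℝ, E) x ∘ c) s)
        (deriv (extChartAt 𝓘(ℝ, E) x ∘ c) s) (deriv (extChartAt 𝓘(ℝ, E) x ∘ c) s) := by
  rw [intervalIntegral.integral_of_le hab, ← integral_Icc_eq_integral_Ioc]
  exact setIntegral_congr_fun measurableSet_Icc fun s hs =>
    sq_norm_velocity c.continuous.continuousAt (h s hs)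

theorem MapsIntoChart.continuousOn {c : LoopSpace E M} {x : M} {a b : ℝ}
    (h : MapsIntoChart c x a b) : ContinuousOn (extChartAt 𝓘(ℝ, E) x ∘ c) (Icc a b) :=
  fun s hs => ((c.h1At_chart (h s hs)).continuousAt).continuousWithinAt

theorem MapsIntoChart.continuousOn_chartMetric {c : LoopSpace E M} {x : M} {a b : ℝ}
    (h : MapsIntoChart c x a b) : ContinuousOn (fun s =>
      (chartMetric x ((extChartAt 𝓘(ℝ, E) x ∘ c) s) : E →L[ℝ] E →L[ℝ] ℝ)) (Icc a b) :=
  (contDiffOn_chartMetric x).continuousOn.comp h.continuousOn h.mapsTo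

theorem LoopSpace.tendsto_chart_of_lt {ι : Type*} {l : Filter ι} {e : ι → LoopSpace E M}
    {c : LoopSpace E M} (he : Tendsto e l (𝓝 c)) {x : M} {a b : ℝ} (hab : a < b)
    (h : MapsIntoChart c x a b) : (∀ᶠ i in l, MapsIntoChart (e i) x a b) ∧
      TendstoUniformlyOn (fun i => extChartAt 𝓘(ℝ, E) x ∘ e i) (extChartAt 𝓘(ℝ, E) x ∘ c) l
        (Icc a b) ∧
      Tendsto (fun i => eLpNorm (deriv (extChartAt 𝓘(ℝ, E) x ∘ e i) -
        deriv (extChartAt 𝓘(ℝ, E) x ∘ c)) 2 (volume.restrict (Icc a b))) l (𝓝 0) := by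
  obtain ⟨h1, h2⟩ := LoopSpace.tendsto_chart he hab.le h
  exact ⟨h1, H1On.tendsto_of_h1NormSq hab (h1.mono fun i hi => (e i).h1On_chart hab.le hi)
    (c.h1On_chart hab.le h) h2⟩

/-- In a chart the integrand is G(u)(u', u'), where G(u) converges uniformly and u' in L². Both
sides are additive in the interval, so short intervals suffice. -/
theorem LoopSpace.tendsto_integral_sq_speed {ι : Type*} {l : Filter ι} {e : ι → LoopSpace E M}
    {c : LoopSpace E M} (he : Tendsto e l (𝓝 c)) {a b : ℝ} (hab : a ≤ b) :
    Tendsto (fun i => ∫ s in a..b, ‖velocity E (e i) s‖ ^ 2) l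
      (𝓝 (∫ s in a..b, ‖velocity E c s‖ ^ 2)) := by
  refine interval_induction (P := fun a b => Tendsto (fun i => ∫ s in a..b, ‖velocity E (e i) s‖ ^ 2)
    l (𝓝 (∫ s in a..b, ‖velocity E c s‖ ^ 2))) ?_ hab ?_
  · intro a b d _ _ h1 h2
    simp_rw [← fun e : LoopSpace E M => intervalIntegral.integral_add_adjacent_intervals
      (e.intervalIntegrable_sq_speed a b) (e.intervalIntegrable_sq_speed b d)]
    exact h1.add h2
  · intro s _
    obtain ⟨δ, hδ, hm⟩ := c.exists_mapsIntoChart (mem_chart_source E (c s))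
    refine ⟨δ, hδ, fun u v _ huv _ hu hv => ?_⟩
    -- Intervals of length zero are treated apart: H¹ smallness controls the supremum only on
    -- intervals of positive length.
    rcases huv.eq_or_lt with rfl | huv
    · simpa using tendsto_const_nhds
    replace hm := hm.mono hu.le hv.le
    obtain ⟨h1, h2, h3⟩ := LoopSpace.tendsto_chart_of_lt he huv hm
    rw [c.integral_sq_speed_chart huv.le hm]
    refine Tendsto.congr' (h1.mono fun i hi => ((e i).integral_sq_speed_chart huv.le hi).symm) ?_
    have hL := h1.mono fun i hi => ((e i).h1On_chart huv.le hi).memLp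
    have hL0 := (c.h1On_chart huv.le hm).memLp
    refine tendsto_integral_bilin_of_continuousOn
      (h1.mono fun i hi => hi.continuousOn_chartMetric) hm.continuousOn_chartMetric ?_
      hL hL0 h3 hL hL0 h3
    exact TendstoUniformlyOn.comp_of_continuousAt hm.isCompact_image (fun z hz =>
      (contDiffAt_chartMetric_of_mem_target (hm.image_subset hz)).continuousAt)
      (mapsTo_image _ _) h2

theorem MapsIntoChart.integral_potential {c : LoopSpace E M} {x : M} {a b : ℝ} (hab : a ≤ b)
    (h : MapsIntoChart c x a b) (V : M → ℝ) : ∫ s in a..b, V (c s) =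
      ∫ s in a..b, (V ∘ (extChartAt 𝓘(ℝ, E) x).symm) ((extChartAt 𝓘(ℝ, E) x ∘ c) s) := by
  refine intervalIntegral.integral_congr fun s hs => ?_
  rw [uIcc_of_le hab] at hs
  simp only [Function.comp_apply]
  rw [(extChartAt 𝓘(ℝ, E) x).left_inv (by rw [extChartAt_source]; exact h s hs)]

theorem MapsIntoChart.continuousOn_comp {F : Type*} [NormedAddCommGroup F] {f : E → F}
    {c : LoopSpace E M} {x : M} {a b : ℝ} (h : MapsIntoChart c x a b)
    (hf : ContinuousOn f (extChartAt 𝓘(ℝ, E) x).target) :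
    ContinuousOn (fun s => f ((extChartAt 𝓘(ℝ, E) x ∘ c) s)) (Icc a b) :=
  hf.comp h.continuousOn h.mapsTo

theorem LoopSpace.tendsto_integral_potential {V : M → ℝ} (hV : ContMDiff 𝓘(ℝ, E) 𝓘(ℝ, ℝ) ∞ V)
    {ι : Type*} {l : Filter ι} {e : ι → LoopSpace E M}
    {c : LoopSpace E M} (he : Tendsto e l (𝓝 c)) {a b : ℝ} (hab : a ≤ b) :
    Tendsto (fun i => ∫ s in a..b, V (e i s)) l (𝓝 (∫ s in a..b, V (c s))) := by
  refine interval_induction (P := fun a b => Tendsto (fun i => ∫ s in a..b, V (e i s))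
    l (𝓝 (∫ s in a..b, V (c s)))) ?_ hab ?_
  · intro a b d _ _ h1 h2
    have key : ∀ e : LoopSpace E M, (∫ s in a..b, V (e s)) + ∫ s in b..d, V (e s) =
        ∫ s in a..d, V (e s) := fun e => intervalIntegral.integral_add_adjacent_intervals
      ((hV.continuous.comp e.continuous).intervalIntegrable (μ := volume) a b)
      ((hV.continuous.comp e.continuous).intervalIntegrable b d)
    have h3 := h1.add h2
    rw [key] at h3
    exact h3.congr fun i => key (e i)
  · intro s _
    obtain ⟨δ, hδ, hm⟩ := c.exists_mapsIntoChart (mem_chart_source E (c s))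
    refine ⟨δ, hδ, fun u v _ huv _ hu hv => ?_⟩
    rcases huv.eq_or_lt with rfl | huv
    · simpa using tendsto_const_nhds
    replace hm := hm.mono hu.le hv.le
    obtain ⟨h1, h2, h3⟩ := LoopSpace.tendsto_chart_of_lt he huv hm
    rw [hm.integral_potential huv.le V]
    refine Tendsto.congr' (h1.mono fun i hi => (hi.integral_potential huv.le V).symm) ?_
    refine tendsto_intervalIntegral_of_tendstoUniformlyOn huv.le
      (h1.mono fun i hi => hi.continuousOn_comp (contDiffOn_chart hV _).continuousOn)
      (hm.continuousOn_comp (contDiffOn_chart hV _).continuousOn) ?_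
    exact TendstoUniformlyOn.comp_of_continuousAt hm.isCompact_image (fun z hz =>
      (contDiffAt_chart hV (hm.image_subset hz)).continuousAt) (mapsTo_image _ _) h2

/-- The penalized action is continuous. -/
theorem tendsto_penalizedAction {V : M → ℝ} (hV : ContMDiff 𝓘(ℝ, E) 𝓘(ℝ, ℝ) ∞ V) (ε : ℝ)
    {ι : Type*} {l : Filter ι} {p : ι → LoopSpace E M × ℝ} {q : LoopSpace E M × ℝ}
    (h : Tendsto p l (𝓝 q)) :
    Tendsto (fun i => penalizedAction V ε (p i)) l (𝓝 (penalizedAction V ε q)) := by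
  have h1 : Tendsto (fun i => (p i).1) l (𝓝 q.1) := (continuous_fst.tendsto q).comp h
  have h2 : Tendsto (fun i => (p i).2) l (𝓝 q.2) := (continuous_snd.tendsto q).comp h
  have h3 : Tendsto (fun i => Real.exp (-(p i).2)) l (𝓝 (Real.exp (-q.2))) :=
    (Real.continuous_exp.tendsto _).comp h2.neg
  have h4 : Tendsto (fun i => Real.exp (p i).2) l (𝓝 (Real.exp q.2)) :=
    (Real.continuous_exp.tendsto _).comp h2
  have h5 : Tendsto (fun i => Real.exp ((p i).2 / 2)) l (𝓝 (Real.exp (q.2 / 2))) :=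
    (Real.continuous_exp.tendsto _).comp (h2.div_const 2)
  exact (((h3.div_const 2).mul (LoopSpace.tendsto_integral_sq_speed h1 zero_le_one)).sub
    (h4.mul (LoopSpace.tendsto_integral_potential hV h1 zero_le_one))).add
    ((h3.add h5).const_mul ε)

end Energy

/-! ### The first variation of the penalized action -/

section FirstVariation

variable {E : Type*} [NormedAddCommGroup E] [NormedSpace ℝ E] [FiniteDimensional ℝ E]
  {M : Type*} [MetricSpace M] [ChartedSpace E M] [IsManifold 𝓘(ℝ, E) ∞ M]
  [RiemannianBundle (fun x : M => TangentSpace 𝓘(ℝ, E) x)]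
  [IsContMDiffRiemannianBundle 𝓘(ℝ, E) ∞ E (fun x : M => TangentSpace 𝓘(ℝ, E) x)]
  [IsRiemannianManifold 𝓘(ℝ, E) M]

theorem MapsIntoChart.continuousOn_fderiv_chartMetric {c : LoopSpace E M} {x : M} {a b : ℝ}
    (h : MapsIntoChart c x a b) {w : ℝ → E} (hw : ContinuousOn w (Icc a b)) :
    ContinuousOn (fun s => fderiv ℝ (chartMetric x : E → E →L[ℝ] E →L[ℝ] ℝ)
      ((extChartAt 𝓘(ℝ, E) x ∘ c) s) (w s)) (Icc a b) :=
  (h.continuousOn_comp (fun _ hz =>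
    (continuousAt_fderiv_chartMetric hz).continuousWithinAt)).clm_apply hw

/-- The integral of `⟨c', ∇_s ξ⟩` in a chart. -/
theorem LoopTangent.integral_inner_chart {c : LoopSpace E M} (ξ : LoopTangent c) {x : M}
    {a b : ℝ} (hab : a ≤ b) (h : MapsIntoChart c x a b) :
    IntervalIntegrable (fun s => inner ℝ (velocity E c s) (covDeriv c ξ s)) volume a b ∧
    ∫ s in a..b, inner ℝ (velocity E c s) (covDeriv c ξ s) =
      (∫ s in Icc a b, chartMetric x ((extChartAt 𝓘(ℝ, E) x ∘ c) s) (deriv (fieldCoord c ξ x) s)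
        (deriv (extChartAt 𝓘(ℝ, E) x ∘ c) s)) +
      (1 / 2 : ℝ) * ∫ s in Icc a b, fderiv ℝ (chartMetric x : E → E →L[ℝ] E →L[ℝ] ℝ)
        ((extChartAt 𝓘(ℝ, E) x ∘ c) s) (fieldCoord c ξ x s)
        (deriv (extChartAt 𝓘(ℝ, E) x ∘ c) s) (deriv (extChartAt 𝓘(ℝ, E) x ∘ c) s) := by
  have hu := (c.h1On_chart hab h).memLp
  have hw := (ξ.h1On hab h).memLp
  have i1 := integrable_bilin_of_continuousOn h.continuousOn_chartMetric hw hu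
  have i2 := integrable_bilin_of_continuousOn
    (h.continuousOn_fderiv_chartMetric ((ξ.h1On hab h).continuousOn hab)) hu hu
  have hae := ξ.ae_inner_velocity_covDeriv hab h
  constructor
  · rw [intervalIntegrable_iff_integrableOn_Icc_of_le hab]
    exact (i1.add (i2.const_mul (1 / 2))).congr (hae.mono fun s hs => hs.symm)
  · rw [intervalIntegral.integral_of_le hab, ← integral_Icc_eq_integral_Ioc,
      ← integral_const_mul, ← integral_add i1 (i2.const_mul _)]
    exact integral_congr_ae hae

theorem LoopTangent.intervalIntegrable_inner {c : LoopSpace E M} (ξ : LoopTangent c) {a b : ℝ}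
    (hab : a ≤ b) :
    IntervalIntegrable (fun s => inner ℝ (velocity E c s) (covDeriv c ξ s)) volume a b := by
  refine interval_induction (P := fun a b => IntervalIntegrable
    (fun s => inner ℝ (velocity E c s) (covDeriv c ξ s)) volume a b)
    (fun _ _ _ _ _ h1 h2 => h1.trans h2) hab fun s _ => ?_
  obtain ⟨δ, hδ, hm⟩ := c.exists_mapsIntoChart (mem_chart_source E (c s))
  exact ⟨δ, hδ, fun u v _ huv _ hu hv => (ξ.integral_inner_chart huv (hm.mono hu.le hv.le)).1⟩

theorem LoopTangent.dPot_chart {V : M → ℝ} (hV : ContMDiff 𝓘(ℝ, E) 𝓘(ℝ, ℝ) ∞ V)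
    {c : LoopSpace E M} (ξ : LoopTangent c) {x : M} {a b : ℝ} (h : MapsIntoChart c x a b) :
    EqOn (fun s => dPot E V (c s) (ξ s)) (fun s => fderiv ℝ (V ∘ (extChartAt 𝓘(ℝ, E) x).symm)
      ((extChartAt 𝓘(ℝ, E) x ∘ c) s) (fieldCoord c ξ x s)) (Icc a b) :=
  fun s hs => dPot_eq_fderiv hV (h s hs) _

theorem LoopTangent.continuousOn_dPot {V : M → ℝ} (hV : ContMDiff 𝓘(ℝ, E) 𝓘(ℝ, ℝ) ∞ V)
    {c : LoopSpace E M} (ξ : LoopTangent c) {x : M} {a b : ℝ} (hab : a ≤ b)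
    (h : MapsIntoChart c x a b) :
    ContinuousOn (fun s => dPot E V (c s) (ξ s)) (Icc a b) := by
  refine ContinuousOn.congr ?_ (ξ.dPot_chart hV h)
  exact (h.continuousOn_comp (fun z hz => (((contDiffAt_chart hV hz).fderiv_right (m := 0)
    (by simp)).continuousAt).continuousWithinAt)).clm_apply ((ξ.h1On hab h).continuousOn hab)

theorem LoopTangent.intervalIntegrable_dPot {V : M → ℝ} (hV : ContMDiff 𝓘(ℝ, E) 𝓘(ℝ, ℝ) ∞ V)
    {c : LoopSpace E M} (ξ : LoopTangent c) {a b : ℝ} (hab : a ≤ b) :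
    IntervalIntegrable (fun s => dPot E V (c s) (ξ s)) volume a b := by
  refine interval_induction (P := fun a b => IntervalIntegrable
    (fun s => dPot E V (c s) (ξ s)) volume a b)
    (fun _ _ _ _ _ h1 h2 => h1.trans h2) hab fun s _ => ?_
  obtain ⟨δ, hδ, hm⟩ := c.exists_mapsIntoChart (mem_chart_source E (c s))
  exact ⟨δ, hδ, fun u v _ huv _ hu hv => (ξ.continuousOn_dPot hV huv
    (hm.mono hu.le hv.le)).intervalIntegrable_of_Icc huv⟩

/-- H¹ convergence of the difference quotients is split into the two forms used to differentiate
integrals: uniform convergence of the quotients, and L² convergence of those of the derivatives. -/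
theorem HasLoopVelocity.tendsto_slope_chart {γ : ℝ → LoopSpace E M} {c : LoopSpace E M}
    {ξ : LoopTangent c} (hγ : HasLoopVelocity γ c ξ) {x : M} {a b : ℝ} (hab : a < b)
    (h : MapsIntoChart c x a b) :
    TendstoUniformlyOn (fun t s => t⁻¹ • ((extChartAt 𝓘(ℝ, E) x ∘ γ t) s -
        (extChartAt 𝓘(ℝ, E) x ∘ c) s)) (fieldCoord c ξ x) (𝓝[≠] 0) (Icc a b) ∧
      Tendsto (fun t : ℝ => eLpNorm (t⁻¹ • (deriv (extChartAt 𝓘(ℝ, E) x ∘ γ t) -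
        deriv (extChartAt 𝓘(ℝ, E) x ∘ c)) - deriv (fieldCoord c ξ x)) 2
        (volume.restrict (Icc a b))) (𝓝[≠] 0) (𝓝 0) := by
  have hγ0 : Tendsto γ (𝓝[≠] 0) (𝓝 c) :=
    (hγ.base ▸ hγ.continuousAt.tendsto).mono_left nhdsWithin_le_nhds
  obtain ⟨h1, -⟩ := LoopSpace.tendsto_chart hγ0 hab.le h
  have hu := c.h1On_chart hab.le h
  have hf : ∀ᶠ t in 𝓝[≠] (0 : ℝ), H1On (t⁻¹ • (extChartAt 𝓘(ℝ, E) x ∘ γ t -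
      extChartAt 𝓘(ℝ, E) x ∘ c)) a b := h1.mono fun t ht =>
    ((((γ t).h1On_chart hab.le ht).sub hu hab.le).1.const_smul hab.le t⁻¹).1
  obtain ⟨h2, h3⟩ := H1On.tendsto_of_h1NormSq hab hf (ξ.h1On hab.le h) (hγ.tendsto x a b hab.le h)
  refine ⟨h2, h3.congr' ?_⟩
  filter_upwards [h1] with t ht
  obtain ⟨h4, h5⟩ := ((γ t).h1On_chart hab.le ht).sub hu hab.le
  refine eLpNorm_congr_ae ?_
  filter_upwards [(h4.const_smul hab.le t⁻¹).2, h5] with s h6 h7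
  rw [Pi.sub_apply, Pi.sub_apply, h6, Pi.smul_apply, h7, Pi.smul_apply]

theorem HasLoopVelocity.tendsto_nhds {γ : ℝ → LoopSpace E M} {c : LoopSpace E M}
    {ξ : LoopTangent c} (hγ : HasLoopVelocity γ c ξ) : Tendsto γ (𝓝[≠] 0) (𝓝 c) :=
  (hγ.base ▸ hγ.continuousAt.tendsto).mono_left nhdsWithin_le_nhds

/-- With p = u' and p_t = u_t', symmetry of G gives G(u_t)(p_t, p_t) - G(u)(p, p) = (G(u_t) -
G(u))(p_t, p_t) + G(u)(p_t - p, p_t + p). After division by t each summand has a limit, by uniform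
convergence of the bilinear forms and L² convergence of the vectors. -/
theorem HasLoopVelocity.hasDerivAt_integral_sq_speed {γ : ℝ → LoopSpace E M} {c : LoopSpace E M}
    {ξ : LoopTangent c} (hγ : HasLoopVelocity γ c ξ) {a b : ℝ} (hab : a ≤ b) :
    HasDerivAt (fun t => ∫ s in a..b, ‖velocity E (γ t) s‖ ^ 2)
      (2 * ∫ s in a..b, inner ℝ (velocity E c s) (covDeriv c ξ s)) 0 := by
  refine interval_induction (P := fun a b => a ≤ b →
    HasDerivAt (fun t => ∫ s in a..b, ‖velocity E (γ t) s‖ ^ 2)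
      (2 * ∫ s in a..b, inner ℝ (velocity E c s) (covDeriv c ξ s)) 0) ?_ hab ?_ hab
  · intro a b d hab hbd h1 h2 _
    have h3 := (h1 hab).add (h2 hbd)
    rw [← mul_add, intervalIntegral.integral_add_adjacent_intervals
      (ξ.intervalIntegrable_inner hab) (ξ.intervalIntegrable_inner hbd)] at h3
    refine h3.congr_of_eventuallyEq (Eventually.of_forall fun t => ?_)
    exact (intervalIntegral.integral_add_adjacent_intervals
      ((γ t).intervalIntegrable_sq_speed a b) ((γ t).intervalIntegrable_sq_speed b d)).symm
  · intro s _
    obtain ⟨δ, hδ, hm⟩ := c.exists_mapsIntoChart (mem_chart_source E (c s))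
    refine ⟨δ, hδ, fun a b _ hab _ ha hb _ => ?_⟩
    replace hm := hm.mono ha.le hb.le
    rcases hab.eq_or_lt with rfl | hab
    · simpa using hasDerivAt_const (0 : ℝ) (0 : ℝ)
    generalize c s = x at hm
    obtain ⟨h1, h2, h3⟩ := LoopSpace.tendsto_chart_of_lt hγ.tendsto_nhds hab hm
    obtain ⟨h4, h5⟩ := hγ.tendsto_slope_chart hab hm
    have hL := h1.mono fun t ht => ((γ t).h1On_chart hab.le ht).memLp
    have hL0 := (c.h1On_chart hab.le hm).memLp
    have hW := ξ.h1On hab.le hm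
    have hG0 := hm.continuousOn_chartMetric
    obtain ⟨C, hC⟩ := isCompact_Icc.exists_bound_of_continuousOn (hW.continuousOn hab.le)
    rw [(ξ.integral_inner_chart hab.le hm).2, hasDerivAt_iff_tendsto_slope]
    set u := extChartAt 𝓘(ℝ, E) x ∘ c with hu
    set w := fieldCoord c ξ x with hw
    set G : E → E →L[ℝ] E →L[ℝ] ℝ := chartMetric x with hG
    have hslope : TendstoUniformlyOn
        (fun t s => t⁻¹ • (G ((extChartAt 𝓘(ℝ, E) x ∘ γ t) s) - G (u s)))
        (fun s => fderiv ℝ G (u s) (w s)) (𝓝[≠] 0) (Icc a b) :=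
      tendstoUniformlyOn_slope_comp hm.isCompact_image (fun z hz =>
        (contDiffAt_chartMetric_of_mem_target (hm.image_subset hz)).of_le (by simp))
        (mapsTo_image _ _) hC h4
    have hslope_cont : ∀ᶠ t in 𝓝[≠] (0 : ℝ), ContinuousOn
        (fun s => t⁻¹ • (G ((extChartAt 𝓘(ℝ, E) x ∘ γ t) s) - G (u s))) (Icc a b) :=
      h1.mono fun t ht => (ht.continuousOn_chartMetric.sub hG0).const_smul t⁻¹
    have hDG := hm.continuousOn_fderiv_chartMetric (hW.continuousOn hab.le)
    -- The summand in which the metric varies.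
    have t1 := tendsto_integral_bilin_of_continuousOn hslope_cont hDG hslope hL hL0 h3 hL hL0 h3
    -- The summand in which the derivative varies, with the metric frozen at the loop `c`; the
    -- factor p_t + p tends to 2p.
    have t2 := tendsto_integral_bilin_of_continuousOn (l := 𝓝[≠] (0 : ℝ))
      (B := fun _ s => G (u s)) (Eventually.of_forall fun _ => hG0) hG0
      (tendstoUniformlyOn_iff_norm.2 fun η hη => Eventually.of_forall fun _ s _ => by
        rw [sub_self, norm_zero]; exact hη.le)
      (hL.mono fun t ht => (ht.sub hL0).const_smul t⁻¹) hW.memLp h5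
      (hL.mono fun t ht => ht.add hL0) (hL0.add hL0)
      (h3.congr fun t => by rw [add_sub_add_right_eq_sub])
    have t3 := t1.add t2
    have hlim : (∫ s in Icc a b, fderiv ℝ G (u s) (w s) (deriv u s) (deriv u s)) +
        (∫ s in Icc a b, G (u s) (deriv w s) ((deriv u + deriv u) s)) =
        2 * ((∫ s in Icc a b, G (u s) (deriv w s) (deriv u s)) +
          1 / 2 * ∫ s in Icc a b, fderiv ℝ G (u s) (w s) (deriv u s) (deriv u s)) := by
      have : ∀ s, G (u s) (deriv w s) ((deriv u + deriv u) s) =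
          2 * G (u s) (deriv w s) (deriv u s) := fun s => by
        rw [Pi.add_apply, map_add]; ring
      simp_rw [this]
      rw [integral_const_mul]
      ring
    rw [← hlim]
    refine t3.congr' ?_
    filter_upwards [h1, hL, hslope_cont] with t ht hLt hst
    rw [slope_def_module, sub_zero, smul_eq_mul, hγ.base, (γ t).integral_sq_speed_chart hab.le ht,
      c.integral_sq_speed_chart hab.le hm,
      ← integral_sub (integrable_bilin_of_continuousOn ht.continuousOn_chartMetric hLt hLt)
        (integrable_bilin_of_continuousOn hm.continuousOn_chartMetric hL0 hL0),
      ← integral_const_mul,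
      ← integral_add (integrable_bilin_of_continuousOn hst hLt hLt)
        (integrable_bilin_of_continuousOn hG0 ((hLt.sub hL0).const_smul t⁻¹) (hLt.add hL0))]
    refine integral_congr_ae (Eventually.of_forall fun s => ?_)
    have hsymm : G (u s) (deriv (extChartAt 𝓘(ℝ, E) x ∘ γ t) s) (deriv u s) =
      G (u s) (deriv u s) (deriv (extChartAt 𝓘(ℝ, E) x ∘ γ t) s) := chartMetric_symm x _ _ _
    simp only [Pi.smul_apply, Pi.sub_apply, Pi.add_apply, map_sub, map_add, map_smul,
      smul_apply, sub_apply, smul_eq_mul, hsymm]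
    simp only [← hG, ← hu]
    ring

theorem HasLoopVelocity.hasDerivAt_integral_potential {V : M → ℝ}
    (hV : ContMDiff 𝓘(ℝ, E) 𝓘(ℝ, ℝ) ∞ V) {γ : ℝ → LoopSpace E M} {c : LoopSpace E M}
    {ξ : LoopTangent c} (hγ : HasLoopVelocity γ c ξ) {a b : ℝ} (hab : a ≤ b) :
    HasDerivAt (fun t => ∫ s in a..b, V (γ t s)) (∫ s in a..b, dPot E V (c s) (ξ s)) 0 := by
  refine interval_induction (P := fun a b => a ≤ b →
    HasDerivAt (fun t => ∫ s in a..b, V (γ t s)) (∫ s in a..b, dPot E V (c s) (ξ s)) 0) ?_ hab ?_ hab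
  · intro a b d hab hbd h1 h2 _
    have h3 := (h1 hab).add (h2 hbd)
    rw [intervalIntegral.integral_add_adjacent_intervals
      (ξ.intervalIntegrable_dPot hV hab) (ξ.intervalIntegrable_dPot hV hbd)] at h3
    refine h3.congr_of_eventuallyEq (Eventually.of_forall fun t => ?_)
    exact (intervalIntegral.integral_add_adjacent_intervals
      ((hV.continuous.comp (γ t).continuous).intervalIntegrable (μ := volume) a b)
      ((hV.continuous.comp (γ t).continuous).intervalIntegrable b d)).symm
  · intro s _
    obtain ⟨δ, hδ, hm⟩ := c.exists_mapsIntoChart (mem_chart_source E (c s))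
    refine ⟨δ, hδ, fun a b _ hab _ ha hb _ => ?_⟩
    replace hm := hm.mono ha.le hb.le
    rcases hab.eq_or_lt with rfl | hab
    · simpa using hasDerivAt_const (0 : ℝ) (0 : ℝ)
    generalize c s = x at hm
    obtain ⟨h1, h2, h3⟩ := LoopSpace.tendsto_chart_of_lt hγ.tendsto_nhds hab hm
    obtain ⟨h4, h5⟩ := hγ.tendsto_slope_chart hab hm
    have hW := ξ.h1On hab.le hm
    obtain ⟨C, hC⟩ := isCompact_Icc.exists_bound_of_continuousOn (hW.continuousOn hab.le)
    set f := V ∘ (extChartAt 𝓘(ℝ, E) x).symm with hf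
    have hslope := tendstoUniformlyOn_slope_comp hm.isCompact_image (fun z hz =>
        (contDiffAt_chart hV (hm.image_subset hz)).of_le (by simp)) (mapsTo_image _ _) hC h4
    have hfc := (contDiffOn_chart hV x).continuousOn
    have hc0 := hm.continuousOn_comp hfc
    have hct := h1.mono fun t ht => ht.continuousOn_comp hfc
    have hlim : ∫ s in a..b, dPot E V (c s) (ξ s) =
        ∫ s in a..b, fderiv ℝ f ((extChartAt 𝓘(ℝ, E) x ∘ c) s) (fieldCoord c ξ x s) :=
      intervalIntegral.integral_congr (by rw [uIcc_of_le hab.le]; exact ξ.dPot_chart hV hm)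
    rw [hlim, hasDerivAt_iff_tendsto_slope]
    have t1 := tendsto_intervalIntegral_of_tendstoUniformlyOn hab.le
      (hct.mono fun t ht => (ht.sub hc0).const_smul t⁻¹)
      ((ξ.continuousOn_dPot hV hab.le hm).congr (ξ.dPot_chart hV hm).symm) hslope
    refine t1.congr' ?_
    filter_upwards [h1, hct] with t ht hct
    rw [slope_def_module, sub_zero, hγ.base, ht.integral_potential hab.le V,
      hm.integral_potential hab.le V, ← intervalIntegral.integral_sub
        (hct.intervalIntegrable_of_Icc hab.le) (hc0.intervalIntegrable_of_Icc hab.le),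
      ← intervalIntegral.integral_smul]
    rfl

/-- The differential in the direction of `ξ` of the action at fixed `τ`. -/
def actionDiff (V : M → ℝ) (τ : ℝ) (c : LoopSpace E M) (ξ : LoopTangent c) : ℝ :=
  Real.exp (-τ) * (∫ s in (0 : ℝ)..1, inner ℝ (velocity E c s) (covDeriv c ξ s)) -
    Real.exp τ * ∫ s in (0 : ℝ)..1, dPot E V (c s) (ξ s)

/-- The derivative in the direction of `τ` of the penalized action. -/
def actionDiffTau (V : M → ℝ) (ε : ℝ) (p : LoopSpace E M × ℝ) : ℝ :=
  -(Real.exp (-p.2) / 2 * ∫ s in (0 : ℝ)..1, ‖velocity E p.1 s‖ ^ 2) -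
    Real.exp p.2 * (∫ s in (0 : ℝ)..1, V (p.1 s)) +
    ε * (-Real.exp (-p.2) + Real.exp (p.2 / 2) / 2)

/-- The first variation of the penalized action. -/
theorem hasDifferential_penalizedAction {V : M → ℝ} (hV : ContMDiff 𝓘(ℝ, E) 𝓘(ℝ, ℝ) ∞ V) (ε : ℝ)
    (p : LoopSpace E M × ℝ) (ξ : LoopTangent p.1) (σ : ℝ) :
    HasDifferential (penalizedAction V ε) p ξ σ
      (actionDiff V p.2 p.1 ξ + σ * actionDiffTau V ε p) := by
  intro γ θ hγ hθ0 hθ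
  have h1 := hγ.hasDerivAt_integral_sq_speed zero_le_one
  have h2 := hγ.hasDerivAt_integral_potential hV zero_le_one
  have h3 := hθ.neg.exp
  have h4 := hθ.exp
  have h5 := (hθ.div_const 2).exp
  have := (((h3.div_const 2).mul h1).sub (h4.mul h2)).add ((h3.add h5).const_mul ε)
  refine this.congr_deriv ?_
  rw [Pi.neg_apply, hθ0, hγ.base]
  simp only [actionDiff, actionDiffTau]
  ring

end FirstVariation

/-! ### Fields along a loop supported in one chart -/

section VectorFields

variable {E : Type*} [NormedAddCommGroup E] [NormedSpace ℝ E]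
  {M : Type*} [MetricSpace M] [ChartedSpace E M]

/-- The tangent vector at `q` with coordinates `v` in the chart at `x`. -/
def vecAt (x q : M) (v : E) : TangentSpace 𝓘(ℝ, E) q :=
  toTangent q (fderiv ℝ (chartChange x q) (extChartAt 𝓘(ℝ, E) x q) v)

theorem vecAt_zero (x q : M) : vecAt x q (0 : E) = 0 :=
  map_zero (fderiv ℝ (chartChange x q : E → E) (extChartAt 𝓘(ℝ, E) x q))

variable [IsManifold 𝓘(ℝ, E) ∞ M]

theorem chartCoord_vecAt {x q : M} (hq : q ∈ (chartAt E x).source) (v : E) :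
    chartCoord x q (vecAt x q v) = v := by
  obtain ⟨w, hw⟩ := exists_chartCoord_eq hq v
  have h1 := chartCoord_eq_fderiv_chartChange hq (mem_chart_source E q) w
  rw [hw, chartCoord_self] at h1
  have : vecAt x q v = w := h1.symm
  rw [this, hw]

theorem chartCoord_zero (x q : M) : chartCoord (E := E) x q 0 = 0 := map_zero _

variable [FiniteDimensional ℝ E] [RiemannianBundle (fun x : M => TangentSpace 𝓘(ℝ, E) x)]
  [IsContMDiffRiemannianBundle 𝓘(ℝ, E) ∞ E (fun x : M => TangentSpace 𝓘(ℝ, E) x)]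
  [IsRiemannianManifold 𝓘(ℝ, E) M]

/-- The new coordinates are Dψ(u)w, a smooth function of the H¹ pair (u, w). Thus the H¹ property
needs to be checked in one chart only at each point. -/
theorem h1At_fieldCoord_of_chart {c : LoopSpace E M} {ξ : ∀ s, TangentSpace 𝓘(ℝ, E) (c s)}
    {x y : M} {s : ℝ} (hx : c s ∈ (chartAt E x).source) (hy : c s ∈ (chartAt E y).source)
    (h : H1At (fieldCoord c ξ x) s) : H1At (fieldCoord c ξ y) s := by
  have hu := c.h1At_chart hx
  have h1 : ContDiffAt ℝ 1 (fun p : E × E => fderiv ℝ (chartChange x y) p.1 p.2)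
      (extChartAt 𝓘(ℝ, E) x (c s), fieldCoord c ξ x s) := by
    have h2 : ContDiffAt ℝ 1 (fderiv ℝ (chartChange x y : E → E)) (extChartAt 𝓘(ℝ, E) x (c s)) :=
      (contDiffAt_chartChange hx hy).fderiv_right (m := 1) (by norm_cast)
    exact (h2.comp (extChartAt 𝓘(ℝ, E) x (c s), fieldCoord c ξ x s) contDiffAt_fst).clm_apply
      contDiffAt_snd
  refine ((hu.prodMk h).comp_contDiffAt h1).congr ?_
  filter_upwards [c.continuous.continuousAt.preimage_mem_nhds
      ((chartAt E x).open_source.mem_nhds hx),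
    c.continuous.continuousAt.preimage_mem_nhds ((chartAt E y).open_source.mem_nhds hy)]
    with r hrx hry
  exact chartCoord_eq_fderiv_chartChange hrx hry (ξ r)

/-- A vector field along a loop is of class `H¹` if it is so near each point in some chart. -/
def LoopTangent.ofH1At {c : LoopSpace E M} (ξ : ∀ s, TangentSpace 𝓘(ℝ, E) (c s))
    (hp : Function.Periodic (fun s => (⟨c s, ξ s⟩ : TangentBundle 𝓘(ℝ, E) M)) 1)
    (h : ∀ s, ∃ x, c s ∈ (chartAt E x).source ∧ H1At (fieldCoord c ξ x) s) : LoopTangent c where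
  toFun := ξ
  periodic := hp
  absolutelyContinuous y a b hab hm := (H1On.of_forall_h1At hab fun s hs => by
    obtain ⟨x, hx, h⟩ := h s
    exact h1At_fieldCoord_of_chart hx (hm s hs) h).1
  deriv_sq_lt_top y a b hab hm := (H1On.of_forall_h1At hab fun s hs => by
    obtain ⟨x, hx, h⟩ := h s
    exact h1At_fieldCoord_of_chart hx (hm s hs) h).2

theorem H1At.const (v : E) (s : ℝ) : H1At (fun _ => v) s :=
  H1At.of_lipschitzWith (K := 0) (LipschitzWith.const v) s

/-- The periodic function `W` is of class `H¹`, and it vanishes outside a closed set of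
parameters that `c` maps into the domain of the chart at `x`. -/
structure IsChartField (c : LoopSpace E M) (x : M) (W : ℝ → E) : Prop where
  periodic : Function.Periodic W 1
  h1At : ∀ s, H1At W s
  eventually_eq_zero : ∀ s, c s ∉ (chartAt E x).source → W =ᶠ[𝓝 s] 0

/-- The vector field with coordinates `W` in the chart at `x`. -/
def IsChartField.field {c : LoopSpace E M} {x : M} {W : ℝ → E} (h : IsChartField c x W) :
    LoopTangent c :=
  LoopTangent.ofH1At (fun s => vecAt x (c s) (W s))
    (fun s => by
      -- Base point and coordinates are moved together, as one pair, so that no transport between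
      -- tangent spaces is needed.
      have h1 : (c (s + 1), W (s + 1)) = (c s, W s) := Prod.ext (c.periodic s) (h.periodic s)
      exact congrArg (fun p : M × E => (⟨p.1, vecAt x p.1 p.2⟩ : TangentBundle 𝓘(ℝ, E) M)) h1)
    (fun s => by
      by_cases hs : c s ∈ (chartAt E x).source
      · refine ⟨x, hs, (h.h1At s).congr ?_⟩
        filter_upwards [c.continuous.continuousAt.preimage_mem_nhds
          ((chartAt E x).open_source.mem_nhds hs)] with r hr
        exact chartCoord_vecAt hr (W r)
      -- Outside the chart at `x` the field vanishes near `s`, so any chart at `c s` shows that it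
      -- is H¹.
      · refine ⟨c s, mem_chart_source E (c s), (H1At.const (0 : E) s).congr ?_⟩
        filter_upwards [h.eventually_eq_zero s hs] with r hr
        change chartCoord (c s) (c r) (vecAt x (c r) (W r)) = 0
        rw [hr, Pi.zero_apply, vecAt_zero, chartCoord_zero])

theorem IsChartField.fieldCoord_eq {c : LoopSpace E M} {x : M} {W : ℝ → E}
    (h : IsChartField c x W) {s : ℝ} (hs : c s ∈ (chartAt E x).source) :
    fieldCoord c h.field x s = W s :=
  chartCoord_vecAt hs (W s)

theorem IsChartField.fieldCoord_eventuallyEq {c : LoopSpace E M} {x : M} {W : ℝ → E}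
    (h : IsChartField c x W) {s : ℝ} (hs : c s ∈ (chartAt E x).source) :
    fieldCoord c h.field x =ᶠ[𝓝 s] W := by
  filter_upwards [c.continuous.continuousAt.preimage_mem_nhds
    ((chartAt E x).open_source.mem_nhds hs)] with r hr
  exact h.fieldCoord_eq hr

theorem IsChartField.fieldCoord_eventuallyEq_zero {c : LoopSpace E M} {x : M} {W : ℝ → E}
    (h : IsChartField c x W) {s : ℝ} (hs : c s ∉ (chartAt E x).source) (y : M) :
    fieldCoord c h.field y =ᶠ[𝓝 s] 0 := by
  filter_upwards [h.eventually_eq_zero s hs] with r hr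
  change chartCoord y (c r) (vecAt x (c r) (W r)) = 0
  rw [hr, Pi.zero_apply, vecAt_zero, chartCoord_zero]

theorem ae_differentiableAt_of_forall_h1At {W : ℝ → E} (h : ∀ s, H1At W s) :
    ∀ᵐ s : ℝ, DifferentiableAt ℝ W s := by
  have h1 : ∀ n : ℕ, ∀ᵐ s : ℝ, s ∈ Icc (-n : ℝ) n → DifferentiableAt ℝ W s := fun n => by
    have hn : (-n : ℝ) ≤ n := by linarith [n.cast_nonneg (α := ℝ)]
    exact (ae_restrict_iff' measurableSet_Icc).1
      ((H1On.of_forall_h1At hn fun s _ => h s).ae_differentiableAt hn)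
  filter_upwards [ae_all_iff.2 h1] with s hs
  obtain ⟨n, hn⟩ := exists_nat_ge |s|
  exact hs n (abs_le.1 hn)

theorem IsChartField.continuous {c : LoopSpace E M} {x : M} {W : ℝ → E}
    (h : IsChartField c x W) : Continuous W :=
  continuous_iff_continuousAt.2 fun s => (h.h1At s).continuousAt

variable (E) in
/-- The integrand of the first variation of the energy, in terms of a metric `G` on `E`. -/
def varDensity (G : E → E →L[ℝ] E →L[ℝ] ℝ) (u W : ℝ → E) (s : ℝ) : ℝ :=
  G (u s) (deriv W s) (deriv u s) + (1 / 2 : ℝ) * fderiv ℝ G (u s) (W s) (deriv u s) (deriv u s)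

theorem varDensity_eq_zero (G : E → E →L[ℝ] E →L[ℝ] ℝ) (u : ℝ → E) {W : ℝ → E} {s : ℝ}
    (h : W =ᶠ[𝓝 s] 0) : varDensity E G u W s = 0 := by
  have h1 : deriv W s = 0 := by
    rw [h.deriv_eq]; exact deriv_const s (0 : E)
  rw [varDensity, h1, h.self_of_nhds]
  simp

theorem IsChartField.ae_inner {c : LoopSpace E M} {x : M} {W : ℝ → E}
    (h : IsChartField c x W) : ∀ᵐ s : ℝ, inner ℝ (velocity E c s) (covDeriv c h.field s) =
      varDensity E (chartMetric x) (extChartAt 𝓘(ℝ, E) x ∘ c) W s := by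
  filter_upwards [c.ae_differentiableAt_chart, ae_differentiableAt_of_forall_h1At h.h1At]
    with s h1 h2
  by_cases hs : c s ∈ (chartAt E x).source
  · have h3 := h.fieldCoord_eventuallyEq hs
    rw [inner_velocity_covDeriv hs (h1 x hs) (h3.differentiableAt_iff.2 h2), h3.deriv_eq,
      h.fieldCoord_eq hs]
    rfl
  · have h3 := h.fieldCoord_eventuallyEq_zero hs (c s)
    have h4 : DifferentiableAt ℝ (fieldCoord c h.field (c s)) s :=
      h3.differentiableAt_iff.2 (differentiableAt_const (0 : E))
    rw [varDensity_eq_zero _ _ (h.eventually_eq_zero s hs),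
      inner_velocity_covDeriv (mem_chart_source E (c s)) (h1 _ (mem_chart_source E (c s))) h4]
    exact varDensity_eq_zero (chartMetric (c s)) (extChartAt 𝓘(ℝ, E) (c s) ∘ c) h3

theorem IsChartField.dPot_eq {V : M → ℝ} (hV : ContMDiff 𝓘(ℝ, E) 𝓘(ℝ, ℝ) ∞ V)
    {c : LoopSpace E M} {x : M} {W : ℝ → E} (h : IsChartField c x W) (s : ℝ) :
    dPot E V (c s) (h.field s) = fderiv ℝ (V ∘ (extChartAt 𝓘(ℝ, E) x).symm)
      (extChartAt 𝓘(ℝ, E) x (c s)) (W s) := by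
  by_cases hs : c s ∈ (chartAt E x).source
  · rw [dPot_eq_fderiv hV hs]
    exact congrArg _ (h.fieldCoord_eq hs)
  · have h1 : W s = 0 := (h.eventually_eq_zero s hs).self_of_nhds
    have h2 : h.field s = 0 := by
      change vecAt x (c s) (W s) = 0
      rw [h1, vecAt_zero]
    rw [h2, h1, map_zero, map_zero]

theorem deriv_periodic {W : ℝ → E} (h : Function.Periodic W 1) :
    Function.Periodic (deriv W) 1 := by
  intro s
  rw [← deriv_comp_add_const]
  congr 1
  exact funext h

theorem varDensity_periodic (G : E → E →L[ℝ] E →L[ℝ] ℝ) {u W : ℝ → E}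
    (hu : Function.Periodic u 1) (hW : Function.Periodic W 1) :
    Function.Periodic (varDensity E G u W) 1 := by
  intro s
  simp only [varDensity, hu s, hW s, deriv_periodic hu s, deriv_periodic hW s]

/-- The integral over a period of a function with support in a small interval. -/
theorem integral_periodic_eq_integral_Icc {f : ℝ → ℝ} (hf : Function.Periodic f 1) {s₀ δ : ℝ}
    (hδ : δ ≤ 1 / 2) (h : ∀ s, |s - s₀| ≤ 1 / 2 → δ < |s - s₀| → f s = 0) :
    ∫ s in (0 : ℝ)..1, f s = ∫ s in Icc (s₀ - δ) (s₀ + δ), f s := by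
  have h1 := hf.intervalIntegral_add_eq 0 (s₀ - 1 / 2)
  rw [zero_add] at h1
  rw [h1, intervalIntegral.integral_of_le (by linarith), ← integral_Icc_eq_integral_Ioc,
    show s₀ - 1 / 2 + 1 = s₀ + 1 / 2 by ring]
  refine setIntegral_eq_of_subset_of_forall_sdiff_eq_zero measurableSet_Icc
    (Icc_subset_Icc (by linarith) (by linarith)) fun s hs => ?_
  refine h s (abs_le.2 ⟨by linarith [hs.1.1], by linarith [hs.1.2]⟩) ?_
  by_contra hcon
  have := abs_le.1 (not_lt.1 hcon)
  exact hs.2 ⟨by linarith [this.1], by linarith [this.2]⟩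

/-- The first variation in the direction of a vector field with support in a chart. -/
theorem IsChartField.actionDiff_eq {V : M → ℝ} (hV : ContMDiff 𝓘(ℝ, E) 𝓘(ℝ, ℝ) ∞ V) (τ : ℝ)
    {c : LoopSpace E M} {x : M} {W : ℝ → E} (h : IsChartField c x W) {s₀ δ : ℝ} (hδ : δ ≤ 1 / 2)
    (hW : ∀ s, |s - s₀| ≤ 1 / 2 → δ < |s - s₀| → W =ᶠ[𝓝 s] 0) :
    actionDiff V τ c h.field =
      Real.exp (-τ) * (∫ s in Icc (s₀ - δ) (s₀ + δ),
        varDensity E (chartMetric x) (extChartAt 𝓘(ℝ, E) x ∘ c) W s) -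
      Real.exp τ * ∫ s in Icc (s₀ - δ) (s₀ + δ),
        fderiv ℝ (V ∘ (extChartAt 𝓘(ℝ, E) x).symm) ((extChartAt 𝓘(ℝ, E) x ∘ c) s) (W s) := by
  have hu : Function.Periodic (extChartAt 𝓘(ℝ, E) x ∘ c) 1 := c.periodic.comp _
  rw [actionDiff, ← integral_periodic_eq_integral_Icc (varDensity_periodic _ hu h.periodic) hδ
      (fun s h1 h2 => varDensity_eq_zero _ _ (hW s h1 h2)),
    ← integral_periodic_eq_integral_Icc (f := fun s => fderiv ℝ
      (V ∘ (extChartAt 𝓘(ℝ, E) x).symm) ((extChartAt 𝓘(ℝ, E) x ∘ c) s) (W s))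
      (fun s => by simp only [hu s, h.periodic s]) hδ
      (fun s h1 h2 => by rw [(hW s h1 h2).self_of_nhds]; exact map_zero _)]
  congr 2
  · refine intervalIntegral.integral_congr_ae ?_
    filter_upwards [h.ae_inner] with s hs _ using hs
  · exact intervalIntegral.integral_congr fun s _ => h.dPot_eq hV s

/-- A pointwise bound for the covariant derivative in terms of coordinates. -/
theorem norm_covDeriv_le {x : M} {c : LoopSpace E M} {ξ : LoopTangent c} {s κ C : ℝ}
    (hκ : 0 < κ) (hC : 0 ≤ C) (hs : c s ∈ (chartAt E x).source)
    (hu : DifferentiableAt ℝ (extChartAt 𝓘(ℝ, E) x ∘ c) s)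
    (hw : DifferentiableAt ℝ (fieldCoord c ξ x) s)
    (h1 : ∀ v, κ * ‖v‖ ^ 2 ≤ chartMetric x (extChartAt 𝓘(ℝ, E) x (c s)) v v)
    (h2 : ‖(chartMetric x (extChartAt 𝓘(ℝ, E) x (c s)) : E →L[ℝ] E →L[ℝ] ℝ)‖ ≤ C)
    (h3 : ‖fderiv ℝ (chartMetric x : E → E →L[ℝ] E →L[ℝ] ℝ) (extChartAt 𝓘(ℝ, E) x (c s))‖ ≤ C) :
    ‖covDeriv c ξ s‖ ≤ 2 * C * Real.sqrt κ⁻¹ * (‖deriv (fieldCoord c ξ x) s‖ +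
      Real.sqrt κ⁻¹ * ‖velocity E c s‖ * ‖fieldCoord c ξ x s‖) := by
  have hc : ContinuousAt c s := c.continuous.continuousAt
  -- The coordinate formula is tested on ∇_s ξ itself. The right-hand side is at most a constant
  -- times |∇_s ξ|, which is then cancelled.
  have e1 := inner_covDeriv hc hs hu hw (covDeriv c ξ s)
  have e2 := norm_deriv_le_norm_velocity hc hs hκ h1
  set z := extChartAt 𝓘(ℝ, E) x (c s)
  set G : E → E →L[ℝ] E →L[ℝ] ℝ := chartMetric x
  set p := deriv (extChartAt 𝓘(ℝ, E) x ∘ c) s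
  set w := fieldCoord c ξ x s
  set w' := deriv (fieldCoord c ξ x) s
  set Y := chartCoord x (c s) (covDeriv c ξ s) with hY
  set N := ‖covDeriv c ξ s‖
  rw [real_inner_self_eq_norm_sq] at e1
  have e3 : κ * ‖Y‖ ^ 2 ≤ N ^ 2 := by
    refine (h1 Y).trans ?_
    rw [← real_inner_self_eq_norm_sq, inner_eq_chartMetric hs]
  have e4 : ‖Y‖ ≤ Real.sqrt κ⁻¹ * N := by
    rw [← Real.sqrt_sq (show 0 ≤ N from norm_nonneg _), ← Real.sqrt_mul (by positivity)]
    refine Real.le_sqrt_of_sq_le ?_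
    rw [← div_eq_inv_mul, le_div_iff₀ hκ]
    linarith
  have e5 : G z w' Y ≤ C * ‖w'‖ * ‖Y‖ :=
    (le_abs_self _).trans (((G z).le_opNorm₂ _ _).trans (by gcongr))
  have e6 : ∀ a v w : E, |fderiv ℝ G z a v w| ≤ C * ‖a‖ * ‖v‖ * ‖w‖ := by
    intro a v w
    refine ((fderiv ℝ G z a).le_opNorm₂ v w).trans ?_
    gcongr
    exact ((fderiv ℝ G z).le_opNorm a).trans (by gcongr)
  have e7 : koszulForm G z p w Y ≤ 3 / 2 * C * ‖p‖ * ‖w‖ * ‖Y‖ := by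
    rw [koszulForm_apply]
    have a1 := (abs_le.1 (e6 p w Y)).2
    have a2 := (abs_le.1 (e6 w p Y)).2
    have a3 := (abs_le.1 (e6 Y p w)).1
    nlinarith
  have e8 : N ^ 2 ≤ 2 * C * (‖w'‖ + ‖p‖ * ‖w‖) * ‖Y‖ := by
    rw [e1]
    have : 0 ≤ C * ‖w'‖ * ‖Y‖ := by positivity
    have : 0 ≤ C * ‖p‖ * ‖w‖ * ‖Y‖ := by positivity
    nlinarith
  have e9 : N ^ 2 ≤ (2 * C * Real.sqrt κ⁻¹ * (‖w'‖ + Real.sqrt κ⁻¹ * ‖velocity E c s‖ * ‖w‖)) * N := by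
    calc N ^ 2 ≤ 2 * C * (‖w'‖ + ‖p‖ * ‖w‖) * ‖Y‖ := e8
      _ ≤ 2 * C * (‖w'‖ + Real.sqrt κ⁻¹ * ‖velocity E c s‖ * ‖w‖) * (Real.sqrt κ⁻¹ * N) := by gcongr
      _ = _ := by ring
  rcases (norm_nonneg (covDeriv c ξ s)).eq_or_lt with h0 | h0
  · rw [show N = 0 from h0.symm]; positivity
  · have : N * N ≤ (2 * C * Real.sqrt κ⁻¹ * (‖w'‖ + Real.sqrt κ⁻¹ * ‖velocity E c s‖ * ‖w‖)) * N := by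
      rw [← sq]; exact e9
    exact le_of_mul_le_mul_right this h0

end VectorFields

/-! ### Periodic cut-off functions -/

section Cutoff

/-- A periodic Lipschitz function with support in the translates of `[s₀ - R, s₀ + R]`. -/
def circleBump (s₀ R s : ℝ) : ℝ := max 0 (R - ‖((s - s₀ : ℝ) : UnitAddCircle)‖)

theorem circleBump_nonneg (s₀ R s : ℝ) : 0 ≤ circleBump s₀ R s := le_max_left _ _

theorem circleBump_le {s₀ R : ℝ} (hR : 0 ≤ R) (s : ℝ) : circleBump s₀ R s ≤ R :=
  max_le hR (by linarith [norm_nonneg ((s - s₀ : ℝ) : UnitAddCircle)])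

theorem circleBump_periodic (s₀ R : ℝ) : Function.Periodic (circleBump s₀ R) 1 := by
  intro s
  have : (((s + 1 - s₀ : ℝ)) : UnitAddCircle) = ((s - s₀ : ℝ) : UnitAddCircle) := by
    rw [show s + 1 - s₀ = (s - s₀) + 1 by ring]
    exact AddCircle.coe_add_period 1 (s - s₀)
  simp only [circleBump, this]

theorem continuous_norm_circle (s₀ : ℝ) :
    Continuous fun s : ℝ => ‖((s - s₀ : ℝ) : UnitAddCircle)‖ :=
  ((AddCircle.continuous_mk' 1).comp (continuous_id.sub continuous_const)).norm

theorem norm_circle_of_abs_le {t : ℝ} (ht : |t| ≤ 1 / 2) : ‖(t : UnitAddCircle)‖ = |t| := by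
  rw [AddCircle.norm_coe_eq_abs_iff 1 one_ne_zero]
  simpa using ht

theorem norm_circle_le_abs (t : ℝ) : ‖(t : UnitAddCircle)‖ ≤ |t| := by
  rw [UnitAddCircle.norm_eq]
  simpa using round_le t 0

theorem circleBump_lipschitz (s₀ R : ℝ) : LipschitzWith 1 (circleBump s₀ R) := by
  have h1 : LipschitzWith 1 fun s : ℝ => ‖((s - s₀ : ℝ) : UnitAddCircle)‖ := by
    refine LipschitzWith.of_dist_le_mul fun s t => ?_
    rw [NNReal.coe_one, one_mul, Real.dist_eq, Real.dist_eq]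
    refine (abs_norm_sub_norm_le _ _).trans ?_
    rw [← AddCircle.coe_sub]
    refine (norm_circle_le_abs _).trans_eq ?_
    congr 1
    ring
  have h2 : LipschitzWith 1 fun s : ℝ => R - ‖((s - s₀ : ℝ) : UnitAddCircle)‖ := by
    refine LipschitzWith.of_dist_le_mul fun s t => ?_
    rw [dist_sub_left]
    exact h1.dist_le_mul s t
  exact h2.const_max 0

theorem circleBump_eventuallyEq_zero {s₀ R s : ℝ} (h : R < ‖((s - s₀ : ℝ) : UnitAddCircle)‖) :
    circleBump s₀ R =ᶠ[𝓝 s] 0 := by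
  filter_upwards [(continuous_norm_circle s₀).continuousAt.eventually (lt_mem_nhds h)] with r hr
  exact max_eq_left (by linarith)

theorem circleBump_of_abs_le {s₀ R s : ℝ} (hs : |s - s₀| ≤ 1 / 2) :
    circleBump s₀ R s = max 0 (R - |s - s₀|) := by
  rw [circleBump, norm_circle_of_abs_le hs]

end Cutoff

/-! ### Cut-off fields and their H¹ norms -/

section ChartFields

variable {E : Type*} [NormedAddCommGroup E] [NormedSpace ℝ E] [FiniteDimensional ℝ E]
  {M : Type*} [MetricSpace M] [ChartedSpace E M] [IsManifold 𝓘(ℝ, E) ∞ M]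
  [RiemannianBundle (fun x : M => TangentSpace 𝓘(ℝ, E) x)]
  [IsContMDiffRiemannianBundle 𝓘(ℝ, E) ∞ E (fun x : M => TangentSpace 𝓘(ℝ, E) x)]
  [IsRiemannianManifold 𝓘(ℝ, E) M]

theorem LoopSpace.mem_of_norm_circle_le (c : LoopSpace E M) {S : Set M} {s₀ R s : ℝ}
    (h : ∀ t ∈ Icc (s₀ - R) (s₀ + R), c t ∈ S) (hs : ‖((s - s₀ : ℝ) : UnitAddCircle)‖ ≤ R) :
    c s ∈ S := by
  rw [UnitAddCircle.norm_eq] at hs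
  have h1 := abs_le.1 hs
  have h2 := h (s - round (s - s₀)) ⟨by linarith, by linarith⟩
  have h3 := c.periodic.sub_zsmul_eq (x := s) (round (s - s₀))
  rw [zsmul_one] at h3
  rwa [h3] at h2

theorem H1At.smul {ρ : ℝ → ℝ} {w : ℝ → E} {s : ℝ} (hρ : H1At ρ s) (hw : H1At w s) :
    H1At (fun r => ρ r • w r) s :=
  (hρ.prodMk hw).comp_contDiffAt (Φ := fun p : ℝ × E => p.1 • p.2)
    (contDiff_fst.smul contDiff_snd).contDiffAt

theorem H1At.sub {v w : ℝ → E} {s : ℝ} (hv : H1At v s) (hw : H1At w s) :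
    H1At (fun r => v r - w r) s :=
  (hv.prodMk hw).comp_contDiffAt (Φ := fun p : E × E => p.1 - p.2)
    (contDiff_fst.sub contDiff_snd).contDiffAt

/-- The vector `w` may be irregular wherever the cut-off vanishes locally; chart coordinates, which
carry no information outside the chart, can therefore be used for it. -/
theorem isChartField_bump {c : LoopSpace E M} {x : M} {ρ : ℝ → ℝ} {w : ℝ → E}
    (hρp : Function.Periodic ρ 1) (hρ : ∀ s, H1At ρ s) (hwp : Function.Periodic w 1)
    (h : ∀ s, ρ =ᶠ[𝓝 s] 0 ∨ (c s ∈ (chartAt E x).source ∧ H1At w s)) :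
    IsChartField c x (fun s => ρ s • w s) where
  periodic s := by simp only [hρp s, hwp s]
  h1At s := by
    rcases h s with h | h
    · refine (H1At.const (0 : E) s).congr (h.mono fun r hr => ?_)
      simp [hr]
    · exact (hρ s).smul h.2
  eventually_eq_zero s hs := by
    rcases h s with h | h
    · exact h.mono fun r hr => by simp [hr]
    · exact absurd h.1 hs

theorem IsChartField.fieldCoord_eventuallyEq_zero' {c : LoopSpace E M} {x : M} {W : ℝ → E}
    (h : IsChartField c x W) {s : ℝ} (hs : W =ᶠ[𝓝 s] 0) (y : M) :
    fieldCoord c h.field y =ᶠ[𝓝 s] 0 := by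
  filter_upwards [hs] with r hr
  change chartCoord y (c r) (vecAt x (c r) (W r)) = 0
  rw [hr, Pi.zero_apply, vecAt_zero, chartCoord_zero]

theorem IsChartField.covDeriv_eq_zero {c : LoopSpace E M} {x : M} {W : ℝ → E}
    (h : IsChartField c x W) {s : ℝ} (hs : W =ᶠ[𝓝 s] 0)
    (hu : DifferentiableAt ℝ (extChartAt 𝓘(ℝ, E) (c s) ∘ c) s) : covDeriv c h.field s = 0 := by
  have h3 := h.fieldCoord_eventuallyEq_zero' hs (c s)
  have h4 : DifferentiableAt ℝ (fieldCoord c h.field (c s)) s :=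
    h3.differentiableAt_iff.2 (differentiableAt_const (0 : E))
  have h5 : deriv (fieldCoord c h.field (c s)) s = 0 := by
    rw [h3.deriv_eq]; exact deriv_const s (0 : E)
  have h6 := inner_covDeriv c.continuous.continuousAt (mem_chart_source E (c s)) hu h4
    (covDeriv c h.field s)
  rw [h5, h3.self_of_nhds, koszulForm_apply] at h6
  rw [← inner_self_eq_zero (𝕜 := ℝ), h6]
  simp

/-- The pointwise bound for ∇_s ξ is squared with (a + b)² ≤ 2(a² + b²) and integrated. The result
depends on the loop only through bounds on its energy and on the metric over the region visited, so
fixed coordinates `W` give fields of bounded norm along a whole sequence. -/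
theorem IsChartField.h1Norm_le {c : LoopSpace E M} {x : M} {W : ℝ → E}
    (h : IsChartField c x W) {A : Set E} {κ C : ℝ} (hκ : 0 < κ) (hC : 0 ≤ C)
    (hA : ∀ z ∈ A, (∀ v, κ * ‖v‖ ^ 2 ≤ chartMetric x z v v) ∧
      ‖(chartMetric x z : E →L[ℝ] E →L[ℝ] ℝ)‖ ≤ C ∧
      ‖fderiv ℝ (chartMetric x : E → E →L[ℝ] E →L[ℝ] ℝ) z‖ ≤ C)
    (hW : ∀ s, W =ᶠ[𝓝 s] 0 ∨ (c s ∈ (chartAt E x).source ∧ extChartAt 𝓘(ℝ, E) x (c s) ∈ A))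
    {w₀ D K : ℝ} (hw : ∀ s, ‖W s‖ ≤ w₀)
    (hD : ∫ s in (0 : ℝ)..1, ‖deriv W s‖ ^ 2 ≤ D)
    (hK : ∫ s in (0 : ℝ)..1, ‖velocity E c s‖ ^ 2 ≤ K) :
    h1Norm h.field ≤ Real.sqrt (C * w₀ ^ 2 + 8 * C ^ 2 * κ⁻¹ * (D + κ⁻¹ * w₀ ^ 2 * K)) := by
  have hw0 : 0 ≤ w₀ := (norm_nonneg _).trans (hw 0)
  refine Real.sqrt_le_sqrt (add_le_add ?_ ?_)
  · have h1 : ∀ s, ‖h.field s‖ ^ 2 ≤ C * w₀ ^ 2 := by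
      intro s
      rcases hW s with hs | ⟨hs, hz⟩
      · have : h.field s = 0 := by
          change vecAt x (c s) (W s) = 0
          rw [hs.self_of_nhds, Pi.zero_apply, vecAt_zero]
        rw [this, norm_zero, zero_pow two_ne_zero]
        positivity
      · rw [← real_inner_self_eq_norm_sq, inner_eq_chartMetric hs]
        have e : chartCoord x (c s) (h.field s) = W s := h.fieldCoord_eq hs
        rw [e]
        have e2 := (chartMetric x (extChartAt 𝓘(ℝ, E) x (c s)) :
          E →L[ℝ] E →L[ℝ] ℝ).le_opNorm₂ (W s) (W s)
        refine (le_abs_self _).trans (e2.trans ?_)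
        rw [sq, ← mul_assoc]
        gcongr
        · exact (hA _ hz).2.1
        · exact hw s
        · exact hw s
    rw [intervalIntegral.integral_of_le zero_le_one]
    calc ∫ s in Ioc (0 : ℝ) 1, ‖h.field s‖ ^ 2 ≤ ∫ s in Ioc (0 : ℝ) 1, C * w₀ ^ 2 :=
          integral_mono_of_nonneg (Eventually.of_forall fun s => by positivity)
            (integrable_const _) (Eventually.of_forall h1)
      _ = C * w₀ ^ 2 := by simp
  · have hWm : MemLp (deriv W) 2 (volume.restrict (Icc (0 : ℝ) 1)) :=
      (H1On.of_forall_h1At zero_le_one fun s _ => h.h1At s).memLp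
    have i1 : IntervalIntegrable (fun s => ‖deriv W s‖ ^ 2) volume 0 1 := by
      rw [intervalIntegrable_iff_integrableOn_Icc_of_le zero_le_one]
      exact hWm.integrable_norm_pow two_ne_zero
    have i2 := c.intervalIntegrable_sq_speed 0 1
    have h2 : ∀ᵐ s, ‖covDeriv c h.field s‖ ^ 2 ≤
        8 * C ^ 2 * κ⁻¹ * (‖deriv W s‖ ^ 2 + κ⁻¹ * w₀ ^ 2 * ‖velocity E c s‖ ^ 2) := by
      filter_upwards [c.ae_differentiableAt_chart, ae_differentiableAt_of_forall_h1At h.h1At]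
        with s h1 h2
      have hκi : 0 < κ⁻¹ := inv_pos.2 hκ
      rcases hW s with hs | ⟨hs, hz⟩
      · rw [h.covDeriv_eq_zero hs (h1 _ (mem_chart_source E (c s))), norm_zero,
          zero_pow two_ne_zero]
        positivity
      · have h3 := h.fieldCoord_eventuallyEq hs
        obtain ⟨a1, a2, a3⟩ := hA _ hz
        have h4 := norm_covDeriv_le hκ hC hs (h1 x hs) (h3.differentiableAt_iff.2 h2) a1 a2 a3
        rw [h3.deriv_eq, h.fieldCoord_eq hs] at h4
        have h5 : ‖covDeriv c h.field s‖ ≤ 2 * C * Real.sqrt κ⁻¹ *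
            (‖deriv W s‖ + Real.sqrt κ⁻¹ * ‖velocity E c s‖ * w₀) := by
          refine h4.trans ?_
          gcongr
          exact hw s
        have h6 := Real.sq_sqrt hκi.le
        calc ‖covDeriv c h.field s‖ ^ 2 ≤ (2 * C * Real.sqrt κ⁻¹ *
              (‖deriv W s‖ + Real.sqrt κ⁻¹ * ‖velocity E c s‖ * w₀)) ^ 2 := by gcongr
          _ = 4 * C ^ 2 * Real.sqrt κ⁻¹ ^ 2 *
              (‖deriv W s‖ + Real.sqrt κ⁻¹ * ‖velocity E c s‖ * w₀) ^ 2 := by ring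
          _ ≤ 4 * C ^ 2 * Real.sqrt κ⁻¹ ^ 2 *
              (2 * (‖deriv W s‖ ^ 2 + (Real.sqrt κ⁻¹ * ‖velocity E c s‖ * w₀) ^ 2)) := by
            gcongr; exact add_sq_le
          _ = 8 * C ^ 2 * Real.sqrt κ⁻¹ ^ 2 *
              (‖deriv W s‖ ^ 2 + Real.sqrt κ⁻¹ ^ 2 * w₀ ^ 2 * ‖velocity E c s‖ ^ 2) := by ring
          _ = _ := by rw [h6]
    have i3 : IntervalIntegrable (fun s => 8 * C ^ 2 * κ⁻¹ * (‖deriv W s‖ ^ 2 +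
        κ⁻¹ * w₀ ^ 2 * ‖velocity E c s‖ ^ 2)) volume 0 1 :=
      (i1.add (i2.const_mul _)).const_mul _
    calc ∫ s in (0 : ℝ)..1, ‖covDeriv c h.field s‖ ^ 2
        ≤ ∫ s in (0 : ℝ)..1, 8 * C ^ 2 * κ⁻¹ * (‖deriv W s‖ ^ 2 +
            κ⁻¹ * w₀ ^ 2 * ‖velocity E c s‖ ^ 2) := by
          rw [intervalIntegral.integral_of_le zero_le_one,
            intervalIntegral.integral_of_le zero_le_one]
          exact integral_mono_of_nonneg (Eventually.of_forall fun s => by positivity) i3.1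
            (ae_restrict_of_ae h2)
      _ = 8 * C ^ 2 * κ⁻¹ * ((∫ s in (0 : ℝ)..1, ‖deriv W s‖ ^ 2) +
            κ⁻¹ * w₀ ^ 2 * ∫ s in (0 : ℝ)..1, ‖velocity E c s‖ ^ 2) := by
          rw [intervalIntegral.integral_const_mul, intervalIntegral.integral_add i1
            (i2.const_mul _), intervalIntegral.integral_const_mul]
      _ ≤ _ := by gcongr

/-- The zero vector field. -/
theorem isChartField_zero (c : LoopSpace E M) : IsChartField c (c 0) (0 : ℝ → E) where
  periodic _ := rfl
  h1At s := H1At.const 0 s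
  eventually_eq_zero _ _ := EventuallyEq.rfl

/-- Together with the vanishing of `actionDiff` on the zero field, this isolates the τ-direction in
the Palais–Smale condition. -/
theorem h1Norm_zero_field (c : LoopSpace E M) : h1Norm (isChartField_zero c).field = 0 := by
  have h1 : ∀ s, (isChartField_zero c).field s = 0 := fun s => vecAt_zero _ _
  have h2 : ∫ s in (0 : ℝ)..1, ‖covDeriv c (isChartField_zero c).field s‖ ^ 2 = 0 := by
    rw [intervalIntegral.integral_congr_ae (g := fun _ => 0)]
    · simp
    · filter_upwards [c.ae_differentiableAt_chart] with s hs _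
      rw [(isChartField_zero c).covDeriv_eq_zero EventuallyEq.rfl (hs _ (mem_chart_source E (c s)))]
      simp
  rw [h1Norm, h2]
  simp [h1]

theorem actionDiff_zero_field {V : M → ℝ} (hV : ContMDiff 𝓘(ℝ, E) 𝓘(ℝ, ℝ) ∞ V) (τ : ℝ)
    (c : LoopSpace E M) : actionDiff V τ c (isChartField_zero c).field = 0 := by
  rw [(isChartField_zero c).actionDiff_eq hV τ (s₀ := 0) (δ := 0) (by norm_num)
    (fun _ _ _ => EventuallyEq.rfl)]
  simp

end ChartFields

/-! ### Bounds for the period and the energy -/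

section PalaisSmaleBounds

variable {E : Type*} [NormedAddCommGroup E] [NormedSpace ℝ E] [FiniteDimensional ℝ E]
  {M : Type*} [MetricSpace M] [ChartedSpace E M] [IsManifold 𝓘(ℝ, E) ∞ M]
  [RiemannianBundle (fun x : M => TangentSpace 𝓘(ℝ, E) x)]
  [IsContMDiffRiemannianBundle 𝓘(ℝ, E) ∞ E (fun x : M => TangentSpace 𝓘(ℝ, E) x)]
  [IsRiemannianManifold 𝓘(ℝ, E) M]

/-- The Palais–Smale condition is separated by testing on (ξ, 0) and on (0, 1). -/
theorem IsPalaisSmaleSeq.eventually_le {V : M → ℝ} (hV : ContMDiff 𝓘(ℝ, E) 𝓘(ℝ, ℝ) ∞ V)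
    {ε a₁ a₂ : ℝ} {p : ℕ → LoopSpace E M × ℝ}
    (hp : IsPalaisSmaleSeq (penalizedAction V ε) a₁ a₂ p) {δ : ℝ} (hδ : 0 < δ) :
    ∀ᶠ n in atTop, (∀ ξ : LoopTangent (p n).1,
      |actionDiff V (p n).2 (p n).1 ξ| ≤ δ * h1Norm ξ) ∧ |actionDiffTau V ε (p n)| ≤ δ := by
  filter_upwards [hp.differential_tendsto_zero δ hδ] with n hn
  constructor
  · intro ξ
    simpa using hn ξ 0 _ (hasDifferential_penalizedAction hV ε (p n) ξ 0)
  · have := hn _ 1 _ (hasDifferential_penalizedAction hV ε (p n) (isChartField_zero (p n).1).field 1)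
    rw [h1Norm_zero_field, actionDiff_zero_field hV] at this
    simpa using this

/-- Along a Palais-Smale sequence, the period and the energy are bounded. -/
theorem IsPalaisSmaleSeq.exists_bounds {V : M → ℝ} (hV : ContMDiff 𝓘(ℝ, E) 𝓘(ℝ, ℝ) ∞ V)
    {ε a₁ a₂ : ℝ} (hε : 0 < ε) {p : ℕ → LoopSpace E M × ℝ}
    (hp : IsPalaisSmaleSeq (penalizedAction V ε) a₁ a₂ p) :
    ∃ T K : ℝ, ∀ᶠ n in atTop, |(p n).2| ≤ T ∧
      ∫ s in (0 : ℝ)..1, ‖velocity E (p n).1 s‖ ^ 2 ≤ K := by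
  set B := a₂ + 1
  refine ⟨max (B / (2 * ε)) (2 * (2 * B / ε)), B * Real.exp (max (B / (2 * ε)) (2 * (2 * B / ε))), ?_⟩
  filter_upwards [hp.eventually_le hV one_pos] with n ⟨_, hn⟩
  have h1 := hp.action_le n
  have h2 := (abs_le.1 hn).1
  simp only [penalizedAction, action] at h1
  simp only [actionDiffTau] at h2
  set τ := (p n).2
  set K := ∫ s in (0 : ℝ)..1, ‖velocity E (p n).1 s‖ ^ 2
  set P := Real.exp τ * ∫ s in (0 : ℝ)..1, V ((p n).1 s)
  have hK : 0 ≤ K := intervalIntegral.integral_nonneg zero_le_one fun s _ => by positivity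
  have e1 := Real.exp_pos (-τ)
  have e2 := Real.exp_pos (τ / 2)
  -- The action minus its τ-derivative. The potential term has dropped out and all remaining terms
  -- are nonnegative, so each is bounded: e^{-τ} bounds τ below, e^{τ/2} bounds it above.
  have key : Real.exp (-τ) * K + ε * (2 * Real.exp (-τ) + Real.exp (τ / 2) / 2) ≤ B := by
    simp only [B]
    linarith
  have h3 : 0 ≤ Real.exp (-τ) * K := by positivity
  have h4 : 0 < ε * Real.exp (-τ) := by positivity
  have h5 : 0 < ε * Real.exp (τ / 2) := by positivity
  have h6 : Real.exp (-τ) ≤ B / (2 * ε) := by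
    rw [le_div_iff₀ (by positivity)]; linarith
  have h7 : Real.exp (τ / 2) ≤ 2 * B / ε := by
    rw [le_div_iff₀ hε]; linarith
  have h8 := Real.add_one_le_exp (-τ)
  have h9 := Real.add_one_le_exp (τ / 2)
  have h10 : |τ| ≤ max (B / (2 * ε)) (2 * (2 * B / ε)) := by
    rw [abs_le]
    constructor
    · linarith [le_max_left (B / (2 * ε)) (2 * (2 * B / ε))]
    · linarith [le_max_right (B / (2 * ε)) (2 * (2 * B / ε))]
  refine ⟨h10, ?_⟩
  have h11 : K = Real.exp (-τ) * K * Real.exp τ := by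
    rw [mul_right_comm, ← Real.exp_add, neg_add_cancel, Real.exp_zero, one_mul]
  have h12 : Real.exp (-τ) * K ≤ B := by linarith
  rw [h11]
  exact mul_le_mul h12 (Real.exp_le_exp.2 ((le_abs_self τ).trans h10)) (Real.exp_pos _).le
    (h3.trans h12)

end PalaisSmaleBounds

/-! ### Coercivity of the difference of two first variations -/

section LocalEnergy

/-- Here z₁, z₂ are the coordinates of two loops, p, q their derivatives, ρ the cut-off and ρ' its
derivative, so that ρ(p - q) + ρ'(z₁ - z₂) is the derivative of the test field. The leading term
ρG(z₁)(p - q, p - q) is coercive. Every other term contains z₁ - z₂, explicitly or through G(z₁) -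
G(z₂), which the mean value inequality on the convex set A bounds by Cd. -/
theorem energy_density_le {E : Type*} [NormedAddCommGroup E] [NormedSpace ℝ E]
    {G : E → E →L[ℝ] E →L[ℝ] ℝ} {A : Set E} (hA : Convex ℝ A) {κ C : ℝ} (hC : 0 ≤ C)
    (hG : ∀ z ∈ A, DifferentiableAt ℝ G z)
    (hb : ∀ z ∈ A, (∀ v, κ * ‖v‖ ^ 2 ≤ G z v v) ∧ ‖G z‖ ≤ C ∧ ‖fderiv ℝ G z‖ ≤ C)
    {z₁ z₂ p q : E} (h₁ : z₁ ∈ A) (h₂ : z₂ ∈ A) {ρ ρ' d : ℝ} (hρ0 : 0 ≤ ρ) (hρ1 : ρ ≤ 1)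
    (hρ' : |ρ'| ≤ 1) (hd : ‖z₁ - z₂‖ ≤ d) :
    κ * (ρ * ‖p - q‖ ^ 2) ≤
      (G z₁ (ρ • (p - q) + ρ' • (z₁ - z₂)) p +
        (1 / 2 : ℝ) * fderiv ℝ G z₁ (ρ • (z₁ - z₂)) p p) -
      (G z₂ (ρ • (p - q) + ρ' • (z₁ - z₂)) q +
        (1 / 2 : ℝ) * fderiv ℝ G z₂ (ρ • (z₁ - z₂)) q q) +
      3 * C * d * (1 + ‖p‖ ^ 2 + ‖q‖ ^ 2) := by
  have hd0 : 0 ≤ d := (norm_nonneg _).trans hd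
  obtain ⟨a1, a2, a3⟩ := hb _ h₁
  obtain ⟨b1, b2, b3⟩ := hb _ h₂
  set y := z₁ - z₂
  have hLip : ‖G z₁ - G z₂‖ ≤ C * d := by
    refine (hA.norm_image_sub_le_of_norm_fderiv_le (fun z hz => hG z hz)
      (fun z hz => (hb z hz).2.2) h₂ h₁).trans ?_
    gcongr
  have e1 : κ * (ρ * ‖p - q‖ ^ 2) ≤ ρ * G z₁ (p - q) (p - q) := by
    have := mul_le_mul_of_nonneg_left (a1 (p - q)) hρ0
    linarith
  have e2 : |ρ * (G z₁ - G z₂) (p - q) q| ≤ C * d * ((‖p‖ + ‖q‖) * ‖q‖) := by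
    rw [abs_mul, abs_of_nonneg hρ0]
    have h3 := (G z₁ - G z₂).le_opNorm₂ (p - q) q
    calc ρ * |(G z₁ - G z₂) (p - q) q| ≤ 1 * (‖G z₁ - G z₂‖ * ‖p - q‖ * ‖q‖) := by
          gcongr; exact h3
      _ ≤ 1 * (C * d * (‖p‖ + ‖q‖) * ‖q‖) := by gcongr; exact norm_sub_le _ _
      _ = _ := by ring
  have e3 : ∀ z v, ‖G z‖ ≤ C → |ρ' * G z y v| ≤ C * d * ‖v‖ := by
    intro z v hz
    rw [abs_mul]
    have h3 := (G z).le_opNorm₂ y v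
    calc |ρ'| * |G z y v| ≤ 1 * (‖G z‖ * ‖y‖ * ‖v‖) := by gcongr; exact h3
      _ ≤ 1 * (C * d * ‖v‖) := by gcongr
      _ = _ := by ring
  have e4 : ∀ z v, ‖fderiv ℝ G z‖ ≤ C → |ρ * fderiv ℝ G z y v v| ≤ C * d * ‖v‖ ^ 2 := by
    intro z v hz
    rw [abs_mul, abs_of_nonneg hρ0]
    have h3 := (fderiv ℝ G z y).le_opNorm₂ v v
    have h4 := (fderiv ℝ G z).le_opNorm y
    calc ρ * |fderiv ℝ G z y v v| ≤ 1 * (‖fderiv ℝ G z y‖ * ‖v‖ * ‖v‖) := by gcongr; exact h3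
      _ ≤ 1 * (C * d * ‖v‖ * ‖v‖) := by gcongr; exact h4.trans (by gcongr)
      _ = _ := by ring
  have f1 := (abs_le.1 (e3 z₁ p a2)).1
  have f2 := (abs_le.1 (e3 z₂ q b2)).2
  have f3 := (abs_le.1 (e4 z₁ p a3)).1
  have f4 := (abs_le.1 (e4 z₂ q b3)).2
  have f5 := (abs_le.1 e2).1
  have hCd : 0 ≤ C * d := by positivity
  have g1 : C * d * ‖p‖ + C * d * ‖q‖ + (C * d * ‖p‖ ^ 2 + C * d * ‖q‖ ^ 2) / 2 +
      C * d * ((‖p‖ + ‖q‖) * ‖q‖) ≤ 3 * C * d * (1 + ‖p‖ ^ 2 + ‖q‖ ^ 2) := by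
    have : ‖p‖ + ‖q‖ + (‖p‖ ^ 2 + ‖q‖ ^ 2) / 2 + (‖p‖ + ‖q‖) * ‖q‖ ≤
        3 * (1 + ‖p‖ ^ 2 + ‖q‖ ^ 2) := by
      nlinarith [sq_nonneg (‖p‖ - 1), sq_nonneg (‖q‖ - 1), sq_nonneg (‖p‖ - ‖q‖)]
    have := mul_le_mul_of_nonneg_left this hCd
    linarith
  -- The leading pair comes from G(z₁)(p - q, p) - G(z₂)(p - q, q) = G(z₁)(p - q, p - q) + (G(z₁) -
  -- G(z₂))(p - q, q).
  have key : (G z₁ (ρ • (p - q) + ρ' • y) p + (1 / 2 : ℝ) * fderiv ℝ G z₁ (ρ • y) p p) -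
      (G z₂ (ρ • (p - q) + ρ' • y) q + (1 / 2 : ℝ) * fderiv ℝ G z₂ (ρ • y) q q) =
      ρ * G z₁ (p - q) (p - q) + ρ * (G z₁ - G z₂) (p - q) q + ρ' * G z₁ y p - ρ' * G z₂ y q +
      (1 / 2) * (ρ * fderiv ℝ G z₁ y p p) - (1 / 2) * (ρ * fderiv ℝ G z₂ y q q) := by
    simp only [map_add, map_smul, map_sub, add_apply, smul_apply, sub_apply, smul_eq_mul]
    ring
  rw [key]
  linarith

variable {E : Type*} [NormedAddCommGroup E] [NormedSpace ℝ E] [FiniteDimensional ℝ E]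

theorem integrable_varDensity {G : E → E →L[ℝ] E →L[ℝ] ℝ} {A : Set E} {u W : ℝ → E} {a b : ℝ}
    (hab : a ≤ b) (hG : ∀ z ∈ A, ContDiffAt ℝ 1 G z) (hu : H1On u a b) (huA : MapsTo u (Icc a b) A)
    (hW : H1On W a b) : Integrable (varDensity E G u W) (volume.restrict (Icc a b)) := by
  have c1 : ContinuousOn (fun s => G (u s)) (Icc a b) := fun s hs =>
    (hG _ (huA hs)).continuousAt.comp_continuousWithinAt (hu.continuousOn hab s hs)
  have c2 : ContinuousOn (fun s => fderiv ℝ G (u s)) (Icc a b) := fun s hs =>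
    ContinuousAt.comp_continuousWithinAt (f := u)
      ((hG _ (huA hs)).fderiv_right (m := 0) (by simp)).continuousAt (hu.continuousOn hab s hs)
  exact (integrable_bilin_of_continuousOn c1 hW.memLp hu.memLp).add
    ((integrable_bilin_of_continuousOn (c2.clm_apply (hW.continuousOn hab)) hu.memLp hu.memLp).const_mul
      (1 / 2))

theorem integral_energy_le {G : E → E →L[ℝ] E →L[ℝ] ℝ} {A : Set E} (hA : Convex ℝ A) {κ C : ℝ}
    (hC : 0 ≤ C) (hG : ∀ z ∈ A, ContDiffAt ℝ 1 G z)
    (hb : ∀ z ∈ A, (∀ v, κ * ‖v‖ ^ 2 ≤ G z v v) ∧ ‖G z‖ ≤ C ∧ ‖fderiv ℝ G z‖ ≤ C)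
    {u₁ u₂ : ℝ → E} {a b : ℝ} (hab : a ≤ b) (h₁ : H1On u₁ a b) (h₂ : H1On u₂ a b)
    (h₁A : MapsTo u₁ (Icc a b) A) (h₂A : MapsTo u₂ (Icc a b) A) {ρ : ℝ → ℝ}
    (hρ : LipschitzWith 1 ρ) (hρ0 : ∀ s, 0 ≤ ρ s) (hρ1 : ∀ s, ρ s ≤ 1) {d : ℝ}
    (hd : ∀ s ∈ Icc a b, ‖u₁ s - u₂ s‖ ≤ d)
    (hW : H1On (fun s => ρ s • (u₁ s - u₂ s)) a b) {K : ℝ}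
    (hK₁ : ∫ s in Icc a b, ‖deriv u₁ s‖ ^ 2 ≤ K) (hK₂ : ∫ s in Icc a b, ‖deriv u₂ s‖ ^ 2 ≤ K) :
    κ * ∫ s in Icc a b, ρ s * ‖deriv u₁ s - deriv u₂ s‖ ^ 2 ≤
      (∫ s in Icc a b, varDensity E G u₁ (fun s => ρ s • (u₁ s - u₂ s)) s) -
      (∫ s in Icc a b, varDensity E G u₂ (fun s => ρ s • (u₁ s - u₂ s)) s) +
      3 * C * d * ((b - a) + 2 * K) := by
  set W := fun s => ρ s • (u₁ s - u₂ s) with hWdef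
  have i1 := integrable_varDensity hab hG h₁ h₁A hW
  have i2 := integrable_varDensity hab hG h₂ h₂A hW
  have i3 := h₁.memLp.integrable_norm_pow two_ne_zero
  have i4 := h₂.memLp.integrable_norm_pow two_ne_zero
  have hd0 : 0 ≤ d := (norm_nonneg _).trans (hd a (left_mem_Icc.2 hab))
  have i5 : Integrable (fun s => varDensity E G u₁ W s - varDensity E G u₂ W s +
      3 * C * d * (1 + ‖deriv u₁ s‖ ^ 2 + ‖deriv u₂ s‖ ^ 2)) (volume.restrict (Icc a b)) :=
    (i1.sub i2).add ((((integrable_const (1 : ℝ)).add i3).add i4).const_mul (3 * C * d))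
  have hρd : ∀ᵐ s, DifferentiableAt ℝ ρ s := hρ.ae_differentiableAt
  have i6 : Integrable (fun s => κ * (ρ s * ‖deriv u₁ s - deriv u₂ s‖ ^ 2))
      (volume.restrict (Icc a b)) := by
    refine Integrable.const_mul ?_ κ
    refine Integrable.bdd_mul (c := 1) ((h₁.memLp.sub h₂.memLp).integrable_norm_pow two_ne_zero)
      hρ.continuous.aestronglyMeasurable (Eventually.of_forall fun s => ?_)
    rw [Real.norm_of_nonneg (hρ0 s)]
    exact hρ1 s
  have key : ∀ᵐ s ∂volume.restrict (Icc a b), κ * (ρ s * ‖deriv u₁ s - deriv u₂ s‖ ^ 2) ≤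
      varDensity E G u₁ W s - varDensity E G u₂ W s +
      3 * C * d * (1 + ‖deriv u₁ s‖ ^ 2 + ‖deriv u₂ s‖ ^ 2) := by
    filter_upwards [ae_restrict_of_ae hρd, h₁.ae_differentiableAt hab, h₂.ae_differentiableAt hab,
      ae_restrict_mem measurableSet_Icc] with s e1 e2 e3 e4
    have e5 : deriv W s = ρ s • (deriv u₁ s - deriv u₂ s) + deriv ρ s • (u₁ s - u₂ s) :=
      (e1.hasDerivAt.smul (e2.hasDerivAt.sub e3.hasDerivAt)).deriv
    have e6 : |deriv ρ s| ≤ 1 := by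
      simpa using norm_deriv_le_of_lipschitz hρ (x₀ := s)
    have := energy_density_le hA hC (fun z hz => (hG z hz).differentiableAt one_ne_zero) hb
      (p := deriv u₁ s) (q := deriv u₂ s) (h₁A e4) (h₂A e4) (hρ0 s) (hρ1 s) e6 (hd s e4)
    simp only [varDensity, e5]
    exact this
  rw [← integral_const_mul]
  refine (integral_mono_ae i6 i5 key).trans ?_
  have e7 : ∫ s in Icc a b, (varDensity E G u₁ W s - varDensity E G u₂ W s +
      3 * C * d * (1 + ‖deriv u₁ s‖ ^ 2 + ‖deriv u₂ s‖ ^ 2)) =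
      (∫ s in Icc a b, varDensity E G u₁ W s) - (∫ s in Icc a b, varDensity E G u₂ W s) +
      3 * C * d * ((b - a) + (∫ s in Icc a b, ‖deriv u₁ s‖ ^ 2) +
        ∫ s in Icc a b, ‖deriv u₂ s‖ ^ 2) := by
    have j1 := integral_sub i1 i2
    have j2 := integral_add (integrable_const (1 : ℝ)) i3
    have j3 := integral_add (show Integrable (fun s => _ + _) _ from (integrable_const (1 : ℝ)).add i3) i4
    have j4 := integral_add (show Integrable (fun s => _ - _) _ from i1.sub i2)
      (show Integrable (fun s => _) _ from
        (((integrable_const (1 : ℝ)).add i3).add i4).const_mul (3 * C * d))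
    refine j4.trans ?_
    rw [j1, integral_const_mul]
    refine congrArg₂ _ rfl (congrArg₂ _ rfl (j3.trans ?_))
    rw [j2]
    simp [hab]
  rw [e7]
  have : 0 ≤ 3 * C * d := by positivity
  refine add_le_add le_rfl (mul_le_mul_of_nonneg_left ?_ this)
  linarith

end LocalEnergy

/-! ### Gradient, Hessian and the normalized gradient field -/

section Gradient

variable {E : Type*} [NormedAddCommGroup E] [NormedSpace ℝ E] [FiniteDimensional ℝ E]
  {M : Type*} [MetricSpace M] [ChartedSpace E M] [IsManifold 𝓘(ℝ, E) ∞ M]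
  [RiemannianBundle (fun x : M => TangentSpace 𝓘(ℝ, E) x)]
  [IsContMDiffRiemannianBundle 𝓘(ℝ, E) ∞ E (fun x : M => TangentSpace 𝓘(ℝ, E) x)]
  [IsRiemannianManifold 𝓘(ℝ, E) M]

theorem exists_equiv_of_pos {B : E →L[ℝ] E →L[ℝ] ℝ} (h : ∀ v, v ≠ 0 → 0 < B v v) :
    ∃ e : E ≃L[ℝ] (E →L[ℝ] ℝ), (e : E →L[ℝ] E →L[ℝ] ℝ) = B := by
  have hinj : Function.Injective (B : E →ₗ[ℝ] (E →L[ℝ] ℝ)) := by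
    refine (injective_iff_map_eq_zero _).2 fun v hv => ?_
    by_contra hne
    have := h v hne
    rw [show B v = 0 from hv] at this
    simp at this
  have hfin : Module.finrank ℝ E = Module.finrank ℝ (E →L[ℝ] ℝ) := by
    rw [← (LinearMap.toContinuousLinearMap (𝕜 := ℝ) (E := E) (F' := ℝ)).finrank_eq]
    exact (Subspace.dual_finrank_eq (K := ℝ) (V := E)).symm
  have : FiniteDimensional ℝ (E →L[ℝ] ℝ) :=
    LinearEquiv.finiteDimensional (LinearMap.toContinuousLinearMap (𝕜 := ℝ) (E := E) (F' := ℝ))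
  refine ⟨(LinearEquiv.ofInjectiveOfFinrankEq _ hinj hfin).toContinuousLinearEquiv, ?_⟩
  ext v w
  rfl

/-- The coordinates in the chart at `x` of the gradient of `V`. -/
def gradCoord (V : M → ℝ) (x : M) (z : E) : E :=
  ContinuousLinearMap.inverse (chartMetric x z : E →L[ℝ] E →L[ℝ] ℝ)
    (fderiv ℝ (V ∘ (extChartAt 𝓘(ℝ, E) x).symm) z)

theorem chartMetric_gradCoord (V : M → ℝ) {x : M} {z : E}
    (hz : z ∈ (extChartAt 𝓘(ℝ, E) x).target) :
    chartMetric x z (gradCoord V x z) = fderiv ℝ (V ∘ (extChartAt 𝓘(ℝ, E) x).symm) z := by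
  obtain ⟨e, he⟩ := exists_equiv_of_pos (B := chartMetric x z) fun v hv => chartMetric_pos hz hv
  rw [gradCoord, ← he, ContinuousLinearMap.inverse_equiv]
  exact e.apply_symm_apply _

/-- Inversion of continuous linear maps is smooth at invertible ones, and the metric is invertible
by positivity. -/
theorem contDiffAt_gradCoord {V : M → ℝ} (hV : ContMDiff 𝓘(ℝ, E) 𝓘(ℝ, ℝ) ∞ V) {x : M} {z : E}
    (hz : z ∈ (extChartAt 𝓘(ℝ, E) x).target) : ContDiffAt ℝ 1 (gradCoord V x) z := by
  obtain ⟨e, he⟩ := exists_equiv_of_pos (B := chartMetric x z) fun v hv => chartMetric_pos hz hv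
  have : CompleteSpace E := FiniteDimensional.complete ℝ E
  have h1 : ContDiffAt ℝ 1 (fun z => ContinuousLinearMap.inverse
      (chartMetric x z : E →L[ℝ] E →L[ℝ] ℝ)) z := by
    have h2 := contDiffAt_map_inverse (𝕜 := ℝ) (n := 1) e
    rw [he] at h2
    exact h2.comp z ((contDiffAt_chartMetric_of_mem_target hz).of_le (by simp))
  have h2 : ContDiffAt ℝ 1 (fderiv ℝ (V ∘ (extChartAt 𝓘(ℝ, E) x).symm)) z :=
    (contDiffAt_chart hV hz).fderiv_right (m := 1) (by norm_cast)
  exact h1.clm_apply h2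

theorem inner_gradient (V : M → ℝ) (q : M) (v : TangentSpace 𝓘(ℝ, E) q) :
    inner ℝ (gradient V q : TangentSpace 𝓘(ℝ, E) q) v = dPot E V q v :=
  inner_riesz q _ v

theorem chartCoord_gradient {V : M → ℝ} (hV : ContMDiff 𝓘(ℝ, E) 𝓘(ℝ, ℝ) ∞ V) {x q : M}
    (hq : q ∈ (chartAt E x).source) :
    chartCoord x q (gradient V q) = gradCoord V x (extChartAt 𝓘(ℝ, E) x q) := by
  have hz : extChartAt 𝓘(ℝ, E) x q ∈ (extChartAt 𝓘(ℝ, E) x).target :=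
    (extChartAt 𝓘(ℝ, E) x).map_source (by rwa [extChartAt_source])
  have h1 : chartMetric x (extChartAt 𝓘(ℝ, E) x q)
      (chartCoord x q (gradient V q) - gradCoord V x (extChartAt 𝓘(ℝ, E) x q)) = 0 := by
    rw [map_sub, chartMetric_gradCoord V hz, sub_eq_zero]
    ext v
    obtain ⟨w, rfl⟩ := exists_chartCoord_eq hq v
    rw [← inner_eq_chartMetric hq, inner_gradient, dPot_eq_fderiv hV hq]
  by_contra hne
  have h2 := chartMetric_pos hz (sub_ne_zero.2 hne)
  rw [h1] at h2
  simp at h2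

/-- In coordinates this is ⟨∇_v grad f, y⟩ = Hess f(v, y). It comes from differentiating G(X) = df,
because the two Christoffel terms add up to ∂_v G(X, y), that is, the connection is metric. -/
theorem fderiv_gradient_field {G : E → E →L[ℝ] E →L[ℝ] ℝ} {f : E → ℝ} {X : E → E} {z : E}
    (hG : DifferentiableAt ℝ G z) (hsymm : ∀ z v w, G z v w = G z w v)
    (hX : DifferentiableAt ℝ X z) (h : ∀ᶠ y in 𝓝 z, G y (X y) = fderiv ℝ f y) (v y : E) :
    G z (fderiv ℝ X z v) y + koszulForm G z v (X z) y =
      fderiv ℝ (fderiv ℝ f) z v y - koszulForm G z v y (X z) := by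
  have h1 : fderiv ℝ (fderiv ℝ f) z = fderiv ℝ (fun y => G y (X y)) z :=
    (EventuallyEq.fderiv_eq h).symm
  have h2 := (hG.hasFDerivAt.clm_apply hX.hasFDerivAt).fderiv
  rw [h1, h2]
  simp only [koszulForm_apply, add_apply, ContinuousLinearMap.comp_apply,
    ContinuousLinearMap.flip_apply]
  rw [fderiv_bilin_symm hG hsymm v y (X z)]
  ring

/-- The correction dV(Γ(v, w)) equals ⟨grad V, Γ(v, w)⟩, and Γ(v, w) represents the Koszul form. -/
theorem hessian_eq {V : M → ℝ} (hV : ContMDiff 𝓘(ℝ, E) 𝓘(ℝ, ℝ) ∞ V) (q : M)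
    (v w : TangentSpace 𝓘(ℝ, E) q) : hessian V q v w =
      fderiv ℝ (fderiv ℝ (V ∘ (extChartAt 𝓘(ℝ, E) q).symm)) (extChartAt 𝓘(ℝ, E) q q)
        (chartCoord q q v) (chartCoord q q w) -
      koszulForm (chartMetric q : E → E →L[ℝ] E →L[ℝ] ℝ) (extChartAt 𝓘(ℝ, E) q q)
        (chartCoord q q v) (chartCoord q q w) (chartCoord q q (gradient V q)) := by
  have h1 : fderiv ℝ (V ∘ (extChartAt 𝓘(ℝ, E) q).symm) (extChartAt 𝓘(ℝ, E) q q)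
      (chartCoord q q (christoffel q v w)) =
      koszulForm (chartMetric q : E → E →L[ℝ] E →L[ℝ] ℝ) (extChartAt 𝓘(ℝ, E) q q)
        (chartCoord q q v) (chartCoord q q w) (chartCoord q q (gradient V q)) := by
    rw [← dPot_eq_fderiv hV (mem_chart_source E q), ← inner_gradient, real_inner_comm, christoffel,
      inner_riesz, chartCoord_self, chartCoord_self, chartCoord_self]
    rfl
  rw [← h1, chartCoord_self, chartCoord_self, chartCoord_self]
  rfl

theorem hessian_smul {V : M → ℝ} (hV : ContMDiff 𝓘(ℝ, E) 𝓘(ℝ, ℝ) ∞ V) (q : M) (a b : ℝ)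
    (v w : TangentSpace 𝓘(ℝ, E) q) : hessian V q (a • v) (b • w) = a * b * hessian V q v w := by
  rw [hessian_eq hV, hessian_eq hV, map_smul, map_smul, koszulForm_apply, koszulForm_apply]
  simp only [map_smul, smul_apply, smul_eq_mul]
  ring

theorem exists_norm_chartCoord_le {x q : M} (hq : q ∈ (chartAt E x).source) :
    ∃ L : ℝ, 0 ≤ L ∧ ∀ v : TangentSpace 𝓘(ℝ, E) q, ‖chartCoord x q v‖ ≤ L * ‖v‖ := by
  obtain ⟨κ, hκ, C, hC, h⟩ := exists_chartMetric_bounds (x := x)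
    (isCompact_singleton (x := extChartAt 𝓘(ℝ, E) x q))
    (singleton_subset_iff.2 ((extChartAt 𝓘(ℝ, E) x).map_source (by rwa [extChartAt_source])))
  refine ⟨Real.sqrt κ⁻¹, Real.sqrt_nonneg _, fun v => ?_⟩
  have h1 := (h _ rfl).1 (chartCoord x q v)
  rw [← inner_eq_chartMetric hq, real_inner_self_eq_norm_sq] at h1
  rw [← Real.sqrt_sq (norm_nonneg v), ← Real.sqrt_mul (by positivity)]
  refine Real.le_sqrt_of_sq_le ?_
  rw [← div_eq_inv_mul, le_div_iff₀ hκ]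
  linarith

theorem abs_koszulForm_le (G : E → E →L[ℝ] E →L[ℝ] ℝ) (z v w u : E) :
    |koszulForm G z v w u| ≤ 3 / 2 * ‖fderiv ℝ G z‖ * ‖v‖ * ‖w‖ * ‖u‖ := by
  have h : ∀ a b d : E, |fderiv ℝ G z a b d| ≤ ‖fderiv ℝ G z‖ * ‖a‖ * ‖b‖ * ‖d‖ := fun a b d => by
    refine ((fderiv ℝ G z a).le_opNorm₂ b d).trans ?_
    gcongr
    exact (fderiv ℝ G z).le_opNorm a
  have a1 := abs_le.1 (h v w u)
  have a2 := abs_le.1 (h w v u)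
  have a3 := abs_le.1 (h u v w)
  rw [koszulForm_apply, abs_le]
  constructor
  · linarith [a1.1, a2.1, a3.2]
  · linarith [a1.2, a2.2, a3.1]

/-- The supremum of an unbounded set of reals is zero by convention, so boundedness is what makes
`hessianNorm` an actual bound for the Hessian. -/
theorem bddAbove_hessian {V : M → ℝ} (hV : ContMDiff 𝓘(ℝ, E) 𝓘(ℝ, ℝ) ∞ V) (q : M) :
    BddAbove {r : ℝ | ∃ v w : TangentSpace 𝓘(ℝ, E) q, ‖v‖ = 1 ∧ ‖w‖ = 1 ∧
      r = |hessian V q v w|} := by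
  obtain ⟨L, hL0, hL⟩ := exists_norm_chartCoord_le (E := E) (mem_chart_source E q)
  set G : E → E →L[ℝ] E →L[ℝ] ℝ := chartMetric q
  set z := extChartAt 𝓘(ℝ, E) q q
  set H := fderiv ℝ (fderiv ℝ (V ∘ (extChartAt 𝓘(ℝ, E) q).symm)) z
  set X : E := chartCoord q q (gradient V q)
  refine ⟨‖H‖ * L * L + 3 / 2 * ‖fderiv ℝ G z‖ * L * L * ‖X‖, ?_⟩
  rintro r ⟨v, w, hv, hw, rfl⟩
  have h1 := hL v
  have h2 := hL w
  rw [hv, mul_one] at h1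
  rw [hw, mul_one] at h2
  rw [hessian_eq hV]
  refine (abs_sub _ _).trans (add_le_add ?_ ?_)
  · refine (H.le_opNorm₂ _ _).trans ?_
    gcongr
  · refine (abs_koszulForm_le G z _ _ _).trans ?_
    gcongr

theorem abs_hessian_le {V : M → ℝ} (hV : ContMDiff 𝓘(ℝ, E) 𝓘(ℝ, ℝ) ∞ V) (q : M)
    (v w : TangentSpace 𝓘(ℝ, E) q) : |hessian V q v w| ≤ hessianNorm E V q * ‖v‖ * ‖w‖ := by
  rcases eq_or_ne v 0 with rfl | hv
  · have := hessian_smul hV q 0 1 (0 : TangentSpace 𝓘(ℝ, E) q) w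
    rw [smul_zero, one_smul, zero_mul, zero_mul] at this
    rw [this]
    simp
  rcases eq_or_ne w 0 with rfl | hw
  · have := hessian_smul hV q 1 0 v (0 : TangentSpace 𝓘(ℝ, E) q)
    rw [smul_zero, one_smul, mul_zero, zero_mul] at this
    rw [this]
    simp
  have hv' : 0 < ‖v‖ := norm_pos_iff.2 hv
  have hw' : 0 < ‖w‖ := norm_pos_iff.2 hw
  have h1 : |hessian V q (‖v‖⁻¹ • v) (‖w‖⁻¹ • w)| ≤ hessianNorm E V q := by
    refine le_csSup (bddAbove_hessian hV q) ⟨_, _, ?_, ?_, rfl⟩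
    · rw [norm_smul, norm_inv, norm_norm, inv_mul_cancel₀ hv'.ne']
    · rw [norm_smul, norm_inv, norm_norm, inv_mul_cancel₀ hw'.ne']
  rw [hessian_smul hV, abs_mul, abs_of_pos (by positivity), ← mul_inv, inv_mul_le_iff₀ (by positivity)]
    at h1
  linarith


/-- The normalized gradient of `V`. -/
def unitGrad (E : Type*) [NormedAddCommGroup E] [NormedSpace ℝ E] [FiniteDimensional ℝ E]
    {M : Type*} [MetricSpace M] [ChartedSpace E M]
    [RiemannianBundle (fun x : M => TangentSpace 𝓘(ℝ, E) x)] (V : M → ℝ) (q : M) :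
    TangentSpace 𝓘(ℝ, E) q :=
  (‖(gradient V q : TangentSpace 𝓘(ℝ, E) q)‖)⁻¹ • gradient V q

theorem norm_unitGrad {V : M → ℝ} {q : M} (h : (gradient V q : TangentSpace 𝓘(ℝ, E) q) ≠ 0) :
    ‖unitGrad E V q‖ = 1 := by
  rw [unitGrad, norm_smul, norm_inv, norm_norm, inv_mul_cancel₀ (norm_ne_zero_iff.2 h)]

theorem dPot_unitGrad (V : M → ℝ) (q : M) :
    dPot E V q (unitGrad E V q) = ‖(gradient V q : TangentSpace 𝓘(ℝ, E) q)‖ := by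
  rw [unitGrad, ← inner_gradient, inner_smul_right, real_inner_self_eq_norm_sq, sq, ← mul_assoc]
  rcases eq_or_ne (‖(gradient V q : TangentSpace 𝓘(ℝ, E) q)‖) 0 with h | h
  · rw [h]; simp
  · rw [inv_mul_cancel₀ h, one_mul]

theorem norm_gradient_eq {V : M → ℝ} (hV : ContMDiff 𝓘(ℝ, E) 𝓘(ℝ, ℝ) ∞ V) {x q : M}
    (hq : q ∈ (chartAt E x).source) : ‖(gradient V q : TangentSpace 𝓘(ℝ, E) q)‖ =
      Real.sqrt (chartMetric x (extChartAt 𝓘(ℝ, E) x q) (gradCoord V x (extChartAt 𝓘(ℝ, E) x q))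
        (gradCoord V x (extChartAt 𝓘(ℝ, E) x q))) := by
  rw [← chartCoord_gradient hV hq, ← inner_eq_chartMetric hq, real_inner_self_eq_norm_sq,
    Real.sqrt_sq (norm_nonneg _)]

/-- The function `|grad V|⁻¹` in the chart at `x`. -/
def invNormGrad (V : M → ℝ) (x : M) (z : E) : ℝ :=
  (Real.sqrt (chartMetric x z (gradCoord V x z) (gradCoord V x z)))⁻¹

theorem contDiffAt_invNormGrad {V : M → ℝ} (hV : ContMDiff 𝓘(ℝ, E) 𝓘(ℝ, ℝ) ∞ V) {x q : M}
    (hq : q ∈ (chartAt E x).source) (h : (gradient V q : TangentSpace 𝓘(ℝ, E) q) ≠ 0) :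
    ContDiffAt ℝ 1 (invNormGrad V x : E → ℝ) (extChartAt 𝓘(ℝ, E) x q) := by
  have hz : extChartAt 𝓘(ℝ, E) x q ∈ (extChartAt 𝓘(ℝ, E) x).target :=
    (extChartAt 𝓘(ℝ, E) x).map_source (by rwa [extChartAt_source])
  have h1 := contDiffAt_gradCoord hV hz
  have h2 := (((contDiffAt_chartMetric hq).of_le (m := 1) (by simp)).clm_apply h1).clm_apply h1
  have h3 := norm_gradient_eq hV hq
  have h4 : Real.sqrt (chartMetric x (extChartAt 𝓘(ℝ, E) x q)
      (gradCoord V x (extChartAt 𝓘(ℝ, E) x q)) (gradCoord V x (extChartAt 𝓘(ℝ, E) x q))) ≠ 0 := by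
    rw [← h3]; exact norm_ne_zero_iff.2 h
  refine (h2.sqrt fun h0 => h4 ?_).inv h4
  rw [h0, Real.sqrt_zero]

theorem chartCoord_unitGrad {V : M → ℝ} (hV : ContMDiff 𝓘(ℝ, E) 𝓘(ℝ, ℝ) ∞ V) {x q : M}
    (hq : q ∈ (chartAt E x).source) : chartCoord x q (unitGrad E V q) =
      invNormGrad V x (extChartAt 𝓘(ℝ, E) x q) • gradCoord V x (extChartAt 𝓘(ℝ, E) x q) := by
  rw [unitGrad, map_smul, chartCoord_gradient hV hq, norm_gradient_eq hV hq]
  rfl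

/-- The normalized gradient of `V` along a loop. -/
def unitGradField {V : M → ℝ} (hV : ContMDiff 𝓘(ℝ, E) 𝓘(ℝ, ℝ) ∞ V) (c : LoopSpace E M)
    (h : ∀ s, (gradient V (c s) : TangentSpace 𝓘(ℝ, E) (c s)) ≠ 0) : LoopTangent c :=
  LoopTangent.ofH1At (fun s => unitGrad E V (c s))
    (fun s => congrArg (fun q : M => (⟨q, unitGrad E V q⟩ : TangentBundle 𝓘(ℝ, E) M))
      (c.periodic s))
    (fun s => by
      have hs := mem_chart_source E (c s)
      have hz : extChartAt 𝓘(ℝ, E) (c s) (c s) ∈ (extChartAt 𝓘(ℝ, E) (c s)).target :=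
        (extChartAt 𝓘(ℝ, E) (c s)).map_source (by rwa [extChartAt_source])
      refine ⟨c s, hs, ((c.h1At_chart hs).comp_contDiffAt
        ((contDiffAt_invNormGrad hV hs (h s)).smul (contDiffAt_gradCoord hV hz))).congr ?_⟩
      filter_upwards [c.continuous.continuousAt.preimage_mem_nhds
        ((chartAt E (c s)).open_source.mem_nhds hs)] with r hr
      exact chartCoord_unitGrad hV hr)

/-- By the product rule ∇_s ξ is |grad V|⁻¹∇_{c'} grad V plus a multiple of grad V. A unit field is
orthogonal to its covariant derivative, so pairing with ∇_s ξ removes that multiple, whose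
coefficient need not be computed, and leaves |∇_s ξ|² = |grad V|⁻¹ Hess V(c', ∇_s ξ). -/
theorem norm_covDeriv_unitGradField_le {V : M → ℝ} (hV : ContMDiff 𝓘(ℝ, E) 𝓘(ℝ, ℝ) ∞ V)
    (c : LoopSpace E M) (h : ∀ s, (gradient V (c s) : TangentSpace 𝓘(ℝ, E) (c s)) ≠ 0) {s : ℝ}
    (hu : DifferentiableAt ℝ (extChartAt 𝓘(ℝ, E) (c s) ∘ c) s) :
    ‖covDeriv c (unitGradField hV c h) s‖ ≤ hessianNorm E V (c s) /
      ‖(gradient V (c s) : TangentSpace 𝓘(ℝ, E) (c s))‖ * ‖velocity E c s‖ := by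
  set ξ := unitGradField hV c h
  have hs := mem_chart_source E (c s)
  have hc : ContinuousAt c s := c.continuous.continuousAt
  set z := extChartAt 𝓘(ℝ, E) (c s) (c s) with hzdef
  have hz : z ∈ (extChartAt 𝓘(ℝ, E) (c s)).target :=
    (extChartAt 𝓘(ℝ, E) (c s)).map_source (by rwa [extChartAt_source])
  set G : E → E →L[ℝ] E →L[ℝ] ℝ := chartMetric (c s) with hGdef
  have hG : DifferentiableAt ℝ G z := (contDiffAt_chartMetric hs).differentiableAt (by simp)
  set u := extChartAt 𝓘(ℝ, E) (c s) ∘ c with hudef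
  set w := fieldCoord c ξ (c s) with hwdef
  have hnear : ∀ᶠ r in 𝓝 s, c r ∈ (chartAt E (c s)).source :=
    c.continuous.continuousAt.preimage_mem_nhds ((chartAt E (c s)).open_source.mem_nhds hs)
  have hweq : w =ᶠ[𝓝 s] fun r => invNormGrad V (c s) (u r) • gradCoord V (c s) (u r) :=
    hnear.mono fun r hr => chartCoord_unitGrad hV hr
  have hX := (contDiffAt_gradCoord hV hz).differentiableAt one_ne_zero
  have ha : DifferentiableAt ℝ (invNormGrad V (c s) : E → ℝ) z :=
    (contDiffAt_invNormGrad hV hs (h s)).differentiableAt one_ne_zero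
  have hXu : HasDerivAt (gradCoord V (c s) ∘ u) (fderiv ℝ (gradCoord V (c s)) z (deriv u s)) s :=
    HasFDerivAt.comp_hasDerivAt s (f := u) hX.hasFDerivAt hu.hasDerivAt
  have hau : HasDerivAt ((invNormGrad V (c s) : E → ℝ) ∘ u)
      (fderiv ℝ (invNormGrad V (c s) : E → ℝ) z (deriv u s)) s :=
    HasFDerivAt.comp_hasDerivAt s (f := u) ha.hasFDerivAt hu.hasDerivAt
  set α := fderiv ℝ (invNormGrad V (c s) : E → ℝ) z (deriv u s)
  have hw' : HasDerivAt w (invNormGrad V (c s) z • fderiv ℝ (gradCoord V (c s)) z (deriv u s) +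
      α • gradCoord V (c s) z) s := (hau.smul hXu).congr_of_eventuallyEq hweq
  have hw := hw'.differentiableAt
  have hXs : chartCoord (c s) (c s) (gradient V (c s)) = gradCoord V (c s) z :=
    chartCoord_gradient hV hs
  have key : ∀ y : TangentSpace 𝓘(ℝ, E) (c s), inner ℝ (covDeriv c ξ s) y =
      invNormGrad V (c s) z * hessian V (c s) (velocity E c s) y +
        α * inner ℝ (gradient V (c s) : TangentSpace 𝓘(ℝ, E) (c s)) y := by
    intro y
    have e1 := inner_covDeriv hc hs hu hw y
    have e2 := fderiv_gradient_field (f := V ∘ (extChartAt 𝓘(ℝ, E) (c s)).symm) hG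
      (chartMetric_symm (c s)) hX (by
        filter_upwards [(isOpen_extChartAt_target (I := 𝓘(ℝ, E)) (c s)).mem_nhds hz] with y hy
        exact chartMetric_gradCoord V hy)
      (deriv u s) (chartCoord (c s) (c s) y)
    have e3 := hessian_eq hV (c s) (velocity E c s) y
    have e4 : chartCoord (c s) (c s) (velocity E c s) = deriv u s := chartCoord_velocity hc hs
    have e5 : inner ℝ (gradient V (c s) : TangentSpace 𝓘(ℝ, E) (c s)) y =
      G z (gradCoord V (c s) z) (chartCoord (c s) (c s) y) := by
      rw [inner_eq_chartMetric hs, hXs]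
    have e6 : w s = invNormGrad V (c s) z • gradCoord V (c s) z := hweq.self_of_nhds
    rw [e4, hXs, ← e2] at e3
    rw [e3, e5, e1]
    change G z (deriv w s) _ + koszulForm G z (deriv u s) (w s) _ = _
    rw [hw'.deriv, e6, koszulForm_apply, koszulForm_apply]
    simp only [map_add, map_smul, add_apply, smul_apply, smul_eq_mul]
    ring
  -- The derivative of the constant |ξ|² = 1, written in the chart, is twice ⟨∇_s ξ, ξ⟩.
  have horth : inner ℝ (covDeriv c ξ s) (gradient V (c s) : TangentSpace 𝓘(ℝ, E) (c s)) = 0 := by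
    have e1 := inner_covDeriv hc hs hu hw (ξ s)
    have e2 : HasDerivAt (fun r => G (u r) (w r) (w r))
        ((fderiv ℝ G z (deriv u s) (w s) + G z (deriv w s)) (w s) + G z (w s) (deriv w s)) s :=
      ((HasFDerivAt.comp_hasDerivAt s (f := u) hG.hasFDerivAt hu.hasDerivAt).clm_apply
        hw.hasDerivAt).clm_apply hw.hasDerivAt
    have e3 : (fun r => G (u r) (w r) (w r)) =ᶠ[𝓝 s] fun _ => 1 := by
      filter_upwards [hnear] with r hr
      have := inner_eq_chartMetric hr (ξ r) (ξ r)
      rw [real_inner_self_eq_norm_sq] at this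
      refine this.symm.trans ?_
      have h1 : ‖ξ r‖ = 1 := norm_unitGrad (h r)
      rw [h1, one_pow]
    have e4 := e2.unique ((hasDerivAt_const s (1 : ℝ)).congr_of_eventuallyEq e3)
    have e5 : inner ℝ (covDeriv c ξ s) (ξ s) = 0 := by
      rw [e1]
      change G z (deriv w s) (w s) + koszulForm G z (deriv u s) (w s) (w s) = 0
      have e7 : G z (w s) (deriv w s) = G z (deriv w s) (w s) := chartMetric_symm _ _ _ _
      rw [add_apply, e7] at e4
      rw [koszulForm_apply, fderiv_bilin_symm hG (chartMetric_symm (c s)) (w s) (deriv u s) (w s)]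
      linarith
    have e6 : ξ s = (‖(gradient V (c s) : TangentSpace 𝓘(ℝ, E) (c s))‖)⁻¹ • gradient V (c s) := rfl
    rw [e6, inner_smul_right] at e5
    exact (mul_eq_zero.1 e5).resolve_left (inv_ne_zero (norm_ne_zero_iff.2 (h s)))
  have h1 := key (covDeriv c ξ s)
  rw [real_inner_comm _ (gradient V (c s)), horth, mul_zero, add_zero, real_inner_self_eq_norm_sq] at h1
  have h2 : invNormGrad V (c s) z = (‖(gradient V (c s) : TangentSpace 𝓘(ℝ, E) (c s))‖)⁻¹ := by
    rw [norm_gradient_eq hV hs]; rfl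
  have h3 := abs_hessian_le hV (c s) (velocity E c s) (covDeriv c ξ s)
  have h4 : 0 < ‖(gradient V (c s) : TangentSpace 𝓘(ℝ, E) (c s))‖ := norm_pos_iff.2 (h s)
  rw [h2] at h1
  set g := ‖(gradient V (c s) : TangentSpace 𝓘(ℝ, E) (c s))‖
  have h5 : ‖covDeriv c ξ s‖ * ‖covDeriv c ξ s‖ ≤
      hessianNorm E V (c s) / g * ‖velocity E c s‖ * ‖covDeriv c ξ s‖ := by
    rw [← sq, h1]
    calc g⁻¹ * hessian V (c s) (velocity E c s) (covDeriv c ξ s)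
        ≤ g⁻¹ * (hessianNorm E V (c s) * ‖velocity E c s‖ * ‖covDeriv c ξ s‖) := by
          gcongr; exact (le_abs_self _).trans h3
      _ = _ := by rw [div_eq_inv_mul]; ring
  rcases (norm_nonneg (covDeriv c ξ s)).eq_or_lt with h0 | h0
  · rw [← h0]
    have : 0 ≤ hessianNorm E V (c s) := Real.sSup_nonneg (by rintro r ⟨v, w, -, -, rfl⟩; positivity)
    positivity
  · exact le_of_mul_le_mul_right h5 h0

end Gradient

/-! ### Loops stay in a compact set; uniform convergence -/

section Compactness

variable {E : Type*} [NormedAddCommGroup E] [NormedSpace ℝ E] [FiniteDimensional ℝ E]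
  {M : Type*} [MetricSpace M] [ChartedSpace E M] [IsManifold 𝓘(ℝ, E) ∞ M]
  [RiemannianBundle (fun x : M => TangentSpace 𝓘(ℝ, E) x)]
  [IsContMDiffRiemannianBundle 𝓘(ℝ, E) ∞ E (fun x : M => TangentSpace 𝓘(ℝ, E) x)]
  [IsRiemannianManifold 𝓘(ℝ, E) M]

/-- Young's inequality |v| ≤ a/2 + |v|²/(2a) replaces Cauchy–Schwarz: the bound is additive over
intervals and free of square roots, at the price of a parameter to be chosen. -/
theorem LoopSpace.dist_le_energy (c : LoopSpace E M) {s t : ℝ} (hst : s ≤ t) {a : ℝ} (ha : 0 < a) :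
    dist (c s) (c t) ≤ a / 2 * (t - s) + (2 * a)⁻¹ * ∫ r in s..t, ‖velocity E c r‖ ^ 2 := by
  refine (c.dist_le hst).trans ?_
  have i1 := c.intervalIntegrable_sq_speed s t
  have h1 : ∫ r in s..t, ‖velocity E c r‖ ≤
      ∫ r in s..t, (a / 2 + (2 * a)⁻¹ * ‖velocity E c r‖ ^ 2) := by
    refine intervalIntegral.integral_mono_on hst (c.intervalIntegrable_speed s t)
      (intervalIntegrable_const.add (i1.const_mul _)) fun r _ => ?_
    have h2 : 0 ≤ (2 * a)⁻¹ * (‖velocity E c r‖ - a) ^ 2 := by positivity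
    have h3 : (2 * a)⁻¹ * (‖velocity E c r‖ - a) ^ 2 =
        a / 2 + (2 * a)⁻¹ * ‖velocity E c r‖ ^ 2 - ‖velocity E c r‖ := by
      field_simp
      ring
    linarith
  rw [intervalIntegral.integral_add intervalIntegrable_const (i1.const_mul _),
    intervalIntegral.integral_const, intervalIntegral.integral_const_mul, smul_eq_mul] at h1
  linarith

theorem LoopSpace.energy_shift (c : LoopSpace E M) (s : ℝ) :
    ∫ r in s..s + 1, ‖velocity E c r‖ ^ 2 = ∫ r in (0 : ℝ)..1, ‖velocity E c r‖ ^ 2 := by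
  have h : Function.Periodic (fun s => ‖velocity E c s‖ ^ 2) 1 := fun s => by
    simp only [c.norm_velocity_add_one s]
  simpa using h.intervalIntegral_add_eq s 0

theorem LoopSpace.energy_le (c : LoopSpace E M) {s t : ℝ} (hst : s ≤ t) (ht : t ≤ s + 1) :
    ∫ r in s..t, ‖velocity E c r‖ ^ 2 ≤ ∫ r in (0 : ℝ)..1, ‖velocity E c r‖ ^ 2 := by
  rw [← c.energy_shift s]
  exact intervalIntegral.integral_mono_interval le_rfl hst ht
    (Eventually.of_forall fun r => by positivity) (c.intervalIntegrable_sq_speed _ _)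

theorem LoopSpace.dist_le_of_energy_le (c : LoopSpace E M) {K : ℝ}
    (hK : ∫ r in (0 : ℝ)..1, ‖velocity E c r‖ ^ 2 ≤ K) {s t : ℝ} (hst : s ≤ t) (ht : t ≤ s + 1)
    {a : ℝ} (ha : 0 < a) : dist (c s) (c t) ≤ a / 2 * (t - s) + (2 * a)⁻¹ * K :=
  (c.dist_le_energy hst ha).trans (by
    gcongr
    exact (c.energy_le hst ht).trans hK)

theorem LoopSpace.apply_fract (c : LoopSpace E M) (s : ℝ) : c (Int.fract s) = c s := by
  have := c.periodic.sub_zsmul_eq (x := s) ⌊s⌋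
  rwa [zsmul_one] at this

theorem LoopSpace.dist_zero_le (c : LoopSpace E M) {K : ℝ}
    (hK : ∫ r in (0 : ℝ)..1, ‖velocity E c r‖ ^ 2 ≤ K) (s : ℝ) :
    dist (c 0) (c s) ≤ 1 / 2 + K / 2 := by
  have hK0 : 0 ≤ K := (intervalIntegral.integral_nonneg zero_le_one fun s _ => by positivity).trans hK
  rw [← c.apply_fract s]
  have := c.dist_le_of_energy_le hK (Int.fract_nonneg s) (by linarith [Int.fract_lt_one s]) one_pos
  linarith [Int.fract_lt_one s]

/-- Along a Palais-Smale sequence, the loops stay in a bounded region. -/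
theorem IsPalaisSmaleSeq.exists_closedBall {V : M → ℝ} (hV : ContMDiff 𝓘(ℝ, E) 𝓘(ℝ, ℝ) ∞ V)
    (hreg : AsymptoticallyRegular E V) {ε a₁ a₂ : ℝ} {p : ℕ → LoopSpace E M × ℝ}
    (hp : IsPalaisSmaleSeq (penalizedAction V ε) a₁ a₂ p) {T K : ℝ}
    (hb : ∀ᶠ n in atTop, |(p n).2| ≤ T ∧ ∫ s in (0 : ℝ)..1, ‖velocity E (p n).1 s‖ ^ 2 ≤ K) :
    ∃ (q : M) (r : ℝ), ∀ᶠ n in atTop, ∀ s, (p n).1 s ∈ Metric.closedBall q r := by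
  obtain ⟨Z, hZ, ⟨q, hq⟩, v, hv, hgrad, hlim⟩ := hreg
  obtain ⟨r, hr⟩ := hZ.isBounded.subset_closedBall q
  set K' := max K 0
  have hK' : 0 ≤ K' := le_max_right _ _
  -- Allowed size of ‖Hess V‖/|grad V|: at most 1, which bounds the H¹ norm of the test field, and
  -- so small that the kinetic part is at most a quarter of e^{-T}v.
  set η := min 1 (Real.exp (-T) * v / (4 * (Real.exp T * (K' + 1)))) with hη
  have hη0 : 0 < η := lt_min one_pos (by positivity)
  -- Allowed size of the differential: on a field of norm at most √(1 + K') it is then at most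
  -- another quarter.
  set δ := Real.exp (-T) * v / (4 * Real.sqrt (1 + K')) with hδ
  have hsq : 0 < Real.sqrt (1 + K') := Real.sqrt_pos.2 (by positivity)
  have hδ0 : 0 < δ := by positivity
  obtain ⟨R₀, hR₀⟩ : ∃ R₀, ∀ q, R₀ ≤ Metric.infDist q Z →
      hessianNorm E V q / ‖(gradient V q : TangentSpace 𝓘(ℝ, E) q)‖ ≤ η := by
    have h1 := hlim.eventually (gt_mem_nhds hη0)
    rw [eventually_comap, eventually_atTop] at h1
    obtain ⟨R₀, h⟩ := h1
    exact ⟨R₀, fun q hq => (h _ hq q rfl).le⟩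
  set L := 1 / 2 + K' / 2
  -- L bounds the distance from c(0) to any point of the loop, so if c(0) is at distance at least R
  -- from Z, the whole loop avoids Z and lies where the Hessian is small.
  set R := max R₀ 0 + L + 1
  refine ⟨q, L + R + r, ?_⟩
  filter_upwards [hb, hp.eventually_le hV hδ0] with n ⟨hn1, hn2⟩ ⟨hn3, _⟩
  set c := (p n).1
  set τ := (p n).2
  replace hn2 : ∫ s in (0 : ℝ)..1, ‖velocity E c s‖ ^ 2 ≤ K' := hn2.trans (le_max_left _ _)
  have hosc : ∀ s, dist (c 0) (c s) ≤ L := c.dist_zero_le hn2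
  have hclose : Metric.infDist (c 0) Z < R := by
    by_contra hcon
    push Not at hcon
    have hfar : ∀ s, max R₀ 0 + 1 ≤ Metric.infDist (c s) Z := by
      intro s
      have h1 : Metric.infDist (c 0) Z ≤ Metric.infDist (c s) Z + dist (c 0) (c s) :=
        Metric.infDist_le_infDist_add_dist
      have h2 := hosc s
      simp only [R] at hcon
      linarith
    have hnot : ∀ s, c s ∉ Z := fun s hs => by
      have := hfar s
      rw [Metric.infDist_zero_of_mem hs] at this
      linarith [le_max_right R₀ 0]
    have hg : ∀ s, v ≤ ‖(gradient V (c s) : TangentSpace 𝓘(ℝ, E) (c s))‖ := fun s =>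
      hgrad _ (hnot s)
    have hne : ∀ s, (gradient V (c s) : TangentSpace 𝓘(ℝ, E) (c s)) ≠ 0 := fun s =>
      norm_pos_iff.1 (hv.trans_le (hg s))
    set ξ := unitGradField hV c hne
    have hcov : ∀ᵐ s, ‖covDeriv c ξ s‖ ≤ η * ‖velocity E c s‖ := by
      filter_upwards [c.ae_differentiableAt_chart] with s hs
      refine (norm_covDeriv_unitGradField_le hV c hne (hs _ (mem_chart_source E (c s)))).trans ?_
      gcongr
      exact hR₀ _ (by linarith [hfar s, le_max_left R₀ 0])
    have i1 := c.intervalIntegrable_sq_speed 0 1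
    have hnorm : h1Norm ξ ≤ Real.sqrt (1 + K') := by
      refine Real.sqrt_le_sqrt (add_le_add ?_ ?_)
      · have : ∀ s, ‖ξ s‖ ^ 2 = 1 := fun s => by
          rw [show ‖ξ s‖ = 1 from norm_unitGrad (hne s), one_pow]
        simp [this]
      · calc ∫ s in (0 : ℝ)..1, ‖covDeriv c ξ s‖ ^ 2
            ≤ ∫ s in (0 : ℝ)..1, ‖velocity E c s‖ ^ 2 := by
              rw [intervalIntegral.integral_of_le zero_le_one,
                intervalIntegral.integral_of_le zero_le_one]
              refine integral_mono_of_nonneg (Eventually.of_forall fun s => by positivity) i1.1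
                (ae_restrict_of_ae (hcov.mono fun s hs => ?_))
              have h1 : ‖covDeriv c ξ s‖ ≤ ‖velocity E c s‖ :=
                hs.trans (mul_le_of_le_one_left (norm_nonneg _) (min_le_left _ _))
              exact pow_le_pow_left₀ (norm_nonneg _) h1 2
          _ ≤ K' := hn2
    have hinner : ∫ s in (0 : ℝ)..1, inner ℝ (velocity E c s) (covDeriv c ξ s) ≤ η * K' := by
      calc ∫ s in (0 : ℝ)..1, inner ℝ (velocity E c s) (covDeriv c ξ s)
          ≤ ∫ s in (0 : ℝ)..1, η * ‖velocity E c s‖ ^ 2 := by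
            refine intervalIntegral.integral_mono_ae zero_le_one
              (ξ.intervalIntegrable_inner zero_le_one) (i1.const_mul η)
              (hcov.mono fun s hs => ?_)
            refine (real_inner_le_norm _ _).trans ?_
            calc ‖velocity E c s‖ * ‖covDeriv c ξ s‖
                ≤ ‖velocity E c s‖ * (η * ‖velocity E c s‖) := by gcongr
              _ = _ := by ring
        _ ≤ η * K' := by
            rw [intervalIntegral.integral_const_mul]; gcongr
    -- The derivative of V along its normalized gradient is |grad V|. Hence dA(ξ) ≤ -(3/4)e^{-T}v,
    -- against the lower bound -(1/4)e^{-T}v from the Palais–Smale condition.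
    have hpot : v ≤ ∫ s in (0 : ℝ)..1, dPot E V (c s) (ξ s) := by
      calc v = ∫ s in (0 : ℝ)..1, v := by simp
        _ ≤ _ := by
          refine intervalIntegral.integral_mono_on zero_le_one intervalIntegrable_const
            (ξ.intervalIntegrable_dPot hV zero_le_one) fun s _ => ?_
          exact (hg s).trans_eq (dPot_unitGrad V (c s)).symm
    have h1 := (abs_le.1 (hn3 ξ)).1
    rw [actionDiff] at h1
    have h2 : δ * h1Norm ξ ≤ Real.exp (-T) * v / 4 := by
      calc δ * h1Norm ξ ≤ δ * Real.sqrt (1 + K') := by gcongr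
        _ = _ := by rw [hδ]; field_simp
    have h3 : Real.exp (-τ) * ∫ s in (0 : ℝ)..1, inner ℝ (velocity E c s) (covDeriv c ξ s) ≤
        Real.exp (-T) * v / 4 := by
      have hK1 : 0 ≤ η * K' := by positivity
      calc _ ≤ Real.exp (-τ) * (η * K') := by gcongr
        _ ≤ Real.exp T * (η * (K' + 1)) := by
            gcongr
            · linarith [(abs_le.1 hn1).1]
            · linarith
        _ ≤ Real.exp T * (Real.exp (-T) * v / (4 * (Real.exp T * (K' + 1))) * (K' + 1)) := by
            gcongr; exact min_le_right _ _
        _ = _ := by field_simp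
    have h4 : Real.exp (-T) * v ≤ Real.exp τ * ∫ s in (0 : ℝ)..1, dPot E V (c s) (ξ s) := by
      gcongr
      linarith [(abs_le.1 hn1).1]
    have h5 : 0 < Real.exp (-T) * v := by positivity
    linarith
  obtain ⟨y, hy, hyd⟩ := (Metric.infDist_lt_iff ⟨q, hq⟩).1 hclose
  intro s
  have h1 := hosc s
  have h2 := Metric.mem_closedBall.1 (hr hy)
  rw [Metric.mem_closedBall]
  have h3 := dist_triangle4 (c s) (c 0) y q
  rw [dist_comm (c s) (c 0)] at h3
  linarith

/-- Arzelà–Ascoli on [0, 1], where equicontinuity comes from the energy bound; periodicity carries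
the convergence to the whole line. -/
theorem exists_subseq_tendstoUniformly {e : ℕ → LoopSpace E M} {S : Set M} (hS : IsCompact S)
    (heS : ∀ n s, e n s ∈ S) {K : ℝ}
    (hK : ∀ n, ∫ s in (0 : ℝ)..1, ‖velocity E (e n) s‖ ^ 2 ≤ K) :
    ∃ (c : ℝ → M) (k : ℕ → ℕ), StrictMono k ∧ Function.Periodic c 1 ∧
      TendstoUniformly (fun j => (e (k j)).toFun) c atTop := by
  let f : ℕ → BoundedContinuousFunction (Icc (0 : ℝ) 1) M := fun n =>
    BoundedContinuousFunction.mkOfCompact ⟨fun s => e n s, (e n).continuous.comp continuous_subtype_val⟩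
  have hK0 : 0 ≤ K :=
    (intervalIntegral.integral_nonneg zero_le_one fun s _ => by positivity).trans (hK 0)
  have hequi : Equicontinuous ((↑) : range f → Icc (0 : ℝ) 1 → M) := by
    intro s₀
    rw [Metric.equicontinuousAt_iff]
    intro η hη
    -- With Young parameter a = (K + 1)/η and |s - t| < η/a, the length term is less than η/2 and
    -- the energy term is at most η/2.
    refine ⟨η / ((K + 1) / η), by positivity, ?_⟩
    rintro s hs ⟨-, n, rfl⟩
    have key : ∀ s t : Icc (0 : ℝ) 1, s ≤ t → dist s t < η / ((K + 1) / η) →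
        dist (e n s) (e n t) < η := by
      intro s t hst hd
      have h1 := (e n).dist_le_of_energy_le (hK n) (s := s) (t := t) hst
        (by linarith [s.2.1, t.2.2]) (a := (K + 1) / η) (by positivity)
      rw [Subtype.dist_eq, dist_comm, Real.dist_eq, abs_of_nonneg (sub_nonneg.2 (show (s : ℝ) ≤ t from hst)),
        lt_div_iff₀ (by positivity)] at hd
      have h2 : (2 * ((K + 1) / η))⁻¹ * K ≤ η / 2 := by
        rw [inv_mul_le_iff₀ (by positivity)]
        field_simp
        linarith
      linarith
    rcases le_total s s₀ with h | h
    · rw [dist_comm]; exact key s s₀ h hs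
    · exact key s₀ s h (by rwa [dist_comm])
  have hcomp : IsCompact (closure (range f)) :=
    BoundedContinuousFunction.arzela_ascoli S hS (range f)
      (by rintro g s ⟨n, rfl⟩; exact heS n s) hequi
  obtain ⟨g, -, k, hk, hg⟩ := hcomp.tendsto_subseq (x := f) fun n =>
    subset_closure (mem_range_self n)
  have hfr : ∀ s : ℝ, Int.fract s ∈ Icc (0 : ℝ) 1 := fun s =>
    ⟨Int.fract_nonneg s, (Int.fract_lt_one s).le⟩
  refine ⟨fun s => g ⟨Int.fract s, hfr s⟩, k, hk, fun s => by simp [Int.fract_add_one], ?_⟩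
  rw [BoundedContinuousFunction.tendsto_iff_tendstoUniformly] at hg
  rw [Metric.tendstoUniformly_iff] at hg ⊢
  intro η hη
  filter_upwards [hg η hη] with j hj s
  have := hj ⟨Int.fract s, hfr s⟩
  rwa [show (f ∘ k) j ⟨Int.fract s, hfr s⟩ = e (k j) s from (e (k j)).apply_fract s] at this

end Compactness

/-! ### Absolute continuity of the uniform limit -/

section LimitLoop

variable {E : Type*} [NormedAddCommGroup E] [NormedSpace ℝ E] [FiniteDimensional ℝ E]
  {M : Type*} [MetricSpace M] [ChartedSpace E M] [IsManifold 𝓘(ℝ, E) ∞ M]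
  [RiemannianBundle (fun x : M => TangentSpace 𝓘(ℝ, E) x)]
  [IsContMDiffRiemannianBundle 𝓘(ℝ, E) ∞ E (fun x : M => TangentSpace 𝓘(ℝ, E) x)]
  [IsRiemannianManifold 𝓘(ℝ, E) M]

theorem LoopSpace.energy_nat (c : LoopSpace E M) (s : ℝ) (N : ℕ) :
    ∫ r in s..s + N, ‖velocity E c r‖ ^ 2 = N * ∫ r in (0 : ℝ)..1, ‖velocity E c r‖ ^ 2 := by
  induction N with
  | zero => simp
  | succ N ih =>
    rw [← intervalIntegral.integral_add_adjacent_intervals (c.intervalIntegrable_sq_speed s (s + N))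
      (c.intervalIntegrable_sq_speed _ _), ih]
    push_cast
    rw [← add_assoc, c.energy_shift]
    ring

theorem LoopSpace.setIntegral_uIoc_le (c : LoopSpace E M) {a b : ℝ} {N : ℕ} (hN : |b - a| ≤ N) :
    ∫ r in uIoc a b, ‖velocity E c r‖ ^ 2 ≤ N * ∫ r in (0 : ℝ)..1, ‖velocity E c r‖ ^ 2 := by
  have h1 : max a b - min a b = |b - a| := max_sub_min_eq_abs a b
  rw [← c.energy_nat (min a b) N, uIoc, ← intervalIntegral.integral_of_le min_le_max]
  exact intervalIntegral.integral_mono_interval le_rfl min_le_max (by linarith)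
    (Eventually.of_forall fun r => by positivity) (c.intervalIntegrable_sq_speed _ _)

theorem LoopSpace.dist_le_uIoc (c : LoopSpace E M) (s t : ℝ) {a : ℝ} (ha : 0 < a) :
    dist (c s) (c t) ≤ a / 2 * dist s t + (2 * a)⁻¹ * ∫ r in uIoc s t, ‖velocity E c r‖ ^ 2 := by
  have key : ∀ s t : ℝ, s ≤ t →
      dist (c s) (c t) ≤ a / 2 * dist s t + (2 * a)⁻¹ * ∫ r in uIoc s t, ‖velocity E c r‖ ^ 2 := by
    intro s t hst
    have := c.dist_le_energy hst ha
    rwa [intervalIntegral.integral_of_le hst, ← uIoc_of_le hst,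
      show t - s = dist s t by rw [dist_comm, Real.dist_eq, abs_of_nonneg (sub_nonneg.2 hst)]] at this
  rcases le_total s t with h | h
  · exact key s t h
  · rw [dist_comm, dist_comm s, uIoc_comm]
    exact key t s h

open AbsolutelyContinuousOnInterval in
/-- A pointwise limit of loops of bounded energy is absolutely continuous. -/
theorem absolutelyContinuousOnInterval_of_tendsto {e : ℕ → LoopSpace E M} {c : ℝ → M}
    (h : ∀ s, Tendsto (fun n => e n s) atTop (𝓝 (c s))) {K : ℝ}
    (hK : ∀ n, ∫ s in (0 : ℝ)..1, ‖velocity E (e n) s‖ ^ 2 ≤ K) (a b : ℝ) :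
    AbsolutelyContinuousOnInterval c a b := by
  obtain ⟨N, hN⟩ := exists_nat_ge |b - a|
  have hK0 : 0 ≤ K :=
    (intervalIntegral.integral_nonneg zero_le_one fun s _ => by positivity).trans (hK 0)
  rw [absolutelyContinuousOnInterval_iff]
  intro η hη
  -- The Young parameter: intervals of total length below η/(2A) contribute η/4, and the energy over
  -- disjoint intervals, at most NK, contributes η/2. The bound is uniform in n and survives the
  -- limit.
  set A : ℝ := (N * K + 1) / η with hA
  have hApos : 0 < A := by positivity
  refine ⟨η / (2 * A), by positivity, fun I hI hlen => ?_⟩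
  have hlim : Tendsto (fun n => ∑ i ∈ Finset.range I.1, dist (e n (I.2 i).1) (e n (I.2 i).2)) atTop
      (𝓝 (∑ i ∈ Finset.range I.1, dist (c (I.2 i).1) (c (I.2 i).2))) :=
    tendsto_finsetSum _ fun i _ => (h _).dist (h _)
  have hbd : ∀ n, ∑ i ∈ Finset.range I.1, dist (e n (I.2 i).1) (e n (I.2 i).2) ≤
      A / 2 * (η / (2 * A)) + (2 * A)⁻¹ * (N * K) := by
    intro n
    have hint : IntegrableOn (fun r => ‖velocity E (e n) r‖ ^ 2) (uIoc a b) :=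
      intervalIntegrable_iff.1 ((e n).intervalIntegrable_sq_speed a b)
    calc ∑ i ∈ Finset.range I.1, dist (e n (I.2 i).1) (e n (I.2 i).2)
        ≤ ∑ i ∈ Finset.range I.1, (A / 2 * dist (I.2 i).1 (I.2 i).2 +
            (2 * A)⁻¹ * ∫ r in uIoc (I.2 i).1 (I.2 i).2, ‖velocity E (e n) r‖ ^ 2) :=
          Finset.sum_le_sum fun i _ => (e n).dist_le_uIoc _ _ hApos
      _ = A / 2 * ∑ i ∈ Finset.range I.1, dist (I.2 i).1 (I.2 i).2 +
            (2 * A)⁻¹ * ∫ r in ⋃ i ∈ Finset.range I.1, uIoc (I.2 i).1 (I.2 i).2,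
              ‖velocity E (e n) r‖ ^ 2 := by
          rw [integral_biUnion_finset _ (by simp +contextual [uIoc]) hI.2
            fun i hi => hint.mono_set (uIoc_subset_of_mem_disjWithin hI (Finset.mem_range.1 hi)),
            Finset.sum_add_distrib, Finset.mul_sum, Finset.mul_sum]
      _ ≤ A / 2 * (η / (2 * A)) + (2 * A)⁻¹ * (N * K) := by
          gcongr
          calc ∫ r in ⋃ i ∈ Finset.range I.1, uIoc (I.2 i).1 (I.2 i).2, ‖velocity E (e n) r‖ ^ 2
              ≤ ∫ r in uIoc a b, ‖velocity E (e n) r‖ ^ 2 :=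
                setIntegral_mono_set hint (Eventually.of_forall fun r => by positivity)
                  (biUnion_uIoc_subset_of_mem_disjWithin hI).eventuallyLE
            _ ≤ N * K := ((e n).setIntegral_uIoc_le hN).trans (by gcongr; exact hK n)
  refine (le_of_tendsto' hlim hbd).trans_lt ?_
  have h1 : A / 2 * (η / (2 * A)) = η / 4 := by field_simp; norm_num
  have h2 : (2 * A)⁻¹ * (N * K) ≤ η / 2 := by
    rw [inv_mul_le_iff₀ (by positivity), hA]
    field_simp
    linarith
  linarith

end LimitLoop

/-! ### Comparison of two almost critical loops in a chart -/

section PairEstimate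

variable {E : Type*} [NormedAddCommGroup E] [NormedSpace ℝ E] [FiniteDimensional ℝ E]
  {M : Type*} [MetricSpace M] [ChartedSpace E M] [IsManifold 𝓘(ℝ, E) ∞ M]
  [RiemannianBundle (fun x : M => TangentSpace 𝓘(ℝ, E) x)]
  [IsContMDiffRiemannianBundle 𝓘(ℝ, E) ∞ E (fun x : M => TangentSpace 𝓘(ℝ, E) x)]
  [IsRiemannianManifold 𝓘(ℝ, E) M]

theorem exists_int_sub_mem_Icc {s₀ R s : ℝ} (hs : ‖((s - s₀ : ℝ) : UnitAddCircle)‖ ≤ R) :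
    ∃ n : ℤ, s - n ∈ Icc (s₀ - R) (s₀ + R) := by
  rw [UnitAddCircle.norm_eq] at hs
  have h1 := abs_le.1 hs
  exact ⟨round (s - s₀), by linarith, by linarith⟩

theorem LoopSpace.apply_sub_int (c : LoopSpace E M) (s : ℝ) (n : ℤ) : c (s - n) = c s := by
  have := c.periodic.sub_zsmul_eq (x := s) n
  rwa [zsmul_one] at this

theorem LoopSpace.integral_sq_deriv_chart_le (c : LoopSpace E M) {x : M} {a b κ K : ℝ}
    (hab : a ≤ b) (hba : b ≤ a + 1) (hκ : 0 < κ) (h : ∀ s ∈ Icc a b, c s ∈ (chartAt E x).source ∧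
      ∀ v, κ * ‖v‖ ^ 2 ≤ chartMetric x (extChartAt 𝓘(ℝ, E) x (c s)) v v)
    (hK : ∫ s in (0 : ℝ)..1, ‖velocity E c s‖ ^ 2 ≤ K) :
    ∫ s in Icc a b, ‖deriv (extChartAt 𝓘(ℝ, E) x ∘ c) s‖ ^ 2 ≤ κ⁻¹ * K := by
  calc ∫ s in Icc a b, ‖deriv (extChartAt 𝓘(ℝ, E) x ∘ c) s‖ ^ 2
      ≤ ∫ s in Icc a b, κ⁻¹ * ‖velocity E c s‖ ^ 2 := by
        refine integral_mono_of_nonneg (Eventually.of_forall fun s => by positivity)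
          ((c.memLp_speed a b).integrable_sq.const_mul _) ?_
        filter_upwards [ae_restrict_mem measurableSet_Icc] with s hs
        have := norm_deriv_le_norm_velocity (c := c) c.continuous.continuousAt (h s hs).1 hκ (h s hs).2
        calc ‖deriv (extChartAt 𝓘(ℝ, E) x ∘ c) s‖ ^ 2
            ≤ (Real.sqrt κ⁻¹ * ‖velocity E c s‖) ^ 2 := by gcongr
          _ = κ⁻¹ * ‖velocity E c s‖ ^ 2 := by
            rw [mul_pow, Real.sq_sqrt (by positivity)]
    _ = κ⁻¹ * ∫ s in a..b, ‖velocity E c s‖ ^ 2 := by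
        rw [integral_const_mul, intervalIntegral.integral_of_le hab, integral_Icc_eq_integral_Ioc]
    _ ≤ κ⁻¹ * K := by
        gcongr
        exact (c.energy_le hab hba).trans hK

theorem norm_deriv_smul_le {ρ : ℝ → ℝ} {w : ℝ → E} {s : ℝ} (hρ : LipschitzWith 1 ρ)
    (hρs : DifferentiableAt ℝ ρ s) (hw : DifferentiableAt ℝ w s) (hρ0 : 0 ≤ ρ s) (hρ1 : ρ s ≤ 1) :
    ‖deriv (fun r => ρ r • w r) s‖ ≤ ‖deriv w s‖ + ‖w s‖ := by
  have hder : deriv (fun r => ρ r • w r) s = ρ s • deriv w s + deriv ρ s • w s :=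
    (hρs.hasDerivAt.smul hw.hasDerivAt).deriv
  rw [hder]
  refine (norm_add_le _ _).trans ?_
  rw [norm_smul, norm_smul]
  have h1 : ‖deriv ρ s‖ ≤ 1 := norm_deriv_le_of_lipschitz hρ
  have h2 : ‖ρ s‖ ≤ 1 := by rwa [Real.norm_eq_abs, abs_of_nonneg hρ0]
  exact add_le_add (mul_le_of_le_one_left (norm_nonneg _) h2)
    (mul_le_of_le_one_left (norm_nonneg _) h1)

theorem integral_sq_deriv_bump_le {ρ : ℝ → ℝ} {u₁ u₂ : ℝ → E} {a b d K : ℝ} (hab : a ≤ b)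
    (hba : b ≤ a + 1) (hρ : LipschitzWith 1 ρ) (hρ0 : ∀ s, 0 ≤ ρ s) (hρ1 : ∀ s, ρ s ≤ 1)
    (h₁ : H1On u₁ a b) (h₂ : H1On u₂ a b) (hd : ∀ s ∈ Icc a b, ‖u₁ s - u₂ s‖ ≤ d)
    (hK₁ : ∫ s in Icc a b, ‖deriv u₁ s‖ ^ 2 ≤ K) (hK₂ : ∫ s in Icc a b, ‖deriv u₂ s‖ ^ 2 ≤ K) :
    ∫ s in Icc a b, ‖deriv (fun r => ρ r • (u₁ r - u₂ r)) s‖ ^ 2 ≤ 3 * (2 * K + d ^ 2) := by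
  have i1 := h₁.memLp.integrable_norm_pow (p := 2) two_ne_zero
  have i2 := h₂.memLp.integrable_norm_pow (p := 2) two_ne_zero
  have i3 : Integrable (fun s => ‖deriv u₁ s‖ ^ 2 + ‖deriv u₂ s‖ ^ 2) (volume.restrict (Icc a b)) :=
    i1.add i2
  calc ∫ s in Icc a b, ‖deriv (fun r => ρ r • (u₁ r - u₂ r)) s‖ ^ 2
      ≤ ∫ s in Icc a b, 3 * ((‖deriv u₁ s‖ ^ 2 + ‖deriv u₂ s‖ ^ 2) + d ^ 2) := by
        refine integral_mono_of_nonneg (Eventually.of_forall fun s => by positivity)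
          ((i3.add (integrable_const _)).const_mul 3) ?_
        filter_upwards [ae_restrict_mem measurableSet_Icc, h₁.ae_differentiableAt hab,
          h₂.ae_differentiableAt hab, ae_restrict_of_ae hρ.ae_differentiableAt] with s hs d1 d2 d3
        have h := norm_deriv_smul_le hρ d3 (d1.sub d2) (hρ0 s) (hρ1 s)
        have h3 : ‖deriv (u₁ - u₂) s‖ ≤ ‖deriv u₁ s‖ + ‖deriv u₂ s‖ := by
          rw [deriv_sub d1 d2]; exact norm_sub_le _ _
        have h4 : ‖deriv (fun r => ρ r • (u₁ r - u₂ r)) s‖ ≤ ‖deriv u₁ s‖ + ‖deriv u₂ s‖ + d :=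
          h.trans (add_le_add h3 (hd s hs))
        calc _ ≤ (‖deriv u₁ s‖ + ‖deriv u₂ s‖ + d) ^ 2 := pow_le_pow_left₀ (norm_nonneg _) h4 2
          _ ≤ _ := by
            nlinarith [sq_nonneg (‖deriv u₁ s‖ - ‖deriv u₂ s‖), sq_nonneg (‖deriv u₁ s‖ - d),
              sq_nonneg (‖deriv u₂ s‖ - d)]
    _ = 3 * ((∫ s in Icc a b, ‖deriv u₁ s‖ ^ 2) + (∫ s in Icc a b, ‖deriv u₂ s‖ ^ 2) +
          (b - a) * d ^ 2) := by
        rw [integral_const_mul, integral_add i3 (integrable_const _), integral_add i1 i2]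
        simp [hab]
    _ ≤ _ := by
        have : (b - a) * d ^ 2 ≤ d ^ 2 := mul_le_of_le_one_left (sq_nonneg _) (by linarith)
        linarith

/-- Two loops with small action differentials that are uniformly close in a chart are close in
`H¹`. -/
theorem LoopSpace.integral_sq_sub_deriv_le {V : M → ℝ} (hV : ContMDiff 𝓘(ℝ, E) 𝓘(ℝ, ℝ) ∞ V)
    {e₁ e₂ : LoopSpace E M} {x : M} {s₀ δ : ℝ} (hδ : 0 < δ) (hδ' : δ ≤ 1 / 2) {A : Set E}
    (hA : Convex ℝ A) (hAt : A ⊆ (extChartAt 𝓘(ℝ, E) x).target) {κ C : ℝ} (hκ : 0 < κ) (hC : 0 ≤ C)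
    (hb : ∀ z ∈ A, (∀ v, κ * ‖v‖ ^ 2 ≤ chartMetric x z v v) ∧
      ‖(chartMetric x z : E →L[ℝ] E →L[ℝ] ℝ)‖ ≤ C ∧
      ‖fderiv ℝ (chartMetric x : E → E →L[ℝ] E →L[ℝ] ℝ) z‖ ≤ C)
    {Cf : ℝ} (hCf : ∀ z ∈ A, ‖fderiv ℝ (V ∘ (extChartAt 𝓘(ℝ, E) x).symm) z‖ ≤ Cf)
    (h₁ : ∀ s ∈ Icc (s₀ - δ) (s₀ + δ), e₁ s ∈ (chartAt E x).source ∧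
      extChartAt 𝓘(ℝ, E) x (e₁ s) ∈ A)
    (h₂ : ∀ s ∈ Icc (s₀ - δ) (s₀ + δ), e₂ s ∈ (chartAt E x).source ∧
      extChartAt 𝓘(ℝ, E) x (e₂ s) ∈ A) {d : ℝ} (hd1 : d ≤ 1)
    (hd : ∀ s ∈ Icc (s₀ - δ) (s₀ + δ),
      ‖extChartAt 𝓘(ℝ, E) x (e₁ s) - extChartAt 𝓘(ℝ, E) x (e₂ s)‖ ≤ d) {K : ℝ}
    (hK₁ : ∫ s in (0 : ℝ)..1, ‖velocity E e₁ s‖ ^ 2 ≤ K)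
    (hK₂ : ∫ s in (0 : ℝ)..1, ‖velocity E e₂ s‖ ^ 2 ≤ K) {τ₁ τ₂ T η : ℝ} (hη : 0 ≤ η)
    (hτ₁ : |τ₁| ≤ T) (hτ₂ : |τ₂| ≤ T)
    (hd₁ : ∀ ξ : LoopTangent e₁, |actionDiff V τ₁ e₁ ξ| ≤ η * h1Norm ξ)
    (hd₂ : ∀ ξ : LoopTangent e₂, |actionDiff V τ₂ e₂ ξ| ≤ η * h1Norm ξ) :
    κ * (δ / 2 * ∫ s in Icc (s₀ - δ / 2) (s₀ + δ / 2), ‖deriv (extChartAt 𝓘(ℝ, E) x ∘ e₁) s -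
      deriv (extChartAt 𝓘(ℝ, E) x ∘ e₂) s‖ ^ 2) ≤
      2 * (Real.exp T * (η * Real.sqrt (C * 1 ^ 2 + 8 * C ^ 2 * κ⁻¹ *
        (3 * (2 * (κ⁻¹ * K) + 1 ^ 2) + κ⁻¹ * 1 ^ 2 * K)) + Real.exp T * (Cf * d))) +
      3 * C * d * (1 + 2 * (κ⁻¹ * K)) := by
  set u₁ : ℝ → E := extChartAt 𝓘(ℝ, E) x ∘ e₁ with hu₁
  set u₂ : ℝ → E := extChartAt 𝓘(ℝ, E) x ∘ e₂ with hu₂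
  have hab : s₀ - δ ≤ s₀ + δ := by linarith
  have hba : s₀ + δ ≤ (s₀ - δ) + 1 := by linarith
  have hd0 : 0 ≤ d := (norm_nonneg _).trans (hd s₀ ⟨by linarith, by linarith⟩)
  have hCf0 : 0 ≤ Cf :=
    (norm_nonneg _).trans (hCf _ (h₁ s₀ ⟨by linarith, by linarith⟩).2)
  have hK0 : 0 ≤ K :=
    (intervalIntegral.integral_nonneg zero_le_one fun s _ => by positivity).trans hK₁
  have m₁ : MapsIntoChart e₁ x (s₀ - δ) (s₀ + δ) := fun s hs => (h₁ s hs).1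
  have m₂ : MapsIntoChart e₂ x (s₀ - δ) (s₀ + δ) := fun s hs => (h₂ s hs).1
  have hu₁H : H1On u₁ (s₀ - δ) (s₀ + δ) := e₁.h1On_chart hab m₁
  have hu₂H : H1On u₂ (s₀ - δ) (s₀ + δ) := e₂.h1On_chart hab m₂
  have k₁ := e₁.integral_sq_deriv_chart_le hab hba hκ
    (fun s hs => ⟨(h₁ s hs).1, (hb _ (h₁ s hs).2).1⟩) hK₁
  have k₂ := e₂.integral_sq_deriv_chart_le hab hba hκ
    (fun s hs => ⟨(h₂ s hs).1, (hb _ (h₂ s hs).2).1⟩) hK₂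
  set ρ : ℝ → ℝ := circleBump s₀ δ with hρ
  have hρL : LipschitzWith 1 ρ := circleBump_lipschitz s₀ δ
  have hρ0 : ∀ s, 0 ≤ ρ s := circleBump_nonneg s₀ δ
  have hρ1 : ∀ s, ρ s ≤ 1 := fun s => (circleBump_le hδ.le s).trans (by linarith)
  -- One coordinate vector, used as a test field along both loops.
  set W : ℝ → E := fun s => ρ s • (u₁ s - u₂ s) with hW
  have hper : Function.Periodic (fun s => u₁ s - u₂ s) 1 := fun s => by
    simp only [hu₁, hu₂, Function.comp_apply, e₁.periodic s, e₂.periodic s]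
  -- Either the cut-off vanishes near `s`, or an integer translate of `s` lies in the interval where
  -- the hypotheses hold; all objects are periodic.
  have hdich : ∀ s, ρ =ᶠ[𝓝 s] 0 ∨ ((e₁ s ∈ (chartAt E x).source ∧ extChartAt 𝓘(ℝ, E) x (e₁ s) ∈ A) ∧
      (e₂ s ∈ (chartAt E x).source ∧ extChartAt 𝓘(ℝ, E) x (e₂ s) ∈ A) ∧ ‖u₁ s - u₂ s‖ ≤ d) := by
    intro s
    rcases lt_or_ge δ ‖((s - s₀ : ℝ) : UnitAddCircle)‖ with h | h
    · exact Or.inl (circleBump_eventuallyEq_zero h)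
    · right
      obtain ⟨n, hn⟩ := exists_int_sub_mem_Icc h
      have := And.intro (h₁ _ hn) (And.intro (h₂ _ hn) (hd _ hn))
      rwa [e₁.apply_sub_int, e₂.apply_sub_int] at this
  have f₁ : IsChartField e₁ x W := isChartField_bump (circleBump_periodic s₀ δ)
    (H1At.of_lipschitzWith hρL) hper fun s => (hdich s).imp_right fun h =>
      ⟨h.1.1, (e₁.h1At_chart h.1.1).sub (e₂.h1At_chart h.2.1.1)⟩
  have f₂ : IsChartField e₂ x W := isChartField_bump (circleBump_periodic s₀ δ)
    (H1At.of_lipschitzWith hρL) hper fun s => (hdich s).imp_right fun h =>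
      ⟨h.2.1.1, (e₁.h1At_chart h.1.1).sub (e₂.h1At_chart h.2.1.1)⟩
  have hW0 : ∀ s, ρ =ᶠ[𝓝 s] 0 → W =ᶠ[𝓝 s] 0 := fun s h => h.mono fun r hr => by
    simp [hW, show ρ r = 0 from hr]
  have hWd : ∀ s, ‖W s‖ ≤ d := by
    intro s
    rcases hdich s with h | h
    · rw [(hW0 s h).eq_of_nhds]; simpa using hd0
    · simp only [hW, norm_smul]
      calc ‖ρ s‖ * ‖u₁ s - u₂ s‖ ≤ 1 * d := by
            refine mul_le_mul ?_ h.2.2 (norm_nonneg _) zero_le_one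
            rw [Real.norm_eq_abs, abs_of_nonneg (hρ0 s)]; exact hρ1 s
        _ = d := one_mul d
  have hWz : ∀ s, |s - s₀| ≤ 1 / 2 → δ < |s - s₀| → W =ᶠ[𝓝 s] 0 := fun s h1 h2 =>
    hW0 s (circleBump_eventuallyEq_zero (by rwa [norm_circle_of_abs_le h1]))
  have hD : ∫ s in (0 : ℝ)..1, ‖deriv W s‖ ^ 2 ≤ 3 * (2 * (κ⁻¹ * K) + 1 ^ 2) := by
    rw [integral_periodic_eq_integral_Icc (s₀ := s₀)
      (fun s => by simp only [deriv_periodic f₁.periodic s]) hδ'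
      (fun s h1 h2 => by rw [(hWz s h1 h2).deriv_eq]; simp)]
    refine (integral_sq_deriv_bump_le hab hba hρL hρ0 hρ1 hu₁H hu₂H hd k₁ k₂).trans ?_
    gcongr
  have n₁ := f₁.h1Norm_le hκ hC hb (fun s => (hdich s).imp (hW0 s) fun h => h.1)
    (fun s => (hWd s).trans hd1) hD hK₁
  have n₂ := f₂.h1Norm_le hκ hC hb (fun s => (hdich s).imp (hW0 s) fun h => h.2.1)
    (fun s => (hWd s).trans hd1) hD hK₂
  set H := Real.sqrt (C * 1 ^ 2 + 8 * C ^ 2 * κ⁻¹ *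
    (3 * (2 * (κ⁻¹ * K) + 1 ^ 2) + κ⁻¹ * 1 ^ 2 * K))
  have hpot : ∀ e : LoopSpace E M, (∀ s ∈ Icc (s₀ - δ) (s₀ + δ), extChartAt 𝓘(ℝ, E) x (e s) ∈ A) →
      |∫ s in Icc (s₀ - δ) (s₀ + δ), fderiv ℝ (V ∘ (extChartAt 𝓘(ℝ, E) x).symm)
        ((extChartAt 𝓘(ℝ, E) x ∘ e) s) (W s)| ≤ Cf * d := by
    intro e he
    rw [← Real.norm_eq_abs]
    refine (norm_setIntegral_le_of_norm_le_const (C := Cf * d) measure_Icc_lt_top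
      fun s hs => ?_).trans ?_
    · exact (ContinuousLinearMap.le_opNorm _ _).trans
        (mul_le_mul (hCf _ (he s hs)) (hWd s) (norm_nonneg _) hCf0)
    · have : volume.real (Icc (s₀ - δ) (s₀ + δ)) ≤ 1 := by
        rw [Real.volume_real_Icc_of_le hab]; linarith
      exact mul_le_of_le_one_right (by positivity) this
  -- The formula for the differential J is solved for the kinetic integral I, given bounds for J,
  -- the potential integral P and τ.
  have hI : ∀ (τ J I P : ℝ), |τ| ≤ T → J = Real.exp (-τ) * I - Real.exp τ * P → |J| ≤ η * H →
      |P| ≤ Cf * d → |I| ≤ Real.exp T * (η * H + Real.exp T * (Cf * d)) := by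
    intro τ J I P hτ hJ hJ' hP
    have hexp : Real.exp τ ≤ Real.exp T := Real.exp_le_exp.2 ((le_abs_self τ).trans hτ)
    have : I = Real.exp τ * (J + Real.exp τ * P) := by
      rw [hJ, sub_add_cancel, ← mul_assoc, ← Real.exp_add]; simp
    rw [this, abs_mul, Real.abs_exp]
    have h1 : |J + Real.exp τ * P| ≤ η * H + Real.exp T * (Cf * d) := by
      refine (abs_add_le _ _).trans (add_le_add hJ' ?_)
      rw [abs_mul, Real.abs_exp]
      exact mul_le_mul hexp hP (abs_nonneg _) (Real.exp_pos _).le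
    exact mul_le_mul hexp h1 (abs_nonneg _) (Real.exp_pos _).le
  have i₁ := hI τ₁ _ _ _ hτ₁ (f₁.actionDiff_eq hV τ₁ hδ' hWz)
    ((hd₁ f₁.field).trans (by gcongr)) (hpot e₁ fun s hs => (h₁ s hs).2)
  have i₂ := hI τ₂ _ _ _ hτ₂ (f₂.actionDiff_eq hV τ₂ hδ' hWz)
    ((hd₂ f₂.field).trans (by gcongr)) (hpot e₂ fun s hs => (h₂ s hs).2)
  have hmain := integral_energy_le hA hC
    (fun z hz => (contDiffAt_chartMetric_of_mem_target (hAt hz)).of_le (by simp)) hb hab hu₁H hu₂H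
    (fun s hs => (h₁ s hs).2) (fun s hs => (h₂ s hs).2) hρL hρ0 hρ1 hd
    (H1On.of_forall_h1At hab fun s _ => f₁.h1At s) k₁ k₂
  have hq : IntegrableOn (fun s => ‖deriv u₁ s - deriv u₂ s‖ ^ 2) (Icc (s₀ - δ) (s₀ + δ)) :=
    (hu₁H.memLp.sub hu₂H.memLp).integrable_norm_pow (p := 2) two_ne_zero
  have hsubs : Icc (s₀ - δ / 2) (s₀ + δ / 2) ⊆ Icc (s₀ - δ) (s₀ + δ) :=
    Icc_subset_Icc (by linarith) (by linarith)
  have hlow : δ / 2 * ∫ s in Icc (s₀ - δ / 2) (s₀ + δ / 2), ‖deriv u₁ s - deriv u₂ s‖ ^ 2 ≤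
      ∫ s in Icc (s₀ - δ) (s₀ + δ), ρ s * ‖deriv u₁ s - deriv u₂ s‖ ^ 2 := by
    have hint : IntegrableOn (fun s => ρ s * ‖deriv u₁ s - deriv u₂ s‖ ^ 2)
        (Icc (s₀ - δ) (s₀ + δ)) :=
      hq.bdd_mul (c := 1) hρL.continuous.aestronglyMeasurable
        (Eventually.of_forall fun s => by
          rw [Real.norm_eq_abs, abs_of_nonneg (hρ0 s)]; exact hρ1 s)
    rw [← integral_const_mul]
    refine (setIntegral_mono_on ((hq.mono_set hsubs).const_mul _) (hint.mono_set hsubs)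
      measurableSet_Icc fun s hs => ?_).trans
      (setIntegral_mono_set hint (Eventually.of_forall fun s => mul_nonneg (hρ0 s) (by positivity))
        hsubs.eventuallyLE)
    have hs' : |s - s₀| ≤ δ / 2 := abs_le.2 ⟨by linarith [hs.1], by linarith [hs.2]⟩
    -- The cut-off is δ minus the distance to s₀, hence at least δ/2 on the interval of half the
    -- size.
    have : δ / 2 ≤ ρ s := by
      rw [hρ, circleBump_of_abs_le (by linarith)]
      exact le_max_of_le_right (by linarith)
    gcongr
  have hend : 3 * C * d * ((s₀ + δ) - (s₀ - δ) + 2 * (κ⁻¹ * K)) ≤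
      3 * C * d * (1 + 2 * (κ⁻¹ * K)) := by
    gcongr
    linarith
  have := mul_le_mul_of_nonneg_left hlow hκ.le
  linarith [(abs_le.1 i₁).2, (abs_le.1 i₂).1]

end PairEstimate

/-! ### L² limits of derivatives -/

section Completeness

variable {E : Type*} [NormedAddCommGroup E] [NormedSpace ℝ E]

theorem eLpNorm_two_le_of_integral_le {α : Type*} [MeasurableSpace α] {μ : Measure α} {f : α → E}
    (hf : MemLp f 2 μ) {η : ℝ} (hη : 0 ≤ η) (h : ∫ s, ‖f s‖ ^ 2 ∂μ ≤ η ^ 2) :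
    eLpNorm f 2 μ ≤ ENNReal.ofReal η := by
  have h1 : eLpNorm f 2 μ ^ 2 = ENNReal.ofReal (∫ s, ‖f s‖ ^ 2 ∂μ) := by
    rw [eLpNorm_two_sq, ofReal_integral_eq_lintegral_ofReal (hf.integrable_norm_pow (p := 2) two_ne_zero)
      (Eventually.of_forall fun s => by positivity)]
    refine lintegral_congr fun s => ?_
    rw [ENNReal.ofReal_pow (norm_nonneg _), ofReal_norm]
  have h2 : eLpNorm f 2 μ ^ 2 ≤ ENNReal.ofReal η ^ 2 := by
    rw [h1, ← ENNReal.ofReal_pow hη]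
    exact ENNReal.ofReal_le_ofReal h
  exact (ENNReal.pow_le_pow_left_iff two_ne_zero).1 h2

/-- Completeness of L². Membership is known only eventually, so the sequence is shifted before it is
viewed in L². -/
theorem exists_limit_of_cauchy_L2 [CompleteSpace E] {α : Type*} [MeasurableSpace α] {μ : Measure α}
    {f : ℕ → α → E} (hf : ∀ᶠ n in atTop, MemLp (f n) 2 μ)
    (hc : ∀ η > 0, ∃ N, ∀ m ≥ N, ∀ n ≥ N, ∫ s, ‖f m s - f n s‖ ^ 2 ∂μ ≤ η) :
    ∃ g, MemLp g 2 μ ∧ Tendsto (fun n => eLpNorm (f n - g) 2 μ) atTop (𝓝 0) := by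
  obtain ⟨N₀, hN₀⟩ := eventually_atTop.1 hf
  have hfN : ∀ n, MemLp (f (n + N₀)) 2 μ := fun n => hN₀ _ (by omega)
  have hcau : CauchySeq fun n => (hfN n).toLp (f (n + N₀)) := by
    rw [EMetric.cauchySeq_iff]
    intro r hr
    obtain ⟨η, hη, hηr⟩ : ∃ η : ℝ, 0 < η ∧ ENNReal.ofReal η < r := by
      obtain ⟨η, h0, h1⟩ := ENNReal.lt_iff_exists_nnreal_btwn.1 hr
      exact ⟨η, by exact_mod_cast h0, by simpa using h1⟩
    obtain ⟨N, hN⟩ := hc (η ^ 2) (by positivity)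
    refine ⟨N, fun m hm n hn => ?_⟩
    rw [Lp.edist_toLp_toLp]
    refine (eLpNorm_two_le_of_integral_le ((hfN m).sub (hfN n)) hη.le ?_).trans_lt hηr
    exact hN _ (by omega) _ (by omega)
  obtain ⟨g, hg⟩ := cauchySeq_tendsto_of_complete hcau
  refine ⟨g, Lp.memLp g, ?_⟩
  rw [← tendsto_add_atTop_iff_nat N₀]
  have h1 := (Lp.tendsto_Lp_iff_tendsto_eLpNorm' _ _).1 hg
  refine h1.congr fun n => eLpNorm_congr_ae ?_
  filter_upwards [(hfN n).coeFn_toLp] with s hs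
  simp [hs]

/-- On a bounded interval L² convergence implies L¹ convergence, so the fundamental theorem of
calculus passes to the limit: u₀ is a primitive of g, and Lebesgue differentiation identifies its
derivative. -/
theorem H1On.of_tendsto [FiniteDimensional ℝ E] {ι : Type*} {l : Filter ι} [NeBot l]
    {u : ι → ℝ → E} {u₀ g : ℝ → E} {a b : ℝ}
    (hab : a ≤ b) (hu : ∀ᶠ i in l, H1On (u i) a b)
    (hlim : ∀ s ∈ Icc a b, Tendsto (fun i => u i s) l (𝓝 (u₀ s)))
    (hg : MemLp g 2 (volume.restrict (Icc a b)))
    (h : Tendsto (fun i => eLpNorm (deriv (u i) - g) 2 (volume.restrict (Icc a b))) l (𝓝 0)) :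
    H1On u₀ a b ∧ deriv u₀ =ᵐ[volume.restrict (Icc a b)] g := by
  have hgint : IntegrableOn g (Icc a b) := hg.integrable (by norm_num)
  have hgi : ∀ s ∈ Icc a b, ∀ t ∈ Icc a b, IntervalIntegrable g volume s t := fun s hs t ht =>
    intervalIntegrable_iff.2 (hgint.mono_set (uIoc_subset_uIcc.trans (uIcc_subset_Icc hs ht)))
  have hL1 : Tendsto (fun i => eLpNorm (deriv (u i) - g) 1 (volume.restrict (Icc a b))) l (𝓝 0) := by
    have h1 := ENNReal.Tendsto.mul_const (b := (volume.restrict (Icc a b)) univ ^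
      (1 / (1 : ℝ≥0∞).toReal - 1 / (2 : ℝ≥0∞).toReal)) h
      (Or.inr (ENNReal.rpow_ne_top_of_nonneg (by norm_num) (measure_ne_top _ _)))
    rw [zero_mul] at h1
    refine tendsto_of_tendsto_of_tendsto_of_le_of_le' tendsto_const_nhds h1
      (Eventually.of_forall fun _ => zero_le) ?_
    filter_upwards [hu] with i hi
    exact eLpNorm_le_eLpNorm_mul_rpow_measure_univ (by norm_num)
      (hi.memLp.aestronglyMeasurable.sub hg.aestronglyMeasurable)
  have hFTC : ∀ s ∈ Icc a b, ∀ t ∈ Icc a b, s ≤ t → ∫ r in s..t, g r = u₀ t - u₀ s := by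
    intro s hs t ht hst
    have hsub : Ioc s t ⊆ Icc a b := fun r hr => ⟨hs.1.trans hr.1.le, hr.2.trans ht.2⟩
    have h1 := tendsto_setIntegral_of_L1' g hg.aestronglyMeasurable
      (hu.mono fun i hi => hi.memLp.integrable (by norm_num)) hL1 (Ioc s t)
    simp only [Measure.restrict_restrict_of_subset hsub] at h1
    rw [intervalIntegral.integral_of_le hst]
    refine tendsto_nhds_unique h1 (((hlim t ht).sub (hlim s hs)).congr' ?_)
    filter_upwards [hu] with i hi
    rw [← (hi.mono hs.1 hst ht.2).1.intervalIntegrable_deriv_vec.2,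
      intervalIntegral.integral_of_le hst]
  have ha : a ∈ Icc a b := ⟨le_rfl, hab⟩
  have hder : deriv u₀ =ᵐ[volume.restrict (Icc a b)] g := by
    rw [← restrict_Ioo_eq_restrict_Icc]
    filter_upwards [ae_restrict_of_ae (hgi a ha b ⟨hab, le_rfl⟩).ae_hasDerivAt_integral,
      ae_restrict_mem measurableSet_Ioo] with s hs hs'
    have h1 := hs (by rw [uIcc_of_le hab]; exact Ioo_subset_Icc_self hs') a left_mem_uIcc
    have h2 : u₀ =ᶠ[𝓝 s] fun t => u₀ a + ∫ r in a..t, g r := by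
      filter_upwards [Icc_mem_nhds hs'.1 hs'.2] with t ht
      rw [hFTC a ha t ht ht.1]; abel
    rw [h2.deriv_eq]
    simpa using (h1.const_add (u₀ a)).deriv
  refine ⟨H1On.of_dist_le hab ?_ fun s t hs hst ht => ?_, hder⟩
  · rw [← eLpNorm_two_sq, eLpNorm_congr_ae hder]
    exact ENNReal.pow_lt_top hg.eLpNorm_lt_top
  · have hs' : s ∈ Icc a b := ⟨hs, hst.trans ht⟩
    have ht' : t ∈ Icc a b := ⟨hs.trans hst, ht⟩
    have hsub : Ioc s t ⊆ Icc a b := fun r hr => ⟨hs.trans hr.1.le, hr.2.trans ht⟩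
    have hder' : deriv u₀ =ᵐ[volume.restrict (Ioc s t)] g :=
      ae_restrict_of_ae_restrict_of_subset hsub hder
    rw [dist_comm, dist_eq_norm, ← hFTC s hs' t ht' hst, intervalIntegral.integral_of_le hst,
      intervalIntegral.integral_of_le hst]
    refine (norm_integral_le_integral_norm _).trans_eq (integral_congr_ae ?_)
    filter_upwards [hder'] with r hr
    rw [hr]

end Completeness

/-! ### H¹ convergence in a chart -/

section LocalConvergence

variable {E : Type*} [NormedAddCommGroup E] [NormedSpace ℝ E] [FiniteDimensional ℝ E]
  {M : Type*} [MetricSpace M] [ChartedSpace E M] [IsManifold 𝓘(ℝ, E) ∞ M]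
  [RiemannianBundle (fun x : M => TangentSpace 𝓘(ℝ, E) x)]
  [IsContMDiffRiemannianBundle 𝓘(ℝ, E) ∞ E (fun x : M => TangentSpace 𝓘(ℝ, E) x)]
  [IsRiemannianManifold 𝓘(ℝ, E) M]

theorem exists_uniform_nhds {e : ℕ → ℝ → M} {c : ℝ → M} {s₀ : ℝ} (hc : ContinuousAt c s₀)
    (h : TendstoUniformly e c atTop) {U : Set M} (hU : U ∈ 𝓝 (c s₀)) :
    ∃ δ > 0, δ ≤ 1 / 2 ∧ (∀ s ∈ Icc (s₀ - δ) (s₀ + δ), c s ∈ U) ∧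
      ∀ᶠ n in atTop, ∀ s ∈ Icc (s₀ - δ) (s₀ + δ), e n s ∈ U := by
  obtain ⟨r, hr, hball⟩ := Metric.mem_nhds_iff.1 hU
  obtain ⟨δ, hδ, hcδ⟩ := Metric.continuousAt_iff.1 hc (r / 2) (by positivity)
  have hcs : ∀ s ∈ Icc (s₀ - min (δ / 2) (1 / 2)) (s₀ + min (δ / 2) (1 / 2)),
      dist (c s) (c s₀) < r / 2 := fun s hs => hcδ (by
    have := min_le_left (δ / 2) (1 / 2)
    rw [Real.dist_eq, abs_lt]
    constructor <;> linarith [hs.1, hs.2])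
  refine ⟨min (δ / 2) (1 / 2), by positivity, min_le_right _ _, fun s hs =>
    hball ((hcs s hs).trans (by linarith)), ?_⟩
  filter_upwards [Metric.tendstoUniformly_iff.1 h (r / 2) (by positivity)] with n hn s hs
  refine hball (Metric.mem_ball.2 ?_)
  have := dist_triangle (e n s) (c s) (c s₀)
  linarith [hn s, hcs s hs, dist_comm (e n s) (c s)]

/-- Uniform convergence makes any two late loops close in the chart, so the pair estimate applies
and the derivatives are Cauchy in L². The limit of the derivatives is the derivative of the uniform
limit. -/
theorem exists_h1_convergence_chart {V : M → ℝ} (hV : ContMDiff 𝓘(ℝ, E) 𝓘(ℝ, ℝ) ∞ V)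
    {e : ℕ → LoopSpace E M} {τ : ℕ → ℝ} {T K : ℝ} (hτ : ∀ n, |τ n| ≤ T)
    (hK : ∀ n, ∫ s in (0 : ℝ)..1, ‖velocity E (e n) s‖ ^ 2 ≤ K)
    (hPS : ∀ η > 0, ∀ᶠ n in atTop, ∀ ξ : LoopTangent (e n),
      |actionDiff V (τ n) (e n) ξ| ≤ η * h1Norm ξ)
    {c : ℝ → M} (hc : Continuous c) (hlim : TendstoUniformly (fun n => (e n).toFun) c atTop)
    {x : M} {s₀ : ℝ} (hx : c s₀ ∈ (chartAt E x).source) :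
    ∃ δ > 0, (∀ s ∈ Icc (s₀ - δ) (s₀ + δ), c s ∈ (chartAt E x).source) ∧
      (∀ᶠ n in atTop, MapsIntoChart (e n) x (s₀ - δ) (s₀ + δ)) ∧
      TendstoUniformlyOn (fun n => extChartAt 𝓘(ℝ, E) x ∘ e n) (extChartAt 𝓘(ℝ, E) x ∘ c) atTop
        (Icc (s₀ - δ) (s₀ + δ)) ∧
      H1On (extChartAt 𝓘(ℝ, E) x ∘ c) (s₀ - δ) (s₀ + δ) ∧
      Tendsto (fun n => eLpNorm (deriv (extChartAt 𝓘(ℝ, E) x ∘ e n) -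
        deriv (extChartAt 𝓘(ℝ, E) x ∘ c)) 2 (volume.restrict (Icc (s₀ - δ) (s₀ + δ)))) atTop
        (𝓝 0) := by
  have : ProperSpace E := FiniteDimensional.proper ℝ E
  have : CompleteSpace E := FiniteDimensional.complete ℝ E
  set φ : M → E := ⇑(extChartAt 𝓘(ℝ, E) x) with hφ
  have hxs : c s₀ ∈ (extChartAt 𝓘(ℝ, E) x).source := by rwa [extChartAt_source]
  have hz₀ : φ (c s₀) ∈ (extChartAt 𝓘(ℝ, E) x).target := (extChartAt 𝓘(ℝ, E) x).map_source hxs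
  obtain ⟨r, hr, hAt⟩ := Metric.nhds_basis_closedBall.mem_iff.1
    ((isOpen_extChartAt_target x).mem_nhds hz₀)
  -- A closed ball is both compact, for uniform bounds on the metric and on dV, and convex, for the
  -- mean value inequality.
  set A : Set E := Metric.closedBall (φ (c s₀)) r with hA
  have hAc : IsCompact A := isCompact_closedBall _ _
  have hAconv : Convex ℝ A := convex_closedBall _ _
  obtain ⟨κ, hκ, C, hC, hb⟩ := exists_chartMetric_bounds hAc hAt
  obtain ⟨Cf, hCf⟩ := hAc.exists_bound_of_continuousOn
    (f := fderiv ℝ (V ∘ (extChartAt 𝓘(ℝ, E) x).symm)) fun z hz =>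
      (((contDiffAt_chart hV (hAt hz)).of_le (m := 1) (by simp)).fderiv_right (m := 0)
        (by simp)).continuousAt.continuousWithinAt
  obtain ⟨L, U, hU, hL⟩ := exists_lipschitz_extChartAt hx
  have hUmem : {q | (q ∈ (chartAt E x).source ∧ φ q ∈ A) ∧ q ∈ U} ∈ 𝓝 (c s₀) :=
    inter_mem (inter_mem ((chartAt E x).open_source.mem_nhds hx)
      ((continuousAt_extChartAt' hxs).preimage_mem_nhds (Metric.closedBall_mem_nhds _ hr))) hU
  obtain ⟨δ, hδ, hδ', hcU, heU⟩ := exists_uniform_nhds hc.continuousAt hlim hUmem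
  have hunif : TendstoUniformlyOn (fun n => φ ∘ e n) (φ ∘ c) atTop (Icc (s₀ - δ) (s₀ + δ)) := by
    rw [tendstoUniformlyOn_iff_norm]
    intro η hη
    filter_upwards [heU, Metric.tendstoUniformly_iff.1 hlim (η / (|L| + 1)) (by positivity)]
      with n hn hd s hs
    rw [← dist_eq_norm]
    calc dist ((φ ∘ e n) s) ((φ ∘ c) s) ≤ L * dist (e n s) (c s) := hL _ (hn s hs).2 _ (hcU s hs).2
      _ ≤ |L| * (η / (|L| + 1)) := by
          rw [dist_comm]
          exact mul_le_mul (le_abs_self L) (hd s).le dist_nonneg (abs_nonneg _)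
      _ ≤ η := by
          rw [mul_div_assoc', div_le_iff₀ (by positivity)]
          nlinarith [abs_nonneg L]
  have hmaps : ∀ᶠ n in atTop, MapsIntoChart (e n) x (s₀ - δ) (s₀ + δ) :=
    heU.mono fun n hn s hs => (hn s hs).1.1
  have hsubs : Icc (s₀ - δ / 2) (s₀ + δ / 2) ⊆ Icc (s₀ - δ) (s₀ + δ) :=
    Icc_subset_Icc (by linarith) (by linarith)
  have hmaps' : ∀ᶠ n in atTop, MapsIntoChart (e n) x (s₀ - δ / 2) (s₀ + δ / 2) :=
    hmaps.mono fun n hn => hn.mono (by linarith) (by linarith)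
  have hH1 : ∀ᶠ n in atTop, H1On (φ ∘ e n) (s₀ - δ / 2) (s₀ + δ / 2) :=
    hmaps'.mono fun n hn => (e n).h1On_chart (by linarith) hn
  have hcau : ∀ θ > 0, ∃ N, ∀ m ≥ N, ∀ n ≥ N, ∫ s in Icc (s₀ - δ / 2) (s₀ + δ / 2),
      ‖deriv (φ ∘ e m) s - deriv (φ ∘ e n) s‖ ^ 2 ≤ θ := by
    intro θ hθ
    have hK0 : 0 ≤ K :=
      (intervalIntegral.integral_nonneg zero_le_one fun s _ => by positivity).trans (hK 0)
    have hCf0 : 0 ≤ Cf := (norm_nonneg _).trans (hCf _ (Metric.mem_closedBall_self hr.le))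
    set H := Real.sqrt (C * 1 ^ 2 + 8 * C ^ 2 * κ⁻¹ *
      (3 * (2 * (κ⁻¹ * K) + 1 ^ 2) + κ⁻¹ * 1 ^ 2 * K)) with hH
    -- When the size of the differentials and the uniform distance are both bounded by d, the
    -- right-hand side of the pair estimate is exactly dQ.
    set Q := 2 * (Real.exp T * (H + Real.exp T * Cf)) + 3 * C * (1 + 2 * (κ⁻¹ * K)) with hQ
    have hQ0 : 0 ≤ Q := by positivity
    set d := min 1 (κ * (δ / 2 * θ) / (Q + 1)) with hd
    have hd0 : 0 < d := by positivity
    obtain ⟨N, hN⟩ := eventually_atTop.1 (heU.and ((hPS d hd0).and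
      (tendstoUniformlyOn_iff_norm.1 hunif (d / 2) (by positivity))))
    refine ⟨N, fun m hm n hn => ?_⟩
    have hmain := LoopSpace.integral_sq_sub_deriv_le hV hδ hδ' hAconv hAt hκ hC.le hb hCf
      (fun s hs => ((hN m hm).1 s hs).1) (fun s hs => ((hN n hn).1 s hs).1) (min_le_left _ _)
      (fun s hs => by
        have h1 := (hN m hm).2.2 s hs
        have h2 := (hN n hn).2.2 s hs
        rw [← dist_eq_norm] at h1 h2 ⊢
        have := dist_triangle_right (φ (e m s)) (φ (e n s)) (φ (c s))
        simp only [Function.comp_apply] at h1 h2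
        linarith) (hK m) (hK n) hd0.le (hτ m) (hτ n) (hN m hm).2.1 (hN n hn).2.1
    have h1 : 2 * (Real.exp T * (d * H + Real.exp T * (Cf * d))) +
        3 * C * d * (1 + 2 * (κ⁻¹ * K)) = d * Q := by rw [hQ]; ring
    have h2 : d * Q ≤ κ * (δ / 2 * θ) := by
      calc d * Q ≤ κ * (δ / 2 * θ) / (Q + 1) * (Q + 1) := by
            gcongr
            · exact min_le_right _ _
            · linarith
        _ = _ := by field_simp
    rw [h1] at hmain
    exact le_of_mul_le_mul_left (le_of_mul_le_mul_left (hmain.trans h2) hκ) (by positivity)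
  obtain ⟨g, hg, hgl⟩ := exists_limit_of_cauchy_L2
    (hH1.mono fun n hn => hn.memLp) hcau
  obtain ⟨h1, h2⟩ := H1On.of_tendsto (u₀ := φ ∘ c) (by linarith) hH1
    (fun s hs => hunif.tendsto_at (hsubs hs)) hg hgl
  refine ⟨δ / 2, by positivity, fun s hs => (hcU s (hsubs hs)).1.1, hmaps', hunif.mono hsubs, h1,
    hgl.congr fun n => eLpNorm_congr_ae ?_⟩
  filter_upwards [h2] with s hs
  simp [hs]

end LocalConvergence

/-! ### Convergence in the loop space -/

section LoopLimit

variable {E : Type*} [NormedAddCommGroup E] [NormedSpace ℝ E] [FiniteDimensional ℝ E]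
  {M : Type*} [MetricSpace M] [ChartedSpace E M] [IsManifold 𝓘(ℝ, E) ∞ M]
  [RiemannianBundle (fun x : M => TangentSpace 𝓘(ℝ, E) x)]
  [IsContMDiffRiemannianBundle 𝓘(ℝ, E) ∞ E (fun x : M => TangentSpace 𝓘(ℝ, E) x)]
  [IsRiemannianManifold 𝓘(ℝ, E) M]

theorem h1NormSq_union_le (a b d : ℝ) (hab : a ≤ b) (hbd : b ≤ d) (f : ℝ → E) :
    h1NormSq a d f ≤ h1NormSq a b f + h1NormSq b d f := by
  rw [h1NormSq, ← Icc_union_Icc_eq_Icc hab hbd]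
  exact lintegral_union_le _ _ _

theorem h1NormSq_mono {a b a' b' : ℝ} (ha : a ≤ a') (hb : b' ≤ b) (f : ℝ → E) :
    h1NormSq a' b' f ≤ h1NormSq a b f :=
  lintegral_mono_set (Icc_subset_Icc ha hb)

theorem tendsto_eLpNorm_of_tendstoUniformlyOn {ι : Type*} {l : Filter ι} {u : ι → ℝ → E} {u₀ : ℝ → E}
    {a b : ℝ} (h : TendstoUniformlyOn u u₀ l (Icc a b)) :
    Tendsto (fun i => eLpNorm (u i - u₀) 2 (volume.restrict (Icc a b))) l (𝓝 0) := by
  rw [ENNReal.tendsto_nhds_zero]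
  intro r hr
  set m : ℝ≥0∞ := (volume.restrict (Icc a b)) univ ^ (2 : ℝ≥0∞).toReal⁻¹ with hm
  have hm_top : m ≠ ⊤ := ENNReal.rpow_ne_top_of_nonneg (by norm_num) (measure_ne_top _ _)
  have hlim : Tendsto (fun η : ℝ => m * ENNReal.ofReal η) (𝓝[>] 0) (𝓝 0) := by
    have h1 : Tendsto (fun η : ℝ => m * ENNReal.ofReal η) (𝓝 0) (𝓝 (m * ENNReal.ofReal 0)) :=
      ENNReal.Tendsto.const_mul (ENNReal.continuous_ofReal.tendsto 0) (Or.inr hm_top)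
    simpa using h1.mono_left nhdsWithin_le_nhds
  obtain ⟨η, hη, hη0⟩ := (((ENNReal.tendsto_nhds_zero.1 hlim) r hr).and self_mem_nhdsWithin).exists
  filter_upwards [tendstoUniformlyOn_iff_norm.1 h η hη0] with i hi
  refine (eLpNorm_le_of_ae_bound (C := η) ?_).trans hη
  filter_upwards [ae_restrict_mem measurableSet_Icc] with s hs
  exact hi s hs

theorem tendsto_h1NormSq_of_tendsto {ι : Type*} {l : Filter ι} {u : ι → ℝ → E} {u₀ : ℝ → E} {a b : ℝ}
    (hab : a ≤ b) (hu : ∀ᶠ i in l, H1On (u i) a b) (hu₀ : H1On u₀ a b)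
    (h : TendstoUniformlyOn u u₀ l (Icc a b))
    (h' : Tendsto (fun i => eLpNorm (deriv (u i) - deriv u₀) 2 (volume.restrict (Icc a b))) l (𝓝 0)) :
    Tendsto (fun i => h1NormSq a b (u i - u₀)) l (𝓝 0) := by
  have h1 := (ENNReal.Tendsto.pow (n := 2) (tendsto_eLpNorm_of_tendstoUniformlyOn h)).add
    (ENNReal.Tendsto.pow (n := 2) h')
  rw [zero_pow two_ne_zero, add_zero] at h1
  refine h1.congr' ?_
  filter_upwards [hu] with i hi
  obtain ⟨h2, h3⟩ := hi.sub hu₀ hab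
  rw [h1NormSq_eq (h2.aestronglyMeasurable hab), eLpNorm_congr_ae h3]

/-- The triangle inequality is applied to the L² norms of the function and of its derivative
separately, and the resulting bound converges to the squared distance from the limit to `v`. This is
needed because the balls generating the topology need not be centred at the limit loop. -/
theorem eventually_h1NormSq_sub_lt {ι : Type*} {l : Filter ι} {u : ι → ℝ → E} {u₀ v : ℝ → E} {a b : ℝ}
    (hab : a ≤ b) (hu : ∀ᶠ i in l, H1On (u i) a b) (hu₀ : H1On u₀ a b) (hv : H1On v a b)
    (h : Tendsto (fun i => h1NormSq a b (u i - u₀)) l (𝓝 0)) {r : ℝ≥0∞}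
    (hr : h1NormSq a b (u₀ - v) < r) : ∀ᶠ i in l, h1NormSq a b (u i - v) < r := by
  obtain ⟨k1, k2⟩ := hu₀.sub hv hab
  rw [h1NormSq_eq (k1.aestronglyMeasurable hab), eLpNorm_congr_ae k2] at hr
  set μ := volume.restrict (Icc a b)
  have hsq : ∀ᶠ i in l, eLpNorm (u i - u₀) 2 μ ^ 2 ≤ h1NormSq a b (u i - u₀) ∧
      eLpNorm (deriv (u i) - deriv u₀) 2 μ ^ 2 ≤ h1NormSq a b (u i - u₀) := by
    filter_upwards [hu] with i hi
    obtain ⟨h2, h3⟩ := hi.sub hu₀ hab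
    rw [h1NormSq_eq (h2.aestronglyMeasurable hab), eLpNorm_congr_ae h3]
    exact ⟨le_self_add, le_add_self⟩
  have hroot : Tendsto (fun i => h1NormSq a b (u i - u₀) ^ (1 / 2 : ℝ)) l (𝓝 0) := by
    have := (ENNReal.continuous_rpow_const (y := (1 / 2 : ℝ))).tendsto 0 |>.comp h
    simpa [Function.comp_def] using this
  have hle : ∀ x y : ℝ≥0∞, x ^ 2 ≤ y → x ≤ y ^ (1 / 2 : ℝ) := fun x y hxy => by
    rw [one_div, ENNReal.le_rpow_inv_iff (by norm_num)]
    exact_mod_cast hxy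
  have hlim : Tendsto (fun i => (h1NormSq a b (u i - u₀) ^ (1 / 2 : ℝ) + eLpNorm (u₀ - v) 2 μ) ^ 2 +
      (h1NormSq a b (u i - u₀) ^ (1 / 2 : ℝ) + eLpNorm (deriv u₀ - deriv v) 2 μ) ^ 2) l
      (𝓝 ((0 + eLpNorm (u₀ - v) 2 μ) ^ 2 + (0 + eLpNorm (deriv u₀ - deriv v) 2 μ) ^ 2)) :=
    (ENNReal.Tendsto.pow (hroot.add_const _)).add (ENNReal.Tendsto.pow (hroot.add_const _))
  rw [zero_add, zero_add] at hlim
  filter_upwards [hlim.eventually (gt_mem_nhds hr), hsq, hu] with i hi1 hi2 hi3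
  obtain ⟨h2, h3⟩ := hi3.sub hv hab
  rw [h1NormSq_eq (h2.aestronglyMeasurable hab), eLpNorm_congr_ae h3]
  refine lt_of_le_of_lt (add_le_add ?_ ?_) hi1
  · gcongr
    calc eLpNorm (u i - v) 2 μ = eLpNorm ((u i - u₀) + (u₀ - v)) 2 μ := by rw [sub_add_sub_cancel]
      _ ≤ eLpNorm (u i - u₀) 2 μ + eLpNorm (u₀ - v) 2 μ :=
        eLpNorm_add_le ((hi3.sub hu₀ hab).1.aestronglyMeasurable hab)
          (k1.aestronglyMeasurable hab) (by norm_num)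
      _ ≤ _ := by gcongr; exact hle _ _ hi2.1
  · gcongr
    calc eLpNorm (deriv (u i) - deriv v) 2 μ
        = eLpNorm ((deriv (u i) - deriv u₀) + (deriv u₀ - deriv v)) 2 μ := by rw [sub_add_sub_cancel]
      _ ≤ eLpNorm (deriv (u i) - deriv u₀) 2 μ + eLpNorm (deriv u₀ - deriv v) 2 μ :=
        eLpNorm_add_le (hi3.memLp.sub hu₀.memLp).aestronglyMeasurable
          (hu₀.memLp.sub hv.memLp).aestronglyMeasurable (by norm_num)
      _ ≤ _ := by gcongr; exact hle _ _ hi2.2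

/-- Local `H¹` convergence in charts, together with the regularity of the limit, gives convergence
in the loop space. -/
theorem LoopSpace.exists_tendsto {e : ℕ → LoopSpace E M} {c : ℝ → M}
    (hper : Function.Periodic c 1) (hac : ∀ a b, AbsolutelyContinuousOnInterval c a b)
    (hloc : ∀ (x : M) (s₀ : ℝ), c s₀ ∈ (chartAt E x).source →
      ∃ δ > 0, (∀ s ∈ Icc (s₀ - δ) (s₀ + δ), c s ∈ (chartAt E x).source) ∧
        (∀ᶠ n in atTop, MapsIntoChart (e n) x (s₀ - δ) (s₀ + δ)) ∧
        TendstoUniformlyOn (fun n => extChartAt 𝓘(ℝ, E) x ∘ e n) (extChartAt 𝓘(ℝ, E) x ∘ c) atTop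
          (Icc (s₀ - δ) (s₀ + δ)) ∧
        H1On (extChartAt 𝓘(ℝ, E) x ∘ c) (s₀ - δ) (s₀ + δ) ∧
        Tendsto (fun n => eLpNorm (deriv (extChartAt 𝓘(ℝ, E) x ∘ e n) -
          deriv (extChartAt 𝓘(ℝ, E) x ∘ c)) 2 (volume.restrict (Icc (s₀ - δ) (s₀ + δ)))) atTop
          (𝓝 0)) :
    ∃ c' : LoopSpace E M, c'.toFun = c ∧ Tendsto e atTop (𝓝 c') := by
  have hcont : Continuous c := continuous_iff_continuousAt.2 fun s =>
    (hac (s - 1) (s + 1)).continuousAt_of_mem_Ioo ⟨by linarith, by linarith⟩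
  -- Finite energy is a local property: near each point the speed is bounded by the norm of the
  -- coordinate derivative, which is in L².
  have henergy : ∫⁻ s in Icc (0 : ℝ) 1, ‖velocity E c s‖ₑ ^ 2 < ⊤ := by
    refine interval_induction (P := fun a b => ∫⁻ s in Icc a b, ‖velocity E c s‖ₑ ^ 2 < ⊤)
      (fun a b d hab hbd h1 h2 => ?_) zero_le_one fun s₀ _ => ?_
    · rw [← Icc_union_Icc_eq_Icc hab hbd]
      exact (lintegral_union_le _ _ _).trans_lt (ENNReal.add_lt_top.2 ⟨h1, h2⟩)
    · have hx := mem_chart_source E (c s₀)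
      obtain ⟨A, hA, hAt, hAn⟩ := exists_compact_nhds_in_chart (E := E) hx
      obtain ⟨κ, hκ, C, hC, hbd⟩ := exists_chartMetric_bounds hA hAt
      obtain ⟨δ, hδ, hs, -, -, hH, -⟩ := hloc (c s₀) s₀ hx
      obtain ⟨δ', hδ', hball⟩ := Metric.mem_nhds_iff.1 (hcont.continuousAt.preimage_mem_nhds hAn)
      refine ⟨min δ δ', lt_min hδ hδ', fun u v _ _ _ hu hv => ?_⟩
      have hm1 := min_le_left δ δ'
      have hm2 := min_le_right δ δ'
      have hbound : ∀ s ∈ Icc u v, ‖velocity E c s‖ₑ ^ 2 ≤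
          ENNReal.ofReal C * ‖deriv (extChartAt 𝓘(ℝ, E) (c s₀) ∘ c) s‖ₑ ^ 2 := by
        intro s hs'
        have hmem := hball (show s ∈ Metric.ball s₀ δ' by
          rw [Metric.mem_ball, Real.dist_eq, abs_lt]; constructor <;> linarith [hs'.1, hs'.2])
        have h1 := sq_norm_velocity hcont.continuousAt hmem.1
        have h2 : ‖velocity E c s‖ ^ 2 ≤ C * ‖deriv (extChartAt 𝓘(ℝ, E) (c s₀) ∘ c) s‖ ^ 2 := by
          rw [h1]
          refine (Real.le_norm_self _).trans ((ContinuousLinearMap.le_opNorm₂ _ _ _).trans ?_)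
          rw [mul_assoc, ← sq]
          gcongr
          exact (hbd _ hmem.2).2.1
        rw [← ofReal_norm, ← ofReal_norm, ← ENNReal.ofReal_pow (norm_nonneg _),
          ← ENNReal.ofReal_pow (norm_nonneg _), ← ENNReal.ofReal_mul hC.le]
        exact ENNReal.ofReal_le_ofReal h2
      calc ∫⁻ s in Icc u v, ‖velocity E c s‖ₑ ^ 2
          ≤ ∫⁻ s in Icc u v, ENNReal.ofReal C *
              ‖deriv (extChartAt 𝓘(ℝ, E) (c s₀) ∘ c) s‖ₑ ^ 2 :=
            setLIntegral_mono' measurableSet_Icc hbound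
        _ ≤ ∫⁻ s in Icc (s₀ - δ) (s₀ + δ), ENNReal.ofReal C *
              ‖deriv (extChartAt 𝓘(ℝ, E) (c s₀) ∘ c) s‖ₑ ^ 2 :=
            lintegral_mono_set (Icc_subset_Icc (by linarith) (by linarith))
        _ < ⊤ := by
            rw [lintegral_const_mul' _ _ ENNReal.ofReal_ne_top]
            exact ENNReal.mul_lt_top ENNReal.ofReal_lt_top hH.2
  set c' : LoopSpace E M := ⟨c, hper, hac, henergy⟩ with hc'
  refine ⟨c', rfl, ?_⟩
  have key : ∀ (x : M) (a b : ℝ), a ≤ b → MapsIntoChart c' x a b →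
      (∀ᶠ n in atTop, MapsIntoChart (e n) x a b) ∧
      Tendsto (fun n => h1NormSq a b (extChartAt 𝓘(ℝ, E) x ∘ e n - extChartAt 𝓘(ℝ, E) x ∘ c))
        atTop (𝓝 0) := by
    intro x a b hab hmaps
    refine interval_induction (P := fun a b => (∀ᶠ n in atTop, MapsIntoChart (e n) x a b) ∧
      Tendsto (fun n => h1NormSq a b (extChartAt 𝓘(ℝ, E) x ∘ e n - extChartAt 𝓘(ℝ, E) x ∘ c))
        atTop (𝓝 0)) (fun a b d hab hbd h1 h2 => ⟨?_, ?_⟩) hab fun s₀ hs₀ => ?_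
    · filter_upwards [h1.1, h2.1] with n k1 k2 s hs
      rcases le_total s b with h | h
      · exact k1 s ⟨hs.1, h⟩
      · exact k2 s ⟨h, hs.2⟩
    · have := h1.2.add h2.2
      rw [add_zero] at this
      exact tendsto_of_tendsto_of_tendsto_of_le_of_le tendsto_const_nhds this
        (fun n => zero_le) fun n => h1NormSq_union_le a b d hab hbd _
    · obtain ⟨δ, hδ, hs, h1, h2, h3, h4⟩ := hloc x s₀ (hmaps s₀ hs₀)
      refine ⟨δ, hδ, fun u v _ _ _ hu hv => ⟨h1.mono fun n hn => hn.mono hu.le hv.le, ?_⟩⟩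
      have hle : s₀ - δ ≤ s₀ + δ := by linarith
      exact tendsto_of_tendsto_of_tendsto_of_le_of_le tendsto_const_nhds
        (tendsto_h1NormSq_of_tendsto hle (h1.mono fun n hn => (e n).h1On_chart hle hn) h3 h2 h4)
        (fun n => zero_le) fun n => h1NormSq_mono hu.le hv.le _
  -- Only generating sets have to be checked: balls around some c₀ that contain the limit.
  refine TopologicalSpace.tendsto_nhds_generateFrom_iff.2 ?_
  rintro U ⟨c₀, x, a, b, r, hab, hc₀, hr, rfl⟩ hcU
  obtain ⟨k1, k2⟩ := key x a b hab hcU.1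
  have := eventually_h1NormSq_sub_lt hab (k1.mono fun n hn => (e n).h1On_chart hab hn)
    (c'.h1On_chart hab hcU.1) (c₀.h1On_chart hab hc₀) k2 hcU.2
  filter_upwards [k1, this] with n hn1 hn2
  exact ⟨hn1, hn2⟩

end LoopLimit

/-! ### The differential of the action at the limit -/

section ChartFieldLimit

variable {E : Type*} [NormedAddCommGroup E] [NormedSpace ℝ E] [FiniteDimensional ℝ E]
  {M : Type*} [MetricSpace M] [ChartedSpace E M] [IsManifold 𝓘(ℝ, E) ∞ M]
  [RiemannianBundle (fun x : M => TangentSpace 𝓘(ℝ, E) x)]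
  [IsContMDiffRiemannianBundle 𝓘(ℝ, E) ∞ E (fun x : M => TangentSpace 𝓘(ℝ, E) x)]
  [IsRiemannianManifold 𝓘(ℝ, E) M]

/-- In a chart ⟨c', ∇_s ξ⟩ is linear in the coordinates of ξ and their derivatives. Additivity is
used almost everywhere only, at points where all the coordinates are differentiable. -/
theorem LoopTangent.actionDiff_eq_sum {V : M → ℝ} (hV : ContMDiff 𝓘(ℝ, E) 𝓘(ℝ, ℝ) ∞ V) (τ : ℝ)
    {c : LoopSpace E M} (ξ : LoopTangent c) {ι : Type*} (t : Finset ι) (η : ι → LoopTangent c)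
    (h : ∀ s, ∑ i ∈ t, η i s = ξ s) : actionDiff V τ c ξ = ∑ i ∈ t, actionDiff V τ c (η i) := by
  have hcoord : ∀ x : M, fieldCoord c ξ x = fun s => ∑ i ∈ t, fieldCoord c (η i) x s := by
    intro x
    funext s
    change chartCoord x (c s) (ξ s) = ∑ i ∈ t, chartCoord x (c s) (η i s)
    rw [← h s, map_sum]
  have hae : ∀ᵐ s ∂volume.restrict (Icc (0 : ℝ) 1), inner ℝ (velocity E c s) (covDeriv c ξ s) =
      ∑ i ∈ t, inner ℝ (velocity E c s) (covDeriv c (η i) s) := by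
    refine interval_induction (P := fun a b => ∀ᵐ s ∂volume.restrict (Icc a b),
      inner ℝ (velocity E c s) (covDeriv c ξ s) =
        ∑ i ∈ t, inner ℝ (velocity E c s) (covDeriv c (η i) s))
      (fun a b d hab hbd h1 h2 => ?_) zero_le_one fun s₀ _ => ?_
    · rw [← Icc_union_Icc_eq_Icc hab hbd]
      exact (ae_restrict_union_iff _ _ _).2 ⟨h1, h2⟩
    · obtain ⟨δ, hδ, hm⟩ := c.exists_mapsIntoChart (mem_chart_source E (c s₀))
      refine ⟨δ, hδ, fun u v _ huv _ hu hv => ?_⟩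
      have hm' : MapsIntoChart c (c s₀) u v := hm.mono hu.le hv.le
      have hη : ∀ᵐ s ∂volume.restrict (Icc u v), ∀ i ∈ t,
          DifferentiableAt ℝ (fieldCoord c (η i) (c s₀)) s :=
        (ae_ball_iff t.countable_toSet).2 fun i _ => ((η i).h1On huv hm').ae_differentiableAt huv
      filter_upwards [hη, (ξ.h1On huv hm').ae_differentiableAt huv,
        (c.h1On_chart huv hm').ae_differentiableAt huv, ae_restrict_mem measurableSet_Icc]
        with s k1 k2 k3 hs
      rw [inner_velocity_covDeriv (hm' s hs) k3 k2, Finset.sum_congr rfl fun i hi =>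
        inner_velocity_covDeriv (hm' s hs) k3 (k1 i hi), hcoord,
        (HasDerivAt.fun_sum fun i hi => (k1 i hi).hasDerivAt).deriv, Finset.sum_add_distrib,
        ← Finset.mul_sum]
      simp only [map_sum, FunLike.coe_sum, Finset.sum_apply]
  simp only [actionDiff, Finset.sum_sub_distrib, ← Finset.mul_sum]
  rw [← intervalIntegral.integral_finsetSum fun i _ => (η i).intervalIntegrable_inner zero_le_one,
    ← intervalIntegral.integral_finsetSum fun i _ =>
      (η i).intervalIntegrable_dPot hV zero_le_one]
  congr 2
  · rw [intervalIntegral.integral_of_le zero_le_one, intervalIntegral.integral_of_le zero_le_one]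
    exact integral_congr_ae (ae_restrict_of_ae_restrict_of_subset Ioc_subset_Icc_self hae)
  · refine intervalIntegral.integral_congr fun s _ => ?_
    rw [← h s, map_sum]

theorem tendstoUniformlyOn_clm_apply {F : Type*} [NormedAddCommGroup F] [NormedSpace ℝ F]
    {ι : Type*} {l : Filter ι} {D : ι → ℝ → E →L[ℝ] F} {D₀ : ℝ → E →L[ℝ] F} {S : Set ℝ}
    (h : TendstoUniformlyOn D D₀ l S) {W : ℝ → E} {w₀ : ℝ} (hW : ∀ s ∈ S, ‖W s‖ ≤ w₀) :
    TendstoUniformlyOn (fun i s => D i s (W s)) (fun s => D₀ s (W s)) l S := by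
  rw [tendstoUniformlyOn_iff_norm] at h ⊢
  intro η hη
  filter_upwards [h (η / (|w₀| + 1)) (by positivity)] with i hi s hs
  rw [← sub_apply]
  calc ‖(D i s - D₀ s) (W s)‖ ≤ ‖D i s - D₀ s‖ * ‖W s‖ := ContinuousLinearMap.le_opNorm _ _
    _ ≤ η / (|w₀| + 1) * (|w₀| + 1) := by
        refine mul_le_mul (hi s hs) ?_ (norm_nonneg _) (by positivity)
        linarith [hW s hs, le_abs_self w₀]
    _ = η := by field_simp

/-- The coordinates `W` of the test field stay fixed while the loop varies; both terms are bilinear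
in L²-convergent derivatives, with uniformly convergent coefficients. -/
theorem tendsto_integral_varDensity {ι : Type*} {l : Filter ι} {e : ι → LoopSpace E M}
    {c : LoopSpace E M} (he : Tendsto e l (𝓝 c)) {x : M} {a b : ℝ} (hab : a < b)
    (h : MapsIntoChart c x a b) {W : ℝ → E} (hW : H1On W a b) :
    Tendsto (fun i => ∫ s in Icc a b,
      varDensity E (chartMetric x) (extChartAt 𝓘(ℝ, E) x ∘ e i) W s) l
      (𝓝 (∫ s in Icc a b, varDensity E (chartMetric x) (extChartAt 𝓘(ℝ, E) x ∘ c) W s)) := by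
  obtain ⟨hm, hu, hd⟩ := LoopSpace.tendsto_chart_of_lt he hab h
  have hWc : ContinuousOn W (Icc a b) := hW.continuousOn hab.le
  obtain ⟨w₀, hw₀⟩ := isCompact_Icc.exists_bound_of_continuousOn hWc
  have hmem : MapsTo (extChartAt 𝓘(ℝ, E) x ∘ c) (Icc a b) ((extChartAt 𝓘(ℝ, E) x ∘ c) '' Icc a b) :=
    mapsTo_image _ _
  have hmemLp : ∀ᶠ i in l, MemLp (deriv (extChartAt 𝓘(ℝ, E) x ∘ e i)) 2
      (volume.restrict (Icc a b)) := hm.mono fun i hi => ((e i).h1On_chart hab.le hi).memLp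
  have hmemLp₀ := (c.h1On_chart hab.le h).memLp
  have hG := TendstoUniformlyOn.comp_of_continuousAt h.isCompact_image
    (G := (chartMetric x : E → E →L[ℝ] E →L[ℝ] ℝ))
    (fun z hz => (contDiffAt_chartMetric_of_mem_target (h.image_subset hz)).continuousAt) hmem hu
  have hDG := tendstoUniformlyOn_clm_apply (TendstoUniformlyOn.comp_of_continuousAt h.isCompact_image
    (G := fderiv ℝ (chartMetric x : E → E →L[ℝ] E →L[ℝ] ℝ))
    (fun z hz => continuousAt_fderiv_chartMetric (h.image_subset hz)) hmem hu) hw₀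
  have h1 := tendsto_integral_bilin_of_continuousOn (v := fun _ : ι => deriv W) (v₀ := deriv W)
    (hm.mono fun i hi => hi.continuousOn_chartMetric) h.continuousOn_chartMetric hG
    (Eventually.of_forall fun _ => hW.memLp) hW.memLp (by simp [tendsto_const_nhds]) hmemLp hmemLp₀ hd
  have h2 := tendsto_integral_bilin_of_continuousOn
    (hm.mono fun i hi => hi.continuousOn_fderiv_chartMetric hWc)
    (h.continuousOn_fderiv_chartMetric hWc) hDG hmemLp hmemLp₀ hd hmemLp hmemLp₀ hd
  have hsplit : ∀ e : LoopSpace E M, MapsIntoChart e x a b →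
      ∫ s in Icc a b, varDensity E (chartMetric x) (extChartAt 𝓘(ℝ, E) x ∘ e) W s =
      (∫ s in Icc a b, chartMetric x ((extChartAt 𝓘(ℝ, E) x ∘ e) s) (deriv W s)
        (deriv (extChartAt 𝓘(ℝ, E) x ∘ e) s)) +
      (1 / 2 : ℝ) * ∫ s in Icc a b, fderiv ℝ (chartMetric x : E → E →L[ℝ] E →L[ℝ] ℝ)
        ((extChartAt 𝓘(ℝ, E) x ∘ e) s) (W s)
        (deriv (extChartAt 𝓘(ℝ, E) x ∘ e) s) (deriv (extChartAt 𝓘(ℝ, E) x ∘ e) s) := by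
    intro e hm
    have hL := (e.h1On_chart hab.le hm).memLp
    rw [← integral_const_mul, ← integral_add
      (integrable_bilin_of_continuousOn hm.continuousOn_chartMetric hW.memLp hL)
      ((integrable_bilin_of_continuousOn (hm.continuousOn_fderiv_chartMetric hWc) hL hL).const_mul _)]
    rfl
  rw [hsplit c h]
  exact (h1.add (h2.const_mul _)).congr' (hm.mono fun i hi => (hsplit (e i) hi).symm)

theorem tendsto_integral_fderiv_potential {V : M → ℝ} (hV : ContMDiff 𝓘(ℝ, E) 𝓘(ℝ, ℝ) ∞ V)
    {ι : Type*} {l : Filter ι} {e : ι → LoopSpace E M}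
    {c : LoopSpace E M} (he : Tendsto e l (𝓝 c)) {x : M} {a b : ℝ} (hab : a < b)
    (h : MapsIntoChart c x a b) {W : ℝ → E} (hW : ContinuousOn W (Icc a b)) :
    Tendsto (fun i => ∫ s in Icc a b, fderiv ℝ (V ∘ (extChartAt 𝓘(ℝ, E) x).symm)
      ((extChartAt 𝓘(ℝ, E) x ∘ e i) s) (W s)) l
      (𝓝 (∫ s in Icc a b, fderiv ℝ (V ∘ (extChartAt 𝓘(ℝ, E) x).symm)
        ((extChartAt 𝓘(ℝ, E) x ∘ c) s) (W s))) := by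
  obtain ⟨hm, hu, -⟩ := LoopSpace.tendsto_chart_of_lt he hab h
  obtain ⟨w₀, hw₀⟩ := isCompact_Icc.exists_bound_of_continuousOn hW
  have hf : ∀ z ∈ (extChartAt 𝓘(ℝ, E) x).target,
      ContinuousAt (fderiv ℝ (V ∘ (extChartAt 𝓘(ℝ, E) x).symm)) z := fun z hz =>
    (((contDiffAt_chart hV hz).of_le (m := 1) (by simp)).fderiv_right (m := 0)
      (by simp)).continuousAt
  have hc : ∀ e : LoopSpace E M, MapsIntoChart e x a b → ContinuousOn (fun s =>
      fderiv ℝ (V ∘ (extChartAt 𝓘(ℝ, E) x).symm) ((extChartAt 𝓘(ℝ, E) x ∘ e) s) (W s)) (Icc a b) :=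
    fun e hm => (hm.continuousOn_comp fun z hz => (hf z hz).continuousWithinAt).clm_apply hW
  simp only [integral_Icc_eq_integral_Ioc, ← intervalIntegral.integral_of_le hab.le]
  exact tendsto_intervalIntegral_of_tendstoUniformlyOn hab.le (hm.mono fun i hi => hc (e i) hi)
    (hc c h) (tendstoUniformlyOn_clm_apply (TendstoUniformlyOn.comp_of_continuousAt h.isCompact_image
      (fun z hz => hf z (h.image_subset hz)) (mapsTo_image _ _) hu) hw₀)

theorem isChartField_of_circle {c : LoopSpace E M} {x : M} {s₀ δ : ℝ}
    (h : MapsIntoChart c x (s₀ - δ) (s₀ + δ)) {W : ℝ → E} (hp : Function.Periodic W 1)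
    (hW : ∀ s, H1At W s)
    (h0 : ∀ s, δ < ‖((s - s₀ : ℝ) : UnitAddCircle)‖ → W =ᶠ[𝓝 s] 0) : IsChartField c x W where
  periodic := hp
  h1At := hW
  eventually_eq_zero s hs := h0 s (by
    by_contra! hle
    exact hs (c.mem_of_norm_circle_le h hle))

/-- At a limit of a sequence of loops with small action differentials, the differential of the
action vanishes on the vector fields supported in a chart. -/
theorem IsChartField.actionDiff_eq_zero {V : M → ℝ} (hV : ContMDiff 𝓘(ℝ, E) 𝓘(ℝ, ℝ) ∞ V)
    {e : ℕ → LoopSpace E M} {c : LoopSpace E M} (he : Tendsto e atTop (𝓝 c)) {τ : ℕ → ℝ} {τ₀ : ℝ}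
    (hτ : Tendsto τ atTop (𝓝 τ₀)) {K : ℝ}
    (hK : ∀ n, ∫ s in (0 : ℝ)..1, ‖velocity E (e n) s‖ ^ 2 ≤ K)
    (hPS : ∀ η > 0, ∀ᶠ n in atTop, ∀ ξ : LoopTangent (e n),
      |actionDiff V (τ n) (e n) ξ| ≤ η * h1Norm ξ) {x : M} {W : ℝ → E} (hW : IsChartField c x W)
    {s₀ δ : ℝ} (hδ : 0 < δ) (hδ' : δ ≤ 1 / 2) (h : MapsIntoChart c x (s₀ - δ) (s₀ + δ))
    (h0 : ∀ s, δ < ‖((s - s₀ : ℝ) : UnitAddCircle)‖ → W =ᶠ[𝓝 s] 0) :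
    actionDiff V τ₀ c hW.field = 0 := by
  have hab : s₀ - δ < s₀ + δ := by linarith
  have hWz : ∀ s, |s - s₀| ≤ 1 / 2 → δ < |s - s₀| → W =ᶠ[𝓝 s] 0 := fun s h1 h2 =>
    h0 s (by rwa [norm_circle_of_abs_le h1])
  have hWH : H1On W (s₀ - δ) (s₀ + δ) := H1On.of_forall_h1At hab.le fun s _ => hW.h1At s
  obtain ⟨hm, hu, -⟩ := LoopSpace.tendsto_chart_of_lt he hab h
  -- A compact thickening of the limit arc inside the chart contains the arcs of all late loops, so
  -- one set of metric bounds serves them all.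
  obtain ⟨r, hr, hrt⟩ := h.isCompact_image.exists_cthickening_subset_open
    (isOpen_extChartAt_target x) h.image_subset
  have : ProperSpace E := FiniteDimensional.proper ℝ E
  obtain ⟨κ, hκ, C, hC, hb⟩ := exists_chartMetric_bounds h.isCompact_image.cthickening hrt
  have hmem : ∀ᶠ n in atTop, ∀ s ∈ Icc (s₀ - δ) (s₀ + δ), e n s ∈ (chartAt E x).source ∧
      extChartAt 𝓘(ℝ, E) x (e n s) ∈
        Metric.cthickening r ((extChartAt 𝓘(ℝ, E) x ∘ c) '' Icc (s₀ - δ) (s₀ + δ)) := by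
    filter_upwards [hm, tendstoUniformlyOn_iff_norm.1 hu r hr] with n h1 h2 s hs
    refine ⟨h1 s hs, Metric.mem_cthickening_of_dist_le _ _ r _ (mem_image_of_mem _ hs) ?_⟩
    rw [dist_eq_norm]
    exact h2 s hs
  obtain ⟨w₀, hw₀⟩ : ∃ w₀, ∀ s, ‖W s‖ ≤ w₀ := by
    obtain ⟨w₀, hw⟩ := isCompact_Icc.exists_bound_of_continuousOn
      (hW.continuous.continuousOn (s := Icc (0 : ℝ) 1))
    refine ⟨w₀, fun s => ?_⟩
    have := hW.periodic.sub_zsmul_eq (x := s) ⌊s⌋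
    rw [zsmul_one] at this
    rw [← this]
    exact hw _ ⟨Int.fract_nonneg s, (Int.fract_lt_one s).le⟩
  set H := Real.sqrt (C * w₀ ^ 2 + 8 * C ^ 2 * κ⁻¹ *
    ((∫ s in (0 : ℝ)..1, ‖deriv W s‖ ^ 2) + κ⁻¹ * w₀ ^ 2 * K)) with hH
  have hformula : ∀ τ : ℝ, ∀ e : LoopSpace E M, MapsIntoChart e x (s₀ - δ) (s₀ + δ) →
      ∃ hf : IsChartField e x W, actionDiff V τ e hf.field =
        Real.exp (-τ) * (∫ s in Icc (s₀ - δ) (s₀ + δ),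
          varDensity E (chartMetric x) (extChartAt 𝓘(ℝ, E) x ∘ e) W s) -
        Real.exp τ * ∫ s in Icc (s₀ - δ) (s₀ + δ),
          fderiv ℝ (V ∘ (extChartAt 𝓘(ℝ, E) x).symm) ((extChartAt 𝓘(ℝ, E) x ∘ e) s) (W s) :=
    fun τ e hm =>
      ⟨isChartField_of_circle hm hW.periodic hW.h1At h0, IsChartField.actionDiff_eq hV τ _ hδ' hWz⟩
  have hlim := (((Real.continuous_exp.tendsto _).comp hτ.neg).mul
    (tendsto_integral_varDensity he hab h hWH)).sub
    (((Real.continuous_exp.tendsto _).comp hτ).mul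
    (tendsto_integral_fderiv_potential hV he hab h hW.continuous.continuousOn))
  rw [hW.actionDiff_eq hV τ₀ hδ' hWz]
  -- The differentials on the transplanted fields converge to the differential at the limit, and
  -- also to zero, since the norms of these fields are bounded by H.
  refine tendsto_nhds_unique hlim (Metric.tendsto_nhds.2 fun θ hθ => ?_)
  filter_upwards [hm, hmem, hPS (θ / (2 * (H + 1))) (by positivity)] with n h1 h2 h3
  obtain ⟨hf, hfe⟩ := hformula (τ n) (e n) h1
  simp only [Function.comp_def] at hfe ⊢
  rw [← hfe, Real.dist_eq, sub_zero]
  have hn : h1Norm hf.field ≤ H := hf.h1Norm_le hκ hC.le hb (fun s => by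
    rcases lt_or_ge δ ‖((s - s₀ : ℝ) : UnitAddCircle)‖ with h | h
    · exact Or.inl (h0 s h)
    · exact Or.inr ((e n).mem_of_norm_circle_le (S := {q | q ∈ (chartAt E x).source ∧
        extChartAt 𝓘(ℝ, E) x q ∈ Metric.cthickening r
          ((extChartAt 𝓘(ℝ, E) x ∘ c) '' Icc (s₀ - δ) (s₀ + δ))}) h2 h)) hw₀ le_rfl (hK n)
  calc |actionDiff V (τ n) (e n) hf.field| ≤ θ / (2 * (H + 1)) * h1Norm hf.field := h3 _
    _ ≤ θ / (2 * (H + 1)) * (H + 1) := by gcongr; linarith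
    _ = θ / 2 := by
        have : H + 1 ≠ 0 := by positivity
        field_simp
    _ < θ := by linarith

theorem chartCoord_injective {x q : M} (hq : q ∈ (chartAt E x).source) :
    Function.Injective (chartCoord (E := E) x q) :=
  (isInvertible_mfderiv_extChartAt (by rwa [extChartAt_source])).injective

/-- A vector field along a loop is a finite sum of vector fields supported in charts. -/
theorem LoopTangent.exists_sum_chartFields {c : LoopSpace E M} (ξ : LoopTangent c) :
    ∃ (t : Finset ℝ) (δ : ℝ → ℝ) (W : ℝ → ℝ → E) (hW : ∀ i, IsChartField c (c i) (W i)),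
      (∀ i, 0 < δ i ∧ δ i ≤ 1 / 2 ∧ MapsIntoChart c (c i) (i - δ i) (i + δ i) ∧
        ∀ s, δ i < ‖((s - i : ℝ) : UnitAddCircle)‖ → W i =ᶠ[𝓝 s] 0) ∧
      ∀ s, ∑ i ∈ t, (hW i).field s = ξ s := by
  have hex : ∀ i : ℝ, ∃ δ > 0, δ ≤ 1 / 2 ∧ MapsIntoChart c (c i) (i - δ) (i + δ) := fun i => by
    obtain ⟨δ, hδ, hm⟩ := c.exists_mapsIntoChart (mem_chart_source E (c i))
    exact ⟨min δ (1 / 2), by positivity, min_le_right _ _,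
      hm.mono (by linarith [min_le_left δ (1 / 2)]) (by linarith [min_le_left δ (1 / 2)])⟩
  choose δ hδ hδ' hm using hex
  obtain ⟨t, -, ht⟩ := isCompact_Icc.elim_nhds_subcover (X := ℝ) (s := Icc (0 : ℝ) 1)
    (fun i => Ioo (i - δ i) (i + δ i))
    fun i _ => Ioo_mem_nhds (by linarith [hδ i]) (by linarith [hδ i])
  set χ : ℝ → ℝ → ℝ := fun i => circleBump i (δ i) with hχ
  -- The quotients χᵢ/S form a partition of unity on the circle: S is periodic and positive, because
  -- the supports of the bumps cover a period.
  set S : ℝ → ℝ := fun s => ∑ i ∈ t, χ i s with hS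
  have hSp : Function.Periodic S 1 := fun s => by
    simp only [hS, hχ, circleBump_periodic _ _ s]
  have hSpos : ∀ s, 0 < S s := by
    intro s
    have hfr := hSp.sub_zsmul_eq (x := s) ⌊s⌋
    rw [zsmul_one] at hfr
    rw [← hfr]
    obtain ⟨i, hi, hmem⟩ := mem_iUnion₂.1
      (ht (show s - ⌊s⌋ ∈ Icc (0 : ℝ) 1 from ⟨Int.fract_nonneg s, (Int.fract_lt_one s).le⟩))
    refine Finset.sum_pos' (fun j _ => circleBump_nonneg _ _ _) ⟨i, hi, ?_⟩
    have habs : |s - ⌊s⌋ - i| < δ i := abs_lt.2 ⟨by linarith [hmem.1], by linarith [hmem.2]⟩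
    simp only [hχ]
    rw [circleBump_of_abs_le (by linarith [hδ' i])]
    exact lt_max_of_lt_right (by linarith)
  have hχH : ∀ i s, H1At (χ i) s := fun i => H1At.of_lipschitzWith (circleBump_lipschitz i (δ i))
  have hSH : ∀ s, H1At S s := by
    have hlip : LipschitzWith (t.card : NNReal) S := by
      refine LipschitzWith.of_dist_le_mul fun s r => ?_
      rw [Real.dist_eq]
      simp only [hS, ← Finset.sum_sub_distrib]
      refine (Finset.abs_sum_le_sum_abs _ _).trans ((Finset.sum_le_sum fun i _ => ?_).trans_eq
        (b := ∑ i ∈ t, dist s r) (by simp))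
      simpa [Real.dist_eq] using (circleBump_lipschitz i (δ i)).dist_le_mul s r
    exact H1At.of_lipschitzWith hlip
  set ρ : ℝ → ℝ → ℝ := fun i s => χ i s / S s with hρ
  have hρH : ∀ i s, H1At (ρ i) s := fun i s =>
    ((hχH i s).prodMk (hSH s)).comp_contDiffAt (Φ := fun p : ℝ × ℝ => p.1 / p.2)
      (contDiffAt_fst.div contDiffAt_snd (hSpos s).ne')
  have hρ0 : ∀ i s, δ i < ‖((s - i : ℝ) : UnitAddCircle)‖ → ρ i =ᶠ[𝓝 s] 0 := fun i s hs =>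
    (circleBump_eventuallyEq_zero hs).mono fun r hr => by
      simp only [hρ, hχ, hr, Pi.zero_apply, zero_div]
  have hcp : ∀ x : M, Function.Periodic (fieldCoord c ξ x) 1 := fun x s =>
    congrArg (fun p : TangentBundle 𝓘(ℝ, E) M => chartCoord x p.1 p.2) (ξ.periodic s)
  have hWf : ∀ i, IsChartField c (c i) (fun s => ρ i s • fieldCoord c ξ (c i) s) := fun i =>
    isChartField_bump (fun s => by simp only [hρ, hSp s, hχ, circleBump_periodic _ _ s]) (hρH i)
      (hcp _) fun s => by
        rcases lt_or_ge (δ i) ‖((s - i : ℝ) : UnitAddCircle)‖ with h | h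
        · exact Or.inl (hρ0 i s h)
        · have := c.mem_of_norm_circle_le (hm i) h
          exact Or.inr ⟨this, ξ.h1At this⟩
  refine ⟨t, δ, _, hWf, fun i => ⟨hδ i, hδ' i, hm i, fun s hs => ?_⟩, fun s => ?_⟩
  · exact (hρ0 i s hs).mono fun r hr => by simp [hr]
  · have hfield : ∀ i, (hWf i).field s = ρ i s • ξ s := by
      intro i
      change vecAt (c i) (c s) (ρ i s • fieldCoord c ξ (c i) s) = ρ i s • ξ s
      by_cases hs : c s ∈ (chartAt E (c i)).source
      · refine chartCoord_injective hs ?_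
        rw [chartCoord_vecAt hs, map_smul]
        rfl
      · have : ρ i s = 0 := by
          by_contra hne
          rcases lt_or_ge (δ i) ‖((s - i : ℝ) : UnitAddCircle)‖ with h | h
          · exact hne (hρ0 i s h).eq_of_nhds
          · exact hs (c.mem_of_norm_circle_le (hm i) h)
        rw [this, zero_smul, zero_smul, vecAt_zero]
    rw [Finset.sum_congr rfl fun i _ => hfield i, ← Finset.sum_smul]
    have : ∑ i ∈ t, ρ i s = 1 := by
      simp only [hρ, ← Finset.sum_div]
      exact div_self (hSpos s).ne'
    rw [this, one_smul]

theorem actionDiff_eq_zero_of_tendsto {V : M → ℝ} (hV : ContMDiff 𝓘(ℝ, E) 𝓘(ℝ, ℝ) ∞ V)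
    {e : ℕ → LoopSpace E M} {c : LoopSpace E M} (he : Tendsto e atTop (𝓝 c)) {τ : ℕ → ℝ} {τ₀ : ℝ}
    (hτ : Tendsto τ atTop (𝓝 τ₀)) {K : ℝ}
    (hK : ∀ n, ∫ s in (0 : ℝ)..1, ‖velocity E (e n) s‖ ^ 2 ≤ K)
    (hPS : ∀ η > 0, ∀ᶠ n in atTop, ∀ ξ : LoopTangent (e n),
      |actionDiff V (τ n) (e n) ξ| ≤ η * h1Norm ξ) (ξ : LoopTangent c) :
    actionDiff V τ₀ c ξ = 0 := by
  obtain ⟨t, δ, W, hW, h, hsum⟩ := ξ.exists_sum_chartFields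
  rw [ξ.actionDiff_eq_sum hV τ₀ t (fun i => (hW i).field) hsum]
  exact Finset.sum_eq_zero fun i _ => (hW i).actionDiff_eq_zero hV he hτ hK hPS (h i).1 (h i).2.1
    (h i).2.2.1 (h i).2.2.2

end ChartFieldLimit

/-! ### Assembly: the limit is a critical point -/

section CriticalPoint

variable {E : Type*} [NormedAddCommGroup E] [NormedSpace ℝ E] [FiniteDimensional ℝ E]
  {M : Type*} [MetricSpace M] [ChartedSpace E M] [IsManifold 𝓘(ℝ, E) ∞ M]
  [RiemannianBundle (fun x : M => TangentSpace 𝓘(ℝ, E) x)]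
  [IsContMDiffRiemannianBundle 𝓘(ℝ, E) ∞ E (fun x : M => TangentSpace 𝓘(ℝ, E) x)]
  [IsRiemannianManifold 𝓘(ℝ, E) M]

theorem tendsto_actionDiffTau {V : M → ℝ} (hV : ContMDiff 𝓘(ℝ, E) 𝓘(ℝ, ℝ) ∞ V) (ε : ℝ)
    {ι : Type*} {l : Filter ι} {p : ι → LoopSpace E M × ℝ} {q : LoopSpace E M × ℝ}
    (h : Tendsto p l (𝓝 q)) :
    Tendsto (fun i => actionDiffTau V ε (p i)) l (𝓝 (actionDiffTau V ε q)) := by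
  have h1 : Tendsto (fun i => (p i).1) l (𝓝 q.1) := (continuous_fst.tendsto q).comp h
  have h2 : Tendsto (fun i => (p i).2) l (𝓝 q.2) := (continuous_snd.tendsto q).comp h
  have hexp : ∀ f : ℝ → ℝ, Continuous f →
      Tendsto (fun i => Real.exp (f (p i).2)) l (𝓝 (Real.exp (f q.2))) := fun f hf =>
    ((Real.continuous_exp.comp hf).tendsto _).comp h2
  have e1 := hexp (fun τ => -τ) continuous_neg
  have e2 := hexp (fun τ => τ) continuous_id
  have e3 := hexp (fun τ => τ / 2) (continuous_id.div_const 2)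
  exact ((((e1.div_const 2).mul (LoopSpace.tendsto_integral_sq_speed h1 zero_le_one)).neg).sub
    (e2.mul (LoopSpace.tendsto_integral_potential hV h1 zero_le_one))).add
    ((e1.neg.add (e3.div_const 2)).const_mul ε)

theorem isCriticalPt_of_eq_zero {V : M → ℝ} (hV : ContMDiff 𝓘(ℝ, E) 𝓘(ℝ, ℝ) ∞ V) (ε : ℝ)
    {q : LoopSpace E M × ℝ} (h : ∀ ξ : LoopTangent q.1, actionDiff V q.2 q.1 ξ = 0)
    (h' : actionDiffTau V ε q = 0) : IsCriticalPt (penalizedAction V ε) q := by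
  intro ξ σ
  have := hasDifferential_penalizedAction hV ε q ξ σ
  rwa [h ξ, h', mul_zero, add_zero] at this

/-- The Palais-Smale condition at positive levels. -/
theorem IsPalaisSmaleSeq.exists_subseq_tendsto [CompleteSpace M] {V : M → ℝ}
    (hV : ContMDiff 𝓘(ℝ, E) 𝓘(ℝ, ℝ) ∞ V) (hreg : AsymptoticallyRegular E V) {ε : ℝ} (hε : 0 < ε)
    {a₁ a₂ : ℝ} {p : ℕ → LoopSpace E M × ℝ}
    (hp : IsPalaisSmaleSeq (penalizedAction V ε) a₁ a₂ p) :
    ∃ (q : LoopSpace E M × ℝ) (k : ℕ → ℕ), StrictMono k ∧ Tendsto (p ∘ k) atTop (𝓝 q) ∧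
      IsCriticalPt (penalizedAction V ε) q := by
  obtain ⟨T, K, hTK⟩ := hp.exists_bounds hV hε
  obtain ⟨y, r, hball⟩ := hp.exists_closedBall hV hreg hTK
  -- The first N terms are dropped, so that the bounds hold for every index; the shift by N
  -- reappears in the final choice of the subsequence.
  obtain ⟨N, hN⟩ := eventually_atTop.1 (hTK.and hball)
  have hN' : ∀ n, (|(p (n + N)).2| ≤ T ∧ ∫ s in (0 : ℝ)..1, ‖velocity E (p (n + N)).1 s‖ ^ 2 ≤ K) ∧
      ∀ s, (p (n + N)).1 s ∈ Metric.closedBall y r := fun n => hN _ (by omega)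
  obtain ⟨c, k, hk, hper, hc⟩ := exists_subseq_tendstoUniformly (e := fun n => (p (n + N)).1)
    (isCompact_closedBall_of_complete E y r) (fun n => (hN' n).2) fun n => (hN' n).1.2
  -- A further extraction makes τ converge; uniform convergence of the loops is inherited.
  obtain ⟨τ₀, -, j, hj, hτ⟩ := isCompact_Icc.tendsto_subseq (s := Icc (-T) T)
    (x := fun n => (p (k n + N)).2) fun n => abs_le.1 (hN' (k n)).1.1
  set m : ℕ → ℕ := fun n => k (j n) + N with hm
  have hmono : StrictMono m := fun a b hab => Nat.add_lt_add_right (hk (hj hab)) N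
  have hbd : ∀ n, |(p (m n)).2| ≤ T ∧ ∫ s in (0 : ℝ)..1, ‖velocity E (p (m n)).1 s‖ ^ 2 ≤ K :=
    fun n => (hN' (k (j n))).1
  have hcm : TendstoUniformly (fun n => (p (m n)).1.toFun) c atTop := fun u hu =>
    hj.tendsto_atTop.eventually (hc u hu)
  have hPS : ∀ η > 0, ∀ᶠ n in atTop, ∀ ξ : LoopTangent (p (m n)).1,
      |actionDiff V (p (m n)).2 (p (m n)).1 ξ| ≤ η * h1Norm ξ := fun η hη =>
    hmono.tendsto_atTop.eventually ((hp.eventually_le hV hη).mono fun n hn => hn.1)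
  have hac : ∀ a b, AbsolutelyContinuousOnInterval c a b :=
    absolutelyContinuousOnInterval_of_tendsto (e := fun n => (p (m n)).1)
      (fun s => hcm.tendsto_at s) fun n => (hbd n).2
  have hcont : Continuous c := continuous_iff_continuousAt.2 fun s =>
    (hac (s - 1) (s + 1)).continuousAt_of_mem_Ioo ⟨by linarith, by linarith⟩
  obtain ⟨c', rfl, hlim⟩ := LoopSpace.exists_tendsto (e := fun n => (p (m n)).1) hper hac
    fun x s₀ hx => exists_h1_convergence_chart hV (fun n => (hbd n).1) (fun n => (hbd n).2) hPS
      hcont hcm hx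
  have hq : Tendsto (p ∘ m) atTop (𝓝 (c', τ₀)) := hlim.prodMk_nhds hτ
  refine ⟨(c', τ₀), m, hmono, hq, isCriticalPt_of_eq_zero hV ε
    (actionDiff_eq_zero_of_tendsto hV hlim hτ (fun n => (hbd n).2) hPS) ?_⟩
  refine tendsto_nhds_unique (tendsto_actionDiffTau hV ε hq)
    (Metric.tendsto_nhds.2 fun η hη => ?_)
  filter_upwards [hmono.tendsto_atTop.eventually (hp.eventually_le hV (half_pos hη))] with n hn
  rw [Real.dist_eq, sub_zero]
  exact hn.2.trans_lt (half_lt_self hη)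

end CriticalPoint

end MechanicalAction

end

open Bundle

theorem proposition4p4
    {E : Type*} [NormedAddCommGroup E] [NormedSpace ℝ E] [FiniteDimensional ℝ E]
    {M : Type*} [MetricSpace M] [ChartedSpace E M] [IsManifold 𝓘(ℝ, E) ∞ M]
    [RiemannianBundle (fun x : M => TangentSpace 𝓘(ℝ, E) x)]
    [IsContMDiffRiemannianBundle 𝓘(ℝ, E) ∞ E (fun x : M => TangentSpace 𝓘(ℝ, E) x)]
    [IsRiemannianManifold 𝓘(ℝ, E) M] [CompleteSpace M]
    (V : M → ℝ) (hV : ContMDiff 𝓘(ℝ, E) 𝓘(ℝ, ℝ) ∞ V)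
    (hreg : MechanicalAction.AsymptoticallyRegular E V)
    (ε : ℝ) (hε : 0 < ε) (a₁ a₂ : ℝ) (p : ℕ → MechanicalAction.LoopSpace E M × ℝ)
    (hp : MechanicalAction.IsPalaisSmaleSeq (MechanicalAction.penalizedAction V ε) a₁ a₂ p) :
    ∃ (q : MechanicalAction.LoopSpace E M × ℝ) (k : ℕ → ℕ),
      StrictMono k ∧ Tendsto (p ∘ k) atTop (𝓝 q) ∧
      MechanicalAction.IsCriticalPt (MechanicalAction.penalizedAction V ε) q ∧
      Tendsto (fun j => MechanicalAction.penalizedAction V ε (p (k j))) atTop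
        (𝓝 (MechanicalAction.penalizedAction V ε q)) ∧
      a₁ ≤ MechanicalAction.penalizedAction V ε q ∧
      MechanicalAction.penalizedAction V ε q ≤ a₂ := by
  obtain ⟨q, k, hk, hq, hcrit⟩ := hp.exists_subseq_tendsto hV hreg hε
  have hlim := MechanicalAction.tendsto_penalizedAction hV ε hq
  exact ⟨q, k, hk, hq, hcrit, hlim, ge_of_tendsto' hlim fun j => hp.le_action (k j),
    le_of_tendsto' hlim fun j => hp.action_le (k j)⟩
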